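/- **Setting.** Let $d,b\ge 1$ and fix tangential sites $\mathbf n^{(1)},\dots,\mathbf n^{(b)}\in\mathbb Z^d$, one of which is $0$ and not all of which are $0$. Put $\mathbb Z^d_1=\mathbb Z^d\setminus\{\mathbf n^{(1)},\dots,\mathbf n^{(b)}\}$ and $C_1=\max_i|\mathbf n^{(i)}|$ (Euclidean norm, as for all lattice points below). Fix $\tau_0>\max(d+b,12)$ and $\tau_1=(4d)^{d+1}(\tau_0+1)$. Let $\rho>0$, let $\mathcal O\subset\mathbb R^b$ be open and bounded, and let $\|z\|_\rho=\sum_{m\in\mathbb Z_1^d}|z_m|e^{\rho|m|}|m|^{d+1}$. Let $D(r,s)$ be the set of $(I,\vartheta,z,\bar z)$, with $z,\bar z$ independent complex variables, such that $|\mathrm{Im}\,\vartheta_j|<s$, $|I_j|<r^2$ for all $j$, $\|z\|_\rho<r$ and $\|\bar z\|_\rho<r$. **Functions and norms.** Consider Taylor–Fourier series $F=\sum F_{kl\alpha\beta}(\xi)\,I^le^{i\langle k,\vartheta\rangle}z^\alpha\bar z^\beta$ with coefficients of class $C^1$ in $\xi\in\mathcal O$. Write $|k|=\sum_i|k_i|$,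 $|l|=\sum_i l_i$, $|F_{kl\alpha\beta}|_{\mathcal O}=\sup_{\xi\in\mathcal O}(|F_{kl\alpha\beta}|+|\partial_\xi F_{kl\alpha\beta}|)$, and let $\mathcal MF(z,\bar z)=\sum|F_{kl\alpha\beta}|_{\mathcal O}\,r^{2|l|}e^{|k|s}|z^\alpha||\bar z^\beta|$. Put $\|F\|_{r,s}=\sup_{\|z\|_\rho,\|\bar z\|_\rho<r}\mathcal MF$ and, for a family $G=(G^{(m)})_{m\in\mathbb Z_1^d}$ of such series, $\|G\|_{r,s}=\sup_{\|z\|_\rho,\|\bar z\|_\rho<r}\sum_m\mathcal MG^{(m)}e^{\rho|m|}|m|^{d+1}$. Let $$\|X_F\|_{r,s}=\sum_j\|F_{I_j}\|_{r,s}+r^{-2}\sum_j\|F_{\vartheta_j}\|_{r,s}+r^{-1}\big(\|\partial_zF\|_{r,s}+\|\partial_{\bar z}F\|_{r,s}\big).$$ $\mathcal A_{r,s}$ is the space of those $F$ with $\|X_F\|_{r,s}<\infty$ (so that the series converges absolutely on $D(r,s)$) which conserve momentum: $F_{kl\alpha\beta}=0$ unless $\pi(k,\alpha,\beta):=\sum_ik_i\mathbf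 n^{(i)}+\sum_mm(\alpha_m-\beta_m)=0$. The Poisson bracket, for the symplectic form $dI\wedge d\vartheta+i\,dz\wedge d\bar z$, is $$\{F,G\}=\sum_j(F_{I_j}G_{\vartheta_j}-F_{\vartheta_j}G_{I_j})+i\sum_m(F_{\bar z_m}G_{z_m}-F_{z_m}G_{\bar z_m}).$$ **Cuts.** For $N\in\mathbb N$ let $B_N=\{x\in\mathbb Z^d\setminus\{0\}:|x|<C_1N\}$. A presentation $[v_i;p_i]_\ell$ of an affine subspace $A\subset\mathbb R^d$ of codimension $\ell$ consists of linearly independent $v_1,\dots,v_\ell\in B_N$ and $p_i\in\mathbb Z$ with $A=\{x:v_i\cdot x=p_i,\ i\le\ell\}$. For integer vectors of equal length let $a\prec b$ if $(|a_i|)_i<(|b_i|)_i$ lexicographically, or $(|a_i|)_i=(|b_i|)_i$ and $a>b$ lexicographically. The presentation is $N$-optimal if $(p_1,\dots,p_\ell;v_1,\dots,v_\ell)$ is $\prec$-minimal among the presentations of $A$. A point $m\in\mathbb Z^d$ with $N$-optimal presentation $[v_i;p_i]_d$ has a cut at $\ell$ with parameters $(N,\theta,\mu,\tau)$ if $p_\ell<\mu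 N^\tau$ and $p_{\ell+1}>\theta N^{4d\tau}$ (with $p_0=0$, $p_{d+1}=\infty$); the associated affine space is $[v_i;p_i]_\ell$. **Quasi-Töplitz functions.** Write $z_m^+=z_m$, $z_m^-=\bar z_m$. A monomial $I^le^{i\langle k,\vartheta\rangle}z^\alpha\bar z^\beta z_m^\sigma z_n^{\sigma'}$ is $(N,\theta,\mu,\tau)$-bilinear if $\sigma m+\sigma'n=-\pi(k,\alpha,\beta)$, $|k|<N$, $|m|,|n|>\theta N^{\tau_1}$, $\sum_j|j|(\alpha_j+\beta_j)<\mu N^3$, and for some $0<\ell<d$ both $m$ and $n$ have a cut at $\ell$ with parameters $(N,\theta,\mu,\tau)$; its cut is the affine space $[v_i;p_i]_\ell$ of that one of $m,n$ for which $(p_1,\dots,p_\ell;v_1,\dots,v_\ell)$ is $\prec$-smaller (this one being named $m$). $\Pi_{(N,\theta,\mu,\tau)}$ is the projection onto the bilinear monomials. $\mathbb F=\mathbb F(N,\theta,\mu,\tau)\subset\mathcal A_{r,s}$ is the set of functions containing only bilinear monomials and whose coefficients depend on $m,n$ only through $\sigma m+\sigma'n$ and the cut of the monomial (besides $\sigma,\sigma',k,l,\alpha,\beta,\xi$).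 For $f\in\mathcal A_{r,s}$ let $$\|X_f\|^T_{r,s}=\sup_{N\in\mathbb N,\,N\ge K,\ \tau_0\le\tau\le\tau_1/4d}\ \inf_{\mathcal F\in\mathbb F}\max\big(\|X_f\|_{r,s},\|X_{\mathcal F}\|_{r,s},\|X_{\bar f}\|_{r,s}\big),\qquad\bar f=N^{4d\tau}(\Pi_{(N,\theta,\mu,\tau)}f-\mathcal F);$$ $f$ is quasi-Töplitz with parameters $(K,\theta,\mu)$ in $D(r,s)$ if $f\in\mathcal A_{r,s}$ and $\|X_f\|^T_{r,s}<\infty$. **Proposition.** There is a constant $C>0$, depending only on $d$, $b$, the sites $\mathbf n^{(i)}$ and $\tau_0$, such that the following holds for all $\rho$, $\mathcal O$ as above, all $0<r'<r$, $0<s'<s$, all $8\,d!\,C_1^d<K\le K'$, and all $\theta,\mu,\theta',\mu'$ with $\tfrac12<\theta$, $\theta'<4$, $\tfrac12<\mu'$, $\mu<4$. Put $\delta=(r'/r)^2\min(s-s',1-r'/r)$, and let $f^{(1)},f^{(2)}\in\mathcal A_{r,s}$ be quasi-Töplitz with parameters $(K,\theta,\mu)$; norms on $D(r,s)$ are taken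 with the parameters $(K,\theta,\mu)$ and norms on $D(r',s')$ with $(K',\theta',\mu')$. (i) If $$\frac{C_1}{(K')^2}\le\mu-\mu',\qquad\frac{2C_1\mu'}{(K')^{4d\tau_0-4}}<\theta'-\theta,\qquad e^{-(s-s')K'}(K')^{\tau_1+1}<1,$$ then $\{f^{(1)},f^{(2)}\}$ belongs to $\mathcal A_{r',s'}$, is quasi-Töplitz with parameters $(K',\theta',\mu')$, and $$\|X_{\{f^{(1)},f^{(2)}\}}\|^T_{r',s'}\le C\delta^{-1}\|X_{f^{(1)}}\|^T_{r,s}\|X_{f^{(2)}}\|^T_{r,s}.$$ (ii) If $$\frac{C_1(\ln K')^2}{(K')^2}\le\mu-\mu',\qquad\frac{2C_1\mu'(\ln K')^2}{(K')^{4d\tau_0-4}}<\theta'-\theta,\qquad e^{-(s-s')K'/(\ln K')^2}(K')^{\tau_1}<1$$ and $Ce\delta^{-1}\|X_{f^{(1)}}\|^T_{r,s}<1$, then for every real $t$ with $|t|\le1$ the Lie series $f^{(2)}\circ\phi^t_{f^{(1)}}:=e^{t\{f^{(1)},\cdot\}}f^{(2)}=\sum_{j\ge0}\frac{t^j}{j!}\{f^{(1)},\cdot\}^jf^{(2)}$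 converges at every point of $D(r',s')$ (for every $\xi\in\mathcal O$), its sum belongs to $\mathcal A_{r',s'}$, is quasi-Töplitz with parameters $(K',\theta',\mu')$, and $$\|X_{f^{(2)}\circ\phi^t_{f^{(1)}}}\|^T_{r',s'}\le\Big(\frac r{r'}\Big)^2\big(1-Ce\delta^{-1}\|X_{f^{(1)}}\|^T_{r,s}\big)^{-1}\|X_{f^{(2)}}\|^T_{r,s}.$$ -/

import Mathlib

open scoped ENNReal

noncomputable section

namespace QuasiToeplitz

/-! ### Sites, monomials and series -/

/-- Euclidean norm of an integer vector. -/
def eucl {d : ℕ} (m : Fin d → ℤ) : ℝ := Real.sqrt (∑ i, (m i : ℝ) ^ 2)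

/-- `C₁ = max_i |n_i|`, the largest Euclidean norm of a tangential site. -/
def siteBound {d b : ℕ} (n : Fin b → Fin d → ℤ) : ℝ := ⨆ i, eucl (n i)

/-- The normal sites: all lattice points that are not tangential sites. -/
abbrev NormalSite {d b : ℕ} (n : Fin b → Fin d → ℤ) : Type :=
  {m : Fin d → ℤ // m ∉ Set.range n}

/-- The exponents of a monomial `I ^ l * exp (i ⟨k, ϑ⟩) * z ^ α * zbar ^ β`. -/
@[ext]
structure Mono {d b : ℕ} (n : Fin b → Fin d → ℤ) where
  k : Fin b → ℤ
  l : Fin b → ℕ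
  α : NormalSite n →₀ ℕ
  β : NormalSite n →₀ ℕ

/-- A Taylor-Fourier series: a coefficient, depending on the parameter `ξ`, for each monomial. -/
abbrev Series {d b : ℕ} (n : Fin b → Fin d → ℤ) : Type :=
  Mono n → (Fin b → ℝ) → ℂ

section Monomials

variable {d b : ℕ} {n : Fin b → Fin d → ℤ}

/-- `|k| = ∑ |k_i|`. -/
def Mono.absK (M : Mono n) : ℕ := ∑ i, (M.k i).natAbs

/-- `|l| = ∑ l_i`. -/
def Mono.absL (M : Mono n) : ℕ := ∑ i, M.l i

/-- The momentum `π(k, α, β) = ∑ k_i n_i + ∑ m (α_m - β_m)`. -/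
def Mono.momentum (M : Mono n) : Fin d → ℤ :=
  ∑ i, M.k i • n i + M.α.sum (fun m a => a • m.1) - M.β.sum (fun m a => a • m.1)

/-- `∑_j |j| (α_j + β_j)`. -/
def Mono.lowSize (M : Mono n) : ℝ :=
  (M.α + M.β).sum (fun j a => (a : ℝ) * eucl j.1)

/-- The sign `σ = ±1`; `true` stands for `+`. -/
def sgn (σ : Bool) : ℤ := if σ then 1 else -1

/-- Multiplication of a monomial by `z_m ^ σ`, where `z_m ^ + = z_m` and `z_m ^ - = zbar_m`. -/
def Mono.mulVar (M : Mono n) (σ : Bool) (m : NormalSite n) : Mono n :=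
  if σ then { M with α := M.α + Finsupp.single m 1 }
  else { M with β := M.β + Finsupp.single m 1 }

end Monomials

/-! ### Phase space and the Poisson bracket -/

/-- The coordinates `(I, ϑ, z, zbar)`; in the complexified phase space `z` and `zbar` are
independent variables. -/
structure Phase {d b : ℕ} (n : Fin b → Fin d → ℤ) where
  I : Fin b → ℂ
  ϑ : Fin b → ℂ
  z : NormalSite n → ℂ
  zbar : NormalSite n → ℂ

section PhaseSpace

variable {d b : ℕ} {n : Fin b → Fin d → ℤ}

/-- The weight `exp (ρ |m|) |m| ^ (d + 1)`. -/
def weight (ρ : ℝ) (m : NormalSite n) : ℝ≥0∞ :=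
  ENNReal.ofReal (Real.exp (ρ * eucl m.1) * eucl m.1 ^ (d + 1))

/-- The weighted norm `‖z‖_ρ = ∑ |z_m| exp (ρ |m|) |m| ^ (d + 1)`. -/
def seqNorm (ρ : ℝ) (z : NormalSite n → ℂ) : ℝ≥0∞ := ∑' m, ‖z m‖ₑ * weight ρ m

/-- The domain `D(r, s)`. -/
def domain (n : Fin b → Fin d → ℤ) (ρ r s : ℝ) : Set (Phase n) :=
  {x | (∀ j, |(x.ϑ j).im| < s) ∧ (∀ j, ‖x.I j‖ < r ^ 2) ∧
    seqNorm ρ x.z < ENNReal.ofReal r ∧ seqNorm ρ x.zbar < ENNReal.ofReal r}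

/-- The value of a monomial at a point of phase space. -/
def Mono.eval (M : Mono n) (x : Phase n) : ℂ :=
  (∏ j, x.I j ^ M.l j) * Complex.exp (Complex.I * ∑ j, (M.k j : ℂ) * x.ϑ j) *
    M.α.prod (fun m a => x.z m ^ a) * M.β.prod (fun m a => x.zbar m ^ a)

/-- The function of `(I, ϑ, z, zbar)` represented by a series, at the parameter `ξ`. -/
def Series.eval (f : Series n) (ξ : Fin b → ℝ) (x : Phase n) : ℂ :=
  ∑' M, f M ξ * M.eval x

/-- `∂F / ∂I_j`. -/
def partialI (j : Fin b) (F : Phase n → ℂ) (x : Phase n) : ℂ :=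
  deriv (fun w => F { x with I := Function.update x.I j w }) (x.I j)

/-- `∂F / ∂ϑ_j`. -/
def partialϑ (j : Fin b) (F : Phase n → ℂ) (x : Phase n) : ℂ :=
  deriv (fun w => F { x with ϑ := Function.update x.ϑ j w }) (x.ϑ j)

open Classical in
/-- `∂F / ∂z_m`. -/
def partialZ (m : NormalSite n) (F : Phase n → ℂ) (x : Phase n) : ℂ :=
  deriv (fun w => F { x with z := Function.update x.z m w }) (x.z m)

open Classical in
/-- `∂F / ∂zbar_m`. -/
def partialZbar (m : NormalSite n) (F : Phase n → ℂ) (x : Phase n) : ℂ :=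
  deriv (fun w => F { x with zbar := Function.update x.zbar m w }) (x.zbar m)

/-- The Poisson bracket of the symplectic form `dI ∧ dϑ + i dz ∧ dzbar`, normalised so that
`{F, ·}` is the derivative along the Hamiltonian vector field of `F`:
`ϑ' = F_I`, `I' = - F_ϑ`, `z' = i F_zbar`, `zbar' = - i F_z`. -/
def poisson (F G : Phase n → ℂ) (x : Phase n) : ℂ :=
  ∑ j, (partialI j F x * partialϑ j G x - partialϑ j F x * partialI j G x) +
    Complex.I * ∑' m, (partialZbar m F x * partialZ m G x - partialZ m F x * partialZbar m G x)

end PhaseSpace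

/-! ### Majorant norms and the space `𝒜_{r,s}` -/

section Norms

variable {d b : ℕ} {n : Fin b → Fin d → ℤ}

/-- `|c|_O = sup_{ξ ∈ O} (|c| + |∂c/∂ξ|)`, the gradient being measured in the sup-norm. -/
def coeffNorm (O : Set (Fin b → ℝ)) (c : (Fin b → ℝ) → ℂ) : ℝ≥0∞ :=
  ⨆ ξ ∈ O, (‖c ξ‖ₑ + ‖fun j : Fin b => fderiv ℝ c ξ (Pi.single j 1)‖ₑ)

/-- `∑ |F_{klαβ}|_O r^{2|l|} e^{|k|s} |z^α| |zbar^β|`. -/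
def majorant (O : Set (Fin b → ℝ)) (r s : ℝ) (f : Series n) (z zbar : NormalSite n → ℂ) :
    ℝ≥0∞ :=
  ∑' M : Mono n, coeffNorm O (f M) *
    ENNReal.ofReal (r ^ (2 * M.absL) * Real.exp (M.absK * s)) *
      (M.α.prod (fun m a => ‖z m‖ₑ ^ a) * M.β.prod (fun m a => ‖zbar m‖ₑ ^ a))

/-- The majorant norm `‖F‖_{r,s}` of a scalar series. -/
def scalarNorm (ρ : ℝ) (O : Set (Fin b → ℝ)) (r s : ℝ) (f : Series n) : ℝ≥0∞ :=
  ⨆ (z : NormalSite n → ℂ) (zbar : NormalSite n → ℂ)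
    (_ : seqNorm ρ z < ENNReal.ofReal r) (_ : seqNorm ρ zbar < ENNReal.ofReal r),
    majorant O r s f z zbar

/-- The majorant norm `sup ‖ℳG‖_ρ` of a vector-valued series. The majorants have non-negative
coefficients, so the supremum over the ball is the one over non-negative arguments. -/
def vectorNorm (ρ : ℝ) (O : Set (Fin b → ℝ)) (r s : ℝ) (G : NormalSite n → Series n) : ℝ≥0∞ :=
  ⨆ (z : NormalSite n → ℂ) (zbar : NormalSite n → ℂ)
    (_ : seqNorm ρ z < ENNReal.ofReal r) (_ : seqNorm ρ zbar < ENNReal.ofReal r),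
    ∑' m, majorant O r s (G m) z zbar * weight ρ m

/-- The series of `∂F / ∂I_j`. -/
def Series.dI (j : Fin b) (f : Series n) : Series n :=
  fun M ξ => ((M.l j : ℂ) + 1) * f { M with l := M.l + Pi.single j 1 } ξ

/-- The series of `∂F / ∂ϑ_j`. -/
def Series.dϑ (j : Fin b) (f : Series n) : Series n :=
  fun M ξ => Complex.I * (M.k j : ℂ) * f M ξ

/-- The series of `∂F / ∂z_m`. -/
def Series.dz (f : Series n) (m : NormalSite n) : Series n :=
  fun M ξ => ((M.α m : ℂ) + 1) * f (M.mulVar true m) ξ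

/-- The series of `∂F / ∂zbar_m`. -/
def Series.dzbar (f : Series n) (m : NormalSite n) : Series n :=
  fun M ξ => ((M.β m : ℂ) + 1) * f (M.mulVar false m) ξ

/-- The weighted norm `‖X_F‖_{r,s}` of the Hamiltonian vector field of `F`. -/
def XNorm (ρ : ℝ) (O : Set (Fin b → ℝ)) (r s : ℝ) (f : Series n) : ℝ≥0∞ :=
  ∑ j, scalarNorm ρ O r s (f.dI j) +
    ENNReal.ofReal (1 / r ^ 2) * ∑ j, scalarNorm ρ O r s (f.dϑ j) +
      ENNReal.ofReal (1 / r) * (vectorNorm ρ O r s f.dz + vectorNorm ρ O r s f.dzbar)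

/-- The space `𝒜_{r,s}`: coefficients of class `C¹` on `O`, conservation of momentum, and finite
semi-norm `‖X_F‖_{r,s}`. Finiteness of the semi-norm gives absolute convergence of the series on
`D(r, s)`, and analyticity of the majorants of `X_F` on the ball of radius `r` (they are power
series with non-negative coefficients that are bounded on this ball). -/
def MemA (ρ : ℝ) (O : Set (Fin b → ℝ)) (r s : ℝ) (f : Series n) : Prop :=
  (∀ M, ContDiffOn ℝ 1 (f M) O) ∧
  (∀ M : Mono n, M.momentum ≠ 0 → ∀ ξ ∈ O, f M ξ = 0) ∧
  XNorm ρ O r s f < ⊤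

end Norms

/-! ### Optimal presentations and cuts -/

section Cuts

variable {d : ℕ}

/-- The affine space `[v_i; p_i]_ℓ = {x ∈ ℝ^d | v_i · x = p_i for all i}`. -/
def affineSpace {ℓ : ℕ} (v : Fin ℓ → Fin d → ℤ) (p : Fin ℓ → ℤ) : Set (Fin d → ℝ) :=
  {x | ∀ i, ∑ j, (v i j : ℝ) * x j = p i}

/-- The vector `(p_1, …, p_ℓ; v_1, …, v_ℓ)`. -/
def display {ℓ : ℕ} (v : Fin ℓ → Fin d → ℤ) (p : Fin ℓ → ℤ) : List ℤ :=
  List.ofFn p ++ (List.ofFn fun i => List.ofFn (v i)).flatten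

/-- The sign lexicographical order `a ≺ b` on integer vectors of equal length. -/
def SignLex (a b : List ℤ) : Prop :=
  List.Lex (· < ·) (a.map Int.natAbs) (b.map Int.natAbs) ∨
    (a.map Int.natAbs = b.map Int.natAbs ∧ List.Lex (· < ·) b a)

/-- `[v_i; p_i]_ℓ` is a presentation of `A` with independent vectors `v_i` in
`B_N = {x ∈ ℤ^d ∖ {0} : |x| < C₁ N}`. -/
def IsPresentation (C₁ : ℝ) (N : ℕ) {ℓ : ℕ} (A : Set (Fin d → ℝ))
    (v : Fin ℓ → Fin d → ℤ) (p : Fin ℓ → ℤ) : Prop :=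
  LinearIndependent ℝ (fun i j => (v i j : ℝ)) ∧ (∀ i, v i ≠ 0 ∧ eucl (v i) < C₁ * N) ∧
    A = affineSpace v p

/-- The presentation `[v_i; p_i]_ℓ` of `A` is `N`-optimal. -/
def IsOptimal (C₁ : ℝ) (N : ℕ) {ℓ : ℕ} (A : Set (Fin d → ℝ))
    (v : Fin ℓ → Fin d → ℤ) (p : Fin ℓ → ℤ) : Prop :=
  IsPresentation C₁ N A v p ∧
    ∀ (w : Fin ℓ → Fin d → ℤ) (q : Fin ℓ → ℤ), IsPresentation C₁ N A w q →
      display v p = display w q ∨ SignLex (display v p) (display w q)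

/-- `[v_i; p_i]_d` is the `N`-optimal presentation of the lattice point `m`. -/
def IsOptimalPoint (C₁ : ℝ) (N : ℕ) (m : Fin d → ℤ) (v : Fin d → Fin d → ℤ) (p : Fin d → ℤ) :
    Prop :=
  IsOptimal C₁ N {fun j => (m j : ℝ)} v p

/-- The cut condition `p_ℓ < μ N^τ`, `p_{ℓ+1} > θ N^{4dτ}` on the constants `p_1, …, p_d` of an
optimal presentation, with `p_0 = 0` and `p_{d+1} = ∞`. The list is indexed from `0` here, that
is `p_{i+1}` is written `p i`. -/
def HasCut (N : ℕ) (θ μ τ : ℝ) (p : Fin d → ℤ) (ℓ : ℕ) : Prop :=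
  (∀ i : Fin d, i.val + 1 = ℓ → (p i : ℝ) < μ * (N : ℝ) ^ τ) ∧
    ∀ i : Fin d, i.val = ℓ → θ * (N : ℝ) ^ (4 * d * τ) < (p i : ℝ)

end Cuts

/-! ### Bilinear monomials, piecewise Töplitz functions and the quasi-Töplitz norm -/

section Toeplitz

variable {d b : ℕ} {n : Fin b → Fin d → ℤ}

/-- `τ₁ = (4d)^{d+1} (τ₀ + 1)`. -/
def tauOne (d : ℕ) (τ₀ : ℝ) : ℝ := (4 * (d : ℝ)) ^ (d + 1) * (τ₀ + 1)

/-- With `M = e^{i⟨k,ϑ⟩} I^l z^α zbar^β`, the monomial `M z_m^σ z_{m'}^{σ'}` is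
`(N, θ, μ, τ)`-bilinear with cut `A`. The cut is the affine space associated to the cut of `m`,
and `m` is the one of the two sites whose cut comes first in the sign lexicographical order. -/
def IsBilinearWithCut (τ₁ : ℝ) (N : ℕ) (θ μ τ : ℝ) (M : Mono n) (σ : Bool) (m : NormalSite n)
    (σ' : Bool) (m' : NormalSite n) (A : Set (Fin d → ℝ)) : Prop :=
  sgn σ • m.1 + sgn σ' • m'.1 = -M.momentum ∧
  M.absK < N ∧
  θ * (N : ℝ) ^ τ₁ < eucl m.1 ∧ θ * (N : ℝ) ^ τ₁ < eucl m'.1 ∧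
  M.lowSize < μ * (N : ℝ) ^ 3 ∧
  ∃ (ℓ : ℕ) (hℓ : ℓ < d) (v w : Fin d → Fin d → ℤ) (p q : Fin d → ℤ), 0 < ℓ ∧
    IsOptimalPoint (siteBound n) N m.1 v p ∧ IsOptimalPoint (siteBound n) N m'.1 w q ∧
    HasCut N θ μ τ p ℓ ∧ HasCut N θ μ τ q ℓ ∧
    (display (v ∘ Fin.castLE hℓ.le) (p ∘ Fin.castLE hℓ.le) =
        display (w ∘ Fin.castLE hℓ.le) (q ∘ Fin.castLE hℓ.le) ∨
      SignLex (display (v ∘ Fin.castLE hℓ.le) (p ∘ Fin.castLE hℓ.le))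
        (display (w ∘ Fin.castLE hℓ.le) (q ∘ Fin.castLE hℓ.le))) ∧
    A = affineSpace (v ∘ Fin.castLE hℓ.le) (p ∘ Fin.castLE hℓ.le)

/-- A monomial is `(N, θ, μ, τ)`-bilinear. -/
def IsBilinear (τ₁ : ℝ) (N : ℕ) (θ μ τ : ℝ) (P : Mono n) : Prop :=
  ∃ M σ m σ' m' A, IsBilinearWithCut τ₁ N θ μ τ M σ m σ' m' A ∧
    P = (M.mulVar σ m).mulVar σ' m'

open Classical in
/-- The projection `Π_{(N, θ, μ, τ)}` onto the bilinear functions. -/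
def bilinearPart (τ₁ : ℝ) (N : ℕ) (θ μ τ : ℝ) (f : Series n) : Series n :=
  fun P ξ => if IsBilinear τ₁ N θ μ τ P then f P ξ else 0

/-- The space `𝔽(N, θ, μ, τ) ⊆ 𝒜_{r,s}` of piecewise Töplitz functions: bilinear functions in which
the coefficient of `M z_m^σ z_{m'}^{σ'}` depends on `m, m'` only through `σ m + σ' m'` and the cut
`A` of the monomial. -/
def IsPiecewiseToeplitz (ρ : ℝ) (O : Set (Fin b → ℝ)) (τ₁ r s : ℝ) (N : ℕ) (θ μ τ : ℝ)
    (f : Series n) : Prop :=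
  MemA ρ O r s f ∧
  (∀ P, ¬ IsBilinear τ₁ N θ μ τ P → ∀ ξ ∈ O, f P ξ = 0) ∧
  ∃ g : Mono n → Bool → Bool → (Fin d → ℤ) → Set (Fin d → ℝ) → (Fin b → ℝ) → ℂ,
    ∀ M σ m σ' m' A, IsBilinearWithCut τ₁ N θ μ τ M σ m σ' m' A →
      ∀ ξ ∈ O, f ((M.mulVar σ m).mulVar σ' m') ξ = g M σ σ' (sgn σ • m.1 + sgn σ' • m'.1) A ξ

/-- The quasi-Töplitz norm `‖X_f‖^T_{r,s}` with parameters `(K, θ, μ)`. -/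
def qtNorm (ρ : ℝ) (O : Set (Fin b → ℝ)) (τ₀ r s K θ μ : ℝ) (f : Series n) : ℝ≥0∞ :=
  ⨆ (N : ℕ) (_ : K ≤ N) (τ : ℝ) (_ : τ₀ ≤ τ ∧ τ ≤ tauOne d τ₀ / (4 * d)),
    ⨅ (F : Series n) (_ : IsPiecewiseToeplitz ρ O (tauOne d τ₀) r s N θ μ τ F),
      max (XNorm ρ O r s f) (max (XNorm ρ O r s F)
        (XNorm ρ O r s fun P ξ => (((N : ℝ) ^ (4 * d * τ) : ℝ) : ℂ) *
          (bilinearPart (tauOne d τ₀) N θ μ τ f P ξ - F P ξ)))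

/-- `f` is quasi-Töplitz in `D(r, s)` with parameters `(K, θ, μ)`. -/
def IsQuasiToeplitz (ρ : ℝ) (O : Set (Fin b → ℝ)) (τ₀ r s K θ μ : ℝ) (f : Series n) : Prop :=
  MemA ρ O r s f ∧ qtNorm ρ O τ₀ r s K θ μ f < ⊤

end Toeplitz

/-- `δ = (r'/r)² min(s - s', 1 - r'/r)`. -/
def delta (r s r' s' : ℝ) : ℝ := (r' / r) ^ 2 * min (s - s') (1 - r' / r)

end QuasiToeplitz

end

noncomputable section
namespace QuasiToeplitz

/-! ### The monoid of monomials and the phase-space directions -/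

section MonoidStructure

variable {d b : ℕ} {n : Fin b → Fin d → ℤ}

/-! Two estimates are combined: an analytic one for brackets in the majorant norm, and an arithmetic
one by which brackets inherit the Töplitz property at the price of a slightly larger `θ` and a
slightly smaller `μ`.

Analysis. For `C¹` coefficients the norm `XNorm` sees only the numbers `|F_{klαβ}|_O` (`XNorm_eq`),
and these are submultiplicative, so brackets may be estimated with non-negative coefficients
throughout. A power series `V` with non-negative coefficients satisfies `V(x) + t X·∇V(x) ≤ V(x +
tX)` for a non-negative vector field `X` (`monoWeight_taylor`). Hence differentiating one field
along another costs `1/t`, where `t` is the time for which the Euler step `x + tX` stays in the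
larger domain (`directional_le`); with the Leibniz rule this gives `fieldNorm_cBracket_le`.
Splitting the loss of domain into `J` equal steps bounds `J` brackets by `(β J T)^J`, and the factor
`1/J!` of the Lie series turns this into a geometric term.

Arithmetic. Optimal presentations are greedy (`IsOptimalPoint.greedy`): each constant is the least
`|u · m|` over admissible `u` outside the span of the earlier vectors. A displacement of length `L`
changes such products by at most `C₁ N L`. A cut leaves a gap between `μ N^τ` and `θ N^{4dτ}`, so it
survives the displacement, its vectors keep their span, and the new cut depends on the site only
through the old cut (`CutData.transfer`, `CutData.span_eq`, `CutData.eq_of_translate`). In the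
bracket at a monomial with two distant variables, either both lie in one factor and the contracted
variable is low, or each factor contains one of them, and conservation of momentum makes the
contracted site a small displacement of plus or minus a distant site. In both cases, replacing the
distant sites by others with the same cuts and the same signed sum permutes the nonzero terms of the
bracket without changing their values (`TwinPair.both_aux`, `TwinPair.mixed_aux`,
`ToeplitzAt.bracket`). One bracket costs `C₁ / N²` in `μ` and `2 C₁ μ' / N^{4dτ₀ - 4}` in `θ`.

Combination. Given approximants `F₁, F₂` at `(N, τ)`, replace the bilinear part of each `fᵢ` by `Fᵢ`
and drop the modes `|k| ≥ N` (`nearSeries`). After a loss of width in the angles this changes `fᵢ`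
by a multiple of `N^{-4dτ}`, by the definition of the norm and the exponential decay in `|k|`. The
bilinear part of the iterated bracket of the modified functions is piecewise Töplitz and
approximates the true iterated bracket to the same order (`exists_approximant`). One bracket gives
(i). For (ii) the terms with `j ≤ log² N` are treated in this way, their total loss being covered by
the factors `(ln K')²` of the hypotheses. For `j > log² N` the weight `N^{4dτ}` is at most `e^{τ₁
j}`, one more geometric factor, so that zero is a sufficient approximant
(`Parameters.approximates_high`). -/

instance : Zero (Mono n) := ⟨⟨0, 0, 0, 0⟩⟩

instance : Add (Mono n) := ⟨fun A B => ⟨A.k + B.k, A.l + B.l, A.α + B.α, A.β + B.β⟩⟩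

@[simp] lemma Mono.zero_k : (0 : Mono n).k = 0 := rfl
@[simp] lemma Mono.zero_l : (0 : Mono n).l = 0 := rfl
@[simp] lemma Mono.zero_α : (0 : Mono n).α = 0 := rfl
@[simp] lemma Mono.zero_β : (0 : Mono n).β = 0 := rfl
@[simp] lemma Mono.add_k (A B : Mono n) : (A + B).k = A.k + B.k := rfl
@[simp] lemma Mono.add_l (A B : Mono n) : (A + B).l = A.l + B.l := rfl
@[simp] lemma Mono.add_α (A B : Mono n) : (A + B).α = A.α + B.α := rfl
@[simp] lemma Mono.add_β (A B : Mono n) : (A + B).β = A.β + B.β := rfl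

/-- Multiplication of monomials adds exponents. Cancellation makes multiplication by a variable
injective, and later makes the splitting of a product into two factors unique. -/
instance : AddCancelCommMonoid (Mono n) where
  add_assoc A B C := by ext1 <;> simp [add_assoc]
  zero_add A := by ext1 <;> simp
  add_zero A := by ext1 <;> simp
  add_comm A B := by ext1 <;> simp [add_comm]
  nsmul := nsmulRec
  add_left_cancel A B C h := by
    have hk := congrArg Mono.k h
    have hl := congrArg Mono.l h
    have ha := congrArg Mono.α h
    have hb := congrArg Mono.β h
    simp only [Mono.add_k, Mono.add_l, Mono.add_α, Mono.add_β, add_right_inj] at hk hl ha hb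
    ext1 <;> assumption

/-- The coordinate directions of phase space: `I_j`, `ϑ_j`, `z_m` and `zbar_m`. -/
inductive Dir {d b : ℕ} (n : Fin b → Fin d → ℤ) where
  | act (j : Fin b) : Dir n
  | ang (j : Fin b) : Dir n
  | pos (m : NormalSite n) : Dir n
  | neg (m : NormalSite n) : Dir n

/-- The symplectically conjugate direction. -/
def Dir.conj : Dir n → Dir n
  | .act j => .ang j
  | .ang j => .act j
  | .pos m => .neg m
  | .neg m => .pos m

@[simp] lemma Dir.conj_conj (a : Dir n) : a.conj.conj = a := by cases a <;> rfl

/-- The variable of a direction, as a monomial; there is none for an angle. -/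
def Dir.inc : Dir n → Mono n
  | .act j => ⟨0, Pi.single j 1, 0, 0⟩
  | .ang _ => 0
  | .pos m => ⟨0, 0, Finsupp.single m 1, 0⟩
  | .neg m => ⟨0, 0, 0, Finsupp.single m 1⟩

/-- The modulus of the factor which differentiation in the direction `a` produces. -/
def Dir.deg (a : Dir n) (M : Mono n) : ℕ :=
  match a with
  | .act j => M.l j
  | .ang j => (M.k j).natAbs
  | .pos m => M.α m
  | .neg m => M.β m

/-- The monomial which is left after differentiation in the direction `a`. -/
def Dir.lower (a : Dir n) (M : Mono n) : Mono n :=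
  match a with
  | .act j => { M with l := M.l - Pi.single j 1 }
  | .ang _ => M
  | .pos m => { M with α := M.α - Finsupp.single m 1 }
  | .neg m => { M with β := M.β - Finsupp.single m 1 }

/-- The angles are the directions without a variable. -/
def Dir.IsAng : Dir n → Prop
  | .ang _ => True
  | _ => False

open Classical in
lemma Dir.deg_add_inc (u a : Dir n) (M : Mono n) :
    u.deg (M + a.inc) = u.deg M + if u = a ∧ ¬ a.IsAng then 1 else 0 := by
  cases u <;> cases a <;>
    simp [Dir.deg, Dir.inc, Dir.IsAng, Pi.single_apply, Finsupp.single_apply, eq_comm]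

lemma Dir.deg_add_le (u : Dir n) (M N : Mono n) : u.deg (M + N) ≤ u.deg M + u.deg N := by
  cases u <;> simp [Dir.deg, Int.natAbs_add_le]

@[simp] lemma Dir.lower_add_inc (a : Dir n) (M : Mono n) : a.lower (M + a.inc) = M := by
  cases a <;> ext1 <;> simp [Dir.lower, Dir.inc]

/-- Subtraction of exponents is truncated, so lowering passes to a factor only if that factor
contains the variable. -/
lemma Dir.lower_add {u : Dir n} {M : Mono n} (h : u.deg M ≠ 0) (N : Mono n) :
    u.lower (M + N) = u.lower M + N := by
  cases u with
  | act j =>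
    ext1 <;> simp [Dir.lower]
    ext i
    by_cases hi : i = j
    · subst hi
      simp [Dir.deg] at h ⊢
      omega
    · simp [hi]
  | ang j => rfl
  | pos m =>
    ext1 <;> simp [Dir.lower]
    ext i
    by_cases hi : i = m
    · subst hi
      simp [Dir.deg] at h ⊢
      omega
    · simp [Ne.symm hi]
  | neg m =>
    ext1 <;> simp [Dir.lower]
    ext i
    by_cases hi : i = m
    · subst hi
      simp [Dir.deg] at h ⊢
      omega
    · simp [Ne.symm hi]

lemma Dir.lower_add_of_deg_ne_zero {u : Dir n} {M : Mono n} (h : u.deg M ≠ 0) :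
    u.lower M + u.inc = M := by
  rw [← Dir.lower_add h, Dir.lower_add_inc]

lemma Dir.add_inc_injective (a : Dir n) : Function.Injective (fun M : Mono n => M + a.inc) :=
  fun _ _ h => add_right_cancel h

/-- Every monomial is built from a pure exponential by multiplication with variables. -/
lemma Mono.induction_on {p : Mono n → Prop} (M : Mono n)
    (hk : ∀ k, p ⟨k, 0, 0, 0⟩)
    (hstep : ∀ (a : Dir n) (M : Mono n), ¬ a.IsAng → p M → p (M + a.inc)) : p M := by
  obtain ⟨k, l, α, β⟩ := M
  have h1 : ∀ l : Fin b → ℕ, p ⟨k, l, 0, 0⟩ := by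
    intro l
    induction hs : (∑ i, l i) generalizing l with
    | zero =>
      have : l = 0 := by
        ext i
        simpa using (Finset.sum_eq_zero_iff.mp hs) i (Finset.mem_univ i)
      rw [this]; exact hk k
    | succ t ih =>
      obtain ⟨i, hi⟩ : ∃ i, l i ≠ 0 := by
        by_contra h
        push Not at h
        simp [h] at hs
      have hd : (Dir.act i : Dir n).deg ⟨k, l, 0, 0⟩ ≠ 0 := hi
      rw [← Dir.lower_add_of_deg_ne_zero hd]
      refine hstep _ _ (by simp [Dir.IsAng]) (ih _ ?_)
      have : l = (l - Pi.single i 1) + Pi.single i 1 := by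
        ext a
        by_cases ha : a = i
        · subst ha; simp; omega
        · simp [ha]
      rw [this] at hs
      simp only [Pi.add_apply, Finset.sum_add_distrib, Finset.sum_pi_single'] at hs
      simpa using hs
  have h2 : ∀ α : NormalSite n →₀ ℕ, p ⟨k, l, α, 0⟩ := by
    intro α
    induction hs : α.degree generalizing α with
    | zero =>
      rw [Finsupp.degree_eq_zero_iff] at hs
      subst hs; exact h1 l
    | succ t ih =>
      obtain ⟨i, hi⟩ : ∃ i, α i ≠ 0 := by
        by_contra h
        push Not at h
        have : α = 0 := Finsupp.ext h
        simp [this] at hs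
      have hd : (Dir.pos i : Dir n).deg ⟨k, l, α, 0⟩ ≠ 0 := hi
      rw [← Dir.lower_add_of_deg_ne_zero hd]
      refine hstep _ _ (by simp [Dir.IsAng]) (ih _ ?_)
      have : α = (α - Finsupp.single i 1) + Finsupp.single i 1 := by
        ext a
        by_cases ha : a = i
        · subst ha; simp; omega
        · simp [Ne.symm ha]
      rw [this] at hs
      simpa using hs
  induction hs : β.degree generalizing β with
  | zero =>
    rw [Finsupp.degree_eq_zero_iff] at hs
    subst hs; exact h2 α
  | succ t ih =>
    obtain ⟨i, hi⟩ : ∃ i, β i ≠ 0 := by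
      by_contra h
      push Not at h
      have : β = 0 := Finsupp.ext h
      simp [this] at hs
    have hd : (Dir.neg i : Dir n).deg ⟨k, l, α, β⟩ ≠ 0 := hi
    rw [← Dir.lower_add_of_deg_ne_zero hd]
    refine hstep _ _ (by simp [Dir.IsAng]) (ih _ ?_)
    have : β = (β - Finsupp.single i 1) + Finsupp.single i 1 := by
      ext a
      by_cases ha : a = i
      · subst ha; simp; omega
      · simp [Ne.symm ha]
    rw [this] at hs
    simpa using hs

end MonoidStructure

/-! ### Majorant calculus with non-negative coefficients -/

section Majorants

variable {d b : ℕ} {n : Fin b → Fin d → ℤ}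

/-- The value of a monomial at non-negative arguments: `R` for the actions, `E` for the modulus
of `exp (i ϑ_j)`. -/
def monoWeight (R E : ℝ≥0∞) (ζ ζ' : NormalSite n → ℝ≥0∞) (M : Mono n) : ℝ≥0∞ :=
  R ^ M.absL * E ^ M.absK *
    (M.α.prod (fun m a => ζ m ^ a) * M.β.prod (fun m a => ζ' m ^ a))

/-- The value of the variable of a direction. -/
def Dir.val (R : ℝ≥0∞) (ζ ζ' : NormalSite n → ℝ≥0∞) : Dir n → ℝ≥0∞
  | .act _ => R
  | .ang _ => 1
  | .pos m => ζ m
  | .neg m => ζ' m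

lemma Mono.absK_add_le (M N : Mono n) : (M + N).absK ≤ M.absK + N.absK := by
  unfold Mono.absK
  rw [← Finset.sum_add_distrib]
  exact Finset.sum_le_sum fun i _ => by simpa using Int.natAbs_add_le _ _

lemma Mono.absL_add (M N : Mono n) : (M + N).absL = M.absL + N.absL := by
  simp [Mono.absL, Finset.sum_add_distrib]

lemma Dir.inc_k (a : Dir n) : a.inc.k = 0 := by cases a <;> rfl

lemma Mono.absK_add_inc (M : Mono n) (a : Dir n) : (M + a.inc).absK = M.absK := by
  simp [Mono.absK, Dir.inc_k]

lemma finsupp_prod_pow_add {ι : Type*} (ζ : ι → ℝ≥0∞) (α β : ι →₀ ℕ) :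
    (α + β).prod (fun m a => ζ m ^ a) =
      α.prod (fun m a => ζ m ^ a) * β.prod (fun m a => ζ m ^ a) := by
  classical
  exact Finsupp.prod_add_index' (by simp) (fun _ _ _ => pow_add _ _ _)

/-- Only an inequality, because Fourier modes can cancel in a product; this is why `1 ≤ E` is
needed. -/
lemma monoWeight_add_le {R E : ℝ≥0∞} (hE : 1 ≤ E) (ζ ζ' : NormalSite n → ℝ≥0∞) (M N : Mono n) :
    monoWeight R E ζ ζ' (M + N) ≤ monoWeight R E ζ ζ' M * monoWeight R E ζ ζ' N := by
  unfold monoWeight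
  rw [Mono.absL_add, Mono.add_α, Mono.add_β, finsupp_prod_pow_add, finsupp_prod_pow_add, pow_add]
  calc _ ≤ R ^ M.absL * R ^ N.absL * (E ^ M.absK * E ^ N.absK) * _ := by
        rw [← pow_add E]
        gcongr
        exact Mono.absK_add_le M N
    _ = _ := by ring

lemma monoWeight_add_inc (R E : ℝ≥0∞) (ζ ζ' : NormalSite n → ℝ≥0∞) (M : Mono n) (a : Dir n) :
    monoWeight R E ζ ζ' (M + a.inc) = monoWeight R E ζ ζ' M * a.val R ζ ζ' := by
  unfold monoWeight
  rw [Mono.absL_add, Mono.add_α, Mono.add_β, finsupp_prod_pow_add, finsupp_prod_pow_add,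
    Mono.absK_add_inc]
  cases a with
  | act j => simp [Dir.inc, Dir.val, Mono.absL]; ring
  | ang j => simp [Dir.inc, Dir.val, Mono.absL]
  | pos m => simp [Dir.inc, Dir.val, Mono.absL]; ring
  | neg m => simp [Dir.inc, Dir.val, Mono.absL]; ring

lemma monoWeight_mono {R E R' E' : ℝ≥0∞} {ζ ζ' η η' : NormalSite n → ℝ≥0∞} (hR : R ≤ R')
    (hE : E ≤ E') (hζ : ζ ≤ η) (hζ' : ζ' ≤ η') (M : Mono n) :
    monoWeight R E ζ ζ' M ≤ monoWeight R' E' η η' M := by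
  unfold monoWeight Finsupp.prod
  gcongr with m _ m _
  · exact pow_le_pow_left' (hζ m) _
  · exact pow_le_pow_left' (hζ' m) _

/-- The derivative of a weight on monomials in the direction `a`. -/
def wDeriv (a : Dir n) (V : Mono n → ℝ≥0∞) (M : Mono n) : ℝ≥0∞ := a.deg M * V (a.lower M)

/-- The derivative of a family of non-negative coefficients in the direction `a`. -/
def cDeriv (a : Dir n) (c : Mono n → ℝ≥0∞) (M : Mono n) : ℝ≥0∞ :=
  a.deg (M + a.inc) * c (M + a.inc)

/-- The pairing `∑ c(M) V(M)` of coefficients with a weight. -/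
def pair (c V : Mono n → ℝ≥0∞) : ℝ≥0∞ := ∑' M, c M * V M

lemma pair_mono {c c' V V' : Mono n → ℝ≥0∞} (hc : ∀ M, c M ≤ c' M) (hV : ∀ M, V M ≤ V' M) :
    pair c V ≤ pair c' V' :=
  ENNReal.tsum_le_tsum fun M => mul_le_mul' (hc M) (hV M)

/-- Differentiation of coefficients is adjoint to differentiation of weights: reindex by `M ↦ M +
a.inc`. The monomials missed by this injection have degree zero in `a`. -/
lemma pair_cDeriv (a : Dir n) (c V : Mono n → ℝ≥0∞) :
    pair (cDeriv a c) V = pair c (wDeriv a V) := by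
  have h := (Dir.add_inc_injective a).tsum_eq (f := fun M => a.deg M * c M * V (a.lower M)) ?_
  · simp only [Dir.lower_add_inc] at h
    unfold pair cDeriv wDeriv
    rw [h]
    exact tsum_congr fun M => by ring
  · intro M hM
    refine ⟨a.lower M, Dir.lower_add_of_deg_ne_zero ?_⟩
    rintro h0
    simp [h0] at hM

/-- Needed to exchange the direction of a component of the vector field with the contracted
direction of a bracket. -/
lemma cDeriv_comm (a u : Dir n) (c : Mono n → ℝ≥0∞) :
    cDeriv u (cDeriv a c) = cDeriv a (cDeriv u c) := by
  classical
  funext M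
  unfold cDeriv
  rw [add_right_comm M a.inc u.inc, ← mul_assoc, ← mul_assoc]
  congr 1
  by_cases h : u = a
  · subst h; rfl
  · rw [Dir.deg_add_inc a a, add_right_comm M u.inc a.inc, Dir.deg_add_inc u u,
      Dir.deg_add_inc u u, Dir.deg_add_inc u a, Dir.deg_add_inc a a, Dir.deg_add_inc a u]
    simp [h, Ne.symm h]
    ring

lemma wDeriv_monoWeight_add_le {R E : ℝ≥0∞} (hE : 1 ≤ E) (ζ ζ' : NormalSite n → ℝ≥0∞)
    (u : Dir n) (M N : Mono n) :
    wDeriv u (monoWeight R E ζ ζ') (M + N) ≤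
      wDeriv u (monoWeight R E ζ ζ') M * monoWeight R E ζ ζ' N +
        monoWeight R E ζ ζ' M * wDeriv u (monoWeight R E ζ ζ') N := by
  have key : ∀ M N : Mono n, (u.deg M : ℝ≥0∞) * monoWeight R E ζ ζ' (u.lower (M + N)) ≤
      u.deg M * monoWeight R E ζ ζ' (u.lower M) * monoWeight R E ζ ζ' N := by
    intro M N
    by_cases h : u.deg M = 0
    · simp [h]
    · rw [Dir.lower_add h, mul_assoc]
      gcongr
      exact monoWeight_add_le hE _ _ _ _
  unfold wDeriv
  calc _ ≤ ((u.deg M : ℝ≥0∞) + u.deg N) * monoWeight R E ζ ζ' (u.lower (M + N)) := by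
        gcongr
        exact_mod_cast Dir.deg_add_le u M N
    _ ≤ _ := by
        rw [add_mul]
        refine add_le_add (key M N) ?_
        rw [add_comm M N]
        exact (key N M).trans_eq (by ring)

open Classical in
lemma wDeriv_monoWeight_add_inc (R E : ℝ≥0∞) (ζ ζ' : NormalSite n → ℝ≥0∞) (u a : Dir n)
    (ha : ¬ a.IsAng) (M : Mono n) :
    wDeriv u (monoWeight R E ζ ζ') (M + a.inc) =
      wDeriv u (monoWeight R E ζ ζ') M * a.val R ζ ζ' +
        if u = a then monoWeight R E ζ ζ' M else 0 := by
  unfold wDeriv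
  rw [Dir.deg_add_inc]
  have key : (u.deg M : ℝ≥0∞) * monoWeight R E ζ ζ' (u.lower (M + a.inc)) =
      u.deg M * monoWeight R E ζ ζ' (u.lower M) * a.val R ζ ζ' := by
    by_cases h : u.deg M = 0
    · simp [h]
    · rw [Dir.lower_add h, monoWeight_add_inc, mul_assoc]
  push_cast
  rw [add_mul, key]
  congr 1
  by_cases h : u = a
  · subst h; simp [ha]
  · simp [h]

/-- First order Taylor inequality for monomials, which have non-negative coefficients. -/
lemma monoWeight_taylor {R E R' E' : ℝ≥0∞} {ζ ζ' η η' : NormalSite n → ℝ≥0∞} {x : ℝ}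
    (hx0 : 0 ≤ x) (y : Dir n → ℝ≥0∞)
    (hR : ∀ j, R + y (.act j) ≤ R') (hE : E * ENNReal.ofReal (Real.exp x) ≤ E')
    (hx : ∑ j, y (.ang j) ≤ ENNReal.ofReal x)
    (hζ : ∀ m, ζ m + y (.pos m) ≤ η m) (hζ' : ∀ m, ζ' m + y (.neg m) ≤ η' m) (M : Mono n) :
    monoWeight R E ζ ζ' M + ∑' a, y a * wDeriv a (monoWeight R E ζ ζ') M ≤
      monoWeight R' E' η η' M := by
  classical
  induction M using Mono.induction_on with
  | hk k =>
    set K := (⟨k, 0, 0, 0⟩ : Mono n).absK with hK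
    have hw : ∀ (R E : ℝ≥0∞) (ζ ζ' : NormalSite n → ℝ≥0∞),
        monoWeight R E ζ ζ' ⟨k, 0, 0, 0⟩ = E ^ K := by
      intro R E ζ ζ'
      simp [monoWeight, Mono.absL, hK]
    have hsum : ∑' a, y a * wDeriv a (monoWeight R E ζ ζ') ⟨k, 0, 0, 0⟩ ≤
        E ^ K * (K * ENNReal.ofReal x) := by
      have hinj : Function.Injective (Dir.ang : Fin b → Dir n) := by
        intro i j h; injection h
      rw [← hinj.tsum_eq]
      · rw [tsum_fintype]
        calc _ ≤ ∑ j, E ^ K * (y (.ang j) * K) := by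
              refine Finset.sum_le_sum fun j _ => ?_
              simp only [wDeriv, Dir.lower, Dir.deg, hw]
              rw [← mul_assoc, mul_comm]
              gcongr
              exact Finset.single_le_sum (f := fun i => (k i).natAbs) (fun _ _ => Nat.zero_le _)
                (Finset.mem_univ j)
          _ = E ^ K * (K * ∑ j, y (.ang j)) := by
              rw [← Finset.mul_sum, ← Finset.sum_mul, mul_comm (K : ℝ≥0∞)]
          _ ≤ _ := by gcongr
      · intro a ha
        cases a with
        | ang j => exact ⟨j, rfl⟩
        | act j => simp [wDeriv, Dir.deg] at ha
        | pos m => simp [wDeriv, Dir.deg] at ha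
        | neg m => simp [wDeriv, Dir.deg] at ha
    rw [hw, hw]
    -- For a pure exponential only the angles contribute, and the inequality reduces to `1 + K x ≤
    -- exp (K x)`.
    calc _ ≤ E ^ K + E ^ K * (K * ENNReal.ofReal x) := by gcongr
      _ = E ^ K * (1 + K * ENNReal.ofReal x) := by ring
      _ ≤ E ^ K * ENNReal.ofReal (Real.exp (K * x)) := by
          gcongr
          rw [← ENNReal.ofReal_natCast, ← ENNReal.ofReal_mul (by positivity), ← ENNReal.ofReal_one,
            ← ENNReal.ofReal_add (by norm_num) (by positivity)]
          apply ENNReal.ofReal_le_ofReal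
          linarith [Real.add_one_le_exp ((K : ℝ) * x)]
      _ = (E * ENNReal.ofReal (Real.exp x)) ^ K := by
          rw [mul_pow, ← ENNReal.ofReal_pow (Real.exp_pos x).le, ← Real.exp_nat_mul]
      _ ≤ _ := by gcongr
  | hstep a M ha ih =>
    have hv : a.val R ζ ζ' + y a ≤ a.val R' η η' := by
      cases a with
      | act j => exact hR j
      | ang j => exact absurd trivial ha
      | pos m => exact hζ m
      | neg m => exact hζ' m
    simp_rw [wDeriv_monoWeight_add_inc R E ζ ζ' _ a ha, monoWeight_add_inc, mul_add]
    rw [ENNReal.tsum_add]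
    simp only [mul_ite, mul_zero]
    rw [tsum_ite_eq]
    set S := ∑' u, y u * wDeriv u (monoWeight R E ζ ζ') M
    have : ∑' u, y u * (wDeriv u (monoWeight R E ζ ζ') M * a.val R ζ ζ') = S * a.val R ζ ζ' := by
      rw [← ENNReal.tsum_mul_right]
      exact tsum_congr fun _ => by ring
    rw [this]
    -- The added term `y a * S` is of second order and non-negative; it completes the product.
    calc _ ≤ (monoWeight R E ζ ζ' M + S) * a.val R ζ ζ' + y a * (monoWeight R E ζ ζ' M + S) := by
          rw [add_mul, add_assoc]
          gcongr
          exact le_self_add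
      _ = (monoWeight R E ζ ζ' M + S) * (a.val R ζ ζ' + y a) := by ring
      _ ≤ _ := by gcongr

end Majorants

/-! ### The norm of a Hamiltonian vector field in terms of non-negative coefficients -/

section FieldNorm

variable {d b : ℕ} {n : Fin b → Fin d → ℤ}

/-- The directions, as a disjoint union. -/
def Dir.equivSum : Dir n ≃ (Fin b ⊕ Fin b) ⊕ (NormalSite n ⊕ NormalSite n) where
  toFun
    | .act j => .inl (.inl j)
    | .ang j => .inl (.inr j)
    | .pos m => .inr (.inl m)
    | .neg m => .inr (.inr m)
  invFun
    | .inl (.inl j) => .act j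
    | .inl (.inr j) => .ang j
    | .inr (.inl m) => .pos m
    | .inr (.inr m) => .neg m
  left_inv a := by cases a <;> rfl
  right_inv a := by rcases a with (_ | _) | (_ | _) <;> rfl

lemma tsum_dir (G : Dir n → ℝ≥0∞) :
    ∑' a, G a = ∑ j, G (.act j) + ∑ j, G (.ang j) +
      (∑' m, G (.pos m) + ∑' m, G (.neg m)) := by
  rw [← Dir.equivSum.symm.tsum_eq,
    Summable.tsum_sum ENNReal.summable ENNReal.summable,
    Summable.tsum_sum ENNReal.summable ENNReal.summable,
    Summable.tsum_sum ENNReal.summable ENNReal.summable, tsum_fintype, tsum_fintype]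
  rfl

/-- The four kinds of components of a Hamiltonian vector field; those in the directions of the
normal sites are taken together. -/
abbrev Comp (b : ℕ) : Type := (Fin b ⊕ Fin b) ⊕ Bool

/-- The weight of the direction `a` within the component `q`. -/
def dirWeight (ρ : ℝ) (q : Comp b) (a : Dir n) : ℝ≥0∞ :=
  match q, a with
  | .inl (.inl j), .act i => if i = j then 1 else 0
  | .inl (.inr j), .ang i => if i = j then 1 else 0
  | .inr true, .pos m => weight ρ m
  | .inr false, .neg m => weight ρ m
  | _, _ => 0

/-- The scaling factor of the component `q` on the domain of radius `r`. -/
def compScale (q : Comp b) (r : ℝ) : ℝ≥0∞ :=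
  match q with
  | .inl (.inl _) => 1
  | .inl (.inr _) => ENNReal.ofReal (1 / r ^ 2)
  | .inr _ => ENNReal.ofReal (1 / r)

/-- The weighted sum of the derivatives of `V` in the directions of the component `q`. -/
def compWeight (ρ : ℝ) (q : Comp b) (V : Mono n → ℝ≥0∞) (M : Mono n) : ℝ≥0∞ :=
  ∑' a, dirWeight ρ q a * wDeriv a V M

/-- The weight of monomials belonging to the domain `D(r, s)`. -/
def domWeight (r s : ℝ) (ζ ζ' : NormalSite n → ℝ≥0∞) : Mono n → ℝ≥0∞ :=
  monoWeight (ENNReal.ofReal (r ^ 2)) (ENNReal.ofReal (Real.exp s)) ζ ζ'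

/-- The ball of radius `r` of the weighted sequence norm, for non-negative sequences. -/
def InBall (ρ r : ℝ) (ζ : NormalSite n → ℝ≥0∞) : Prop :=
  ∑' m, ζ m * weight ρ m < ENNReal.ofReal r

/-- The majorant norm of the component `q`. -/
def compNorm (ρ r s : ℝ) (q : Comp b) (c : Mono n → ℝ≥0∞) : ℝ≥0∞ :=
  ⨆ (ζ : NormalSite n → ℝ≥0∞) (ζ' : NormalSite n → ℝ≥0∞) (_ : InBall ρ r ζ) (_ : InBall ρ r ζ'),
    pair c (compWeight ρ q (domWeight r s ζ ζ'))

/-- The majorant norm of the vector field of a series whose coefficients are bounded by `c`. -/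
def fieldNorm (ρ r s : ℝ) (c : Mono n → ℝ≥0∞) : ℝ≥0∞ :=
  ∑ q : Comp b, compScale q r * compNorm ρ r s q c

lemma le_compNorm {ρ r s : ℝ} {ζ ζ' : NormalSite n → ℝ≥0∞} (h : InBall ρ r ζ)
    (h' : InBall ρ r ζ') (q : Comp b) (c : Mono n → ℝ≥0∞) :
    pair c (compWeight ρ q (domWeight r s ζ ζ')) ≤ compNorm ρ r s q c :=
  le_iSup₂_of_le ζ ζ' (le_iSup₂_of_le h h' le_rfl)

lemma compNorm_le {ρ r s : ℝ} {q : Comp b} {c : Mono n → ℝ≥0∞} {x : ℝ≥0∞}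
    (h : ∀ ζ ζ', InBall ρ r ζ → InBall ρ r ζ' →
      pair c (compWeight ρ q (domWeight r s ζ ζ')) ≤ x) : compNorm ρ r s q c ≤ x :=
  iSup₂_le fun ζ ζ' => iSup₂_le fun h1 h2 => h ζ ζ' h1 h2

lemma pair_compWeight (ρ : ℝ) (q : Comp b) (c V : Mono n → ℝ≥0∞) :
    pair c (compWeight ρ q V) = ∑' a, dirWeight ρ q a * pair (cDeriv a c) V := by
  simp_rw [pair_cDeriv, pair, compWeight, ← ENNReal.tsum_mul_left]
  rw [ENNReal.tsum_comm]
  exact tsum_congr fun a => tsum_congr fun M => by ring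

lemma tsum_dirWeight_act (ρ : ℝ) (j : Fin b) (G : Dir n → ℝ≥0∞) :
    ∑' a, dirWeight ρ (.inl (.inl j)) a * G a = G (.act j) := by
  rw [tsum_dir]; simp [dirWeight]

lemma tsum_dirWeight_ang (ρ : ℝ) (j : Fin b) (G : Dir n → ℝ≥0∞) :
    ∑' a, dirWeight ρ (.inl (.inr j)) a * G a = G (.ang j) := by
  rw [tsum_dir]; simp [dirWeight]

lemma tsum_dirWeight_pos (ρ : ℝ) (G : Dir n → ℝ≥0∞) :
    ∑' a, dirWeight ρ (.inr true : Comp b) a * G a = ∑' m, weight ρ m * G (.pos m) := by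
  rw [tsum_dir]; simp [dirWeight]

lemma tsum_dirWeight_neg (ρ : ℝ) (G : Dir n → ℝ≥0∞) :
    ∑' a, dirWeight ρ (.inr false : Comp b) a * G a = ∑' m, weight ρ m * G (.neg m) := by
  rw [tsum_dir]; simp [dirWeight]

lemma compNorm_mono {ρ r s : ℝ} {q : Comp b} {c c' : Mono n → ℝ≥0∞} (h : ∀ M, c M ≤ c' M) :
    compNorm ρ r s q c ≤ compNorm ρ r s q c' :=
  compNorm_le fun _ _ h1 h2 => (pair_mono h fun _ => le_rfl).trans (le_compNorm h1 h2 q c')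

lemma fieldNorm_mono {ρ r s : ℝ} {c c' : Mono n → ℝ≥0∞} (h : ∀ M, c M ≤ c' M) :
    fieldNorm ρ r s c ≤ fieldNorm ρ r s c' :=
  Finset.sum_le_sum fun _ _ => mul_le_mul_right (compNorm_mono h) _

lemma fieldNorm_tsum_le {ι : Type*} {ρ r s : ℝ} (c : ι → Mono n → ℝ≥0∞) :
    fieldNorm ρ r s (fun M => ∑' i, c i M) ≤ ∑' i, fieldNorm ρ r s (c i) := by
  unfold fieldNorm
  rw [Summable.tsum_finsetSum fun _ _ => ENNReal.summable]
  refine Finset.sum_le_sum fun q _ => ?_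
  rw [ENNReal.tsum_mul_left]
  gcongr
  refine compNorm_le fun ζ ζ' h1 h2 => ?_
  calc _ = ∑' i, pair (c i) (compWeight ρ q (domWeight r s ζ ζ')) := by
        unfold pair
        rw [ENNReal.tsum_comm]
        exact tsum_congr fun M => by rw [ENNReal.tsum_mul_right]
    _ ≤ _ := ENNReal.tsum_le_tsum fun i => le_compNorm h1 h2 q (c i)

lemma fieldNorm_add_le {ρ r s : ℝ} (c c' : Mono n → ℝ≥0∞) :
    fieldNorm ρ r s (fun M => c M + c' M) ≤ fieldNorm ρ r s c + fieldNorm ρ r s c' := by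
  have := fieldNorm_tsum_le (ρ := ρ) (r := r) (s := s) (fun i : Bool => if i then c else c')
  simpa [tsum_bool, add_comm] using this

lemma fieldNorm_const_mul {ρ r s : ℝ} (x : ℝ≥0∞) (c : Mono n → ℝ≥0∞) :
    fieldNorm ρ r s (fun M => x * c M) = x * fieldNorm ρ r s c := by
  unfold fieldNorm compNorm pair
  simp_rw [mul_assoc x, ENNReal.tsum_mul_left, ← ENNReal.mul_iSup, Finset.mul_sum]
  exact Finset.sum_congr rfl fun q _ => by ring

/-- The angle derivatives carry `r⁻²`, the worst of the three scalings, whence the square of `r /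
r'`. -/
lemma compScale_le {r r' : ℝ} (hr' : 0 < r') (hr : r' ≤ r) (q : Comp b) :
    compScale q r' ≤ ENNReal.ofReal ((r / r') ^ 2) * compScale q r := by
  have h0 : 0 < r := hr'.trans_le hr
  have h1 : 1 ≤ r / r' := (one_le_div hr').2 hr
  rcases q with (j | j) | q
  · simp only [compScale, mul_one]
    rw [← ENNReal.ofReal_one]
    exact ENNReal.ofReal_le_ofReal (one_le_pow₀ h1)
  · simp only [compScale]
    rw [← ENNReal.ofReal_mul (by positivity)]
    apply ENNReal.ofReal_le_ofReal
    apply le_of_eq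
    field_simp
  · simp only [compScale]
    rw [← ENNReal.ofReal_mul (by positivity)]
    apply ENNReal.ofReal_le_ofReal
    have : 1 / r' = r / r' * (1 / r) := by field_simp
    rw [this]
    gcongr
    nlinarith

lemma InBall.mono {ρ r r' : ℝ} (hr : r' ≤ r) {ζ : NormalSite n → ℝ≥0∞} (h : InBall ρ r' ζ) :
    InBall ρ r ζ :=
  lt_of_lt_of_le h (ENNReal.ofReal_le_ofReal hr)

lemma domWeight_mono {r r' s s' : ℝ} (hr' : 0 ≤ r') (hr : r' ≤ r) (hs : s' ≤ s)
    (ζ ζ' : NormalSite n → ℝ≥0∞) (M : Mono n) :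
    domWeight r' s' ζ ζ' M ≤ domWeight r s ζ ζ' M :=
  monoWeight_mono (ENNReal.ofReal_le_ofReal (by gcongr)) (ENNReal.ofReal_le_ofReal (by gcongr))
    le_rfl le_rfl M

lemma compWeight_mono {ρ : ℝ} {q : Comp b} {V V' : Mono n → ℝ≥0∞} (h : ∀ M, V M ≤ V' M)
    (M : Mono n) : compWeight ρ q V M ≤ compWeight ρ q V' M :=
  ENNReal.tsum_le_tsum fun _ => mul_le_mul_right (mul_le_mul_right (h _) _) _

lemma compNorm_domain_mono {ρ r r' s s' : ℝ} (hr' : 0 ≤ r') (hr : r' ≤ r) (hs : s' ≤ s)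
    (q : Comp b) (c : Mono n → ℝ≥0∞) : compNorm ρ r' s' q c ≤ compNorm ρ r s q c :=
  compNorm_le fun ζ ζ' h1 h2 => (pair_mono (fun _ => le_rfl)
    (compWeight_mono (domWeight_mono hr' hr hs ζ ζ'))).trans
      (le_compNorm (h1.mono hr) (h2.mono hr) q c)

lemma fieldNorm_domain_mono {ρ r r' s s' : ℝ} (hr' : 0 < r') (hr : r' ≤ r) (hs : s' ≤ s)
    (c : Mono n → ℝ≥0∞) :
    fieldNorm ρ r' s' c ≤ ENNReal.ofReal ((r / r') ^ 2) * fieldNorm ρ r s c := by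
  unfold fieldNorm
  rw [Finset.mul_sum]
  refine Finset.sum_le_sum fun q _ => ?_
  rw [← mul_assoc]
  exact mul_le_mul' (compScale_le hr' hr q) (compNorm_domain_mono hr'.le hr hs q c)

lemma Dir.lower_absK (a : Dir n) (M : Mono n) : (a.lower M).absK = M.absK := by
  cases a <;> rfl

/-- Gain from a loss of analyticity for series with high Fourier modes only. -/
lemma fieldNorm_ultraviolet {ρ r s η : ℝ} {N : ℕ} (hη : 0 ≤ η) {c : Mono n → ℝ≥0∞}
    (hc : ∀ M, M.absK < N → c M = 0) :
    fieldNorm ρ r (s - η) c ≤ ENNReal.ofReal (Real.exp (-(η * N))) * fieldNorm ρ r s c := by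
  have key : ∀ ζ ζ' (M : Mono n), N ≤ M.absK → domWeight r (s - η) ζ ζ' M ≤
      ENNReal.ofReal (Real.exp (-(η * N))) * domWeight r s ζ ζ' M := by
    intro ζ ζ' M hM
    unfold domWeight monoWeight
    have : ENNReal.ofReal (Real.exp (s - η)) ^ M.absK ≤
        ENNReal.ofReal (Real.exp (-(η * N))) * ENNReal.ofReal (Real.exp s) ^ M.absK := by
      rw [← ENNReal.ofReal_pow (Real.exp_pos _).le, ← ENNReal.ofReal_pow (Real.exp_pos _).le,
        ← ENNReal.ofReal_mul (Real.exp_pos _).le, ← Real.exp_nat_mul, ← Real.exp_nat_mul,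
        ← Real.exp_add]
      apply ENNReal.ofReal_le_ofReal
      apply Real.exp_le_exp.2
      have : (N : ℝ) ≤ M.absK := by exact_mod_cast hM
      nlinarith
    calc _ ≤ ENNReal.ofReal (r ^ 2) ^ M.absL * (ENNReal.ofReal (Real.exp (-(η * N))) *
          ENNReal.ofReal (Real.exp s) ^ M.absK) * _ := by gcongr
      _ = _ := by ring
  unfold fieldNorm
  rw [Finset.mul_sum]
  refine Finset.sum_le_sum fun q _ => ?_
  rw [mul_left_comm]
  gcongr
  refine compNorm_le fun ζ ζ' h1 h2 => ?_
  refine le_trans ?_ (mul_le_mul_right (le_compNorm h1 h2 q c) _)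
  unfold pair
  rw [← ENNReal.tsum_mul_left]
  refine ENNReal.tsum_le_tsum fun M => ?_
  by_cases hM : M.absK < N
  · simp [hc M hM]
  · push Not at hM
    rw [mul_left_comm]
    gcongr
    unfold compWeight
    rw [← ENNReal.tsum_mul_left]
    refine ENNReal.tsum_le_tsum fun a => ?_
    rw [mul_left_comm]
    gcongr
    unfold wDeriv
    rw [mul_left_comm]
    gcongr
    exact key ζ ζ' _ (by rwa [Dir.lower_absK])

lemma ofReal_mul_ofReal_one_div {x : ℝ} (hx : 0 < x) :
    ENNReal.ofReal x * ENNReal.ofReal (1 / x) = 1 := by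
  rw [← ENNReal.ofReal_mul hx.le, mul_one_div_cancel hx.ne', ENNReal.ofReal_one]

/-- This bound and the next three undo the scaling in `fieldNorm`: they give the actual size of each
part of the vector field on the ball. -/
lemma sum_act_le {ρ r s : ℝ} {ζ ζ' : NormalSite n → ℝ≥0∞} (h : InBall ρ r ζ)
    (h' : InBall ρ r ζ') (c : Mono n → ℝ≥0∞) :
    ∑ j, pair (cDeriv (.act j) c) (domWeight r s ζ ζ') ≤ fieldNorm ρ r s c := by
  unfold fieldNorm
  rw [Fintype.sum_sum_type, Fintype.sum_sum_type]
  refine le_trans ?_ (le_self_add.trans le_self_add)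
  refine Finset.sum_le_sum fun j _ => ?_
  rw [compScale, one_mul]
  refine le_trans (le_of_eq ?_) (le_compNorm h h' _ c)
  rw [pair_compWeight, tsum_dirWeight_act]

lemma sum_ang_le {ρ r s : ℝ} (hr : 0 < r) {ζ ζ' : NormalSite n → ℝ≥0∞} (h : InBall ρ r ζ)
    (h' : InBall ρ r ζ') (c : Mono n → ℝ≥0∞) :
    ∑ j, pair (cDeriv (.ang j) c) (domWeight r s ζ ζ') ≤
      ENNReal.ofReal (r ^ 2) * fieldNorm ρ r s c := by
  unfold fieldNorm
  rw [Fintype.sum_sum_type, Fintype.sum_sum_type]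
  refine le_trans ?_ (mul_le_mul_right (le_add_self.trans le_self_add) _)
  rw [Finset.mul_sum]
  refine Finset.sum_le_sum fun j _ => ?_
  rw [compScale, ← mul_assoc, ofReal_mul_ofReal_one_div (by positivity), one_mul]
  refine le_trans (le_of_eq ?_) (le_compNorm h h' _ c)
  rw [pair_compWeight, tsum_dirWeight_ang]

lemma sum_pos_le {ρ r s : ℝ} (hr : 0 < r) {ζ ζ' : NormalSite n → ℝ≥0∞} (h : InBall ρ r ζ)
    (h' : InBall ρ r ζ') (c : Mono n → ℝ≥0∞) :
    ∑' m, weight ρ m * pair (cDeriv (.pos m) c) (domWeight r s ζ ζ') ≤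
      ENNReal.ofReal r * fieldNorm ρ r s c := by
  unfold fieldNorm
  rw [Fintype.sum_sum_type, Fintype.sum_bool]
  refine le_trans ?_ (mul_le_mul_right (le_self_add.trans le_add_self) _)
  rw [compScale, ← mul_assoc, ofReal_mul_ofReal_one_div (by positivity), one_mul]
  refine le_trans (le_of_eq ?_) (le_compNorm h h' _ c)
  rw [pair_compWeight, tsum_dirWeight_pos]

lemma sum_neg_le {ρ r s : ℝ} (hr : 0 < r) {ζ ζ' : NormalSite n → ℝ≥0∞} (h : InBall ρ r ζ)
    (h' : InBall ρ r ζ') (c : Mono n → ℝ≥0∞) :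
    ∑' m, weight ρ m * pair (cDeriv (.neg m) c) (domWeight r s ζ ζ') ≤
      ENNReal.ofReal r * fieldNorm ρ r s c := by
  unfold fieldNorm
  rw [Fintype.sum_sum_type, Fintype.sum_bool]
  refine le_trans ?_ (mul_le_mul_right (le_add_self.trans le_add_self) _)
  rw [compScale, ← mul_assoc, ofReal_mul_ofReal_one_div (by positivity), one_mul]
  refine le_trans (le_of_eq ?_) (le_compNorm h h' _ c)
  rw [pair_compWeight, tsum_dirWeight_neg]

end FieldNorm

/-! ### The majorant of the Poisson bracket -/

section MajorantBracket

variable {d b : ℕ} {n : Fin b → Fin d → ℤ}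

/-- The index set of the terms of a Poisson bracket which contribute to the monomial `P`. -/
abbrev Fiber (P : Mono n) : Type :=
  {x : Dir n × Mono n × Mono n // x.2.1 + x.2.2 = P}

/-- The majorant of the coefficients of a Poisson bracket. -/
def cBracket (c₁ c₂ : Mono n → ℝ≥0∞) (P : Mono n) : ℝ≥0∞ :=
  ∑' x : Fiber P, cDeriv x.1.1 c₁ x.1.2.1 * cDeriv x.1.1.conj c₂ x.1.2.2

lemma pair_cBracket (c₁ c₂ V : Mono n → ℝ≥0∞) :
    pair (cBracket c₁ c₂) V =
      ∑' a, ∑' M, ∑' N, cDeriv a c₁ M * cDeriv a.conj c₂ N * V (M + N) := by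
  set G : Dir n × Mono n × Mono n → ℝ≥0∞ :=
    fun x => cDeriv x.1 c₁ x.2.1 * cDeriv x.1.conj c₂ x.2.2 * V (x.2.1 + x.2.2)
  have h1 : pair (cBracket c₁ c₂) V = ∑' x, G x := by
    rw [← (Equiv.sigmaFiberEquiv fun x : Dir n × Mono n × Mono n => x.2.1 + x.2.2).tsum_eq,
      ENNReal.tsum_sigma']
    unfold pair cBracket
    refine tsum_congr fun P => ?_
    rw [← ENNReal.tsum_mul_right]
    refine tsum_congr fun x => ?_
    simp only [G, Equiv.sigmaFiberEquiv, Equiv.coe_fn_mk, x.2]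
  rw [h1, ENNReal.tsum_prod']
  exact tsum_congr fun a => ENNReal.tsum_prod'

lemma tsum_tsum_mul (A B : Mono n → ℝ≥0∞) : ∑' M, ∑' N, A M * B N = (∑' M, A M) * ∑' N, B N := by
  simp_rw [ENNReal.tsum_mul_left, ENNReal.tsum_mul_right]

lemma pair_cBracket_le {R E : ℝ≥0∞} (hE : 1 ≤ E) (ζ ζ' : NormalSite n → ℝ≥0∞)
    (c₁ c₂ : Mono n → ℝ≥0∞) :
    pair (cBracket c₁ c₂) (monoWeight R E ζ ζ') ≤
      ∑' a : Dir n, pair (cDeriv a c₁) (monoWeight R E ζ ζ') *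
        pair (cDeriv a.conj c₂) (monoWeight R E ζ ζ') := by
  rw [pair_cBracket]
  refine ENNReal.tsum_le_tsum fun a => ?_
  unfold pair
  rw [← tsum_tsum_mul]
  refine ENNReal.tsum_le_tsum fun M => ENNReal.tsum_le_tsum fun N => ?_
  calc _ ≤ cDeriv a c₁ M * cDeriv a.conj c₂ N * (monoWeight R E ζ ζ' M * monoWeight R E ζ ζ' N) := by
        gcongr
        exact monoWeight_add_le hE _ _ _ _
    _ = _ := by ring

/-- By the Leibniz rule the derivative `u` falls on one of the factors. Since derivatives commute,
each of the two terms is the `u`-component of one factor differentiated along the vector field of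
the other, the expression bounded in `directional_le`. -/
lemma pair_cBracket_wDeriv_le {R E : ℝ≥0∞} (hE : 1 ≤ E) (ζ ζ' : NormalSite n → ℝ≥0∞)
    (u : Dir n) (c₁ c₂ : Mono n → ℝ≥0∞) :
    pair (cBracket c₁ c₂) (wDeriv u (monoWeight R E ζ ζ')) ≤
      (∑' a : Dir n, pair (cDeriv u c₁) (wDeriv a (monoWeight R E ζ ζ')) *
        pair (cDeriv a.conj c₂) (monoWeight R E ζ ζ')) +
      ∑' a : Dir n, pair (cDeriv u c₂) (wDeriv a (monoWeight R E ζ ζ')) *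
        pair (cDeriv a.conj c₁) (monoWeight R E ζ ζ') := by
  set V := monoWeight R E ζ ζ'
  have hsw : ∀ (a : Dir n) (c : Mono n → ℝ≥0∞),
      pair (cDeriv u c) (wDeriv a V) = pair (cDeriv a c) (wDeriv u V) := by
    intro a c
    rw [← pair_cDeriv, cDeriv_comm, pair_cDeriv]
  -- Passing to the conjugate direction in the sum exchanges the roles of the two factors.
  have h2 : ∑' a : Dir n, pair (cDeriv u c₂) (wDeriv a V) * pair (cDeriv a.conj c₁) V =
      ∑' a : Dir n, pair (cDeriv a c₁) V * pair (cDeriv a.conj c₂) (wDeriv u V) := by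
    rw [← (⟨Dir.conj, Dir.conj, Dir.conj_conj, Dir.conj_conj⟩ : Dir n ≃ Dir n).tsum_eq]
    refine tsum_congr fun a => ?_
    simp only [Equiv.coe_fn_mk, Dir.conj_conj, hsw]
    ring
  rw [h2, ← ENNReal.tsum_add, pair_cBracket]
  refine ENNReal.tsum_le_tsum fun a => ?_
  rw [hsw]
  unfold pair
  rw [← tsum_tsum_mul, ← tsum_tsum_mul, ← ENNReal.tsum_add]
  refine ENNReal.tsum_le_tsum fun M => ?_
  rw [← ENNReal.tsum_add]
  refine ENNReal.tsum_le_tsum fun N => ?_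
  calc _ ≤ cDeriv a c₁ M * cDeriv a.conj c₂ N * (wDeriv u V M * V N + V M * wDeriv u V N) := by
        gcongr
        exact wDeriv_monoWeight_add_le hE _ _ _ _ _
    _ = _ := by ring

lemma one_le_ofReal_exp {s : ℝ} (hs : 0 ≤ s) : 1 ≤ ENNReal.ofReal (Real.exp s) := by
  rw [← ENNReal.ofReal_one]
  exact ENNReal.ofReal_le_ofReal (Real.one_le_exp hs)

/-- Cauchy estimate: the derivative of a majorant along a vector field, with `t` the time for which
the flow of the vector field stays in the larger domain. -/
lemma directional_le {ρ r s r' s' : ℝ} (hr' : 0 < r') (hr : r' < r) (hs : s' < s)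
    {ζ ζ' : NormalSite n → ℝ≥0∞} (h : InBall ρ r' ζ) (h' : InBall ρ r' ζ')
    (c : Mono n → ℝ≥0∞) {t : ℝ≥0∞}
    (ht : t * fieldNorm ρ r s c ≤ ENNReal.ofReal (min (s - s') (1 - r' / r))) :
    ∃ η η', InBall ρ r η ∧ InBall ρ r η' ∧ ∀ H : Mono n → ℝ≥0∞,
      t * ∑' a : Dir n, pair H (wDeriv a (domWeight r' s' ζ ζ')) *
        pair (cDeriv a.conj c) (domWeight r' s' ζ ζ') ≤ pair H (domWeight r s η η') := by
  have h0 : 0 < r := hr'.trans hr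
  set V := domWeight r' s' ζ ζ' with hV
  set B := fieldNorm ρ r s c with hB
  set Y : Dir n → ℝ≥0∞ := fun a => pair (cDeriv a c) V with hY
  set Y' : Dir n → ℝ≥0∞ := fun a => pair (cDeriv a c) (domWeight r s ζ ζ') with hY'
  have hYY : ∀ a, Y a ≤ Y' a := fun a =>
    pair_mono (fun _ => le_rfl) (domWeight_mono hr'.le hr.le hs.le ζ ζ')
  have hb := h.mono hr.le
  have hb' := h'.mono hr.le
  have ht1 : t * B ≤ ENNReal.ofReal (s - s') :=
    ht.trans (ENNReal.ofReal_le_ofReal (min_le_left _ _))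
  have ht2 : t * B ≤ ENNReal.ofReal (1 - r' / r) :=
    ht.trans (ENNReal.ofReal_le_ofReal (min_le_right _ _))
  have hball : ∀ (ξ : NormalSite n → ℝ≥0∞) (g : NormalSite n → Dir n), InBall ρ r' ξ →
      ∑' m, weight ρ m * Y' (g m) ≤ ENNReal.ofReal r * B →
      InBall ρ r fun m => ξ m + t * Y (g m) := by
    intro ξ g hξ hg
    unfold InBall
    simp_rw [add_mul]
    rw [ENNReal.tsum_add]
    have h2 : ∑' m, t * Y (g m) * weight ρ m ≤ ENNReal.ofReal (r - r') := by
      calc _ ≤ ∑' m, t * (weight ρ m * Y' (g m)) := by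
            refine ENNReal.tsum_le_tsum fun m => ?_
            rw [mul_assoc, mul_comm (Y _)]
            gcongr
            exact hYY _
        _ = t * ∑' m, weight ρ m * Y' (g m) := ENNReal.tsum_mul_left
        _ ≤ t * (ENNReal.ofReal r * B) := by gcongr
        _ = ENNReal.ofReal r * (t * B) := by ring
        _ ≤ ENNReal.ofReal r * ENNReal.ofReal (1 - r' / r) := by gcongr
        _ = _ := by
            rw [← ENNReal.ofReal_mul h0.le]
            congr 1
            field_simp
    calc _ < ENNReal.ofReal r' + ENNReal.ofReal (r - r') :=
          ENNReal.add_lt_add_of_lt_of_le (ne_top_of_le_ne_top ENNReal.ofReal_ne_top h2) hξ h2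
      _ = _ := by
          rw [← ENNReal.ofReal_add hr'.le (by linarith)]
          congr 1
          ring
  -- One Euler step of length `t` along the Hamiltonian field of `c`: each variable moves by the
  -- derivative in the conjugate direction.
  refine ⟨fun m => ζ m + t * Y (.neg m), fun m => ζ' m + t * Y (.pos m),
    hball ζ .neg h (sum_neg_le h0 hb hb' c), hball ζ' .pos h' (sum_pos_le h0 hb hb' c), fun H => ?_⟩
  have hgen : ∀ Z : Dir n → ℝ≥0∞, t * ∑' a, pair H (wDeriv a V) * Z a =
      pair H (fun M => ∑' a, t * Z a * wDeriv a V M) := by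
    intro Z
    unfold pair
    simp_rw [← ENNReal.tsum_mul_left, ← ENNReal.tsum_mul_right, ← ENNReal.tsum_mul_left]
    rw [ENNReal.tsum_comm]
    exact tsum_congr fun M => tsum_congr fun a => by ring
  calc _ = pair H (fun M => ∑' a : Dir n, t * Y a.conj * wDeriv a V M) := hgen fun a => Y a.conj
    _ ≤ _ := pair_mono (fun _ => le_rfl) fun M => by
        refine le_trans le_add_self (monoWeight_taylor (x := s - s') (by linarith)
          (fun a : Dir n => t * Y a.conj) (fun j => ?_) ?_ ?_ (fun m => le_rfl)
          (fun m => le_rfl) M)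
        · have : Y' (.ang j) ≤ ENNReal.ofReal (r ^ 2) * B :=
            (Finset.single_le_sum (f := fun j => Y' (.ang j)) (fun _ _ => bot_le)
              (Finset.mem_univ j)).trans (sum_ang_le h0 hb hb' c)
          calc _ ≤ ENNReal.ofReal (r' ^ 2) + t * (ENNReal.ofReal (r ^ 2) * B) := by
                gcongr
                exact (hYY _).trans this
            _ = ENNReal.ofReal (r' ^ 2) + ENNReal.ofReal (r ^ 2) * (t * B) := by ring
            _ ≤ ENNReal.ofReal (r' ^ 2) + ENNReal.ofReal (r ^ 2) * ENNReal.ofReal (1 - r' / r) := by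
                gcongr
            _ ≤ _ := by
                have : r' / r ≤ 1 := (div_le_one h0).2 hr.le
                rw [← ENNReal.ofReal_mul (by positivity), ← ENNReal.ofReal_add (by positivity)
                  (mul_nonneg (by positivity) (by linarith))]
                apply ENNReal.ofReal_le_ofReal
                have : r ^ 2 * (1 - r' / r) = r ^ 2 - r * r' := by field_simp
                nlinarith
        · rw [← ENNReal.ofReal_mul (Real.exp_pos _).le, ← Real.exp_add]
          apply ENNReal.ofReal_le_ofReal
          simp
        · rw [← Finset.mul_sum]
          refine le_trans (mul_le_mul_right ?_ t) ht1
          exact (Finset.sum_le_sum fun j _ => hYY _).trans (sum_act_le hb hb' c)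

/-- Take the longest admissible time `δ / B`. If `B = 0` even `t = ⊤` is admissible, which forces `D
= 0`. -/
lemma le_div_of_forall_time {D A B δ : ℝ≥0∞} (hA : A ≠ ⊤) (hB : B ≠ ⊤) (hδ : δ ≠ 0) (hδ' : δ ≠ ⊤)
    (h : ∀ t : ℝ≥0∞, t * B ≤ δ → t * D ≤ A) : D ≤ A * B / δ := by
  by_cases hB0 : B = 0
  · subst hB0
    have hD : D = 0 := by
      by_contra hD
      have := h ⊤ (by simp)
      rw [ENNReal.top_mul hD] at this
      exact hA (top_le_iff.1 this)
    simp [hD]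
  · have := h (δ / B) (ENNReal.div_mul_cancel hB0 hB).le
    rw [ENNReal.le_div_iff_mul_le (Or.inl hδ) (Or.inl hδ')]
    calc D * δ = δ / B * D * B := by
          rw [mul_right_comm, ENNReal.div_mul_cancel hB0 hB, mul_comm]
      _ ≤ A * B := by gcongr

/-- The basic estimate of a Poisson bracket. -/
theorem fieldNorm_cBracket_le {ρ r s r' s' : ℝ} (hr' : 0 < r') (hr : r' < r) (hs' : 0 ≤ s')
    (hs : s' < s) {c₁ c₂ : Mono n → ℝ≥0∞} (h₁ : fieldNorm ρ r s c₁ ≠ ⊤)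
    (h₂ : fieldNorm ρ r s c₂ ≠ ⊤) :
    fieldNorm ρ r' s' (cBracket c₁ c₂) ≤
      ENNReal.ofReal (2 * (r / r') ^ 2 / min (s - s') (1 - r' / r)) *
        fieldNorm ρ r s c₁ * fieldNorm ρ r s c₂ := by
  have h0 : 0 < r := hr'.trans hr
  set δ := min (s - s') (1 - r' / r) with hδ
  have hδ0 : 0 < δ := lt_min (by linarith) (by rw [sub_pos, div_lt_one h0]; exact hr)
  have hfin : ∀ {c : Mono n → ℝ≥0∞}, fieldNorm ρ r s c ≠ ⊤ → ∀ q, compNorm ρ r s q c ≠ ⊤ := by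
    intro c hc q hq
    apply hc
    unfold fieldNorm
    rw [ENNReal.sum_eq_top]
    refine ⟨q, Finset.mem_univ q, ?_⟩
    rw [hq, ENNReal.mul_top]
    rcases q with (j | j) | q <;> simp [compScale, h0]
  have hone : ∀ {c₁ c₂ : Mono n → ℝ≥0∞}, fieldNorm ρ r s c₁ ≠ ⊤ → fieldNorm ρ r s c₂ ≠ ⊤ →
      ∀ q ζ ζ', InBall ρ r' ζ → InBall ρ r' ζ' →
      ∑' u : Dir n, dirWeight ρ q u * ∑' a : Dir n, pair (cDeriv u c₁)
        (wDeriv a (domWeight r' s' ζ ζ')) * pair (cDeriv a.conj c₂) (domWeight r' s' ζ ζ') ≤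
      compNorm ρ r s q c₁ * fieldNorm ρ r s c₂ / ENNReal.ofReal δ := by
    intro c₁ c₂ h₁ h₂ q ζ ζ' hζ hζ'
    refine le_div_of_forall_time (hfin h₁ q) h₂ (by simpa using hδ0) ENNReal.ofReal_ne_top
      fun t ht => ?_
    obtain ⟨η, η', hη, hη', hH⟩ := directional_le hr' hr hs hζ hζ' c₂ ht
    rw [← ENNReal.tsum_mul_left]
    refine le_trans ?_ (le_compNorm hη hη' q c₁)
    rw [pair_compWeight]
    refine ENNReal.tsum_le_tsum fun u => ?_
    rw [mul_left_comm]
    gcongr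
    exact hH _
  have hq : ∀ q, compNorm ρ r' s' q (cBracket c₁ c₂) ≤
      (compNorm ρ r s q c₁ * fieldNorm ρ r s c₂ + compNorm ρ r s q c₂ * fieldNorm ρ r s c₁) /
        ENNReal.ofReal δ := by
    intro q
    refine compNorm_le fun ζ ζ' hζ hζ' => ?_
    rw [ENNReal.add_div]
    refine le_trans ?_ (add_le_add (hone h₁ h₂ q ζ ζ' hζ hζ') (hone h₂ h₁ q ζ ζ' hζ hζ'))
    rw [← ENNReal.tsum_add, pair_compWeight]
    refine ENNReal.tsum_le_tsum fun u => ?_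
    rw [← mul_add, pair_cDeriv]
    gcongr
    exact pair_cBracket_wDeriv_le (one_le_ofReal_exp hs') ζ ζ' u c₁ c₂
  calc _ ≤ ∑ q : Comp b, ENNReal.ofReal ((r / r') ^ 2) * compScale q r *
        ((compNorm ρ r s q c₁ * fieldNorm ρ r s c₂ + compNorm ρ r s q c₂ * fieldNorm ρ r s c₁) /
        ENNReal.ofReal δ) :=
        Finset.sum_le_sum fun q _ => mul_le_mul' (compScale_le hr' hr.le q) (hq q)
    _ = ENNReal.ofReal ((r / r') ^ 2) * (ENNReal.ofReal δ)⁻¹ *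
        ((∑ q : Comp b, compScale q r * compNorm ρ r s q c₁) * fieldNorm ρ r s c₂ +
          (∑ q : Comp b, compScale q r * compNorm ρ r s q c₂) * fieldNorm ρ r s c₁) := by
        rw [Finset.sum_mul, Finset.sum_mul, ← Finset.sum_add_distrib, Finset.mul_sum]
        refine Finset.sum_congr rfl fun q _ => ?_
        rw [ENNReal.div_eq_inv_mul]
        ring
    _ = ENNReal.ofReal ((r / r') ^ 2) * (ENNReal.ofReal δ)⁻¹ *
        (2 * (fieldNorm ρ r s c₁ * fieldNorm ρ r s c₂)) := by
        rw [← fieldNorm, ← fieldNorm]; ring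
    _ = _ := by
        rw [ENNReal.ofReal_div_of_pos hδ0, ENNReal.ofReal_mul (by norm_num), ENNReal.div_eq_inv_mul,
          ENNReal.ofReal_ofNat]
        ring

end MajorantBracket

/-! ### Calculus of the coefficient norm -/

section CoeffNorm

variable {b : ℕ} {O : Set (Fin b → ℝ)}

lemma enorm_le_coeffNorm {c : (Fin b → ℝ) → ℂ} {ξ : Fin b → ℝ} (hξ : ξ ∈ O) :
    ‖c ξ‖ₑ ≤ coeffNorm O c :=
  le_self_add.trans (le_iSup₂ (f := fun ξ (_ : ξ ∈ O) =>
    ‖c ξ‖ₑ + ‖fun j : Fin b => fderiv ℝ c ξ (Pi.single j 1)‖ₑ) ξ hξ)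

lemma differentiableAt_of_contDiffOn (hO : IsOpen O) {c : (Fin b → ℝ) → ℂ}
    (hc : ContDiffOn ℝ 1 c O) {ξ : Fin b → ℝ} (hξ : ξ ∈ O) : DifferentiableAt ℝ c ξ :=
  (hc.contDiffAt (hO.mem_nhds hξ)).differentiableAt one_ne_zero

lemma coeffNorm_congr (hO : IsOpen O) {c c' : (Fin b → ℝ) → ℂ} (h : Set.EqOn c c' O) :
    coeffNorm O c = coeffNorm O c' := by
  refine iSup_congr fun ξ => iSup_congr fun hξ => ?_
  have : c =ᶠ[nhds ξ] c' := Filter.eventuallyEq_of_mem (hO.mem_nhds hξ) h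
  rw [h hξ, this.fderiv_eq]

@[simp] lemma coeffNorm_zero : coeffNorm O (fun _ => (0 : ℂ)) = 0 := by
  simp only [coeffNorm, fderiv_fun_const, enorm_zero, zero_add, ENNReal.iSup_eq_zero]
  exact fun _ _ => enorm_eq_zero.2 rfl

lemma coeffNorm_const_mul (hO : IsOpen O) {c : (Fin b → ℝ) → ℂ} (hc : ContDiffOn ℝ 1 c O) (x : ℂ) :
    coeffNorm O (fun ξ => x * c ξ) = ‖x‖ₑ * coeffNorm O c := by
  unfold coeffNorm
  simp_rw [ENNReal.mul_iSup]
  refine iSup_congr fun ξ => iSup_congr fun hξ => ?_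
  have hd := differentiableAt_of_contDiffOn hO hc hξ
  have : (fun j : Fin b => fderiv ℝ (fun ξ => x * c ξ) ξ (Pi.single j 1)) =
      x • fun j : Fin b => fderiv ℝ c ξ (Pi.single j 1) := by
    funext j
    rw [fderiv_const_mul hd]
    simp
  rw [this, enorm_smul, enorm_mul, mul_add]

lemma coeffNorm_add_le (hO : IsOpen O) {c c' : (Fin b → ℝ) → ℂ} (hc : ContDiffOn ℝ 1 c O)
    (hc' : ContDiffOn ℝ 1 c' O) :
    coeffNorm O (fun ξ => c ξ + c' ξ) ≤ coeffNorm O c + coeffNorm O c' := by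
  refine iSup₂_le fun ξ hξ => ?_
  have hd := differentiableAt_of_contDiffOn hO hc hξ
  have hd' := differentiableAt_of_contDiffOn hO hc' hξ
  have : (fun j : Fin b => fderiv ℝ (fun ξ => c ξ + c' ξ) ξ (Pi.single j 1)) =
      (fun j : Fin b => fderiv ℝ c ξ (Pi.single j 1)) +
        fun j : Fin b => fderiv ℝ c' ξ (Pi.single j 1) := by
    funext j
    rw [fderiv_fun_add hd hd']
    simp
  rw [this]
  calc _ ≤ (‖c ξ‖ₑ + ‖c' ξ‖ₑ) + (‖fun j : Fin b => fderiv ℝ c ξ (Pi.single j 1)‖ₑ +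
        ‖fun j : Fin b => fderiv ℝ c' ξ (Pi.single j 1)‖ₑ) :=
        add_le_add (enorm_add_le _ _) (enorm_add_le _ _)
    _ = (‖c ξ‖ₑ + ‖fun j : Fin b => fderiv ℝ c ξ (Pi.single j 1)‖ₑ) +
        (‖c' ξ‖ₑ + ‖fun j : Fin b => fderiv ℝ c' ξ (Pi.single j 1)‖ₑ) := by ring
    _ ≤ _ := add_le_add
        (le_iSup₂ (f := fun ξ (_ : ξ ∈ O) =>
          ‖c ξ‖ₑ + ‖fun j : Fin b => fderiv ℝ c ξ (Pi.single j 1)‖ₑ) ξ hξ)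
        (le_iSup₂ (f := fun ξ (_ : ξ ∈ O) =>
          ‖c' ξ‖ₑ + ‖fun j : Fin b => fderiv ℝ c' ξ (Pi.single j 1)‖ₑ) ξ hξ)

/-- Product rule, with the non-negative term `‖D‖ₑ * ‖D'‖ₑ` added to complete the product. Because
of this the dependence on the parameter `ξ` costs nothing in the bracket estimates. -/
lemma coeffNorm_mul_le (hO : IsOpen O) {c c' : (Fin b → ℝ) → ℂ} (hc : ContDiffOn ℝ 1 c O)
    (hc' : ContDiffOn ℝ 1 c' O) :
    coeffNorm O (fun ξ => c ξ * c' ξ) ≤ coeffNorm O c * coeffNorm O c' := by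
  refine iSup₂_le fun ξ hξ => ?_
  have hd := differentiableAt_of_contDiffOn hO hc hξ
  have hd' := differentiableAt_of_contDiffOn hO hc' hξ
  set D := fun j : Fin b => fderiv ℝ c ξ (Pi.single j 1) with hD
  set D' := fun j : Fin b => fderiv ℝ c' ξ (Pi.single j 1) with hD'
  have : (fun j : Fin b => fderiv ℝ (fun ξ => c ξ * c' ξ) ξ (Pi.single j 1)) =
      c ξ • D' + c' ξ • D := by
    funext j
    rw [fderiv_fun_mul hd hd']
    simp [hD, hD']
  rw [this]
  calc _ ≤ ‖c ξ‖ₑ * ‖c' ξ‖ₑ + (‖c ξ‖ₑ * ‖D'‖ₑ + ‖c' ξ‖ₑ * ‖D‖ₑ) := by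
        rw [enorm_mul]
        refine add_le_add le_rfl ((enorm_add_le _ _).trans_eq ?_)
        rw [enorm_smul, enorm_smul]
    _ ≤ (‖c ξ‖ₑ + ‖D‖ₑ) * (‖c' ξ‖ₑ + ‖D'‖ₑ) := by
        calc _ ≤ ‖c ξ‖ₑ * ‖c' ξ‖ₑ + (‖c ξ‖ₑ * ‖D'‖ₑ + ‖c' ξ‖ₑ * ‖D‖ₑ) + ‖D‖ₑ * ‖D'‖ₑ := le_self_add
          _ = _ := by ring
    _ ≤ _ := mul_le_mul'
        (le_iSup₂ (f := fun ξ (_ : ξ ∈ O) =>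
          ‖c ξ‖ₑ + ‖fun j : Fin b => fderiv ℝ c ξ (Pi.single j 1)‖ₑ) ξ hξ)
        (le_iSup₂ (f := fun ξ (_ : ξ ∈ O) =>
          ‖c' ξ‖ₑ + ‖fun j : Fin b => fderiv ℝ c' ξ (Pi.single j 1)‖ₑ) ξ hξ)

/-- The factor `b` affects only the summability of derivatives in `contDiffOn_tsum_coeff`, not the
resulting bound, which is again in terms of partial derivatives. -/
lemma opNorm_le_of_partials (L : (Fin b → ℝ) →L[ℝ] ℂ) :
    ‖L‖ ≤ b * ‖fun j : Fin b => L (Pi.single j 1)‖ := by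
  refine L.opNorm_le_bound (by positivity) fun v => ?_
  have hv : L v = ∑ j, v j • L (Pi.single j 1) := by
    conv_lhs => rw [← Finset.univ_sum_single v]
    rw [map_sum]
    refine Finset.sum_congr rfl fun j _ => ?_
    rw [← map_smul]
    congr 1
    rw [← Pi.single_smul', smul_eq_mul, mul_one]
  rw [hv]
  calc _ ≤ ∑ j : Fin b, ‖v j • L (Pi.single j 1)‖ := norm_sum_le _ _
    _ ≤ ∑ _j : Fin b, ‖v‖ * ‖fun j : Fin b => L (Pi.single j 1)‖ := by
        refine Finset.sum_le_sum fun j _ => ?_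
        rw [norm_smul]
        gcongr
        · exact norm_le_pi_norm v j
        · exact norm_le_pi_norm (fun j : Fin b => L (Pi.single j 1)) j
    _ = _ := by simp; ring

/-- A series of `C¹` coefficients with summable norms is `C¹`. -/
lemma contDiffOn_tsum_coeff {ι : Type*} (hO : IsOpen O) {c : ι → (Fin b → ℝ) → ℂ}
    (hc : ∀ i, ContDiffOn ℝ 1 (c i) O) (hsum : ∑' i, coeffNorm O (c i) ≠ ⊤) :
    ContDiffOn ℝ 1 (fun ξ => ∑' i, c i ξ) O ∧
      coeffNorm O (fun ξ => ∑' i, c i ξ) ≤ ∑' i, coeffNorm O (c i) := by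
  have hfin : ∀ i, coeffNorm O (c i) ≠ ⊤ := ENNReal.ne_top_of_tsum_ne_top hsum
  set u : ι → ℝ := fun i => (coeffNorm O (c i)).toReal with hu
  have hus : Summable u := ENNReal.summable_toReal hsum
  have hterm : ∀ i, ∀ ξ ∈ O,
      ‖c i ξ‖ₑ + ‖fun j : Fin b => fderiv ℝ (c i) ξ (Pi.single j 1)‖ₑ ≤ coeffNorm O (c i) :=
    fun i ξ hξ => le_iSup₂ (f := fun ξ (_ : ξ ∈ O) =>
      ‖c i ξ‖ₑ + ‖fun j : Fin b => fderiv ℝ (c i) ξ (Pi.single j 1)‖ₑ) ξ hξ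
  have hval : ∀ i, ∀ ξ ∈ O, ‖c i ξ‖ ≤ u i := by
    intro i ξ hξ
    have := ENNReal.toReal_mono (hfin i) (le_self_add.trans (hterm i ξ hξ))
    simpa using this
  have hgrad : ∀ i, ∀ ξ ∈ O, ‖fun j : Fin b => fderiv ℝ (c i) ξ (Pi.single j 1)‖ ≤ u i := by
    intro i ξ hξ
    have := ENNReal.toReal_mono (hfin i) (le_add_self.trans (hterm i ξ hξ))
    rwa [toReal_enorm] at this
  have hder : ∀ i, ∀ ξ ∈ O, ‖fderiv ℝ (c i) ξ‖ ≤ b * u i := fun i ξ hξ =>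
    (opNorm_le_of_partials _).trans (by gcongr; exact hgrad i ξ hξ)
  have hdiff : ∀ ξ ∈ O, HasFDerivAt (fun ξ => ∑' i, c i ξ) (∑' i, fderiv ℝ (c i) ξ) ξ := by
    intro ξ hξ
    obtain ⟨ε, hε, hball⟩ := Metric.isOpen_iff.1 hO ξ hξ
    refine hasFDerivAt_tsum_of_isPreconnected (hus.mul_left (b : ℝ)) Metric.isOpen_ball
      (convex_ball ξ ε).isPreconnected
      (fun i y hy => (differentiableAt_of_contDiffOn hO (hc i) (hball hy)).hasFDerivAt)
      (fun i y hy => hder i y (hball hy)) (Metric.mem_ball_self hε) ?_ (Metric.mem_ball_self hε)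
    exact Summable.of_norm_bounded hus fun i => hval i ξ hξ
  have hsD : ∀ ξ ∈ O, Summable fun i => fderiv ℝ (c i) ξ := fun ξ hξ =>
    Summable.of_norm_bounded (hus.mul_left (b : ℝ)) fun i => hder i ξ hξ
  constructor
  · have h1 : (1 : WithTop ℕ∞) = 0 + 1 := by norm_num
    rw [h1, contDiffOn_succ_iff_fderiv_of_isOpen hO]
    refine ⟨fun ξ hξ => (hdiff ξ hξ).differentiableAt.differentiableWithinAt, by simp, ?_⟩
    rw [contDiffOn_zero]
    have hcont : ContinuousOn (fun ξ => ∑' i, fderiv ℝ (c i) ξ) O := by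
      refine continuousOn_tsum (fun i => ?_) (hus.mul_left (b : ℝ)) hder
      exact (hc i).continuousOn_fderiv_of_isOpen hO (by norm_num)
    exact hcont.congr fun ξ hξ => (hdiff ξ hξ).fderiv
  · refine iSup₂_le fun ξ hξ => ?_
    have hpart : (fun j : Fin b => fderiv ℝ (fun ξ => ∑' i, c i ξ) ξ (Pi.single j 1)) =
        ∑' i, fun j : Fin b => fderiv ℝ (c i) ξ (Pi.single j 1) := by
      rw [(hdiff ξ hξ).fderiv]
      have hs : Summable fun i => fun j : Fin b => fderiv ℝ (c i) ξ (Pi.single j 1) :=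
        Summable.of_norm_bounded hus fun i => hgrad i ξ hξ
      funext j
      rw [tsum_apply hs]
      exact (ContinuousLinearMap.apply ℝ ℂ (Pi.single j (1 : ℝ) : Fin b → ℝ)).map_tsum (hsD ξ hξ)
    rw [hpart]
    calc _ ≤ ∑' i, ‖c i ξ‖ₑ + ∑' i, ‖fun j : Fin b => fderiv ℝ (c i) ξ (Pi.single j 1)‖ₑ :=
          add_le_add (enorm_tsum_le_tsum_enorm) (enorm_tsum_le_tsum_enorm)
      _ = ∑' i, (‖c i ξ‖ₑ + ‖fun j : Fin b => fderiv ℝ (c i) ξ (Pi.single j 1)‖ₑ) :=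
          ENNReal.tsum_add.symm
      _ ≤ _ := ENNReal.tsum_le_tsum fun i => hterm i ξ hξ

end CoeffNorm

/-! ### Series, their norms and their Poisson brackets -/

section SeriesNorms

variable {d b : ℕ} {n : Fin b → Fin d → ℤ}

lemma one_le_eucl {m : Fin d → ℤ} (hm : m ≠ 0) : 1 ≤ eucl m := by
  obtain ⟨i, hi⟩ := Function.ne_iff.1 hm
  unfold eucl
  rw [Real.one_le_sqrt]
  have h1 : (1 : ℝ) ≤ (m i : ℝ) ^ 2 := by
    have : (1 : ℤ) ≤ m i ^ 2 := by
      have := sq_pos_of_ne_zero (a := m i) hi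
      omega
    exact_mod_cast this
  exact h1.trans (Finset.single_le_sum (f := fun i => (m i : ℝ) ^ 2) (fun _ _ => sq_nonneg _)
    (Finset.mem_univ i))

lemma NormalSite.ne_zero (hz : ∃ i, n i = 0) (m : NormalSite n) : m.1 ≠ 0 := by
  intro h
  obtain ⟨i, hi⟩ := hz
  exact m.2 ⟨i, hi.trans h.symm⟩

/-- As the origin is a tangential site, every normal site is a nonzero lattice point and has length
at least one. -/
lemma one_le_weight (hz : ∃ i, n i = 0) {ρ : ℝ} (hρ : 0 < ρ) (m : NormalSite n) :
    1 ≤ weight ρ m := by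
  have h := one_le_eucl (m.ne_zero hz)
  unfold weight
  rw [← ENNReal.ofReal_one]
  apply ENNReal.ofReal_le_ofReal
  have h1 : 1 ≤ Real.exp (ρ * eucl m.1) := Real.one_le_exp (by positivity)
  have h2 : 1 ≤ eucl m.1 ^ (d + 1) := one_le_pow₀ h
  nlinarith

lemma weight_ne_top (ρ : ℝ) (m : NormalSite n) : weight ρ m ≠ ⊤ := ENNReal.ofReal_ne_top

lemma InBall.ne_top (hz : ∃ i, n i = 0) {ρ r : ℝ} (hρ : 0 < ρ) {ζ : NormalSite n → ℝ≥0∞}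
    (h : InBall ρ r ζ) (m : NormalSite n) : ζ m ≠ ⊤ := by
  intro ht
  have h1 := ENNReal.ne_top_of_tsum_ne_top (ne_top_of_lt h) m
  rw [ht, ENNReal.top_mul] at h1
  · exact h1 rfl
  · exact (zero_lt_one.trans_le (one_le_weight hz hρ m)).ne'

lemma majorant_eq (O : Set (Fin b → ℝ)) (r s : ℝ) (f : Series n) (z zbar : NormalSite n → ℂ) :
    majorant O r s f z zbar =
      pair (fun M => coeffNorm O (f M)) (domWeight r s (fun m => ‖z m‖ₑ) fun m => ‖zbar m‖ₑ) := by
  unfold majorant pair domWeight monoWeight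
  refine tsum_congr fun M => ?_
  rw [ENNReal.ofReal_mul (by rw [pow_mul]; positivity), pow_mul, ENNReal.ofReal_pow (sq_nonneg r),
    Real.exp_nat_mul, ENNReal.ofReal_pow (Real.exp_pos s).le]
  ring

lemma seqNorm_lt_iff {ρ r : ℝ} {z : NormalSite n → ℂ} :
    seqNorm ρ z < ENNReal.ofReal r ↔ InBall ρ r fun m => ‖z m‖ₑ := Iff.rfl

/-- A supremum over the ball in terms of non-negative sequences. -/
lemma iSup_ball_eq (hz : ∃ i, n i = 0) {ρ r : ℝ} (hρ : 0 < ρ)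
    (G : (NormalSite n → ℝ≥0∞) → (NormalSite n → ℝ≥0∞) → ℝ≥0∞) :
    (⨆ (z : NormalSite n → ℂ) (zbar : NormalSite n → ℂ) (_ : seqNorm ρ z < ENNReal.ofReal r)
      (_ : seqNorm ρ zbar < ENNReal.ofReal r), G (fun m => ‖z m‖ₑ) fun m => ‖zbar m‖ₑ) =
    ⨆ (ζ : NormalSite n → ℝ≥0∞) (ζ' : NormalSite n → ℝ≥0∞) (_ : InBall ρ r ζ)
      (_ : InBall ρ r ζ'), G ζ ζ' := by
  apply le_antisymm
  · exact iSup₂_le fun z zbar => iSup₂_le fun h h' =>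
      le_iSup₂_of_le (fun m => ‖z m‖ₑ) (fun m => ‖zbar m‖ₑ) (le_iSup₂_of_le h h' le_rfl)
  · have hlift : ∀ ζ : NormalSite n → ℝ≥0∞, InBall ρ r ζ →
        (fun m => ‖((ζ m).toReal : ℂ)‖ₑ) = ζ := by
      intro ζ hζ
      funext m
      rw [← ofReal_norm, Complex.norm_real, Real.norm_of_nonneg ENNReal.toReal_nonneg,
        ENNReal.ofReal_toReal (hζ.ne_top hz hρ m)]
    refine iSup₂_le fun ζ ζ' => iSup₂_le fun h h' => ?_
    refine le_iSup₂_of_le (fun m => ((ζ m).toReal : ℂ)) (fun m => ((ζ' m).toReal : ℂ)) ?_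
    refine le_iSup₂_of_le ?_ ?_ ?_
    · rw [seqNorm_lt_iff, hlift ζ h]; exact h
    · rw [seqNorm_lt_iff, hlift ζ' h']; exact h'
    · rw [hlift ζ h, hlift ζ' h']

/-- The coefficient norms of a series. -/
def coeffs (O : Set (Fin b → ℝ)) (f : Series n) (M : Mono n) : ℝ≥0∞ := coeffNorm O (f M)

/-- The factor which differentiation in the direction `a` produces. -/
def Dir.fac (a : Dir n) (M : Mono n) : ℂ :=
  match a with
  | .act j => (M.l j : ℂ) + 1
  | .ang j => Complex.I * (M.k j : ℂ)
  | .pos m => (M.α m : ℂ) + 1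
  | .neg m => (M.β m : ℂ) + 1

/-- The derivative of a series in the direction `a`. -/
def Series.deriv (a : Dir n) (f : Series n) : Series n :=
  fun M ξ => a.fac M * f (M + a.inc) ξ

lemma Dir.enorm_fac (a : Dir n) (M : Mono n) : ‖a.fac M‖ₑ = a.deg (M + a.inc) := by
  have hc : ∀ k : ℕ, ‖(k : ℂ) + 1‖ₑ = ((k + 1 : ℕ) : ℝ≥0∞) := by
    intro k
    rw [← ofReal_norm, ← Nat.cast_succ, Complex.norm_natCast, ENNReal.ofReal_natCast]
  cases a with
  | act j => simp [Dir.fac, Dir.deg, Dir.inc, hc]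
  | ang j =>
    simp only [Dir.fac, Dir.deg, Dir.inc, add_zero]
    rw [← ofReal_norm, norm_mul, Complex.norm_I, one_mul, Complex.norm_intCast,
      ← ENNReal.ofReal_natCast, Nat.cast_natAbs, Int.cast_abs]
  | pos m => simp [Dir.fac, Dir.deg, Dir.inc, hc]
  | neg m => simp [Dir.fac, Dir.deg, Dir.inc, hc]

lemma Series.dI_eq (f : Series n) (j : Fin b) : f.dI j = f.deriv (.act j) := by
  funext M ξ
  have : ({ M with l := M.l + Pi.single j 1 } : Mono n) = M + (Dir.act j).inc := by
    ext1 <;> simp [Dir.inc]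
  simp [Series.dI, Series.deriv, Dir.fac, this]

lemma Series.dϑ_eq (f : Series n) (j : Fin b) : f.dϑ j = f.deriv (.ang j) := by
  funext M ξ
  simp [Series.dϑ, Series.deriv, Dir.fac, Dir.inc]

lemma Mono.mulVar_true (M : Mono n) (m : NormalSite n) :
    M.mulVar true m = M + (Dir.pos m).inc := by
  ext1 <;> simp [Dir.inc, Mono.mulVar]

lemma Mono.mulVar_false (M : Mono n) (m : NormalSite n) :
    M.mulVar false m = M + (Dir.neg m).inc := by
  ext1 <;> simp [Dir.inc, Mono.mulVar]

lemma Series.dz_eq (f : Series n) (m : NormalSite n) : f.dz m = f.deriv (.pos m) := by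
  funext M ξ
  simp [Series.dz, Series.deriv, Dir.fac, Mono.mulVar_true]

lemma Series.dzbar_eq (f : Series n) (m : NormalSite n) : f.dzbar m = f.deriv (.neg m) := by
  funext M ξ
  simp [Series.dzbar, Series.deriv, Dir.fac, Mono.mulVar_false]

variable {O : Set (Fin b → ℝ)}

lemma coeffs_deriv (hO : IsOpen O) {f : Series n} (hf : ∀ M, ContDiffOn ℝ 1 (f M) O) (a : Dir n) :
    coeffs O (f.deriv a) = cDeriv a (coeffs O f) := by
  funext M
  unfold coeffs Series.deriv cDeriv
  rw [coeffNorm_const_mul hO (hf _), Dir.enorm_fac]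

/-- Reduces all norm estimates to non-negative coefficients. Differentiability in `ξ` enters because
the factors produced by differentiating a monomial are pulled out of a norm containing `fderiv`. -/
lemma XNorm_eq (hz : ∃ i, n i = 0) {ρ r s : ℝ} (hρ : 0 < ρ) (hO : IsOpen O) {f : Series n}
    (hf : ∀ M, ContDiffOn ℝ 1 (f M) O) : XNorm ρ O r s f = fieldNorm ρ r s (coeffs O f) := by
  have hS : ∀ g : Series n, scalarNorm ρ O r s g =
      ⨆ (ζ : NormalSite n → ℝ≥0∞) (ζ' : NormalSite n → ℝ≥0∞) (_ : InBall ρ r ζ)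
        (_ : InBall ρ r ζ'), pair (coeffs O g) (domWeight r s ζ ζ') := by
    intro g
    unfold scalarNorm
    simp_rw [majorant_eq]
    exact iSup_ball_eq hz hρ fun ζ ζ' => pair (coeffs O g) (domWeight r s ζ ζ')
  have hV : ∀ g : NormalSite n → Series n, vectorNorm ρ O r s g =
      ⨆ (ζ : NormalSite n → ℝ≥0∞) (ζ' : NormalSite n → ℝ≥0∞) (_ : InBall ρ r ζ)
        (_ : InBall ρ r ζ'), ∑' m, weight ρ m * pair (coeffs O (g m)) (domWeight r s ζ ζ') := by
    intro g
    unfold vectorNorm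
    simp_rw [majorant_eq, mul_comm _ (weight ρ _)]
    exact iSup_ball_eq hz hρ fun ζ ζ' =>
      ∑' m, weight ρ m * pair (coeffs O (g m)) (domWeight r s ζ ζ')
  unfold XNorm fieldNorm
  rw [Fintype.sum_sum_type, Fintype.sum_sum_type, Fintype.sum_bool, Finset.mul_sum, mul_add]
  congr 1
  · congr 1
    · refine Finset.sum_congr rfl fun j _ => ?_
      rw [hS, Series.dI_eq, coeffs_deriv hO hf]
      simp only [compScale, one_mul, compNorm, pair_compWeight, tsum_dirWeight_act]
    · refine Finset.sum_congr rfl fun j _ => ?_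
      rw [hS, Series.dϑ_eq, coeffs_deriv hO hf]
      simp only [compScale, compNorm, pair_compWeight, tsum_dirWeight_ang]
  · rw [hV, hV]
    simp only [Series.dz_eq, Series.dzbar_eq, coeffs_deriv hO hf, compScale, compNorm,
      pair_compWeight, tsum_dirWeight_pos, tsum_dirWeight_neg]

lemma memA_iff (hz : ∃ i, n i = 0) {ρ r s : ℝ} (hρ : 0 < ρ) (hO : IsOpen O) {f : Series n} :
    MemA ρ O r s f ↔ (∀ M, ContDiffOn ℝ 1 (f M) O) ∧
      (∀ M : Mono n, M.momentum ≠ 0 → ∀ ξ ∈ O, f M ξ = 0) ∧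
      fieldNorm ρ r s (coeffs O f) ≠ ⊤ := by
  unfold MemA
  constructor
  · rintro ⟨h1, h2, h3⟩
    exact ⟨h1, h2, by rw [← XNorm_eq hz hρ hO h1]; exact h3.ne⟩
  · rintro ⟨h1, h2, h3⟩
    exact ⟨h1, h2, by rw [XNorm_eq hz hρ hO h1]; exact lt_top_iff_ne_top.2 h3⟩

/-- There is a sequence without zeros in every ball. -/
lemma exists_pos_inBall (hz : ∃ i, n i = 0) {ρ r : ℝ} (hρ : 0 < ρ) (hr : 0 < r) :
    ∃ ζ : NormalSite n → ℝ≥0∞, (∀ m, ζ m ≠ 0) ∧ InBall ρ r ζ := by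
  obtain ⟨ε, hε, hsum⟩ := ENNReal.exists_pos_sum_of_countable' (ε := ENNReal.ofReal r)
    (by simpa using hr) (NormalSite n)
  refine ⟨fun m => ε m / weight ρ m, fun m => ?_, ?_⟩
  · exact (ENNReal.div_pos (hε m).ne' (weight_ne_top ρ m)).ne'
  · unfold InBall
    refine lt_of_le_of_lt (ENNReal.tsum_le_tsum fun m => ?_) hsum
    rw [ENNReal.div_mul_cancel (zero_lt_one.trans_le (one_le_weight hz hρ m)).ne'
      (weight_ne_top ρ m)]

lemma monoWeight_ne_zero {R E : ℝ≥0∞} {ζ ζ' : NormalSite n → ℝ≥0∞} (hR : R ≠ 0) (hE : E ≠ 0)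
    (hζ : ∀ m, ζ m ≠ 0) (hζ' : ∀ m, ζ' m ≠ 0) (M : Mono n) : monoWeight R E ζ ζ' M ≠ 0 := by
  unfold monoWeight Finsupp.prod
  refine mul_ne_zero (mul_ne_zero (pow_ne_zero _ hR) (pow_ne_zero _ hE)) (mul_ne_zero ?_ ?_)
  · exact Finset.prod_ne_zero_iff.2 fun m _ => pow_ne_zero _ (hζ m)
  · exact Finset.prod_ne_zero_iff.2 fun m _ => pow_ne_zero _ (hζ' m)

lemma domWeight_ne_zero {r s : ℝ} (hr : 0 < r) {ζ ζ' : NormalSite n → ℝ≥0∞}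
    (hζ : ∀ m, ζ m ≠ 0) (hζ' : ∀ m, ζ' m ≠ 0) (M : Mono n) : domWeight r s ζ ζ' M ≠ 0 :=
  monoWeight_ne_zero (by simpa using hr.ne') (by simpa using Real.exp_pos s) hζ hζ' M

lemma sum_mul_le_sum_mul_sum {ι : Type*} [Fintype ι] (x y : ι → ℝ≥0∞) :
    ∑ i, x i * y i ≤ (∑ i, x i) * ∑ i, y i := by
  rw [Finset.sum_mul]
  refine Finset.sum_le_sum fun i _ => ?_
  gcongr
  exact Finset.single_le_sum (f := y) (fun _ _ => bot_le) (Finset.mem_univ i)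

lemma tsum_mul_le_tsum_mul_tsum {ι : Type*} {w : ι → ℝ≥0∞} (hw : ∀ i, 1 ≤ w i) (x y : ι → ℝ≥0∞) :
    ∑' i, x i * y i ≤ (∑' i, w i * x i) * ∑' i, w i * y i := by
  rw [← ENNReal.tsum_mul_right]
  refine ENNReal.tsum_le_tsum fun i => mul_le_mul' (le_mul_of_one_le_left' (hw i)) ?_
  exact (le_mul_of_one_le_left' (hw i)).trans (ENNReal.le_tsum i)

/-- Bound of the majorant of a Poisson bracket itself, without loss of domain. -/
lemma pair_cBracket_domWeight_le (hz : ∃ i, n i = 0) {ρ r s : ℝ} (hρ : 0 < ρ) (hr : 0 < r)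
    (hs : 0 ≤ s) {ζ ζ' : NormalSite n → ℝ≥0∞} (h : InBall ρ r ζ) (h' : InBall ρ r ζ')
    (c₁ c₂ : Mono n → ℝ≥0∞) :
    pair (cBracket c₁ c₂) (domWeight r s ζ ζ') ≤
      ENNReal.ofReal (4 * r ^ 2) * (fieldNorm ρ r s c₁ * fieldNorm ρ r s c₂) := by
  set B₁ := fieldNorm ρ r s c₁
  set B₂ := fieldNorm ρ r s c₂
  refine (pair_cBracket_le (one_le_ofReal_exp hs) ζ ζ' c₁ c₂).trans ?_
  rw [← domWeight, tsum_dir]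
  have e1 : ∑ j, pair (cDeriv (.act j) c₁) (domWeight r s ζ ζ') *
      pair (cDeriv (Dir.act j).conj c₂) (domWeight r s ζ ζ') ≤ B₁ * (ENNReal.ofReal (r ^ 2) * B₂) :=
    (sum_mul_le_sum_mul_sum _ _).trans (mul_le_mul' (sum_act_le h h' c₁) (sum_ang_le hr h h' c₂))
  have e2 : ∑ j, pair (cDeriv (.ang j) c₁) (domWeight r s ζ ζ') *
      pair (cDeriv (Dir.ang j).conj c₂) (domWeight r s ζ ζ') ≤ (ENNReal.ofReal (r ^ 2) * B₁) * B₂ :=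
    (sum_mul_le_sum_mul_sum _ _).trans (mul_le_mul' (sum_ang_le hr h h' c₁) (sum_act_le h h' c₂))
  have e3 : ∑' m, pair (cDeriv (.pos m) c₁) (domWeight r s ζ ζ') *
      pair (cDeriv (Dir.pos m).conj c₂) (domWeight r s ζ ζ') ≤
        (ENNReal.ofReal r * B₁) * (ENNReal.ofReal r * B₂) :=
    (tsum_mul_le_tsum_mul_tsum (one_le_weight hz hρ) _ _).trans
      (mul_le_mul' (sum_pos_le hr h h' c₁) (sum_neg_le hr h h' c₂))
  have e4 : ∑' m, pair (cDeriv (.neg m) c₁) (domWeight r s ζ ζ') *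
      pair (cDeriv (Dir.neg m).conj c₂) (domWeight r s ζ ζ') ≤
        (ENNReal.ofReal r * B₁) * (ENNReal.ofReal r * B₂) :=
    (tsum_mul_le_tsum_mul_tsum (one_le_weight hz hρ) _ _).trans
      (mul_le_mul' (sum_neg_le hr h h' c₁) (sum_pos_le hr h h' c₂))
  refine (add_le_add (add_le_add e1 e2) (add_le_add e3 e4)).trans_eq ?_
  rw [ENNReal.ofReal_mul (by norm_num), ENNReal.ofReal_pow hr.le, ENNReal.ofReal_ofNat]
  ring

/-- At a sequence without zeros every monomial has positive weight, so a finite majorant there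
bounds each single coefficient. -/
lemma cBracket_ne_top (hz : ∃ i, n i = 0) {ρ r s : ℝ} (hρ : 0 < ρ) (hr : 0 < r)
    (hs : 0 ≤ s) {c₁ c₂ : Mono n → ℝ≥0∞} (h₁ : fieldNorm ρ r s c₁ ≠ ⊤)
    (h₂ : fieldNorm ρ r s c₂ ≠ ⊤) (P : Mono n) : cBracket c₁ c₂ P ≠ ⊤ := by
  obtain ⟨ζ, hζ, hb⟩ := exists_pos_inBall (n := n) hz hρ hr
  have h := pair_cBracket_domWeight_le hz hρ hr hs hb hb c₁ c₂
  have hfin : pair (cBracket c₁ c₂) (domWeight r s ζ ζ) ≠ ⊤ :=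
    ne_top_of_le_ne_top (ENNReal.mul_ne_top ENNReal.ofReal_ne_top (ENNReal.mul_ne_top h₁ h₂)) h
  have h1 := ENNReal.ne_top_of_tsum_ne_top hfin P
  intro ht
  rw [ht, ENNReal.top_mul (domWeight_ne_zero hr hζ hζ P)] at h1
  exact h1 rfl

/-! ### The bracket of two series -/

/-- The coefficient of the direction `a` in the Poisson bracket. -/
def Dir.symp : Dir n → ℂ
  | .act _ => 1
  | .ang _ => -1
  | .pos _ => -Complex.I
  | .neg _ => Complex.I

lemma Dir.enorm_symp (a : Dir n) : ‖a.symp‖ₑ = 1 := by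
  cases a <;> simp [Dir.symp, ← ofReal_norm]

/-- A term of the Poisson bracket of two series. -/
def brTerm (f g : Series n) (x : Dir n × Mono n × Mono n) (ξ : Fin b → ℝ) : ℂ :=
  x.1.symp * (f.deriv x.1 x.2.1 ξ * g.deriv x.1.conj x.2.2 ξ)

/-- The series of the Poisson bracket of two series. -/
def bracket (f g : Series n) : Series n := fun P ξ => ∑' x : Fiber P, brTerm f g x.1 ξ

lemma contDiffOn_deriv {f : Series n} (hf : ∀ M, ContDiffOn ℝ 1 (f M) O) (a : Dir n) (M : Mono n) :
    ContDiffOn ℝ 1 (f.deriv a M) O :=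
  contDiffOn_const.mul (hf _)

lemma contDiffOn_brTerm {f g : Series n} (hf : ∀ M, ContDiffOn ℝ 1 (f M) O)
    (hg : ∀ M, ContDiffOn ℝ 1 (g M) O) (x : Dir n × Mono n × Mono n) :
    ContDiffOn ℝ 1 (brTerm f g x) O :=
  contDiffOn_const.mul ((contDiffOn_deriv hf _ _).mul (contDiffOn_deriv hg _ _))

lemma coeffNorm_brTerm_le (hO : IsOpen O) {f g : Series n} (hf : ∀ M, ContDiffOn ℝ 1 (f M) O)
    (hg : ∀ M, ContDiffOn ℝ 1 (g M) O) (x : Dir n × Mono n × Mono n) :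
    coeffNorm O (brTerm f g x) ≤
      cDeriv x.1 (coeffs O f) x.2.1 * cDeriv x.1.conj (coeffs O g) x.2.2 := by
  rw [← coeffs_deriv hO hf, ← coeffs_deriv hO hg]
  unfold brTerm
  rw [coeffNorm_const_mul hO ((contDiffOn_deriv hf _ _).mul (contDiffOn_deriv hg _ _)),
    Dir.enorm_symp, one_mul]
  exact coeffNorm_mul_le hO (contDiffOn_deriv hf _ _) (contDiffOn_deriv hg _ _)

lemma tsum_coeffNorm_brTerm_le (hO : IsOpen O) {f g : Series n}
    (hf : ∀ M, ContDiffOn ℝ 1 (f M) O) (hg : ∀ M, ContDiffOn ℝ 1 (g M) O) (P : Mono n) :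
    ∑' x : Fiber P, coeffNorm O (brTerm f g x.1) ≤ cBracket (coeffs O f) (coeffs O g) P :=
  ENNReal.tsum_le_tsum fun x => coeffNorm_brTerm_le hO hf hg x.1

lemma contDiffOn_bracket (hO : IsOpen O) {f g : Series n} (hf : ∀ M, ContDiffOn ℝ 1 (f M) O)
    (hg : ∀ M, ContDiffOn ℝ 1 (g M) O) {P : Mono n}
    (h : cBracket (coeffs O f) (coeffs O g) P ≠ ⊤) : ContDiffOn ℝ 1 (bracket f g P) O :=
  (contDiffOn_tsum_coeff hO (fun x : Fiber P => contDiffOn_brTerm hf hg x.1)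
    (ne_top_of_le_ne_top h (tsum_coeffNorm_brTerm_le hO hf hg P))).1

lemma coeffs_bracket_le (hO : IsOpen O) {f g : Series n} (hf : ∀ M, ContDiffOn ℝ 1 (f M) O)
    (hg : ∀ M, ContDiffOn ℝ 1 (g M) O) (P : Mono n) :
    coeffs O (bracket f g) P ≤ cBracket (coeffs O f) (coeffs O g) P := by
  by_cases h : cBracket (coeffs O f) (coeffs O g) P = ⊤
  · rw [h]; exact le_top
  · have hle := tsum_coeffNorm_brTerm_le hO hf hg P
    exact (contDiffOn_tsum_coeff hO (fun x : Fiber P => contDiffOn_brTerm hf hg x.1)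
      (ne_top_of_le_ne_top h hle)).2.trans hle

lemma summable_brTerm (hO : IsOpen O) {f g : Series n} (hf : ∀ M, ContDiffOn ℝ 1 (f M) O)
    (hg : ∀ M, ContDiffOn ℝ 1 (g M) O) {P : Mono n}
    (h : cBracket (coeffs O f) (coeffs O g) P ≠ ⊤) {ξ : Fin b → ℝ} (hξ : ξ ∈ O) :
    Summable fun x : Fiber P => brTerm f g x.1 ξ := by
  apply Summable.of_norm
  have h1 : ∑' x : Fiber P, ‖brTerm f g x.1 ξ‖ₑ ≠ ⊤ :=
    ne_top_of_le_ne_top h ((ENNReal.tsum_le_tsum fun x => enorm_le_coeffNorm hξ).trans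
      (tsum_coeffNorm_brTerm_le hO hf hg P))
  simpa using ENNReal.summable_toReal h1

lemma Mono.momentum_add (M N : Mono n) : (M + N).momentum = M.momentum + N.momentum := by
  classical
  unfold Mono.momentum
  rw [Mono.add_α, Mono.add_β, Finsupp.sum_add_index' (by simp) (by simp [add_smul]),
    Finsupp.sum_add_index' (by simp) (by simp [add_smul])]
  simp only [Mono.add_k, Pi.add_apply, add_smul, Finset.sum_add_distrib]
  abel

lemma Dir.momentum_inc_add_conj (a : Dir n) : a.inc.momentum + a.conj.inc.momentum = 0 := by
  cases a <;> simp [Dir.inc, Dir.conj, Mono.momentum]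

/-- A variable and its conjugate carry opposite momenta, so contracting a pair does not change the
total momentum. -/
lemma brTerm_eq_zero {f g : Series n} {ξ : Fin b → ℝ}
    (hf : ∀ M : Mono n, M.momentum ≠ 0 → f M ξ = 0)
    (hg : ∀ M : Mono n, M.momentum ≠ 0 → g M ξ = 0) {x : Dir n × Mono n × Mono n}
    (hx : (x.2.1 + x.2.2).momentum ≠ 0) : brTerm f g x ξ = 0 := by
  by_contra h
  have h1 : (x.2.1 + x.1.inc).momentum = 0 := by
    by_contra h1
    simp [brTerm, Series.deriv, hf _ h1] at h
  have h2 : (x.2.2 + x.1.conj.inc).momentum = 0 := by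
    by_contra h2
    simp [brTerm, Series.deriv, hg _ h2] at h
  apply hx
  rw [Mono.momentum_add] at h1 h2 ⊢
  have := x.1.momentum_inc_add_conj
  calc x.2.1.momentum + x.2.2.momentum =
      (x.2.1.momentum + x.1.inc.momentum) + (x.2.2.momentum + x.1.conj.inc.momentum) -
        (x.1.inc.momentum + x.1.conj.inc.momentum) := by abel
    _ = 0 := by rw [h1, h2, this]; simp

/-- The bracket of two elements of `𝒜_{r,s}` belongs to `𝒜_{r',s'}`. -/
theorem memA_bracket (hz : ∃ i, n i = 0) {ρ r s r' s' : ℝ} (hρ : 0 < ρ) (hO : IsOpen O)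
    (hr' : 0 < r') (hr : r' < r) (hs' : 0 ≤ s') (hs : s' < s) {f g : Series n}
    (hf : MemA ρ O r s f) (hg : MemA ρ O r s g) : MemA ρ O r' s' (bracket f g) := by
  rw [memA_iff hz hρ hO] at hf hg ⊢
  have h0 := hr'.trans hr
  have hfin : ∀ P, cBracket (coeffs O f) (coeffs O g) P ≠ ⊤ :=
    cBracket_ne_top hz hρ h0 (hs'.trans hs.le) hf.2.2 hg.2.2
  refine ⟨fun P => contDiffOn_bracket hO hf.1 hg.1 (hfin P), fun P hP ξ hξ => ?_, ?_⟩
  · unfold bracket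
    rw [tsum_congr fun x : Fiber P => brTerm_eq_zero (fun M hM => hf.2.1 M hM ξ hξ)
      (fun M hM => hg.2.1 M hM ξ hξ) (by rw [x.2]; exact hP), tsum_zero]
  · refine ne_top_of_le_ne_top ?_ ((fieldNorm_mono (coeffs_bracket_le hO hf.1 hg.1)).trans
      (fieldNorm_cBracket_le hr' hr hs' hs hf.2.2 hg.2.2))
    exact ENNReal.mul_ne_top (ENNReal.mul_ne_top ENNReal.ofReal_ne_top hf.2.2) hg.2.2

theorem XNorm_bracket_le (hz : ∃ i, n i = 0) {ρ r s r' s' : ℝ} (hρ : 0 < ρ) (hO : IsOpen O)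
    (hr' : 0 < r') (hr : r' < r) (hs' : 0 ≤ s') (hs : s' < s) {f g : Series n}
    (hf : MemA ρ O r s f) (hg : MemA ρ O r s g) :
    XNorm ρ O r' s' (bracket f g) ≤
      ENNReal.ofReal (2 * (r / r') ^ 2 / min (s - s') (1 - r' / r)) *
        XNorm ρ O r s f * XNorm ρ O r s g := by
  rw [XNorm_eq hz hρ hO (memA_bracket hz hρ hO hr' hr hs' hs hf hg).1, XNorm_eq hz hρ hO hf.1,
    XNorm_eq hz hρ hO hg.1]
  have hf' := ((memA_iff hz hρ hO).1 hf)
  have hg' := ((memA_iff hz hρ hO).1 hg)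
  exact (fieldNorm_mono (coeffs_bracket_le hO hf.1 hg.1)).trans
      (fieldNorm_cBracket_le hr' hr hs' hs hf'.2.2 hg'.2.2)

end SeriesNorms

/-! ### Evaluation of series and of their Poisson brackets -/

section Evaluation

variable {d b : ℕ} {n : Fin b → Fin d → ℤ} {O : Set (Fin b → ℝ)}

lemma Mono.eval_add (M N : Mono n) (x : Phase n) : (M + N).eval x = M.eval x * N.eval x := by
  classical
  unfold Mono.eval
  have h1 : ∀ (α β : NormalSite n →₀ ℕ) (z : NormalSite n → ℂ),
      (α + β).prod (fun m a => z m ^ a) =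
        α.prod (fun m a => z m ^ a) * β.prod (fun m a => z m ^ a) := fun α β z =>
    Finsupp.prod_add_index' (by simp) (fun _ _ _ => pow_add _ _ _)
  rw [Mono.add_α, Mono.add_β, h1, h1]
  simp only [Mono.add_l, Mono.add_k, Pi.add_apply, pow_add, Finset.prod_mul_distrib, Int.cast_add,
    add_mul, Finset.sum_add_distrib, mul_add, Complex.exp_add]
  ring

/-- The closed polydisc which is described by the weight `domWeight r s ζ ζ'`. -/
def polydisc (r s : ℝ) (ζ ζ' : NormalSite n → ℝ≥0∞) : Set (Phase n) :=
  {x | (∀ j, |(x.ϑ j).im| ≤ s) ∧ (∀ j, ‖x.I j‖ ≤ r ^ 2) ∧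
    (∀ m, ‖x.z m‖ₑ ≤ ζ m) ∧ ∀ m, ‖x.zbar m‖ₑ ≤ ζ' m}

lemma enorm_finset_prod {ι : Type*} (s : Finset ι) (g : ι → ℂ) :
    ‖∏ i ∈ s, g i‖ₑ = ∏ i ∈ s, ‖g i‖ₑ := by
  classical
  induction s using Finset.induction_on with
  | empty => simp
  | insert i s hi ih => rw [Finset.prod_insert hi, Finset.prod_insert hi, enorm_mul, ih]

lemma enorm_finsupp_prod_le {ζ : NormalSite n → ℝ≥0∞} {z : NormalSite n → ℂ}
    (h : ∀ m, ‖z m‖ₑ ≤ ζ m) (α : NormalSite n →₀ ℕ) :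
    ‖α.prod (fun m a => z m ^ a)‖ₑ ≤ α.prod (fun m a => ζ m ^ a) := by
  unfold Finsupp.prod
  rw [enorm_finset_prod]
  refine Finset.prod_le_prod' fun m _ => ?_
  rw [enorm_pow]
  exact pow_le_pow_left' (h m) _

lemma enorm_eval_le {r s : ℝ} {ζ ζ' : NormalSite n → ℝ≥0∞} {x : Phase n}
    (hx : x ∈ polydisc r s ζ ζ') (M : Mono n) : ‖M.eval x‖ₑ ≤ domWeight r s ζ ζ' M := by
  obtain ⟨h1, h2, h3, h4⟩ := hx
  unfold Mono.eval domWeight monoWeight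
  rw [enorm_mul, enorm_mul, enorm_mul, mul_assoc]
  refine mul_le_mul' (mul_le_mul' ?_ ?_)
    (mul_le_mul' (enorm_finsupp_prod_le h3 _) (enorm_finsupp_prod_le h4 _))
  · rw [enorm_finset_prod, Mono.absL, ← Finset.prod_pow_eq_pow_sum]
    refine Finset.prod_le_prod' fun j _ => ?_
    rw [enorm_pow]
    refine pow_le_pow_left' ?_ _
    rw [← ofReal_norm]
    exact ENNReal.ofReal_le_ofReal (h2 j)
  · rw [← ofReal_norm, Complex.norm_exp, ← ENNReal.ofReal_pow (Real.exp_pos s).le,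
      ← Real.exp_nat_mul]
    apply ENNReal.ofReal_le_ofReal
    apply Real.exp_le_exp.2
    have : (Complex.I * ∑ j, (M.k j : ℂ) * x.ϑ j).re = ∑ j, -((M.k j : ℝ) * (x.ϑ j).im) := by
      simp [Complex.mul_re]
    rw [this, Mono.absK, Nat.cast_sum, Finset.sum_mul]
    refine Finset.sum_le_sum fun j _ => ?_
    calc -((M.k j : ℝ) * (x.ϑ j).im) ≤ |(M.k j : ℝ) * (x.ϑ j).im| := neg_le_abs _
      _ = |(M.k j : ℝ)| * |(x.ϑ j).im| := abs_mul _ _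
      _ ≤ ((M.k j).natAbs : ℝ) * s := by
          rw [Nat.cast_natAbs, Int.cast_abs]
          gcongr
          exact h1 j

lemma mem_polydisc_of_mem_domain {ρ r s : ℝ} {x : Phase n} (hx : x ∈ domain n ρ r s) :
    x ∈ polydisc r s (fun m => ‖x.z m‖ₑ) fun m => ‖x.zbar m‖ₑ :=
  ⟨fun j => (hx.1 j).le, fun j => (hx.2.1 j).le, fun _ => le_rfl, fun _ => le_rfl⟩

lemma Mono.exists_deg_ne_zero {M : Mono n} (hM : M ≠ 0) : ∃ a : Dir n, a.deg M ≠ 0 := by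
  by_contra h
  push Not at h
  apply hM
  ext1
  · funext j; simpa [Dir.deg] using h (.ang j)
  · funext j; exact h (.act j)
  · exact Finsupp.ext fun m => h (.pos m)
  · exact Finsupp.ext fun m => h (.neg m)

/-- An Euler inequality: a nontrivial monomial has positive degree in some direction, and that
single term of the sum already dominates it. -/
lemma monoWeight_le_tsum {R E : ℝ≥0∞} (ζ ζ' : NormalSite n → ℝ≥0∞) {M : Mono n} (hM : M ≠ 0) :
    monoWeight R E ζ ζ' M ≤ ∑' a : Dir n, a.val R ζ ζ' * wDeriv a (monoWeight R E ζ ζ') M := by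
  obtain ⟨a, ha⟩ := Mono.exists_deg_ne_zero hM
  refine le_trans ?_ (ENNReal.le_tsum a)
  unfold wDeriv
  conv_lhs => rw [← Dir.lower_add_of_deg_ne_zero ha, monoWeight_add_inc]
  have : (1 : ℝ≥0∞) ≤ a.deg M := by exact_mod_cast Nat.one_le_iff_ne_zero.2 ha
  calc _ = a.val R ζ ζ' * (1 * monoWeight R E ζ ζ' (a.lower M)) := by ring
    _ ≤ _ := by gcongr

lemma InBall.apply_le (hz : ∃ i, n i = 0) {ρ r : ℝ} (hρ : 0 < ρ) {ζ : NormalSite n → ℝ≥0∞}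
    (h : InBall ρ r ζ) (m : NormalSite n) : ζ m ≤ ENNReal.ofReal r :=
  ((le_mul_of_one_le_right' (one_le_weight hz hρ m)).trans
    (ENNReal.le_tsum (f := fun m => ζ m * weight ρ m) m)).trans (le_of_lt h)

open Classical in
/-- The majorant of a series without its constant term is controlled by its vector field. -/
lemma tsum_offConst_le (hz : ∃ i, n i = 0) {ρ r s : ℝ} (hρ : 0 < ρ) (hr : 0 < r)
    {ζ ζ' : NormalSite n → ℝ≥0∞} (h : InBall ρ r ζ) (h' : InBall ρ r ζ') (c : Mono n → ℝ≥0∞) :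
    ∑' M, (if M = 0 then 0 else c M * domWeight r s ζ ζ' M) ≤
      ENNReal.ofReal (4 * r ^ 2) * fieldNorm ρ r s c := by
  set V := domWeight r s ζ ζ' with hV
  set B := fieldNorm ρ r s c
  calc _ ≤ ∑' M, c M * ∑' a : Dir n, a.val (ENNReal.ofReal (r ^ 2)) ζ ζ' * wDeriv a V M := by
        refine ENNReal.tsum_le_tsum fun M => ?_
        split_ifs with hM
        · exact bot_le
        · gcongr
          exact monoWeight_le_tsum ζ ζ' hM
    _ = ∑' a : Dir n, a.val (ENNReal.ofReal (r ^ 2)) ζ ζ' * pair (cDeriv a c) V := by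
        simp_rw [pair_cDeriv, pair, ← ENNReal.tsum_mul_left]
        rw [ENNReal.tsum_comm]
        exact tsum_congr fun _ => tsum_congr fun _ => by ring
    _ ≤ ENNReal.ofReal (r ^ 2) * B + ENNReal.ofReal (r ^ 2) * B +
        (ENNReal.ofReal r * (ENNReal.ofReal r * B) + ENNReal.ofReal r * (ENNReal.ofReal r * B)) := by
        rw [tsum_dir]
        have hsite : ∀ (η : NormalSite n → ℝ≥0∞) (g : NormalSite n → ℝ≥0∞), InBall ρ r η →
            ∑' m, weight ρ m * g m ≤ ENNReal.ofReal r * B →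
            ∑' m, η m * g m ≤ ENNReal.ofReal r * (ENNReal.ofReal r * B) := by
          intro η g hη hg
          refine le_trans ?_ (mul_le_mul_right hg _)
          rw [← ENNReal.tsum_mul_left]
          refine ENNReal.tsum_le_tsum fun m => mul_le_mul' (hη.apply_le hz hρ m) ?_
          exact le_mul_of_one_le_left' (one_le_weight hz hρ m)
        refine add_le_add (add_le_add ?_ ?_) (add_le_add ?_ ?_)
        · simp only [Dir.val]
          rw [← Finset.mul_sum]
          exact mul_le_mul_right (sum_act_le h h' c) _
        · simp only [Dir.val, one_mul]
          exact sum_ang_le hr h h' c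
        · exact hsite ζ (fun m => pair (cDeriv (.pos m) c) V) h (sum_pos_le hr h h' c)
        · exact hsite ζ' (fun m => pair (cDeriv (.neg m) c) V) h' (sum_neg_le hr h h' c)
    _ = _ := by
        rw [ENNReal.ofReal_mul (by norm_num), ENNReal.ofReal_pow hr.le, ENNReal.ofReal_ofNat]
        ring

lemma summable_of_tsum_enorm {ι : Type*} {g : ι → ℂ} (h : ∑' i, ‖g i‖ₑ ≠ ⊤) :
    Summable fun i => ‖g i‖ := by
  simpa using ENNReal.summable_toReal h

lemma summable_eval (hz : ∃ i, n i = 0) {ρ r s : ℝ} (hρ : 0 < ρ) (hr : 0 < r) {f : Series n}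
    (hf : fieldNorm ρ r s (coeffs O f) ≠ ⊤) {ξ : Fin b → ℝ} (hξ : ξ ∈ O) {x : Phase n}
    (hx : x ∈ domain n ρ r s) : Summable fun M => f M ξ * M.eval x := by
  classical
  apply Summable.of_norm
  have h1 : Summable fun M => ‖if M = 0 then 0 else f M ξ * M.eval x‖ := by
    refine summable_of_tsum_enorm (ne_top_of_le_ne_top
      (ENNReal.mul_ne_top ENNReal.ofReal_ne_top hf) (le_trans (ENNReal.tsum_le_tsum fun M => ?_)
        (tsum_offConst_le (s := s) hz hρ hr hx.2.2.1 hx.2.2.2 (coeffs O f))))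
    split_ifs
    · simp
    · rw [enorm_mul]
      exact mul_le_mul' (enorm_le_coeffNorm hξ) (enorm_eval_le (mem_polydisc_of_mem_domain hx) M)
  -- The constant term is invisible to the vector field, but it is a single summand.
  have h2 : Summable fun M : Mono n => ‖if M = 0 then f M ξ * M.eval x else 0‖ :=
    summable_of_hasFiniteSupport ((Set.finite_singleton (0 : Mono n)).subset fun M hM => by
      by_contra h
      have h' : M ≠ 0 := h
      simp [h'] at hM)
  refine (h1.add h2).congr fun M => ?_
  by_cases h : M = 0 <;> simp [h]

/-- The coordinate of a phase-space point in the direction `a`. -/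
def Dir.coord (a : Dir n) (x : Phase n) : ℂ :=
  match a with
  | .act j => x.I j
  | .ang j => x.ϑ j
  | .pos m => x.z m
  | .neg m => x.zbar m

open Classical in
/-- Change of the coordinate in the direction `a` to the value `w`. -/
def Dir.move (a : Dir n) (x : Phase n) (w : ℂ) : Phase n :=
  match a with
  | .act j => { x with I := Function.update x.I j w }
  | .ang j => { x with ϑ := Function.update x.ϑ j w }
  | .pos m => { x with z := Function.update x.z m w }
  | .neg m => { x with zbar := Function.update x.zbar m w }

lemma Dir.move_coord (a : Dir n) (x : Phase n) : a.move x (a.coord x) = x := by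
  cases a <;> simp [Dir.move, Dir.coord]

/-- The partial derivative of a function on phase space in the direction `a`. -/
def partialDir (a : Dir n) (F : Phase n → ℂ) (x : Phase n) : ℂ :=
  _root_.deriv (fun w => F (a.move x w)) (a.coord x)

/-- The complex factor of the derivative of a monomial in the direction `a`. -/
def Dir.cfac (a : Dir n) (M : Mono n) : ℂ :=
  match a with
  | .act j => (M.l j : ℂ)
  | .ang j => Complex.I * (M.k j : ℂ)
  | .pos m => (M.α m : ℂ)
  | .neg m => (M.β m : ℂ)

lemma Dir.cfac_add_inc (a : Dir n) (M : Mono n) : a.cfac (M + a.inc) = a.fac M := by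
  cases a <;> simp [Dir.cfac, Dir.fac, Dir.inc]

lemma Dir.enorm_cfac (a : Dir n) (M : Mono n) : ‖a.cfac M‖ₑ = a.deg M := by
  cases a with
  | ang j =>
    simp only [Dir.cfac, Dir.deg]
    rw [← ofReal_norm, norm_mul, Complex.norm_I, one_mul, Complex.norm_intCast,
      ← ENNReal.ofReal_natCast, Nat.cast_natAbs, Int.cast_abs]
  | _ => simp [Dir.cfac, Dir.deg, ← ofReal_norm]

open Classical in
lemma hasDerivAt_finsupp_prod (α : NormalSite n →₀ ℕ) (m : NormalSite n) (z : NormalSite n → ℂ)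
    (w : ℂ) : HasDerivAt (fun w => α.prod fun i a => Function.update z m w i ^ a)
      (α m * (α - Finsupp.single m 1).prod fun i a => Function.update z m w i ^ a) w := by
  have key : ∀ (β : NormalSite n →₀ ℕ) (w : ℂ),
      (β.prod fun i a => Function.update z m w i ^ a) =
        w ^ β m * (β.erase m).prod fun i a => z i ^ a := by
    intro β w
    rw [← Finsupp.mul_prod_erase' β m _ (by simp)]
    simp only [Function.update_self]
    congr 1
    refine Finsupp.prod_congr fun i hi => ?_
    rw [Finsupp.support_erase, Finset.mem_erase] at hi
    rw [Function.update_of_ne hi.1]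
  have he : (α - Finsupp.single m 1).erase m = α.erase m := by
    ext i
    by_cases h : i = m
    · subst h; simp
    · simp [Finsupp.erase_ne h, Ne.symm h]
  simp_rw [key]
  rw [he]
  have := (hasDerivAt_pow (α m) w).mul_const ((α.erase m).prod fun i a => z i ^ a)
  simpa [mul_assoc] using this

lemma hasDerivAt_eval_move (a : Dir n) (M : Mono n) (x : Phase n) (w : ℂ) :
    HasDerivAt (fun w => M.eval (a.move x w)) (a.cfac M * (a.lower M).eval (a.move x w)) w := by
  classical
  cases a with
  | act j =>
    have key : ∀ (l : Fin b → ℕ) (w : ℂ), ∏ i, Function.update x.I j w i ^ l i =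
        w ^ l j * ∏ i ∈ Finset.univ.erase j, x.I i ^ l i := by
      intro l w
      rw [← Finset.mul_prod_erase _ _ (Finset.mem_univ j), Function.update_self]
      congr 1
      exact Finset.prod_congr rfl fun i hi => by
        rw [Function.update_of_ne (Finset.ne_of_mem_erase hi)]
    have he : ∏ i ∈ Finset.univ.erase j, x.I i ^ (M.l - Pi.single j 1 : Fin b → ℕ) i =
        ∏ i ∈ Finset.univ.erase j, x.I i ^ M.l i :=
      Finset.prod_congr rfl fun i hi => by simp [Finset.ne_of_mem_erase hi]
    simp only [Mono.eval, Dir.move, Dir.lower, Dir.cfac, key, he]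
    have := (hasDerivAt_pow (M.l j) w).mul_const ((∏ i ∈ Finset.univ.erase j, x.I i ^ M.l i) *
      Complex.exp (Complex.I * ∑ j, (M.k j : ℂ) * x.ϑ j) *
      M.α.prod (fun m a => x.z m ^ a) * M.β.prod (fun m a => x.zbar m ^ a))
    refine (this.congr_deriv ?_).congr_of_eventuallyEq (Filter.Eventually.of_forall fun w => ?_)
    · simp; ring
    · ring
  | ang j =>
    have key : ∀ w : ℂ, ∑ i, (M.k i : ℂ) * Function.update x.ϑ j w i =
        M.k j * w + ∑ i ∈ Finset.univ.erase j, (M.k i : ℂ) * x.ϑ i := by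
      intro w
      rw [← Finset.add_sum_erase _ _ (Finset.mem_univ j), Function.update_self]
      congr 1
      exact Finset.sum_congr rfl fun i hi => by
        rw [Function.update_of_ne (Finset.ne_of_mem_erase hi)]
    simp only [Mono.eval, Dir.move, Dir.lower, Dir.cfac, key]
    have h1 : HasDerivAt (fun w : ℂ => Complex.exp (Complex.I * (M.k j * w +
        ∑ i ∈ Finset.univ.erase j, (M.k i : ℂ) * x.ϑ i)))
        (Complex.exp (Complex.I * (M.k j * w +
        ∑ i ∈ Finset.univ.erase j, (M.k i : ℂ) * x.ϑ i)) * (Complex.I * (M.k j * 1))) w :=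
      ((((hasDerivAt_id w).const_mul (M.k j : ℂ)).add_const _).const_mul Complex.I).cexp
    have := h1.mul_const ((∏ i, x.I i ^ M.l i) *
      M.α.prod (fun m a => x.z m ^ a) * M.β.prod (fun m a => x.zbar m ^ a))
    refine (this.congr_deriv ?_).congr_of_eventuallyEq (Filter.Eventually.of_forall fun w => ?_)
    · ring
    · ring
  | pos m =>
    simp only [Mono.eval, Dir.move, Dir.lower, Dir.cfac]
    have := ((hasDerivAt_finsupp_prod M.α m x.z w).const_mul ((∏ j, x.I j ^ M.l j) *
      Complex.exp (Complex.I * ∑ j, (M.k j : ℂ) * x.ϑ j))).mul_const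
        (M.β.prod (fun m a => x.zbar m ^ a))
    exact this.congr_deriv (by ring)
  | neg m =>
    simp only [Mono.eval, Dir.move, Dir.lower, Dir.cfac]
    have := (hasDerivAt_finsupp_prod M.β m x.zbar w).const_mul ((∏ j, x.I j ^ M.l j) *
      Complex.exp (Complex.I * ∑ j, (M.k j : ℂ) * x.ϑ j) * M.α.prod (fun m a => x.z m ^ a))
    exact this.congr_deriv (by ring)

open Classical in
lemma InBall.exists_add (hz : ∃ i, n i = 0) {ρ r : ℝ} (hρ : 0 < ρ) {ζ : NormalSite n → ℝ≥0∞}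
    (h : InBall ρ r ζ) (m : NormalSite n) :
    ∃ ε : ℝ, 0 < ε ∧ InBall ρ r fun i => ζ i + if i = m then ENNReal.ofReal ε else 0 := by
  have hw0 : weight ρ m ≠ 0 := (zero_lt_one.trans_le (one_le_weight hz hρ m)).ne'
  obtain ⟨y, hy, hlt⟩ := exists_between h
  set S := ∑' i, ζ i * weight ρ i
  have hS : S ≠ ⊤ := ne_top_of_lt hy
  have hyt : y ≠ ⊤ := ne_top_of_lt hlt
  have hpos : 0 < (y - S) / weight ρ m := ENNReal.div_pos (tsub_pos_of_lt hy).ne' (weight_ne_top ρ m)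
  have hfin : (y - S) / weight ρ m ≠ ⊤ := ENNReal.div_ne_top (ENNReal.sub_ne_top hyt) hw0
  refine ⟨((y - S) / weight ρ m).toReal, ENNReal.toReal_pos hpos.ne' hfin, ?_⟩
  rw [ENNReal.ofReal_toReal hfin]
  unfold InBall
  simp_rw [add_mul]
  rw [ENNReal.tsum_add]
  simp only [ite_mul, zero_mul]
  rw [tsum_ite_eq, ENNReal.div_mul_cancel hw0 (weight_ne_top ρ m)]
  rwa [add_tsub_cancel_of_le hy.le]

/-- The domain `D(r, s)` is open in every coordinate direction. -/
lemma exists_polydisc (hz : ∃ i, n i = 0) {ρ r s : ℝ} (hρ : 0 < ρ) {x : Phase n}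
    (hx : x ∈ domain n ρ r s) (a : Dir n) : ∃ ε > 0, ∃ ζ ζ', InBall ρ r ζ ∧ InBall ρ r ζ' ∧
      ∀ w ∈ Metric.ball (a.coord x) ε,
        a.move x w ∈ polydisc r s ζ ζ' ∩ domain n ρ r s := by
  classical
  obtain ⟨h1, h2, h3, h4⟩ := hx
  have hupd : ∀ (z : NormalSite n → ℂ) (m : NormalSite n) (ε : ℝ) (w : ℂ),
      w ∈ Metric.ball (z m) ε → ∀ i, ‖Function.update z m w i‖ₑ ≤
        ‖z i‖ₑ + if i = m then ENNReal.ofReal ε else 0 := by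
    intro z m ε w hw i
    by_cases hi : i = m
    · subst hi
      simp only [Function.update_self, if_true]
      calc ‖w‖ₑ = ‖z i + (w - z i)‖ₑ := by ring_nf
        _ ≤ ‖z i‖ₑ + ‖w - z i‖ₑ := enorm_add_le _ _
        _ ≤ _ := by
            gcongr
            rw [← ofReal_norm]
            apply ENNReal.ofReal_le_ofReal
            rw [← dist_eq_norm]
            exact (Metric.mem_ball.1 hw).le
    · simp [hi]
  cases a with
  | act j =>
    refine ⟨r ^ 2 - ‖x.I j‖, by linarith [h2 j], _, _, h3, h4, fun w hw => ?_⟩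
    have hI : ∀ i, ‖Function.update x.I j w i‖ < r ^ 2 := by
      intro i
      by_cases hi : i = j
      · subst hi
        rw [Function.update_self]
        rw [Metric.mem_ball, dist_eq_norm] at hw
        have := norm_sub_norm_le w (x.I i)
        simp only [Dir.coord] at hw
        linarith
      · rw [Function.update_of_ne hi]; exact h2 i
    exact ⟨⟨fun j => (h1 j).le, fun i => (hI i).le, fun _ => le_rfl, fun _ => le_rfl⟩,
      h1, hI, h3, h4⟩
  | ang j =>
    refine ⟨s - |(x.ϑ j).im|, by linarith [h1 j], _, _, h3, h4, fun w hw => ?_⟩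
    have hI : ∀ i, |(Function.update x.ϑ j w i).im| < s := by
      intro i
      by_cases hi : i = j
      · subst hi
        rw [Function.update_self]
        rw [Metric.mem_ball, dist_eq_norm] at hw
        have h5 := Complex.abs_im_le_norm (w - x.ϑ i)
        rw [Complex.sub_im] at h5
        have := abs_sub_abs_le_abs_sub w.im (x.ϑ i).im
        simp only [Dir.coord] at hw
        linarith
      · rw [Function.update_of_ne hi]; exact h1 i
    exact ⟨⟨fun j => (hI j).le, fun i => (h2 i).le, fun _ => le_rfl, fun _ => le_rfl⟩,
      hI, h2, h3, h4⟩
  | pos m =>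
    obtain ⟨ε, hε, hb⟩ := InBall.exists_add hz hρ h3 m
    refine ⟨ε, hε, _, _, hb, h4, fun w hw => ?_⟩
    have hu := hupd x.z m ε w hw
    exact ⟨⟨fun j => (h1 j).le, fun i => (h2 i).le, hu, fun _ => le_rfl⟩, h1, h2,
      (ENNReal.tsum_le_tsum fun m => mul_le_mul_left (hu m) _).trans_lt hb, h4⟩
  | neg m =>
    obtain ⟨ε, hε, hb⟩ := InBall.exists_add hz hρ h4 m
    refine ⟨ε, hε, _, _, h3, hb, fun w hw => ?_⟩
    have hu := hupd x.zbar m ε w hw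
    exact ⟨⟨fun j => (h1 j).le, fun i => (h2 i).le, fun _ => le_rfl, hu⟩, h1, h2, h3,
      (ENNReal.tsum_le_tsum fun m => mul_le_mul_left (hu m) _).trans_lt hb⟩

lemma pair_cDeriv_ne_top (hz : ∃ i, n i = 0) {ρ r s : ℝ} (hρ : 0 < ρ) (hr : 0 < r)
    {ζ ζ' : NormalSite n → ℝ≥0∞} (h : InBall ρ r ζ) (h' : InBall ρ r ζ') {c : Mono n → ℝ≥0∞}
    (hc : fieldNorm ρ r s c ≠ ⊤) (a : Dir n) : pair (cDeriv a c) (domWeight r s ζ ζ') ≠ ⊤ := by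
  have hr2 : ENNReal.ofReal (r ^ 2) * fieldNorm ρ r s c ≠ ⊤ :=
    ENNReal.mul_ne_top ENNReal.ofReal_ne_top hc
  have hr1 : ENNReal.ofReal r * fieldNorm ρ r s c ≠ ⊤ :=
    ENNReal.mul_ne_top ENNReal.ofReal_ne_top hc
  cases a with
  | act j => exact ne_top_of_le_ne_top hc ((Finset.single_le_sum
      (f := fun j => pair (cDeriv (.act j) c) (domWeight r s ζ ζ')) (fun _ _ => bot_le)
      (Finset.mem_univ j)).trans (sum_act_le h h' c))
  | ang j => exact ne_top_of_le_ne_top hr2 ((Finset.single_le_sum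
      (f := fun j => pair (cDeriv (.ang j) c) (domWeight r s ζ ζ')) (fun _ _ => bot_le)
      (Finset.mem_univ j)).trans (sum_ang_le hr h h' c))
  | pos m => exact ne_top_of_le_ne_top hr1 (((le_mul_of_one_le_left' (one_le_weight hz hρ m)).trans
      (ENNReal.le_tsum (f := fun m => weight ρ m * pair (cDeriv (.pos m) c) (domWeight r s ζ ζ'))
        m)).trans (sum_pos_le hr h h' c))
  | neg m => exact ne_top_of_le_ne_top hr1 (((le_mul_of_one_le_left' (one_le_weight hz hρ m)).trans
      (ENNReal.le_tsum (f := fun m => weight ρ m * pair (cDeriv (.neg m) c) (domWeight r s ζ ζ'))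
        m)).trans (sum_neg_le hr h h' c))

/-- Series may be differentiated term by term. -/
lemma partialDir_eval (hz : ∃ i, n i = 0) {ρ r s : ℝ} (hρ : 0 < ρ) (hr : 0 < r) {f : Series n}
    (hf : fieldNorm ρ r s (coeffs O f) ≠ ⊤) {ξ : Fin b → ℝ} (hξ : ξ ∈ O) {F : Phase n → ℂ}
    (hF : ∀ x ∈ domain n ρ r s, F x = f.eval ξ x) {x : Phase n}
    (hx : x ∈ domain n ρ r s) (a : Dir n) : partialDir a F x = (f.deriv a).eval ξ x := by
  -- The slightly enlarged sequences `ζ, ζ'` dominate a whole disc in the direction `a`, so the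
  -- differentiated series has a summable bound that is uniform on the disc.
  obtain ⟨ε, hε, ζ, ζ', hζ, hζ', hball⟩ := exists_polydisc hz hρ hx a
  have hfin : ∑' M, ‖f M ξ‖ₑ * wDeriv a (domWeight r s ζ ζ') M ≠ ⊤ :=
    ne_top_of_le_ne_top (pair_cDeriv_ne_top hz hρ hr hζ hζ' hf a) (by
      rw [pair_cDeriv]
      exact ENNReal.tsum_le_tsum fun M => mul_le_mul_left (enorm_le_coeffNorm hξ) _)
  have hterm : ∀ M, ∀ w ∈ Metric.ball (a.coord x) ε,
      ‖f M ξ * (a.cfac M * (a.lower M).eval (a.move x w))‖ₑ ≤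
        ‖f M ξ‖ₑ * wDeriv a (domWeight r s ζ ζ') M := by
    intro M w hw
    rw [enorm_mul, enorm_mul, Dir.enorm_cfac]
    unfold wDeriv
    gcongr
    exact enorm_eval_le (hball w hw).1 _
  have hder : HasDerivAt (fun w => ∑' M, f M ξ * M.eval (a.move x w))
      (∑' M, f M ξ * (a.cfac M * (a.lower M).eval (a.move x (a.coord x)))) (a.coord x) := by
    refine hasDerivAt_tsum_of_isPreconnected (ENNReal.summable_toReal hfin) Metric.isOpen_ball
      (convex_ball _ ε).isPreconnected
      (fun M w _ => (hasDerivAt_eval_move a M x w).const_mul (f M ξ)) (fun M w hw => ?_)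
      (Metric.mem_ball_self hε) ?_ (Metric.mem_ball_self hε)
    · have := ENNReal.toReal_mono (ENNReal.ne_top_of_tsum_ne_top hfin M) (hterm M w hw)
      rwa [toReal_enorm] at this
    · simp only [Dir.move_coord]
      exact summable_eval hz hρ hr hf hξ hx
  have heq : (fun w => F (a.move x w)) =ᶠ[nhds (a.coord x)]
      fun w => ∑' M, f M ξ * M.eval (a.move x w) :=
    Filter.eventuallyEq_of_mem (Metric.ball_mem_nhds _ hε) fun w hw => hF _ (hball w hw).2
  unfold partialDir
  rw [heq.deriv_eq, hder.deriv, Dir.move_coord]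
  have h := (Dir.add_inc_injective a).tsum_eq
    (f := fun M => f M ξ * (a.cfac M * (a.lower M).eval x)) ?_
  · rw [← h]
    unfold Series.eval Series.deriv
    refine tsum_congr fun M => ?_
    simp only [Dir.lower_add_inc, Dir.cfac_add_inc]
    ring
  · intro M hM
    refine ⟨a.lower M, Dir.lower_add_of_deg_ne_zero ?_⟩
    intro h0
    have : a.cfac M = 0 := by
      rw [← enorm_eq_zero, Dir.enorm_cfac, h0, Nat.cast_zero]
    simp [this] at hM

lemma summable_norm_deriv_eval (hz : ∃ i, n i = 0) {ρ r s : ℝ} (hρ : 0 < ρ) (hO : IsOpen O)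
    (hr : 0 < r) {f : Series n} (hf : MemA ρ O r s f) {ξ : Fin b → ℝ} (hξ : ξ ∈ O) {x : Phase n}
    (hx : x ∈ domain n ρ r s) (a : Dir n) : Summable fun M => ‖f.deriv a M ξ * M.eval x‖ := by
  have hf' := (memA_iff hz hρ hO).1 hf
  refine summable_of_tsum_enorm (ne_top_of_le_ne_top
    (pair_cDeriv_ne_top (s := s) hz hρ hr hx.2.2.1 hx.2.2.2 hf'.2.2 a)
    (ENNReal.tsum_le_tsum fun M => ?_))
  rw [enorm_mul, ← coeffs_deriv hO hf.1]
  exact mul_le_mul' (enorm_le_coeffNorm hξ) (enorm_eval_le (mem_polydisc_of_mem_domain hx) M)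

lemma tsum_sum_sum {ι κ : Type*} [Fintype ι] {D : (ι ⊕ ι) ⊕ (κ ⊕ κ) → ℂ} (hD : Summable D) :
    ∑' a, D a = ∑ j, D (.inl (.inl j)) + ∑ j, D (.inl (.inr j)) +
      (∑' m, D (.inr (.inl m)) + ∑' m, D (.inr (.inr m))) := by
  have hl : Summable fun y => D (.inl y) := hD.comp_injective Sum.inl_injective
  have hr : Summable fun y => D (.inr y) := hD.comp_injective Sum.inr_injective
  have hp : Summable fun m => D (.inr (.inl m)) := hr.comp_injective Sum.inl_injective
  have hn : Summable fun m => D (.inr (.inr m)) := hr.comp_injective Sum.inr_injective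
  have h2 := Summable.tsum_sum (f := fun y => D (.inr y)) hp hn
  have h1 := Summable.tsum_sum (f := D) hl hr
  rw [h1, h2, tsum_fintype, Fintype.sum_sum_type]

lemma tsum_dir_of_summable {D : Dir n → ℂ} (hD : Summable D) :
    ∑' a, D a = ∑ j, D (.act j) + ∑ j, D (.ang j) +
      (∑' m, D (.pos m) + ∑' m, D (.neg m)) := by
  have h : Summable fun y => D (Dir.equivSum.symm y) := (Equiv.summable_iff _).2 hD
  rw [← Dir.equivSum.symm.tsum_eq]
  exact tsum_sum_sum h

lemma tsum_fiber {T : Dir n × Mono n × Mono n → ℂ} (hT : Summable T) :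
    ∑' P : Mono n, ∑' y : Fiber P, T y.1 = ∑' y, T y := by
  set e := Equiv.sigmaFiberEquiv fun x : Dir n × Mono n × Mono n => x.2.1 + x.2.2
  have h : Summable fun y => T (e y) := (Equiv.summable_iff e).2 hT
  rw [← e.tsum_eq, h.tsum_sigma]
  rfl

/-- The series of the Poisson bracket represents the Poisson bracket of functions. -/
theorem poisson_eq_bracket_eval (hz : ∃ i, n i = 0) {ρ r s : ℝ} (hρ : 0 < ρ) (hO : IsOpen O)
    (hr : 0 < r) (hs : 0 ≤ s) {f g : Series n} (hf : MemA ρ O r s f) (hg : MemA ρ O r s g)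
    {ξ : Fin b → ℝ} (hξ : ξ ∈ O) {F G : Phase n → ℂ}
    (hF : ∀ x ∈ domain n ρ r s, F x = f.eval ξ x) (hG : ∀ x ∈ domain n ρ r s, G x = g.eval ξ x)
    {x : Phase n} (hx : x ∈ domain n ρ r s) :
    poisson F G x = (bracket f g).eval ξ x := by
  have hf' := (memA_iff hz hρ hO).1 hf
  have hg' := (memA_iff hz hρ hO).1 hg
  set T : Dir n × Mono n × Mono n → ℂ :=
    fun y => brTerm f g y ξ * (y.2.1 + y.2.2).eval x with hT
  have hTs : Summable T := by
    apply Summable.of_norm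
    refine summable_of_tsum_enorm (ne_top_of_le_ne_top (ENNReal.mul_ne_top ENNReal.ofReal_ne_top
      (ENNReal.mul_ne_top hf'.2.2 hg'.2.2)) (le_trans ?_ (pair_cBracket_domWeight_le hz hρ hr hs
        hx.2.2.1 hx.2.2.2 (coeffs O f) (coeffs O g))))
    rw [pair_cBracket, ENNReal.tsum_prod']
    refine ENNReal.tsum_le_tsum fun a => ?_
    rw [ENNReal.tsum_prod']
    refine ENNReal.tsum_le_tsum fun M => ENNReal.tsum_le_tsum fun N => ?_
    simp only [hT, enorm_mul]
    exact mul_le_mul' ((enorm_le_coeffNorm hξ).trans (coeffNorm_brTerm_le hO hf.1 hg.1 (a, M, N)))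
      (enorm_eval_le (mem_polydisc_of_mem_domain hx) _)
  have hR : (bracket f g).eval ξ x = ∑' y, T y := by
    unfold Series.eval bracket
    rw [← tsum_fiber hTs]
    refine tsum_congr fun P => ?_
    rw [← tsum_mul_right]
    refine tsum_congr fun y => ?_
    simp only [hT, y.2]
  set D : Dir n → ℂ := fun a => a.symp * (partialDir a F x * partialDir a.conj G x) with hD
  have hin : ∀ a : Dir n, ∑' y : Mono n × Mono n, T (a, y) = D a := by
    intro a
    simp only [hD]
    rw [partialDir_eval hz hρ hr hf'.2.2 hξ hF hx a,
      partialDir_eval hz hρ hr hg'.2.2 hξ hG hx a.conj]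
    unfold Series.eval
    rw [tsum_mul_tsum_of_summable_norm (summable_norm_deriv_eval hz hρ hO hr hf hξ hx a)
      (summable_norm_deriv_eval hz hρ hO hr hg hξ hx a.conj), ← tsum_mul_left]
    refine tsum_congr fun y => ?_
    simp only [hT, brTerm, Mono.eval_add]
    ring
  have hDs : Summable D := by
    have := hTs.prod
    simpa only [hin] using this
  have hL : ∑' y, T y = ∑' a, D a := by
    rw [hTs.tsum_prod]
    exact tsum_congr hin
  have hsplit := tsum_dir_of_summable hDs
  have hpi : Function.Injective (Dir.pos : NormalSite n → Dir n) := by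
    intro i j h; injection h
  have hni : Function.Injective (Dir.neg : NormalSite n → Dir n) := by
    intro i j h; injection h
  have hsp : Summable fun m => D (.pos m) := hDs.comp_injective hpi
  have hsn : Summable fun m => D (.neg m) := hDs.comp_injective hni
  rw [hR, hL, hsplit, ← Finset.sum_add_distrib, ← hsp.tsum_add hsn]
  unfold poisson
  rw [← tsum_mul_left]
  congr 1
  · refine Finset.sum_congr rfl fun j _ => ?_
    simp only [hD, Dir.symp, Dir.conj]
    change partialDir (.act j) F x * partialDir (.ang j) G x -
      partialDir (.ang j) F x * partialDir (.act j) G x = _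
    ring
  · refine tsum_congr fun m => ?_
    simp only [hD, Dir.symp, Dir.conj]
    change Complex.I * (partialDir (.neg m) F x * partialDir (.pos m) G x -
      partialDir (.pos m) F x * partialDir (.neg m) G x) = _
    ring

lemma MemA.mono (hz : ∃ i, n i = 0) {ρ r s r' s' : ℝ} (hρ : 0 < ρ) (hO : IsOpen O) (hr' : 0 < r')
    (hr : r' ≤ r) (hs : s' ≤ s) {f : Series n} (hf : MemA ρ O r s f) : MemA ρ O r' s' f := by
  rw [memA_iff hz hρ hO] at hf ⊢
  exact ⟨hf.1, hf.2.1, ne_top_of_le_ne_top (ENNReal.mul_ne_top ENNReal.ofReal_ne_top hf.2.2)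
    (fieldNorm_domain_mono hr' hr hs _)⟩

/-- Membership in the domain is an open condition in `r` and `s`. Hence pointwise identities for
iterated brackets hold on the full domain, although norm bounds lose domain with each bracket. -/
lemma exists_smaller_domain {ρ r s : ℝ} (hr : 0 < r) (hs : 0 < s) {x : Phase n}
    (hx : x ∈ domain n ρ r s) :
    ∃ r' s', 0 < r' ∧ r' < r ∧ 0 < s' ∧ s' < s ∧ x ∈ domain n ρ r' s' := by
  obtain ⟨h1, h2, h3, h4⟩ := hx
  have hs1 : ∀ᶠ s' in nhdsWithin s (Set.Iio s), ∀ j, |(x.ϑ j).im| < s' :=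
    Filter.eventually_all.2 fun j => nhdsWithin_le_nhds (lt_mem_nhds (h1 j))
  have hs2 : ∀ᶠ s' in nhdsWithin s (Set.Iio s), 0 < s' ∧ s' < s := by
    filter_upwards [nhdsWithin_le_nhds (lt_mem_nhds hs), self_mem_nhdsWithin] with s' h h'
    exact ⟨h, h'⟩
  obtain ⟨s', hs'1, hs'2⟩ := (hs1.and hs2).exists
  have hcont : Filter.Tendsto (fun t : ℝ => t ^ 2) (nhds r) (nhds (r ^ 2)) :=
    (continuous_pow 2).tendsto r
  have hof : Filter.Tendsto ENNReal.ofReal (nhds r) (nhds (ENNReal.ofReal r)) :=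
    ENNReal.continuous_ofReal.tendsto r
  have hr1 : ∀ᶠ r' in nhdsWithin r (Set.Iio r), ∀ j, ‖x.I j‖ < r' ^ 2 :=
    Filter.eventually_all.2 fun j => nhdsWithin_le_nhds (hcont (lt_mem_nhds (h2 j)))
  have hr2 : ∀ᶠ r' in nhdsWithin r (Set.Iio r), 0 < r' ∧ r' < r := by
    filter_upwards [nhdsWithin_le_nhds (lt_mem_nhds hr), self_mem_nhdsWithin] with s' h h'
    exact ⟨h, h'⟩
  have hr3 : ∀ᶠ r' in nhdsWithin r (Set.Iio r), seqNorm ρ x.z < ENNReal.ofReal r' :=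
    nhdsWithin_le_nhds (hof (lt_mem_nhds h3))
  have hr4 : ∀ᶠ r' in nhdsWithin r (Set.Iio r), seqNorm ρ x.zbar < ENNReal.ofReal r' :=
    nhdsWithin_le_nhds (hof (lt_mem_nhds h4))
  obtain ⟨r', ⟨⟨hr'1, hr'2⟩, hr'3⟩, hr'4⟩ := (((hr1.and hr2).and hr3).and hr4).exists
  exact ⟨r', s', hr'2.1, hr'2.2, hs'2.1, hs'2.2, hs'1, hr'1, hr'3, hr'4⟩

lemma domain_mono {ρ r s r' s' : ℝ} (hr' : 0 < r') (hr : r' ≤ r) (hs : s' ≤ s) :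
    domain n ρ r' s' ⊆ domain n ρ r s := fun x hx =>
  ⟨fun j => (hx.1 j).trans_le hs, fun j => (hx.2.1 j).trans_le (by gcongr),
    hx.2.2.1.trans_le (ENNReal.ofReal_le_ofReal hr), hx.2.2.2.trans_le (ENNReal.ofReal_le_ofReal hr)⟩

/-- Iterated brackets belong to `𝒜_{r',s'}` for every smaller domain. -/
lemma memA_iterate_bracket (hz : ∃ i, n i = 0) {ρ r s : ℝ} (hρ : 0 < ρ) (hO : IsOpen O)
    {f g : Series n} (hf : MemA ρ O r s f) (hg : MemA ρ O r s g) (k : ℕ) :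
    ∀ r' s', 0 < r' → r' < r → 0 ≤ s' → s' < s → MemA ρ O r' s' ((bracket f)^[k] g) := by
  induction k with
  | zero => exact fun r' s' h1 h2 h3 h4 => hg.mono hz hρ hO h1 h2.le h4.le
  | succ k ih =>
    intro r' s' h1 h2 h3 h4
    rw [Function.iterate_succ_apply']
    have h5 : (r' + r) / 2 < r := by linarith
    have h6 : (s' + s) / 2 < s := by linarith
    have h7 : 0 < (r' + r) / 2 := by linarith
    exact memA_bracket (r := (r' + r) / 2) (s := (s' + s) / 2) hz hρ hO h1 (by linarith) h3
      (by linarith) (hf.mono hz hρ hO h7 h5.le h6.le) (ih _ _ h7 h5 (by linarith) h6)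

theorem iterate_poisson_eq (hz : ∃ i, n i = 0) {ρ r s : ℝ} (hρ : 0 < ρ) (hO : IsOpen O)
    (hr : 0 < r) (hs : 0 < s) {f g : Series n} (hf : MemA ρ O r s f) (hg : MemA ρ O r s g)
    {ξ : Fin b → ℝ} (hξ : ξ ∈ O) (k : ℕ) : ∀ x ∈ domain n ρ r s,
      (poisson (f.eval ξ))^[k] (g.eval ξ) x = ((bracket f)^[k] g).eval ξ x := by
  induction k with
  | zero => intro x _; rfl
  | succ k ih =>
    intro x hx
    rw [Function.iterate_succ_apply', Function.iterate_succ_apply']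
    obtain ⟨r', s', h1, h2, h3, h4, hx'⟩ := exists_smaller_domain hr hs hx
    exact poisson_eq_bracket_eval hz hρ hO h1 h3.le (hf.mono hz hρ hO h1 h2.le h4.le)
      (memA_iterate_bracket hz hρ hO hf hg k r' s' h1 h2 h3.le h4) hξ (fun _ _ => rfl)
      (fun y hy => ih y (domain_mono h1 h2.le h4.le hy)) hx'

end Evaluation

/-! ### The sign-lexicographical order -/

section SignLexOrder

lemma List.append_lt_append_of_length_eq {α : Type*} [LinearOrder α] {l l' : List α}
    (hl : l.length = l'.length) (h : l < l') (e e' : List α) : l ++ e < l' ++ e' := by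
  induction l generalizing l' with
  | nil =>
    cases l' with
    | nil => exact absurd h (lt_irrefl _)
    | cons => simp at hl
  | cons a l ih =>
    cases l' with
    | nil => simp at hl
    | cons a' l' =>
      rw [List.cons_append, List.cons_append, List.cons_lt_cons_iff]
      rw [List.cons_lt_cons_iff] at h
      rcases h with h | ⟨h1, h2⟩
      · exact Or.inl h
      · exact Or.inr ⟨h1, ih (by simpa using hl) h2⟩

/-- `display` lists all constants before all vectors, so common rows at the end of two presentations
insert one common block `c` in the middle and another one `e` at the end. -/
lemma List.insert_lt_insert_of_append_lt {α : Type*} [LinearOrder α] {x x' y y' : List α}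
    (hx : x.length = x'.length) (hy : y.length = y'.length) (h : x ++ y < x' ++ y')
    (c e : List α) : x ++ c ++ (y ++ e) < x' ++ c ++ (y' ++ e) := by
  induction x generalizing x' with
  | nil =>
    cases x' with
    | nil =>
      simp only [List.nil_append] at h ⊢
      exact List.append_left_lt (List.append_lt_append_of_length_eq hy h e e)
    | cons => simp at hx
  | cons a x ih =>
    cases x' with
    | nil => simp at hx
    | cons a' x' =>
      simp only [List.cons_append, List.cons_lt_cons_iff] at h ⊢
      rcases h with h | ⟨h1, h2⟩
      · exact Or.inl h
      · exact Or.inr ⟨h1, ih (by simpa using hx) h2⟩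

lemma List.ofFn_append_lt {α : Type*} [LinearOrder α] {k : ℕ} {f g : Fin k → α} (i : Fin k)
    (heq : ∀ a < i, f a = g a) (hlt : f i < g i) (e e' : List α) :
    List.ofFn f ++ e < List.ofFn g ++ e' := by
  induction k with
  | zero => exact i.elim0
  | succ k ih =>
    rw [List.ofFn_succ, List.ofFn_succ, List.cons_append, List.cons_append, List.cons_lt_cons_iff]
    induction i using Fin.cases with
    | zero => exact Or.inl hlt
    | succ i =>
      refine Or.inr ⟨heq 0 (Fin.succ_pos i), ih i (fun a ha => ?_) hlt⟩
      exact heq a.succ (Fin.succ_lt_succ_iff.2 ha)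

/-- The sign-lexicographical order as a pull-back of a linear order. -/
def signKey (a : List ℤ) : List ℕ ×ₗ (List ℤ)ᵒᵈ := toLex (a.map Int.natAbs, OrderDual.toDual a)

lemma signKey_lt_iff {a b : List ℤ} : signKey a < signKey b ↔ SignLex a b :=
  Prod.Lex.toLex_lt_toLex

lemma signKey_injective : Function.Injective signKey := by
  intro a b h
  have := congrArg (fun x => OrderDual.ofDual (ofLex x).2) h
  simpa [signKey] using this

lemma signKey_le_iff {a b : List ℤ} : signKey a ≤ signKey b ↔ a = b ∨ SignLex a b := by
  rw [le_iff_eq_or_lt, signKey_lt_iff, signKey_injective.eq_iff]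

variable {d : ℕ}

lemma display_injective {ℓ : ℕ} {v w : Fin ℓ → Fin d → ℤ} {p q : Fin ℓ → ℤ}
    (h : display v p = display w q) : v = w ∧ p = q := by
  unfold display at h
  obtain ⟨h1, h2⟩ := List.append_inj h (by simp)
  refine ⟨?_, List.ofFn_injective h1⟩
  have h3 : (List.ofFn fun i => List.ofFn (v i)) = List.ofFn fun i => List.ofFn (w i) := by
    refine List.eq_iff_flatten_eq.2 ⟨h2, ?_⟩
    simp [List.map_ofFn, Function.comp_def]
  have h4 := List.ofFn_injective h3
  funext i
  exact List.ofFn_injective (congrFun h4 i)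

lemma display_add {ℓ t : ℕ} (v : Fin (ℓ + t) → Fin d → ℤ) (p : Fin (ℓ + t) → ℤ) :
    display v p = (List.ofFn (p ∘ Fin.castLE (Nat.le_add_right ℓ t)) ++
      List.ofFn fun i => p (Fin.natAdd ℓ i)) ++
      ((List.ofFn fun i => List.ofFn (v (Fin.castLE (Nat.le_add_right ℓ t) i))).flatten ++
        (List.ofFn fun i => List.ofFn (v (Fin.natAdd ℓ i))).flatten) := by
  unfold display
  rw [List.ofFn_add, List.ofFn_add, List.flatten_append]
  rfl

/-- Comparison of two presentations which differ in the first `ℓ` rows only. -/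
lemma signKey_display_head_le {ℓ t : ℕ} {v w : Fin (ℓ + t) → Fin d → ℤ} {p q : Fin (ℓ + t) → ℤ}
    (hvw : ∀ i, v (Fin.natAdd ℓ i) = w (Fin.natAdd ℓ i))
    (hpq : ∀ i, p (Fin.natAdd ℓ i) = q (Fin.natAdd ℓ i))
    (h : signKey (display v p) ≤ signKey (display w q)) :
    signKey (display (v ∘ Fin.castLE (Nat.le_add_right ℓ t)) (p ∘ Fin.castLE (Nat.le_add_right ℓ t))) ≤
      signKey (display (w ∘ Fin.castLE (Nat.le_add_right ℓ t))
        (q ∘ Fin.castLE (Nat.le_add_right ℓ t))) := by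
  by_contra hcon
  rw [not_le, signKey_lt_iff] at hcon
  refine absurd h (not_le.2 (signKey_lt_iff.2 ?_))
  rw [display_add v p, display_add w q]
  simp_rw [hvw, hpq]
  set x := List.ofFn (p ∘ Fin.castLE (Nat.le_add_right ℓ t)) with hx
  set x' := List.ofFn (q ∘ Fin.castLE (Nat.le_add_right ℓ t)) with hx'
  set c := List.ofFn fun i => q (Fin.natAdd ℓ i)
  set e := (List.ofFn fun i => List.ofFn (w (Fin.natAdd ℓ i))).flatten
  set y := (List.ofFn fun i => List.ofFn (v (Fin.castLE (Nat.le_add_right ℓ t) i))).flatten with hy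
  set y' := (List.ofFn fun i => List.ofFn (w (Fin.castLE (Nat.le_add_right ℓ t) i))).flatten with hy'
  have hlx : x'.length = x.length := by simp [hx, hx']
  have hly : y'.length = y.length := by
    simp [hy, hy', List.length_flatten, List.map_ofFn, Function.comp_def]
  change SignLex (x' ++ y') (x ++ y) at hcon
  rcases hcon with h1 | ⟨h1, h2⟩
  · left
    simp only [List.map_append] at h1 ⊢
    exact List.insert_lt_insert_of_append_lt (by simpa using hlx) (by simpa using hly) h1 _ _
  · right
    simp only [List.map_append] at h1 ⊢
    obtain ⟨h3, h4⟩ := List.append_inj h1 (by simpa using hlx)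
    exact ⟨by rw [h3, h4], List.insert_lt_insert_of_append_lt hlx.symm hly.symm h2 _ _⟩

end SignLexOrder

/-! ### Optimal presentations of lattice points -/

section OptimalPresentations

variable {d : ℕ}

/-- An integer vector as a real vector. -/
def realVec (v : Fin d → ℤ) : Fin d → ℝ := fun j => (v j : ℝ)

/-- The integer scalar product. -/
def idot (u m : Fin d → ℤ) : ℤ := ∑ j, u j * m j

lemma idot_add (u m m' : Fin d → ℤ) : idot u (m + m') = idot u m + idot u m' := by
  simp [idot, mul_add, Finset.sum_add_distrib]

lemma idot_smul (u m : Fin d → ℤ) (ε : ℤ) : idot u (ε • m) = ε * idot u m := by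
  simp only [idot, Pi.smul_apply, smul_eq_mul, Finset.mul_sum]
  exact Finset.sum_congr rfl fun _ _ => by ring

lemma eucl_eq_norm (m : Fin d → ℤ) : eucl m = ‖WithLp.toLp 2 (realVec m)‖ := by
  simp [eucl, EuclideanSpace.norm_eq, realVec]

lemma eucl_nonneg (m : Fin d → ℤ) : 0 ≤ eucl m := Real.sqrt_nonneg _

lemma eucl_add_le (m m' : Fin d → ℤ) : eucl (m + m') ≤ eucl m + eucl m' := by
  rw [eucl_eq_norm, eucl_eq_norm, eucl_eq_norm]
  have : WithLp.toLp 2 (realVec (m + m')) =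
      WithLp.toLp 2 (realVec m) + WithLp.toLp 2 (realVec m') := by
    rw [← WithLp.toLp_add]
    congr 1
    funext j
    simp [realVec]
  rw [this]
  exact norm_add_le _ _

lemma eucl_zsmul (k : ℤ) (m : Fin d → ℤ) : eucl (k • m) = |(k : ℝ)| * eucl m := by
  rw [eucl_eq_norm, eucl_eq_norm]
  have : WithLp.toLp 2 (realVec (k • m)) = (k : ℝ) • WithLp.toLp 2 (realVec m) := by
    rw [← WithLp.toLp_smul]
    congr 1
    funext j
    simp [realVec]
  rw [this, norm_smul, Real.norm_eq_abs]

lemma eucl_neg (m : Fin d → ℤ) : eucl (-m) = eucl m := by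
  have := eucl_zsmul (-1) m
  simpa using this

lemma eucl_sub_le (m m' : Fin d → ℤ) : eucl m ≤ eucl (m + m') + eucl m' := by
  have := eucl_add_le (m + m') (-m')
  rwa [add_neg_cancel_right, eucl_neg] at this

@[simp] lemma eucl_zero : eucl (0 : Fin d → ℤ) = 0 := by simp [eucl]

lemma abs_idot_le (u m : Fin d → ℤ) : |(idot u m : ℝ)| ≤ eucl u * eucl m := by
  have h := Finset.sum_mul_sq_le_sq_mul_sq Finset.univ (fun j => (u j : ℝ)) fun j => (m j : ℝ)
  have h1 : (idot u m : ℝ) = ∑ j, (u j : ℝ) * m j := by simp [idot]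
  rw [h1]
  unfold eucl
  rw [← Real.sqrt_mul (Finset.sum_nonneg fun _ _ => sq_nonneg _), ← Real.sqrt_sq_eq_abs]
  exact Real.sqrt_le_sqrt h

/-- The span of the first `κ` vectors of a family. -/
def headSpan (v : Fin d → Fin d → ℤ) (κ : ℕ) : Submodule ℝ (Fin d → ℝ) :=
  Submodule.span ℝ ((fun i => realVec (v i)) '' {i | i.val < κ})

lemma headSpan_eq_range {ℓ : ℕ} (hℓ : ℓ ≤ d) (v : Fin d → Fin d → ℤ) :
    headSpan v ℓ = Submodule.span ℝ (Set.range fun i => realVec ((v ∘ Fin.castLE hℓ) i)) := by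
  unfold headSpan
  congr 1
  ext x
  constructor
  · rintro ⟨i, hi, rfl⟩
    exact ⟨⟨i, hi⟩, rfl⟩
  · rintro ⟨i, rfl⟩
    exact ⟨Fin.castLE hℓ i, i.2, rfl⟩

lemma exists_notMem_span {E : Type*} [AddCommGroup E] [Module ℝ E] {k l : ℕ} {f : Fin k → E}
    {g : Fin l → E} (hf : LinearIndependent ℝ f) (hlk : l < k) :
    ∃ i, f i ∉ Submodule.span ℝ (Set.range g) := by
  by_contra h
  push Not at h
  have h1 : Submodule.span ℝ (Set.range f) ≤ Submodule.span ℝ (Set.range g) := by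
    rw [Submodule.span_le]
    rintro _ ⟨i, rfl⟩
    exact h i
  have : FiniteDimensional ℝ (Submodule.span ℝ (Set.range g)) :=
    FiniteDimensional.span_of_finite ℝ (Set.finite_range g)
  have h2 := Submodule.finrank_mono h1
  rw [finrank_span_eq_card hf] at h2
  have h3 : Module.finrank ℝ (Submodule.span ℝ (Set.range g)) ≤ Fintype.card (Fin l) :=
    finrank_range_le_card g
  simp only [Fintype.card_fin] at h2 h3
  omega

lemma linearIndependent_head {v : Fin d → Fin d → ℤ} (hv : LinearIndependent ℝ fun i => realVec (v i))
    {ℓ : ℕ} (hℓ : ℓ ≤ d) : LinearIndependent ℝ fun i => realVec ((v ∘ Fin.castLE hℓ) i) :=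
  hv.comp _ (Fin.castLE_injective hℓ)

lemma span_range_eq_top {v : Fin d → Fin d → ℤ} (hv : LinearIndependent ℝ fun i => realVec (v i)) :
    Submodule.span ℝ (Set.range fun i => realVec (v i)) = ⊤ :=
  hv.span_eq_top_of_card_eq_finrank' (by simp)

lemma mem_affineSpace_realVec {ℓ : ℕ} {v : Fin ℓ → Fin d → ℤ} {p : Fin ℓ → ℤ} {m : Fin d → ℤ} :
    realVec m ∈ affineSpace v p ↔ ∀ i, idot (v i) m = p i := by
  unfold affineSpace idot realVec
  simp only [Set.mem_ofPred_eq]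
  refine forall_congr' fun i => ?_
  exact_mod_cast Iff.rfl

/-- Presentations of a lattice point. -/
lemma isPresentation_point_iff {C₁ : ℝ} {N : ℕ} {m : Fin d → ℤ} {v : Fin d → Fin d → ℤ}
    {p : Fin d → ℤ} : IsPresentation C₁ N {fun j => (m j : ℝ)} v p ↔
      LinearIndependent ℝ (fun i => realVec (v i)) ∧ (∀ i, v i ≠ 0 ∧ eucl (v i) < C₁ * N) ∧
        ∀ i, idot (v i) m = p i := by
  unfold IsPresentation
  refine and_congr_right fun hv => and_congr_right fun _ => ?_
  rw [← mem_affineSpace_realVec]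
  constructor
  · intro h
    rw [← h]
    rfl
  · intro h
    ext x
    rw [Set.mem_singleton_iff]
    constructor
    · rintro rfl; exact h
    · intro hx
      set A : Matrix (Fin d) (Fin d) ℝ := fun i j => (v i j : ℝ) with hA
      have hu : IsUnit A := Matrix.linearIndependent_rows_iff_isUnit.1 hv
      apply Matrix.mulVec_injective_of_isUnit hu
      funext i
      exact (hx i).trans (h i).symm

lemma IsOptimalPoint.presentation {C₁ : ℝ} {N : ℕ} {m : Fin d → ℤ} {v : Fin d → Fin d → ℤ}
    {p : Fin d → ℤ} (h : IsOptimalPoint C₁ N m v p) :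
      LinearIndependent ℝ (fun i => realVec (v i)) ∧ (∀ i, v i ≠ 0 ∧ eucl (v i) < C₁ * N) ∧
        ∀ i, idot (v i) m = p i :=
  isPresentation_point_iff.1 h.1

lemma IsOptimalPoint.signKey_le {C₁ : ℝ} {N : ℕ} {m : Fin d → ℤ} {v w : Fin d → Fin d → ℤ}
    {p : Fin d → ℤ} (h : IsOptimalPoint C₁ N m v p)
    (hw : LinearIndependent ℝ fun i => realVec (w i)) (hb : ∀ i, w i ≠ 0 ∧ eucl (w i) < C₁ * N) :
    signKey (display v p) ≤ signKey (display w fun i => idot (w i) m) :=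
  signKey_le_iff.2 (h.2 w _ (isPresentation_point_iff.2 ⟨hw, hb, fun _ => rfl⟩))

/-- Replacing row `k` by the combination multiplies the determinant by `c k`. -/
lemma linearIndependent_update {v : Fin d → Fin d → ℝ} (hv : LinearIndependent ℝ v) (k : Fin d)
    {u : Fin d → ℝ} {c : Fin d → ℝ} (hu : u = ∑ i, c i • v i) (hc : c k ≠ 0) :
    LinearIndependent ℝ (Function.update v k u) := by
  set A : Matrix (Fin d) (Fin d) ℝ := v with hA
  have h1 : IsUnit A := Matrix.linearIndependent_rows_iff_isUnit.1 hv
  have h2 := Matrix.det_updateRow_sum A k c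
  have h3 : IsUnit (A.updateRow k (∑ i, c i • A i)) := by
    rw [Matrix.isUnit_iff_isUnit_det, h2, smul_eq_mul]
    exact (isUnit_iff_ne_zero.2 hc).mul ((Matrix.isUnit_iff_isUnit_det A).1 h1)
  have h4 := Matrix.linearIndependent_rows_iff_isUnit.2 h3
  rw [hu]
  exact h4

/-- Optimal presentations are greedy. -/
lemma IsOptimalPoint.greedy {C₁ : ℝ} {N : ℕ} {m : Fin d → ℤ} {v : Fin d → Fin d → ℤ}
    {p : Fin d → ℤ} (h : IsOptimalPoint C₁ N m v p) {k : Fin d} {u : Fin d → ℤ}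
    (hu0 : u ≠ 0) (hub : eucl u < C₁ * N) (hu : realVec u ∉ headSpan v k.val) :
    |p k| ≤ |idot u m| := by
  obtain ⟨hv, hb, hp⟩ := h.presentation
  by_contra hcon
  push Not at hcon
  have : Nonempty (Fin d) := ⟨k⟩
  set B := basisOfLinearIndependentOfCardEqFinrank hv (by simp) with hB
  have hBv : ⇑B = fun i => realVec (v i) := coe_basisOfLinearIndependentOfCardEqFinrank hv _
  -- Otherwise `u` would be a combination of the first `k` vectors.
  obtain ⟨i₀, hi₀, hc⟩ : ∃ i₀, k ≤ i₀ ∧ B.repr (realVec u) i₀ ≠ 0 := by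
    by_contra hno
    push Not at hno
    apply hu
    unfold headSpan
    rw [← hBv, Module.Basis.mem_span_image]
    intro i hi
    by_contra hik
    exact (Finsupp.mem_support_iff.1 hi) (hno i (not_lt.1 hik))
  -- `u` takes place `k`, and the displaced `v k` takes the place of `v i₀`, which `u` makes
  -- redundant. The constants before place `k` are unchanged and that at `k` gets smaller,
  -- contradicting optimality.
  set π := Equiv.swap k i₀ with hπ
  set w : Fin d → Fin d → ℤ := Function.update (v ∘ π) k u with hw
  have hwr : (fun i => realVec (w i)) = Function.update (fun i => realVec (v (π i))) k (realVec u) := by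
    funext i
    by_cases hi : i = k
    · subst hi; simp [hw]
    · simp [hw, hi]
  have hwi : LinearIndependent ℝ fun i => realVec (w i) := by
    rw [hwr]
    refine linearIndependent_update (hv.comp π π.injective) k
      (c := fun i => B.repr (realVec u) (π i)) ?_ ?_
    · conv_lhs => rw [← B.sum_repr (realVec u)]
      rw [← Equiv.sum_comp π]
      simp [hBv]
    · simpa [hπ] using hc
  have hwb : ∀ i, w i ≠ 0 ∧ eucl (w i) < C₁ * N := by
    intro i
    by_cases hi : i = k
    · subst hi; simp only [hw, Function.update_self]; exact ⟨hu0, hub⟩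
    · simp only [hw, Function.update_of_ne hi]; exact hb _
  refine absurd (h.signKey_le hwi hwb) (not_le.2 (signKey_lt_iff.2 (Or.inl ?_)))
  unfold display
  rw [List.map_append, List.map_append, List.map_ofFn, List.map_ofFn]
  refine List.ofFn_append_lt k (fun a ha => ?_) ?_ _ _
  · simp only [Function.comp]
    rw [hw, Function.update_of_ne ha.ne]
    simp only [Function.comp, hπ]
    rw [Equiv.swap_apply_of_ne_of_ne ha.ne (ha.trans_le hi₀).ne, hp]
  · simp only [Function.comp, hw, Function.update_self]
    rw [Int.abs_eq_natAbs, Int.abs_eq_natAbs] at hcon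
    exact_mod_cast hcon

/-- Greediness at place `i`, tested with the later vector `v k`. -/
lemma IsOptimalPoint.abs_mono {C₁ : ℝ} {N : ℕ} {m : Fin d → ℤ} {v : Fin d → Fin d → ℤ}
    {p : Fin d → ℤ} (h : IsOptimalPoint C₁ N m v p) {i k : Fin d} (hik : i ≤ k) : |p i| ≤ |p k| := by
  obtain ⟨hv, hb, hp⟩ := h.presentation
  rw [← hp k]
  refine h.greedy (hb k).1 (hb k).2 ?_
  unfold headSpan
  exact hv.notMem_span_image (by simpa using hik)

/-- Changing the sign of row `k` keeps all moduli, and among equal moduli the order prefers the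
larger entry; a negative constant could therefore be improved. -/
lemma IsOptimalPoint.nonneg {C₁ : ℝ} {N : ℕ} {m : Fin d → ℤ} {v : Fin d → Fin d → ℤ}
    {p : Fin d → ℤ} (h : IsOptimalPoint C₁ N m v p) (k : Fin d) : 0 ≤ p k := by
  obtain ⟨hv, hb, hp⟩ := h.presentation
  by_contra hneg
  push Not at hneg
  set w : Fin d → Fin d → ℤ := Function.update v k (-(v k)) with hw
  have hwr : (fun i => realVec (w i)) =
      Function.update (fun i => realVec (v i)) k (-(realVec (v k))) := by
    funext i
    by_cases hi : i = k
    · subst hi; funext j; simp [hw, realVec]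
    · simp [hw, hi]
  have hwi : LinearIndependent ℝ fun i => realVec (w i) := by
    rw [hwr]
    exact linearIndependent_update hv k (c := Pi.single k (-1)) (by simp [Pi.single_apply]) (by simp)
  have hwb : ∀ i, w i ≠ 0 ∧ eucl (w i) < C₁ * N := by
    intro i
    by_cases hi : i = k
    · subst hi; simp only [hw, Function.update_self, eucl_neg]; exact ⟨neg_ne_zero.2 (hb i).1, (hb i).2⟩
    · simp only [hw, Function.update_of_ne hi]; exact hb _
  have hq : ∀ i, i ≠ k → idot (w i) m = p i := by
    intro i hi
    rw [hw, Function.update_of_ne hi, hp]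
  have hqk : idot (w k) m = -p k := by
    rw [hw, Function.update_self, ← hp k]
    simp [idot]
  refine absurd (h.signKey_le hwi hwb) (not_le.2 (signKey_lt_iff.2 (Or.inr ⟨?_, ?_⟩)))
  · unfold display
    simp only [List.map_append, List.map_ofFn, List.map_flatten]
    congr 1
    · congr 1
      funext i
      by_cases hi : i = k
      · subst hi; simp [hqk]
      · simp [hq i hi]
    · congr 2
      funext i
      simp only [Function.comp, List.map_ofFn]
      congr 1
      funext j
      by_cases hi : i = k
      · subst hi; simp [hw]
      · simp [hw, hi]
  · unfold display
    refine List.ofFn_append_lt k (fun a ha => (hq a ha.ne).symm) ?_ _ _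
    rw [hqk]
    omega

lemma finite_eucl_lt (R : ℝ) : {v : Fin d → ℤ | eucl v < R}.Finite := by
  refine (Set.Finite.pi' (fun _ : Fin d => Set.finite_Icc (-⌈R⌉) ⌈R⌉)).subset fun v hv j => ?_
  have h1 : |(v j : ℝ)| ≤ eucl v := by
    unfold eucl
    rw [← Real.sqrt_sq_eq_abs]
    exact Real.sqrt_le_sqrt (Finset.single_le_sum (f := fun j => (v j : ℝ) ^ 2)
      (fun _ _ => sq_nonneg _) (Finset.mem_univ j))
  have h2 : |(v j : ℝ)| ≤ (⌈R⌉ : ℝ) := h1.trans ((le_of_lt hv).trans (Int.le_ceil R))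
  rw [Set.mem_Icc]
  have h3 := abs_le.1 h2
  exact ⟨by exact_mod_cast h3.1, by exact_mod_cast h3.2⟩

/-- Every lattice point has an optimal presentation. -/
lemma exists_isOptimalPoint {C₁ : ℝ} {N : ℕ} (hN : 1 < C₁ * N) (m : Fin d → ℤ) :
    ∃ v p, IsOptimalPoint C₁ N m v p := by
  set S : Set (Fin d → Fin d → ℤ) := {v | LinearIndependent ℝ (fun i => realVec (v i)) ∧
    ∀ i, v i ≠ 0 ∧ eucl (v i) < C₁ * N} with hS
  have hfin : S.Finite := (Set.Finite.pi' fun _ : Fin d => finite_eucl_lt (C₁ * N)).subset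
    fun v hv i => (hv.2 i).2
  have hne : S.Nonempty := by
    refine ⟨fun i => Pi.single i 1, ?_, fun i => ⟨?_, ?_⟩⟩
    · have : (fun i : Fin d => realVec (Pi.single i (1 : ℤ))) = Pi.basisFun ℝ (Fin d) := by
        funext i j
        simp [realVec, Pi.single_apply]
      rw [this]
      exact (Pi.basisFun ℝ (Fin d)).linearIndependent
    · simp
    · have : eucl (Pi.single i (1 : ℤ) : Fin d → ℤ) = 1 := by
        simp [eucl, Pi.single_apply]
      rwa [this]
  obtain ⟨v, hv, hmin⟩ := Set.exists_min_image S
    (fun v => signKey (display v fun i => idot (v i) m)) hfin hne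
  refine ⟨v, fun i => idot (v i) m, isPresentation_point_iff.2 ⟨hv.1, hv.2, fun _ => rfl⟩,
    fun w q hw => ?_⟩
  obtain ⟨h1, h2, h3⟩ := isPresentation_point_iff.1 hw
  have : q = fun i => idot (w i) m := by funext i; exact (h3 i).symm
  rw [this]
  exact signKey_le_iff.1 (hmin w ⟨h1, h2⟩)

/-- The head of an optimal presentation is optimal among the families with the same span. -/
lemma IsOptimalPoint.signKey_head_le {C₁ : ℝ} {N : ℕ} {m : Fin d → ℤ} {v : Fin d → Fin d → ℤ}
    {p : Fin d → ℤ} (h : IsOptimalPoint C₁ N m v p) {ℓ : ℕ} (hℓ : ℓ ≤ d) {U : Fin ℓ → Fin d → ℤ}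
    (hspan : headSpan v ℓ ≤ Submodule.span ℝ (Set.range fun i => realVec (U i)))
    (hb : ∀ i, U i ≠ 0 ∧ eucl (U i) < C₁ * N) :
    signKey (display (v ∘ Fin.castLE hℓ) (p ∘ Fin.castLE hℓ)) ≤
      signKey (display U fun i => idot (U i) m) := by
  obtain ⟨hv, hvb, hp⟩ := h.presentation
  set w : Fin d → Fin d → ℤ := fun i => if hi : i.val < ℓ then U ⟨i, hi⟩ else v i with hw
  have hwhead : ∀ i : Fin ℓ, w (Fin.castLE hℓ i) = U i := fun i => by simp [hw]
  have hwi : LinearIndependent ℝ fun i => realVec (w i) := by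
    refine linearIndependent_of_top_le_span_of_card_eq_finrank ?_ (by simp)
    rw [← span_range_eq_top hv, Submodule.span_le]
    rintro _ ⟨i, rfl⟩
    by_cases hi : i.val < ℓ
    · have h1 : realVec (v i) ∈ headSpan v ℓ := Submodule.subset_span ⟨i, hi, rfl⟩
      refine Submodule.span_mono ?_ (hspan h1)
      rintro _ ⟨a, rfl⟩
      exact ⟨Fin.castLE hℓ a, by simp only [hwhead]⟩
    · exact Submodule.subset_span ⟨i, by simp [hw, hi]⟩
  have hwb : ∀ i, w i ≠ 0 ∧ eucl (w i) < C₁ * N := by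
    intro i
    by_cases hi : i.val < ℓ
    · simp only [hw, hi, dite_true]; exact hb _
    · simp only [hw, hi, dite_false]; exact hvb _
  have hkey := h.signKey_le hwi hwb
  have hU : display U (fun i => idot (U i) m) =
      display (w ∘ Fin.castLE hℓ) ((fun i => idot (w i) m) ∘ Fin.castLE hℓ) := by
    congr 1
    · funext i; exact (hwhead i).symm
    · funext i; simp only [Function.comp, hwhead]
  have htail : ∀ i : Fin d, ℓ ≤ i.val → v i = w i := fun i hi => by simp [hw, not_lt.2 hi]
  have htail' : ∀ i : Fin d, ℓ ≤ i.val → p i = idot (w i) m := fun i hi => by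
    rw [← htail i hi, hp]
  rw [hU]
  -- The number `D` of rows is separated from the dimension `d` of the vectors, so that `D = ℓ + t`
  -- can be substituted.
  have hgen : ∀ (D : ℕ) (hD : ℓ ≤ D) (v w : Fin D → Fin d → ℤ) (p q : Fin D → ℤ),
      (∀ i : Fin D, ℓ ≤ i.val → v i = w i) → (∀ i : Fin D, ℓ ≤ i.val → p i = q i) →
      signKey (display v p) ≤ signKey (display w q) →
      signKey (display (v ∘ Fin.castLE hD) (p ∘ Fin.castLE hD)) ≤
        signKey (display (w ∘ Fin.castLE hD) (q ∘ Fin.castLE hD)) := by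
    intro D hD v w p q h1 h2 h3
    obtain ⟨t, rfl⟩ := Nat.exists_eq_add_of_le hD
    exact signKey_display_head_le (fun i => h1 _ (by simp)) (fun i => h2 _ (by simp)) h3
  exact hgen d hℓ v w p (fun i => idot (w i) m) htail htail' hkey

end OptimalPresentations

/-! ### Cuts of nearby lattice points -/

section CutTransfer

variable {d : ℕ} {C₁ : ℝ} {N : ℕ}

/-- The point `m` has a cut at `ℓ`, with associated presentation `[V_i; P_i]_ℓ`. -/
def CutData (C₁ : ℝ) (N : ℕ) (θ μ τ : ℝ) (m : Fin d → ℤ) {ℓ : ℕ} (hℓ : ℓ < d)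
    (V : Fin ℓ → Fin d → ℤ) (P : Fin ℓ → ℤ) : Prop :=
  ∃ v p, IsOptimalPoint C₁ N m v p ∧ HasCut N θ μ τ p ℓ ∧ v ∘ Fin.castLE hℓ.le = V ∧
    p ∘ Fin.castLE hℓ.le = P

/-- Cauchy–Schwarz for the displacement `c`; the sign `ε` disappears under the modulus. -/
lemma abs_idot_smul_add_le {u m c : Fin d → ℤ} {ε : ℤ} (hε : |ε| = 1) {L : ℝ}
    (hu : eucl u < C₁ * N) (hc : eucl c ≤ L) :
    |(idot u (ε • m + c) : ℝ)| ≤ |(idot u m : ℝ)| + C₁ * N * L ∧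
      |(idot u m : ℝ)| ≤ |(idot u (ε • m + c) : ℝ)| + C₁ * N * L := by
  have h1 : |(idot u c : ℝ)| ≤ C₁ * N * L :=
    (abs_idot_le u c).trans (mul_le_mul hu.le hc (eucl_nonneg c) ((eucl_nonneg u).trans hu.le))
  have h2 : |((ε * idot u m : ℤ) : ℝ)| = |(idot u m : ℝ)| := by
    rw [Int.cast_mul, abs_mul, ← Int.cast_abs, hε]
    simp
  have h3 : (idot u (ε • m + c) : ℝ) = ((ε * idot u m : ℤ) : ℝ) + (idot u c : ℝ) := by
    rw [idot_add, idot_smul]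
    push_cast
    ring
  rw [h3, ← h2]
  refine ⟨(abs_add_le _ _).trans (by gcongr), ?_⟩
  have h4 := abs_add_le (((ε * idot u m : ℤ) : ℝ) + (idot u c : ℝ)) (-(idot u c : ℝ))
  rw [add_neg_cancel_right, abs_neg] at h4
  linarith

/-- A lattice point close to `± m` has a cut at the same place, with relaxed parameters. -/
lemma CutData.transfer {θ μ θ' μ' τ : ℝ} {m c : Fin d → ℤ} {ℓ : ℕ} {hℓ : ℓ < d}
    {V : Fin ℓ → Fin d → ℤ} {P : Fin ℓ → ℤ} (h : CutData C₁ N θ' μ' τ m hℓ V P)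
    (hN : 1 < C₁ * N) {ε : ℤ} (hε : |ε| = 1) {L : ℝ} (hc : eucl c ≤ L)
    (hμ : μ' * (N : ℝ) ^ τ + C₁ * N * L ≤ μ * (N : ℝ) ^ τ)
    (hθ : θ * (N : ℝ) ^ (4 * d * τ) + C₁ * N * L ≤ θ' * (N : ℝ) ^ (4 * d * τ)) :
    ∃ W Q, CutData C₁ N θ μ τ (ε • m + c) hℓ W Q := by
  obtain ⟨v, p, hopt, hcut, rfl, rfl⟩ := h
  obtain ⟨w, q, hoptj⟩ := exists_isOptimalPoint (C₁ := C₁) hN (ε • m + c)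
  refine ⟨_, _, w, q, hoptj, ⟨fun i hi => ?_, fun i hi => ?_⟩, rfl, rfl⟩
  · obtain ⟨hv, hvb, hp⟩ := hopt.presentation
    have hi' : i.val ≤ d := i.2.le
    -- Of the `ℓ` head vectors of `m`, one lies outside the span of the first `ℓ - 1` vectors of the
    -- new point. Greediness at the new point, tested with it, bounds the new `p_ℓ` by the old one
    -- plus `C₁ N L`.
    obtain ⟨a, ha⟩ := exists_notMem_span
      (g := fun x => realVec ((w ∘ Fin.castLE hi') x)) (linearIndependent_head hv hℓ.le)
      (show i.val < ℓ by omega)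
    rw [← headSpan_eq_range] at ha
    set a' := Fin.castLE hℓ.le a with ha'
    have h1 := hoptj.greedy (hvb a').1 (hvb a').2 ha
    have h2 := (abs_idot_smul_add_le (m := m) hε (hvb a').2 hc).1
    have h3 : |p a'| ≤ |p i| := hopt.abs_mono (by
      rw [Fin.le_def]; simp only [ha', Fin.val_castLE]; omega)
    rw [abs_of_nonneg (hopt.nonneg i)] at h3
    rw [abs_of_nonneg (hoptj.nonneg i)] at h1
    rw [hp a'] at h2
    have h4 := hcut.1 i hi
    have h1' : (q i : ℝ) ≤ |(idot (v a') (ε • m + c) : ℝ)| := by exact_mod_cast h1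
    have h3' : |(p a' : ℝ)| ≤ (p i : ℝ) := by exact_mod_cast h3
    linarith
  · obtain ⟨hw, hwb, hq⟩ := hoptj.presentation
    have hi' : ℓ + 1 ≤ d := hℓ
    -- Conversely, one of the first `ℓ + 1` vectors of the new point lies outside the head span of
    -- `m`; greediness at `m` bounds the old `p_{ℓ+1}` by the new one plus `C₁ N L`.
    obtain ⟨a, ha⟩ := exists_notMem_span
      (g := fun x => realVec ((v ∘ Fin.castLE hℓ.le) x)) (linearIndependent_head hw hi')
      (Nat.lt_succ_self ℓ)
    rw [← headSpan_eq_range] at ha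
    set a' := Fin.castLE hi' a with ha'
    have h1 := hopt.greedy (k := i) (hwb a').1 (hwb a').2 (by rw [hi]; exact ha)
    have h2 := (abs_idot_smul_add_le (m := m) hε (hwb a').2 hc).2
    have h3 : |q a'| ≤ |q i| := hoptj.abs_mono (by
      rw [Fin.le_def]; simp only [ha', Fin.val_castLE]; omega)
    rw [abs_of_nonneg (hoptj.nonneg i)] at h3
    rw [abs_of_nonneg (hopt.nonneg i)] at h1
    rw [hq a'] at h2
    have h4 := hcut.2 i hi
    have h1' : (p i : ℝ) ≤ |(idot (w a') m : ℝ)| := by exact_mod_cast h1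
    have h3' : |(q a' : ℝ)| ≤ (q i : ℝ) := by exact_mod_cast h3
    linarith

lemma idot_eq_of_mem_span {ℓ : ℕ} {V : Fin ℓ → Fin d → ℤ} {m m' : Fin d → ℤ}
    (h : ∀ i, idot (V i) m = idot (V i) m') {u : Fin d → ℤ}
    (hu : realVec u ∈ Submodule.span ℝ (Set.range fun i => realVec (V i))) :
    idot u m = idot u m' := by
  have key : ∀ x ∈ Submodule.span ℝ (Set.range fun i => realVec (V i)),
      ∑ j, x j * (m j : ℝ) = ∑ j, x j * (m' j : ℝ) := by
    intro x hx
    induction hx using Submodule.span_induction with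
    | mem x hx =>
      obtain ⟨i, rfl⟩ := hx
      have := h i
      unfold idot at this
      simp only [realVec]
      exact_mod_cast this
    | zero => simp
    | add x y _ _ hx hy => simp [add_mul, Finset.sum_add_distrib, hx, hy]
    | smul a x _ hx => simp [mul_assoc, ← Finset.mul_sum, hx]
  have := key _ hu
  unfold idot
  simp only [realVec] at this
  exact_mod_cast this

/-- The span of the cut of a point close to `± m` is the span of the cut of `m`. -/
lemma CutData.span_eq {θ μ θ' μ' τ : ℝ} {m c : Fin d → ℤ} {ℓ : ℕ} {hℓ : ℓ < d}
    {V W : Fin ℓ → Fin d → ℤ} {P Q : Fin ℓ → ℤ} (h : CutData C₁ N θ' μ' τ m hℓ V P) (hℓ0 : 0 < ℓ)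
    {ε : ℤ} (hε : |ε| = 1) {L : ℝ} (hc : eucl c ≤ L)
    (hj : CutData C₁ N θ μ τ (ε • m + c) hℓ W Q)
    (hμθ : μ * (N : ℝ) ^ τ + C₁ * N * L ≤ θ' * (N : ℝ) ^ (4 * d * τ)) :
    Submodule.span ℝ (Set.range fun i => realVec (W i)) =
      Submodule.span ℝ (Set.range fun i => realVec (V i)) := by
  obtain ⟨v, p, hopt, hcut, rfl, rfl⟩ := h
  obtain ⟨w, q, hoptj, hcutj, rfl, rfl⟩ := hj
  obtain ⟨hv, hvb, hp⟩ := hopt.presentation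
  obtain ⟨hw, hwb, hq⟩ := hoptj.presentation
  refine Submodule.eq_of_le_of_finrank_le ?_ ?_
  · rw [Submodule.span_le]
    rintro _ ⟨a, rfl⟩
    by_contra ha
    rw [SetLike.mem_coe, ← headSpan_eq_range] at ha
    set a' := Fin.castLE hℓ.le a with ha'
    -- A head vector of the new point outside the head span of `m` would have a product with `m` of
    -- at least `p_{ℓ+1} > θ' N^{4dτ}`, although its product with the new point is below `μ N^τ`.
    -- The gap excludes this.
    have h1 := hopt.greedy (k := ⟨ℓ, hℓ⟩) (hwb a').1 (hwb a').2 ha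
    have h2 := (abs_idot_smul_add_le (m := m) hε (hwb a').2 hc).2
    have h3 : |q a'| ≤ |q ⟨ℓ - 1, by omega⟩| := hoptj.abs_mono (by
      rw [Fin.le_def]; simp only [ha', Fin.val_castLE]; omega)
    rw [abs_of_nonneg (hoptj.nonneg ⟨ℓ - 1, by omega⟩)] at h3
    rw [abs_of_nonneg (hopt.nonneg _)] at h1
    rw [hq a'] at h2
    have h4 := hcut.2 ⟨ℓ, hℓ⟩ rfl
    have h5 := hcutj.1 ⟨ℓ - 1, by omega⟩ (by simp only; omega)
    have h1' : (p ⟨ℓ, hℓ⟩ : ℝ) ≤ |(idot (w a') m : ℝ)| := by exact_mod_cast h1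
    have h3' : |(q a' : ℝ)| ≤ (q ⟨ℓ - 1, by omega⟩ : ℝ) := by exact_mod_cast h3
    linarith
  · rw [finrank_span_eq_card (linearIndependent_head hv hℓ.le),
      finrank_span_eq_card (linearIndependent_head hw hℓ.le)]

lemma CutData.idot_eq {θ μ τ : ℝ} {m : Fin d → ℤ} {ℓ : ℕ} {hℓ : ℓ < d}
    {V : Fin ℓ → Fin d → ℤ} {P : Fin ℓ → ℤ} (h : CutData C₁ N θ μ τ m hℓ V P) (i : Fin ℓ) :
    idot (V i) m = P i := by
  obtain ⟨v, p, hopt, -, rfl, rfl⟩ := h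
  exact hopt.presentation.2.2 _

lemma CutData.linearIndependent {θ μ τ : ℝ} {m : Fin d → ℤ} {ℓ : ℕ} {hℓ : ℓ < d}
    {V : Fin ℓ → Fin d → ℤ} {P : Fin ℓ → ℤ} (h : CutData C₁ N θ μ τ m hℓ V P) :
    LinearIndependent ℝ fun i => realVec (V i) := by
  obtain ⟨v, p, hopt, -, rfl, rfl⟩ := h
  exact linearIndependent_head hopt.presentation.1 hℓ.le

lemma CutData.eucl_lt {θ μ τ : ℝ} {m : Fin d → ℤ} {ℓ : ℕ} {hℓ : ℓ < d}
    {V : Fin ℓ → Fin d → ℤ} {P : Fin ℓ → ℤ} (h : CutData C₁ N θ μ τ m hℓ V P) (i : Fin ℓ) :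
    V i ≠ 0 ∧ eucl (V i) < C₁ * N := by
  obtain ⟨v, p, hopt, -, rfl, rfl⟩ := h
  exact hopt.presentation.2.1 _

lemma CutData.signKey_le {θ μ τ : ℝ} {m : Fin d → ℤ} {ℓ : ℕ} {hℓ : ℓ < d}
    {V W : Fin ℓ → Fin d → ℤ} {P Q : Fin ℓ → ℤ} (h : CutData C₁ N θ μ τ m hℓ V P)
    (hspan : Submodule.span ℝ (Set.range fun i => realVec (V i)) ≤
      Submodule.span ℝ (Set.range fun i => realVec (W i)))
    (hb : ∀ i, W i ≠ 0 ∧ eucl (W i) < C₁ * N) (hQ : ∀ i, idot (W i) m = Q i) :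
    signKey (display V P) ≤ signKey (display W Q) := by
  obtain ⟨v, p, hopt, -, rfl, rfl⟩ := h
  rw [← headSpan_eq_range] at hspan
  have := hopt.signKey_head_le hℓ.le hspan hb
  rwa [show (fun i => idot (W i) m) = Q from funext hQ] at this

lemma CutData.mono {θ μ θ' μ' τ : ℝ} {m : Fin d → ℤ} {ℓ : ℕ} {hℓ : ℓ < d}
    {V : Fin ℓ → Fin d → ℤ} {P : Fin ℓ → ℤ} (h : CutData C₁ N θ μ τ m hℓ V P) (hθ : θ' ≤ θ)
    (hμ : μ ≤ μ') : CutData C₁ N θ' μ' τ m hℓ V P := by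
  obtain ⟨v, p, hopt, hcut, rfl, rfl⟩ := h
  refine ⟨v, p, hopt, ⟨fun i hi => (hcut.1 i hi).trans_le ?_, fun i hi => lt_of_le_of_lt ?_ (hcut.2 i hi)⟩,
    rfl, rfl⟩ <;> gcongr

/-- Translates of points with the same cut have the same cut. -/
lemma CutData.eq_of_translate {θ μ θ₁ μ₁ τ : ℝ} {m m' c : Fin d → ℤ} {ℓ : ℕ}
    {hℓ : ℓ < d} {V W W' : Fin ℓ → Fin d → ℤ} {P Q Q' : Fin ℓ → ℤ} (hℓ0 : 0 < ℓ)
    (h : CutData C₁ N θ μ τ m hℓ V P) (h' : CutData C₁ N θ μ τ m' hℓ V P)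
    {ε : ℤ} (hε : |ε| = 1) {L : ℝ} (hc : eucl c ≤ L)
    (hj : CutData C₁ N θ₁ μ₁ τ (ε • m + c) hℓ W Q)
    (hj' : CutData C₁ N θ₁ μ₁ τ (ε • m' + c) hℓ W' Q')
    (hμθ : μ₁ * (N : ℝ) ^ τ + C₁ * N * L ≤ θ * (N : ℝ) ^ (4 * d * τ)) :
    W = W' ∧ Q = Q' := by
  have hs := h.span_eq hℓ0 hε hc hj hμθ
  have hs' := h'.span_eq hℓ0 hε hc hj' hμθ
  have key : ∀ u : Fin d → ℤ, realVec u ∈ Submodule.span ℝ (Set.range fun i => realVec (V i)) →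
      idot u (ε • m + c) = idot u (ε • m' + c) := by
    intro u hu
    have := idot_eq_of_mem_span (m := m) (m' := m')
      (fun i => (h.idot_eq i).trans (h'.idot_eq i).symm) hu
    rw [idot_add, idot_add, idot_smul, idot_smul, this]
  -- The two heads span the same space, on which the translated points have equal products, and each
  -- head is optimal among the families with this span. So each precedes the other in the order.
  refine display_injective (signKey_injective (le_antisymm ?_ ?_))
  · refine hj.signKey_le (by rw [hs, hs']) hj'.eucl_lt fun i => ?_
    rw [key, hj'.idot_eq]
    rw [← hs']
    exact Submodule.subset_span ⟨i, rfl⟩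
  · refine hj'.signKey_le (by rw [hs, hs']) hj.eucl_lt fun i => ?_
    rw [← key, hj.idot_eq]
    rw [← hs]
    exact Submodule.subset_span ⟨i, rfl⟩

/-- A functional that vanishes on all `V a` but not on some `W i` is a direction along which `x`
stays in one affine space and leaves the other. -/
lemma span_le_of_affineSpace_eq {ℓ ℓ' : ℕ} {V : Fin ℓ → Fin d → ℤ} {P : Fin ℓ → ℤ}
    {W : Fin ℓ' → Fin d → ℤ} {Q : Fin ℓ' → ℤ} (h : affineSpace V P = affineSpace W Q)
    {x : Fin d → ℝ} (hx : x ∈ affineSpace V P) :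
    Submodule.span ℝ (Set.range fun i => realVec (W i)) ≤
      Submodule.span ℝ (Set.range fun i => realVec (V i)) := by
  rw [Submodule.span_le]
  rintro _ ⟨i, rfl⟩
  by_contra hi
  obtain ⟨φ, hφ, hφ0⟩ := Submodule.exists_le_ker_of_notMem hi
  set y : Fin d → ℝ := fun j => φ (Pi.single j 1) with hy
  have hφy : ∀ u : Fin d → ℝ, φ u = ∑ j, u j * y j := by
    intro u
    conv_lhs => rw [← (Pi.basisFun ℝ (Fin d)).sum_repr u]
    simp [hy]
  have h1 : x + y ∈ affineSpace V P := by
    intro a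
    have h2 := hx a
    have h3 : φ (realVec (V a)) = 0 := hφ0 (Submodule.subset_span ⟨a, rfl⟩)
    rw [hφy] at h3
    simp only [realVec] at h3
    simp only [Pi.add_apply, mul_add, Finset.sum_add_distrib, h2, h3, add_zero]
  have h4 := (h ▸ h1) i
  have h5 := (h ▸ hx) i
  simp only [Pi.add_apply, mul_add, Finset.sum_add_distrib, h5] at h4
  apply hφ
  rw [hφy]
  simp only [realVec]
  linarith

/-- The cut is determined by its affine space. -/
lemma CutData.eq_of_affineSpace_eq {θ μ τ : ℝ} {m m' : Fin d → ℤ} {ℓ ℓ' : ℕ} {hℓ : ℓ < d}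
    {hℓ' : ℓ' < d} {V : Fin ℓ → Fin d → ℤ} {P : Fin ℓ → ℤ} {V' : Fin ℓ' → Fin d → ℤ}
    {P' : Fin ℓ' → ℤ} (h : CutData C₁ N θ μ τ m hℓ V P) (h' : CutData C₁ N θ μ τ m' hℓ' V' P')
    (hA : affineSpace V P = affineSpace V' P') : ∃ e : ℓ' = ℓ, V ∘ Fin.cast e = V' ∧
      P ∘ Fin.cast e = P' := by
  have hm : realVec m ∈ affineSpace V P := mem_affineSpace_realVec.2 h.idot_eq
  have hm' : realVec m' ∈ affineSpace V' P' := mem_affineSpace_realVec.2 h'.idot_eq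
  have hs := le_antisymm (span_le_of_affineSpace_eq hA.symm hm') (span_le_of_affineSpace_eq hA hm)
  have he : ℓ' = ℓ := by
    have h1 := finrank_span_eq_card h.linearIndependent
    have h2 := finrank_span_eq_card h'.linearIndependent
    rw [hs] at h1
    simpa using h2.symm.trans h1
  subst he
  refine ⟨rfl, ?_⟩
  refine display_injective (signKey_injective (le_antisymm ?_ ?_))
  · exact h.signKey_le hs.le h'.eucl_lt (mem_affineSpace_realVec.1 (hA ▸ hm))
  · exact h'.signKey_le hs.ge h.eucl_lt (mem_affineSpace_realVec.1 (hA ▸ hm'))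

end CutTransfer

/-! ### Brackets of piecewise Töplitz series -/

section SiteVariables

variable {d b : ℕ} {n : Fin b → Fin d → ℤ}

/-- The direction of the variable `z_m^σ`. -/
def Dir.site (σ : Bool) (m : NormalSite n) : Dir n := if σ then .pos m else .neg m

lemma Mono.mulVar_eq (M : Mono n) (σ : Bool) (m : NormalSite n) :
    M.mulVar σ m = M + (Dir.site σ m).inc := by
  cases σ
  · exact Mono.mulVar_false M m
  · exact Mono.mulVar_true M m

lemma Dir.conj_site (σ : Bool) (m : NormalSite n) : (Dir.site σ m).conj = Dir.site (!σ) m := by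
  cases σ <;> rfl

lemma Dir.site_injective {σ σ' : Bool} {m m' : NormalSite n} (h : Dir.site σ m = Dir.site σ' m') :
    σ = σ' ∧ m = m' := by
  cases σ <;> cases σ' <;> simp [Dir.site] at h ⊢ <;> exact h

lemma Dir.not_isAng_site (σ : Bool) (m : NormalSite n) : ¬ (Dir.site σ m).IsAng := by
  cases σ <;> simp [Dir.site, Dir.IsAng]

lemma sgn_not (σ : Bool) : sgn (!σ) = -sgn σ := by cases σ <;> rfl

lemma sgn_mul_self (σ : Bool) : sgn σ * sgn σ = 1 := by cases σ <;> rfl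

lemma abs_sgn (σ : Bool) : |sgn σ| = 1 := by cases σ <;> rfl

lemma eucl_sgn_smul (σ : Bool) (m : Fin d → ℤ) : eucl (sgn σ • m) = eucl m := by
  rw [eucl_zsmul, ← Int.cast_abs, abs_sgn]
  simp

lemma Dir.momentum_site (σ : Bool) (m : NormalSite n) :
    (Dir.site σ m).inc.momentum = sgn σ • m.1 := by
  cases σ <;> simp [Dir.site, Dir.inc, Mono.momentum, sgn]

lemma Mono.lowSize_add (M N : Mono n) : (M + N).lowSize = M.lowSize + N.lowSize := by
  classical
  unfold Mono.lowSize
  rw [Mono.add_α, Mono.add_β, add_add_add_comm,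
    Finsupp.sum_add_index' (by simp) (by intros; push_cast; ring)]

lemma Mono.lowSize_nonneg (M : Mono n) : 0 ≤ M.lowSize :=
  Finset.sum_nonneg fun _ _ => mul_nonneg (Nat.cast_nonneg _) (eucl_nonneg _)

lemma Dir.lowSize_site (σ : Bool) (m : NormalSite n) :
    (Dir.site σ m).inc.lowSize = eucl m.1 := by
  cases σ <;> simp [Dir.site, Dir.inc, Mono.lowSize]

/-- Every direction is that of a site variable, or has neither momentum nor size. -/
lemma Dir.site_or (a : Dir n) : (∃ σ m, a = Dir.site σ m) ∨
    a.inc.momentum = 0 ∧ a.conj.inc.momentum = 0 ∧ a.inc.lowSize = 0 := by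
  cases a with
  | act j => right; simp [Dir.inc, Dir.conj, Mono.momentum, Mono.lowSize]
  | ang j => right; simp [Dir.inc, Dir.conj, Mono.momentum, Mono.lowSize]
  | pos m => exact Or.inl ⟨true, m, rfl⟩
  | neg m => exact Or.inl ⟨false, m, rfl⟩

lemma eucl_le_siteBound (i : Fin b) : eucl (n i) ≤ siteBound n :=
  le_ciSup (f := fun i => eucl (n i)) (Set.finite_range _).bddAbove i

lemma eucl_sum_le {ι : Type*} (s : Finset ι) (x : ι → Fin d → ℤ) :
    eucl (∑ i ∈ s, x i) ≤ ∑ i ∈ s, eucl (x i) := by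
  classical
  induction s using Finset.induction_on with
  | empty => simp
  | insert a s ha ih =>
    rw [Finset.sum_insert ha, Finset.sum_insert ha]
    exact (eucl_add_le _ _).trans (by gcongr)

lemma eucl_momentum_le (M : Mono n) :
    eucl M.momentum ≤ siteBound n * M.absK + M.lowSize := by
  classical
  have h1 : eucl (∑ i, M.k i • n i) ≤ siteBound n * M.absK := by
    refine (eucl_sum_le _ _).trans ?_
    unfold Mono.absK
    push_cast
    rw [Finset.mul_sum]
    refine Finset.sum_le_sum fun i _ => ?_
    rw [eucl_zsmul, mul_comm, Nat.cast_natAbs, Int.cast_abs]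
    gcongr
    exact eucl_le_siteBound i
  have h2 : ∀ α : NormalSite n →₀ ℕ, eucl (α.sum fun m a => a • m.1) ≤
      α.sum fun j a => (a : ℝ) * eucl j.1 := by
    intro α
    refine (eucl_sum_le _ _).trans (Finset.sum_le_sum fun i _ => le_of_eq ?_)
    have := eucl_zsmul (α i : ℤ) i.1
    simpa using this
  have h3 : M.lowSize = (M.α.sum fun j a => (a : ℝ) * eucl j.1) +
      M.β.sum fun j a => (a : ℝ) * eucl j.1 := by
    unfold Mono.lowSize
    rw [Finsupp.sum_add_index' (by simp) (by intros; push_cast; ring)]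
  unfold Mono.momentum
  rw [sub_eq_add_neg]
  refine (eucl_add_le _ _).trans ?_
  rw [eucl_neg, h3, ← add_assoc]
  refine add_le_add ((eucl_add_le _ _).trans (add_le_add h1 (h2 _))) (h2 _)

lemma Dir.fac_add_inc_of_ne {a u : Dir n} (h : a ≠ u) (M : Mono n) :
    a.fac (M + u.inc) = a.fac M := by
  cases a <;> cases u <;>
    simp_all [Dir.fac, Dir.inc, eq_comm]

lemma Dir.deg_site_mul_le (σ : Bool) (m : NormalSite n) (M : Mono n) :
    (Dir.site σ m).deg M * eucl m.1 ≤ M.lowSize := by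
  have h1 : (Dir.site σ m).deg M ≤ (M.α + M.β) m := by
    cases σ <;> simp [Dir.site, Dir.deg]
  have h2 : ((M.α + M.β) m : ℝ) * eucl m.1 ≤ M.lowSize := by
    unfold Mono.lowSize Finsupp.sum
    by_cases hm : m ∈ (M.α + M.β).support
    · exact Finset.single_le_sum (f := fun j => ((M.α + M.β) j : ℝ) * eucl j.1)
        (fun j _ => mul_nonneg (Nat.cast_nonneg _) (eucl_nonneg _)) hm
    · rw [Finsupp.notMem_support_iff.1 hm]
      simpa using Finset.sum_nonneg fun j _ =>
        mul_nonneg (Nat.cast_nonneg ((M.α + M.β) j)) (eucl_nonneg j.1)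
  refine le_trans ?_ h2
  gcongr
  exact eucl_nonneg _

/-- A single occurrence of `m` would already contribute `eucl m` to the low size. -/
lemma Dir.deg_site_eq_zero {σ : Bool} {m : NormalSite n} {M : Mono n} (h : M.lowSize < eucl m.1) :
    (Dir.site σ m).deg M = 0 := by
  by_contra h0
  have h1 := Dir.deg_site_mul_le σ m M
  have h2 : (1 : ℝ) ≤ (Dir.site σ m).deg M := by exact_mod_cast Nat.one_le_iff_ne_zero.2 h0
  have h3 := eucl_nonneg m.1
  nlinarith

lemma Dir.fac_site_eq_one {σ : Bool} {m : NormalSite n} {M : Mono n} (h : M.lowSize < eucl m.1) :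
    (Dir.site σ m).fac M = 1 := by
  have := Dir.deg_site_eq_zero (σ := σ) h
  cases σ <;> simp_all [Dir.site, Dir.deg, Dir.fac]

end SiteVariables

/-! ### Monomials with equal cuts, and corresponding terms of a bracket. -/

section TwinPairs

variable {d b : ℕ} {n : Fin b → Fin d → ℤ}

/-- Two distant sites with the same cut. -/
def Twin (τ₁ : ℝ) (N : ℕ) (θ μ τ : ℝ) {ℓ : ℕ} (hℓ : ℓ < d) (m w : NormalSite n) : Prop :=
  θ * (N : ℝ) ^ τ₁ < eucl m.1 ∧ θ * (N : ℝ) ^ τ₁ < eucl w.1 ∧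
    ∃ V P, CutData (siteBound n) N θ μ τ m.1 hℓ V P ∧ CutData (siteBound n) N θ μ τ w.1 hℓ V P

/-- Two monomials `M z_m^σ z_{m'}^{σ'}` and `M z_w^σ z_{w'}^{σ'}` in which corresponding sites have
the same cut, with a bound `κ` on `|k|`. -/
structure TwinPair (τ₁ : ℝ) (N : ℕ) (θ μ τ : ℝ) (κ : ℕ) (M : Mono n) (σ : Bool)
    (m w : NormalSite n) (σ' : Bool) (m' w' : NormalSite n) : Prop where
  absK_lt : M.absK < κ
  lowSize_lt : M.lowSize < μ * (N : ℝ) ^ 3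
  left_momentum : sgn σ • m.1 + sgn σ' • m'.1 = -M.momentum
  right_momentum : sgn σ • w.1 + sgn σ' • w'.1 = -M.momentum
  twin : ∃ (ℓ : ℕ) (hℓ : ℓ < d), 0 < ℓ ∧ Twin τ₁ N θ μ τ hℓ m w ∧ Twin τ₁ N θ μ τ hℓ m' w'

/-- At the parameter `ξ`, the series takes equal values on twin monomials. -/
def ToeplitzAt (τ₁ : ℝ) (N : ℕ) (θ μ τ : ℝ) (κ : ℕ) (Φ : Series n) (ξ : Fin b → ℝ) : Prop :=
  ∀ M σ m w σ' m' w', TwinPair τ₁ N θ μ τ κ M σ m w σ' m' w' →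
    Φ (M + (Dir.site σ m).inc + (Dir.site σ' m').inc) ξ =
      Φ (M + (Dir.site σ w).inc + (Dir.site σ' w').inc) ξ

variable {τ₁ : ℝ} {N : ℕ} {θ μ τ : ℝ} {κ : ℕ} {M : Mono n} {σ σ' : Bool}
  {m w m' w' : NormalSite n}

lemma Twin.symm {ℓ : ℕ} {hℓ : ℓ < d} (h : Twin τ₁ N θ μ τ hℓ m w) : Twin τ₁ N θ μ τ hℓ w m := by
  obtain ⟨h1, h2, V, P, h3, h4⟩ := h
  exact ⟨h2, h1, V, P, h4, h3⟩

lemma Twin.mono {ℓ : ℕ} {hℓ : ℓ < d} (h : Twin τ₁ N θ μ τ hℓ m w) {θ' μ' : ℝ} (hθ : θ' ≤ θ)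
    (hμ : μ ≤ μ') : Twin τ₁ N θ' μ' τ hℓ m w := by
  obtain ⟨h1, h2, V, P, h3, h4⟩ := h
  refine ⟨lt_of_le_of_lt ?_ h1, lt_of_le_of_lt ?_ h2, V, P, h3.mono hθ hμ, h4.mono hθ hμ⟩ <;> gcongr

lemma TwinPair.symm (h : TwinPair τ₁ N θ μ τ κ M σ m w σ' m' w') :
    TwinPair τ₁ N θ μ τ κ M σ w m σ' w' m' := by
  obtain ⟨ℓ, hℓ, h0, h1, h2⟩ := h.twin
  exact ⟨h.absK_lt, h.lowSize_lt, h.right_momentum, h.left_momentum, ℓ, hℓ, h0, h1.symm, h2.symm⟩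

lemma TwinPair.swap (h : TwinPair τ₁ N θ μ τ κ M σ m w σ' m' w') :
    TwinPair τ₁ N θ μ τ κ M σ' m' w' σ m w := by
  obtain ⟨ℓ, hℓ, h0, h1, h2⟩ := h.twin
  exact ⟨h.absK_lt, h.lowSize_lt, (add_comm _ _).trans h.left_momentum,
    (add_comm _ _).trans h.right_momentum, ℓ, hℓ, h0, h2, h1⟩

/-- The parameters `(θ₁, μ₁)` are weaker than `(θ, μ)` by a margin which allows displacements of
size `L` and low modes of momentum at most `C₁ κ₂`. -/
structure Relaxed (C₁ τ₁ : ℝ) (N d : ℕ) (τ L θ μ θ₁ μ₁ : ℝ) (κ₁ κ₂ : ℕ) : Prop where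
  le_θ : θ₁ ≤ θ
  le_μ : μ ≤ μ₁
  low : μ * (N : ℝ) ^ 3 + C₁ * κ₂ ≤ μ₁ * (N : ℝ) ^ 3
  disp : C₁ * κ₁ + μ * (N : ℝ) ^ 3 ≤ L
  site : C₁ ≤ L
  size : L ≤ θ₁ * (N : ℝ) ^ τ₁
  high : θ₁ * (N : ℝ) ^ τ₁ + L ≤ θ * (N : ℝ) ^ τ₁
  cut_μ : μ * (N : ℝ) ^ τ + C₁ * N * L ≤ μ₁ * (N : ℝ) ^ τ
  cut_θ : θ₁ * (N : ℝ) ^ (4 * d * τ) + C₁ * N * L ≤ θ * (N : ℝ) ^ (4 * d * τ)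
  sep : μ₁ * (N : ℝ) ^ τ + C₁ * N * L ≤ θ * (N : ℝ) ^ (4 * d * τ)
  one_lt : 1 < C₁ * N

variable {L θ₁ μ₁ θ₂ μ₂ : ℝ} {κ₁ κ₂ : ℕ}

/-- Both sites undergo the same sign and displacement. Each keeps a cut at `ℓ`, and
`CutData.eq_of_translate` shows that the two new cuts coincide again. -/
lemma Twin.transfer (hR : Relaxed (siteBound n) τ₁ N d τ L θ μ θ₁ μ₁ κ₁ κ₂) {ℓ : ℕ} {hℓ : ℓ < d}
    (hℓ0 : 0 < ℓ) (h : Twin τ₁ N θ μ τ hℓ m w) {ε : ℤ} (hε : |ε| = 1) {c : Fin d → ℤ}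
    (hc : eucl c ≤ L) {j j' : NormalSite n} (hj : j.1 = ε • m.1 + c) (hj' : j'.1 = ε • w.1 + c) :
    Twin τ₁ N θ₁ μ₁ τ hℓ j j' := by
  obtain ⟨h1, h2, V, P, h3, h4⟩ := h
  have key : ∀ {m j : NormalSite n}, θ * (N : ℝ) ^ τ₁ < eucl m.1 → j.1 = ε • m.1 + c →
      θ₁ * (N : ℝ) ^ τ₁ < eucl j.1 := by
    intro m j hm hj
    have h5 := eucl_sub_le (ε • m.1) c
    rw [eucl_zsmul, ← Int.cast_abs, hε, Int.cast_one, one_mul, ← hj] at h5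
    linarith [hR.high]
  refine ⟨key h1 hj, key h2 hj', ?_⟩
  obtain ⟨W, Q, hW⟩ := h3.transfer hR.one_lt hε hc hR.cut_μ hR.cut_θ
  obtain ⟨W', Q', hW'⟩ := h4.transfer hR.one_lt hε hc hR.cut_μ hR.cut_θ
  obtain ⟨rfl, rfl⟩ := CutData.eq_of_translate hℓ0 h3 h4 hε hc hW hW' hR.sep
  rw [← hj] at hW
  rw [← hj'] at hW'
  exact ⟨W, Q, hW, hW'⟩

/-- A contracted variable is low, if its other factor contains low variables only. -/
lemma lowSize_inc_le {a : Dir n} {A : Mono n} (h : (A + a.conj.inc).momentum = 0) :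
    a.inc.lowSize ≤ siteBound n * A.absK + A.lowSize := by
  have hnn : 0 ≤ siteBound n * A.absK + A.lowSize := (eucl_nonneg _).trans (eucl_momentum_le A)
  rcases a.site_or with ⟨ε, j, rfl⟩ | ⟨-, -, h0⟩
  · rw [Dir.conj_site, Mono.momentum_add, Dir.momentum_site] at h
    rw [Dir.lowSize_site, ← eucl_sgn_smul (!ε) j.1, ← eucl_neg, ← eq_neg_of_add_eq_zero_left h]
    exact eucl_momentum_le A
  · rw [h0]; exact hnn

lemma siteBound_nonneg (n : Fin b → Fin d → ℤ) : 0 ≤ siteBound n :=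
  Real.iSup_nonneg fun _ => eucl_nonneg _

/-- Both distant variables lie in the factor with low part `A`. Conservation of momentum in the
other factor makes the contracted variable low, so it joins the low part and `Φ` is evaluated at
twin monomials for the relaxed parameters. -/
lemma TwinPair.both_aux (hR : Relaxed (siteBound n) τ₁ N d τ L θ μ θ₁ μ₁ κ₁ κ₂)
    (hL : siteBound n * κ₂ + μ * (N : ℝ) ^ 3 ≤ L) {A B : Mono n}
    (h : TwinPair τ₁ N θ μ τ κ (A + B) σ m w σ' m' w') {Φ : Series n} {ξ : Fin b → ℝ}
    (hΦ : ToeplitzAt τ₁ N θ₁ μ₁ τ κ₁ Φ ξ) {a : Dir n} (hA : A.absK < κ₁) (hB : B.absK < κ₂)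
    (hmom : (B + a.conj.inc).momentum = 0) :
    Φ.deriv a (A + (Dir.site σ m).inc + (Dir.site σ' m').inc) ξ =
      Φ.deriv a (A + (Dir.site σ w).inc + (Dir.site σ' w').inc) ξ := by
  have hC := siteBound_nonneg n
  have hBκ : (B.absK : ℝ) ≤ κ₂ := by exact_mod_cast hB.le
  have hlow := h.lowSize_lt
  rw [Mono.lowSize_add] at hlow
  have hA0 := A.lowSize_nonneg
  have hB0 := B.lowSize_nonneg
  have ha : a.inc.lowSize ≤ siteBound n * κ₂ + B.lowSize :=
    (lowSize_inc_le hmom).trans (by gcongr)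
  obtain ⟨ℓ, hℓ, hℓ0, h1, h2⟩ := h.twin
  -- The contracted variable is shorter than every distant one, hence different from it, and the
  -- factor of the derivative depends on `A` alone.
  have hne : ∀ {m : NormalSite n} {σ : Bool}, θ * (N : ℝ) ^ τ₁ < eucl m.1 → a ≠ Dir.site σ m := by
    rintro m σ hm rfl
    rw [Dir.lowSize_site] at ha
    have : 0 ≤ siteBound n * κ₂ := by positivity
    linarith [hR.high, hR.size]
  have hmomB : B.momentum = a.inc.momentum := by
    rw [Mono.momentum_add] at hmom
    rw [eq_neg_of_add_eq_zero_left hmom, ← eq_neg_of_add_eq_zero_left a.momentum_inc_add_conj]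
  unfold Series.deriv
  rw [Dir.fac_add_inc_of_ne (hne h2.1), Dir.fac_add_inc_of_ne (hne h1.1),
    Dir.fac_add_inc_of_ne (hne h2.2.1), Dir.fac_add_inc_of_ne (hne h1.2.1)]
  congr 1
  have hpair : TwinPair τ₁ N θ₁ μ₁ τ κ₁ (A + a.inc) σ m w σ' m' w' := by
    have hp : (A + a.inc).momentum = (A + B).momentum := by
      rw [Mono.momentum_add, Mono.momentum_add, hmomB]
    refine ⟨by rwa [Mono.absK_add_inc], ?_, by rw [hp, h.left_momentum],
      by rw [hp, h.right_momentum], ℓ, hℓ, hℓ0, h1.mono hR.le_θ hR.le_μ, h2.mono hR.le_θ hR.le_μ⟩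
    rw [Mono.lowSize_add]
    linarith [hR.low]
  have := hΦ _ _ _ _ _ _ _ hpair
  rwa [show A + (Dir.site σ m).inc + (Dir.site σ' m').inc + a.inc =
      A + a.inc + (Dir.site σ m).inc + (Dir.site σ' m').inc by abel,
    show A + (Dir.site σ w).inc + (Dir.site σ' w').inc + a.inc =
      A + a.inc + (Dir.site σ w).inc + (Dir.site σ' w').inc by abel]

/-- Corresponding contracted directions in the mixed terms of a bracket. -/
def MixedRel (A : Mono n) (σ : Bool) (m w : NormalSite n) (a a' : Dir n) : Prop :=
  ∃ ε j j', a = Dir.site ε j ∧ a' = Dir.site ε j' ∧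
    (A + (Dir.site σ m).inc + a.inc).momentum = 0 ∧ (A + (Dir.site σ w).inc + a'.inc).momentum = 0

lemma MixedRel.symm {A : Mono n} {a a' : Dir n} (h : MixedRel A σ m w a a') :
    MixedRel A σ w m a' a := by
  obtain ⟨ε, j, j', h1, h2, h3, h4⟩ := h
  exact ⟨ε, j', j, h2, h1, h4, h3⟩

/-- The contracted site is determined by its sign and by conservation of momentum. -/
lemma MixedRel.unique {A : Mono n} {a a' a'' : Dir n} (h : MixedRel A σ m w a a')
    (h' : MixedRel A σ m w a a'') : a' = a'' := by
  obtain ⟨ε, j, j', rfl, rfl, -, h2⟩ := h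
  obtain ⟨ε', i, i', h3, rfl, -, h4⟩ := h'
  obtain ⟨rfl, rfl⟩ := Dir.site_injective h3
  rw [Mono.momentum_add, Dir.momentum_site] at h2 h4
  have h5 := (eq_neg_of_add_eq_zero_right h2).trans (eq_neg_of_add_eq_zero_right h4).symm
  have h6 := congrArg (fun x => sgn ε • x) h5
  simp only [smul_smul, sgn_mul_self, one_smul] at h6
  rw [Subtype.ext h6]

/-- One distant variable lies in each factor. Conservation of momentum gives the contracted site as
`j = e • m + c` with `e = ±1` and `c` of length at most `L`. The same map applied to `w` defines
`j'`; by `Twin.transfer`, `j` and `j'` are twins, so each factor takes equal values on the two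
sides. -/
lemma TwinPair.mixed_aux (hR₁ : Relaxed (siteBound n) τ₁ N d τ L θ μ θ₁ μ₁ κ₁ κ₂)
    (hR₂ : Relaxed (siteBound n) τ₁ N d τ L θ μ θ₂ μ₂ κ₂ κ₁) {A B : Mono n}
    (h : TwinPair τ₁ N θ μ τ κ (A + B) σ m w σ' m' w') {Φ Γ : Series n} {ξ : Fin b → ℝ}
    (hΦ : ToeplitzAt τ₁ N θ₁ μ₁ τ κ₁ Φ ξ) (hΓ : ToeplitzAt τ₁ N θ₂ μ₂ τ κ₂ Γ ξ) {a : Dir n}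
    (hA : A.absK < κ₁) (hB : B.absK < κ₂)
    (hmom : (A + (Dir.site σ m).inc + a.inc).momentum = 0) :
    ∃ a', MixedRel A σ m w a a' ∧
      Φ.deriv a (A + (Dir.site σ m).inc) ξ = Φ.deriv a' (A + (Dir.site σ w).inc) ξ ∧
      Γ.deriv a.conj (B + (Dir.site σ' m').inc) ξ =
        Γ.deriv a'.conj (B + (Dir.site σ' w').inc) ξ := by
  have hC := siteBound_nonneg n
  have hAκ : (A.absK : ℝ) ≤ κ₁ := by exact_mod_cast hA.le
  have hBκ : (B.absK : ℝ) ≤ κ₂ := by exact_mod_cast hB.le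
  have hlow := h.lowSize_lt
  rw [Mono.lowSize_add] at hlow
  have hA0 := A.lowSize_nonneg
  have hB0 := B.lowSize_nonneg
  obtain ⟨ℓ, hℓ, hℓ0, h1, h2⟩ := h.twin
  have hA1 : eucl A.momentum ≤ L := by
    have := eucl_momentum_le A
    have : siteBound n * A.absK ≤ siteBound n * κ₁ := by gcongr
    linarith [hR₁.disp]
  have hB1 : eucl B.momentum ≤ L := by
    have := eucl_momentum_le B
    have : siteBound n * B.absK ≤ siteBound n * κ₂ := by gcongr
    linarith [hR₂.disp]
  have hL0 : 0 ≤ L := (eucl_nonneg _).trans hA1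
  rw [Mono.momentum_add, Mono.momentum_add, Dir.momentum_site] at hmom
  obtain ⟨ε, j, rfl⟩ : ∃ ε j, a = Dir.site ε j := by
    rcases a.site_or with h0 | ⟨h0, -, -⟩
    · exact h0
    -- Contracting an action or an angle would leave the distant `m` alone to balance the small
    -- momentum of `A`.
    · exfalso
      rw [h0, add_zero] at hmom
      have := eucl_sgn_smul σ m.1
      rw [eq_neg_of_add_eq_zero_right hmom, eucl_neg] at this
      linarith [h1.1, hR₁.high, hR₁.size]
  rw [Dir.momentum_site] at hmom
  set e : ℤ := -(sgn ε * sgn σ) with he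
  have heabs : |e| = 1 := by rw [he, abs_neg, abs_mul, abs_sgn, abs_sgn, one_mul]
  set c : Fin d → ℤ := -(sgn ε • A.momentum) with hc
  have hcL : eucl c ≤ L := by rwa [hc, eucl_neg, eucl_sgn_smul]
  have hsolve : ∀ x y : Fin d → ℤ, A.momentum + sgn σ • x + sgn ε • y = 0 ↔ y = e • x + c := by
    intro x y
    rw [he, hc]
    have hs := sgn_mul_self ε
    constructor
    · intro h0
      have h6 := congrArg (fun x => sgn ε • x) h0
      simp only [smul_add, smul_smul, hs, one_smul, smul_zero] at h6
      rw [eq_neg_of_add_eq_zero_right h6, neg_smul]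
      abel
    · rintro rfl
      rw [smul_add, smul_smul, smul_neg, smul_smul, hs, one_smul, mul_neg, ← mul_assoc, hs,
        one_mul, neg_smul]
      abel
  have hj := (hsolve _ _).1 hmom
  have hw_high : θ₁ * (N : ℝ) ^ τ₁ < eucl (e • w.1 + c) := by
    have h5 := eucl_sub_le (e • w.1) c
    rw [eucl_zsmul, ← Int.cast_abs, heabs, Int.cast_one, one_mul] at h5
    linarith [hR₁.high, h1.2.1]
  -- The new site is too long to be tangential.
  have hnormal : e • w.1 + c ∉ Set.range n := by
    rintro ⟨i, hi⟩
    have := eucl_le_siteBound (n := n) i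
    rw [hi] at this
    linarith [hR₁.size, hR₁.site]
  set j' : NormalSite n := ⟨e • w.1 + c, hnormal⟩ with hj'
  have hmom' : A.momentum + sgn σ • w.1 + sgn ε • j'.1 = 0 := (hsolve _ _).2 rfl
  have t1 := Twin.transfer hR₁ hℓ0 h1 heabs hcL hj (j' := j') rfl
  have t2 := Twin.transfer hR₂ hℓ0 h1 heabs hcL hj (j' := j') rfl
  have hpA : TwinPair τ₁ N θ₁ μ₁ τ κ₁ A σ m w ε j j' := by
    refine ⟨hA, ?_, ?_, ?_, ℓ, hℓ, hℓ0, h1.mono hR₁.le_θ hR₁.le_μ, t1⟩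
    · have : μ * (N : ℝ) ^ 3 ≤ μ₁ * (N : ℝ) ^ 3 := by gcongr; exact hR₁.le_μ
      linarith
    · rw [add_assoc] at hmom
      exact eq_neg_of_add_eq_zero_right hmom
    · rw [add_assoc] at hmom'
      exact eq_neg_of_add_eq_zero_right hmom'
  have hflip : ∀ {m m' j : NormalSite n}, sgn σ • m.1 + sgn σ' • m'.1 = -(A + B).momentum →
      sgn σ • m.1 + sgn ε • j.1 = -A.momentum →
      sgn σ' • m'.1 + sgn (!ε) • j.1 = -B.momentum := by
    intro m m' j h5 h6
    rw [Mono.momentum_add] at h5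
    rw [sgn_not, neg_smul, ← sub_eq_add_neg]
    have h7 : sgn σ' • m'.1 - sgn ε • j.1 =
        (sgn σ • m.1 + sgn σ' • m'.1) - (sgn σ • m.1 + sgn ε • j.1) := by abel
    rw [h7, h5, h6]
    abel
  have hpB : TwinPair τ₁ N θ₂ μ₂ τ κ₂ B σ' m' w' (!ε) j j' := by
    refine ⟨hB, ?_, hflip h.left_momentum hpA.left_momentum,
      hflip h.right_momentum hpA.right_momentum, ℓ, hℓ, hℓ0, h2.mono hR₂.le_θ hR₂.le_μ, t2⟩
    have : μ * (N : ℝ) ^ 3 ≤ μ₂ * (N : ℝ) ^ 3 := by gcongr; exact hR₂.le_μ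
    linarith
  -- The contracted site is absent from the low part. It also differs from the other distant
  -- variable, since two equal variables would have momentum of length `2 * eucl j.1`. So
  -- differentiation produces the factor one.
  have hfac : ∀ {B : Mono n} {σ ε : Bool} {m j : NormalSite n}, eucl B.momentum ≤ L →
      B.lowSize ≤ L → L < eucl m.1 → L < eucl j.1 →
      sgn σ • m.1 + sgn ε • j.1 = -B.momentum →
      (Dir.site ε j).fac (B + (Dir.site σ m).inc) = 1 := by
    intro B σ ε m j hB hB' hm hj hs
    rw [Dir.fac_add_inc_of_ne, Dir.fac_site_eq_one (hB'.trans_lt hj)]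
    intro heq
    obtain ⟨rfl, rfl⟩ := Dir.site_injective heq
    have h8 : sgn ε • j.1 + sgn ε • j.1 = (2 : ℤ) • (sgn ε • j.1) := by rw [two_smul]
    have h9 : eucl (-B.momentum) = 2 * eucl j.1 := by
      rw [← hs, h8, eucl_zsmul, eucl_sgn_smul]
      norm_num
    rw [eucl_neg] at h9
    linarith [eucl_nonneg B.momentum]
  have hAl : A.lowSize ≤ L := by
    have : 0 ≤ siteBound n * κ₁ := by positivity
    linarith [hR₁.disp]
  have hBl : B.lowSize ≤ L := by
    have : 0 ≤ siteBound n * κ₁ := by positivity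
    linarith [hR₁.disp]
  have hhi : ∀ {x : ℝ}, θ * (N : ℝ) ^ τ₁ < x → L < x := fun hx => by
    linarith [hR₁.high, hR₁.size]
  have hhi1 : ∀ {x : ℝ}, θ₁ * (N : ℝ) ^ τ₁ < x → L < x := fun hx => by
    linarith [hR₁.size]
  refine ⟨Dir.site ε j', ⟨ε, j, j', rfl, rfl, ?_, ?_⟩, ?_, ?_⟩
  · simpa only [Mono.momentum_add, Dir.momentum_site] using hmom
  · simpa only [Mono.momentum_add, Dir.momentum_site] using hmom'
  · unfold Series.deriv
    rw [hfac hA1 hAl (hhi h1.1) (hhi1 t1.1) hpA.left_momentum,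
      hfac hA1 hAl (hhi h1.2.1) (hhi1 t1.2.1) hpA.right_momentum, hΦ _ _ _ _ _ _ _ hpA]
  · unfold Series.deriv
    rw [Dir.conj_site, Dir.conj_site, hfac hB1 hBl (hhi h2.1) (hhi1 t1.1) hpB.left_momentum,
      hfac hB1 hBl (hhi h2.2.1) (hhi1 t1.2.1) hpB.right_momentum, hΓ _ _ _ _ _ _ _ hpB]

end TwinPairs

/-! ### Matching the terms of the brackets at two twin monomials. -/

section ToeplitzBracket

variable {d b : ℕ} {n : Fin b → Fin d → ℤ}

/-- A relation replaces a bijection because only nonzero terms have a partner. -/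
lemma tsum_eq_tsum_of_rel {X Y : Type*} {f : X → ℂ} {g : Y → ℂ} (R : X → Y → Prop)
    (hf : ∀ x, f x ≠ 0 → ∃ y, R x y ∧ f x = g y) (hg : ∀ y, g y ≠ 0 → ∃ x, R x y ∧ g y = f x)
    (hR : ∀ x y y', R x y → R x y' → y = y') (hR' : ∀ x x' y, R x y → R x' y → x = x') :
    ∑' x, f x = ∑' y, g y := by
  choose i hi hfi using fun y : Function.support g => hg y.1 y.2
  refine tsum_eq_tsum_of_ne_zero_bij i (fun y y' h => ?_) (fun x hx => ?_) fun y => (hfi y).symm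
  · exact Subtype.ext (hR _ _ _ (hi y) (h ▸ hi y'))
  · obtain ⟨y, hy, hxy⟩ := hf x hx
    refine ⟨⟨y, ?_⟩, ?_⟩
    · rw [Function.mem_support, ← hxy]; exact hx
    · exact hR' _ _ y (hi ⟨y, _⟩) hy

/-- The monomial `u` or the empty monomial. -/
def Mono.part (e : Bool) (u : Mono n) : Mono n := if e then u else 0

@[simp] lemma Mono.part_true (u : Mono n) : Mono.part true u = u := rfl
@[simp] lemma Mono.part_false (u : Mono n) : Mono.part false u = 0 := rfl

lemma Dir.deg_add (u : Dir n) (h : ¬ u.IsAng) (A B : Mono n) :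
    u.deg (A + B) = u.deg A + u.deg B := by
  cases u <;> simp_all [Dir.deg, Dir.IsAng]

lemma Dir.deg_part_inc (u : Dir n) (h : ¬ u.IsAng) (e : Bool) :
    u.deg (Mono.part e u.inc) = if e then 1 else 0 := by
  classical
  have h0 : u.deg (0 : Mono n) = 0 := by cases u <;> simp [Dir.deg]
  cases e
  · simpa using h0
  · have := Dir.deg_add_inc u u 0
    simpa [h0, h] using this

lemma Dir.deg_part_inc_of_ne {u u' : Dir n} (h : u ≠ u') (e : Bool) :
    u.deg (Mono.part e u'.inc) = 0 := by
  classical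
  have h0 : u.deg (0 : Mono n) = 0 := by cases u <;> simp [Dir.deg]
  cases e
  · simpa using h0
  · have := Dir.deg_add_inc u u' 0
    simpa [h0, h] using this

/-- The Boolean `e` records that a factor `u` is taken out of the first term of the sum. -/
lemma exists_split {u : Dir n} (hu : ¬ u.IsAng) {A B M : Mono n} (h : A + B = M + u.inc) :
    ∃ e A' B', A = A' + Mono.part e u.inc ∧ B = B' + Mono.part (!e) u.inc ∧ A' + B' = M := by
  classical
  have h1 : u.deg A + u.deg B ≠ 0 := by
    rw [← Dir.deg_add u hu, h, Dir.deg_add u hu]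
    have := Dir.deg_part_inc u hu true
    simp at this
    omega
  by_cases hA : u.deg A = 0
  · have hB : u.deg B ≠ 0 := by omega
    refine ⟨false, A, u.lower B, by simp, by simp [Dir.lower_add_of_deg_ne_zero hB], ?_⟩
    apply add_right_cancel (b := u.inc)
    rw [add_assoc, Dir.lower_add_of_deg_ne_zero hB, h]
  · refine ⟨true, u.lower A, B, by simp [Dir.lower_add_of_deg_ne_zero hA], by simp, ?_⟩
    apply add_right_cancel (b := u.inc)
    rw [add_right_comm, Dir.lower_add_of_deg_ne_zero hA, h]

/-- Corresponding terms in the brackets at two monomials `M u u'` and `M v v'`, where `u, v` and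
`u', v'` are site variables of the same sign. -/
def TermRel (M : Mono n) (σ : Bool) (m w : NormalSite n) (σ' : Bool) (m' w' : NormalSite n)
    (x y : Dir n × Mono n × Mono n) : Prop :=
  ∃ A B e e', A + B = M ∧
    x.2.1 = A + Mono.part e (Dir.site σ m).inc + Mono.part e' (Dir.site σ' m').inc ∧
    x.2.2 = B + Mono.part (!e) (Dir.site σ m).inc + Mono.part (!e') (Dir.site σ' m').inc ∧
    y.2.1 = A + Mono.part e (Dir.site σ w).inc + Mono.part e' (Dir.site σ' w').inc ∧
    y.2.2 = B + Mono.part (!e) (Dir.site σ w).inc + Mono.part (!e') (Dir.site σ' w').inc ∧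
    (e = e' → x.1 = y.1) ∧ (e = true → e' = false → MixedRel A σ m w x.1 y.1) ∧
    (e = false → e' = true → MixedRel A σ' m' w' x.1 y.1)

variable {M : Mono n} {σ σ' : Bool} {m w m' w' : NormalSite n}

lemma TermRel.symm {x y : Dir n × Mono n × Mono n} (h : TermRel M σ m w σ' m' w' x y) :
    TermRel M σ w m σ' w' m' y x := by
  obtain ⟨A, B, e, e', h0, h1, h2, h3, h4, h5, h6, h7⟩ := h
  exact ⟨A, B, e, e', h0, h3, h4, h1, h2, fun h => (h5 h).symm, fun h h' => (h6 h h').symm,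
    fun h h' => (h7 h h').symm⟩

/-- The two distant variables are different and absent from `M`, so their degrees in the first
factor determine `e` and `e'`. Cancellation then determines the low parts, and `MixedRel.unique` the
contracted direction in the mixed cases. -/
lemma TermRel.unique (hne : Dir.site σ m ≠ Dir.site σ' m') (hm : (Dir.site σ m).deg M = 0)
    (hm' : (Dir.site σ' m').deg M = 0) {x y y' : Dir n × Mono n × Mono n}
    (h : TermRel M σ m w σ' m' w' x y) (h' : TermRel M σ m w σ' m' w' x y') : y = y' := by
  obtain ⟨A, B, e, e', h0, h1, h2, h3, h4, h5, h6, h7⟩ := h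
  obtain ⟨A', B', i, i', g0, g1, g2, g3, g4, g5, g6, g7⟩ := h'
  set u := Dir.site σ m
  set u' := Dir.site σ' m'
  have hu : ¬ u.IsAng := Dir.not_isAng_site _ _
  have hu' : ¬ u'.IsAng := Dir.not_isAng_site _ _
  have z1 : u.deg A = 0 := by rw [← h0, Dir.deg_add u hu] at hm; omega
  have z2 : u.deg A' = 0 := by rw [← g0, Dir.deg_add u hu] at hm; omega
  have z3 : u'.deg A = 0 := by rw [← h0, Dir.deg_add u' hu'] at hm'; omega
  have z4 : u'.deg A' = 0 := by rw [← g0, Dir.deg_add u' hu'] at hm'; omega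
  have hA := h1.symm.trans g1
  have d1 := congrArg u.deg hA
  have d2 := congrArg u'.deg hA
  simp only [Dir.deg_add u hu, Dir.deg_add u' hu', Dir.deg_part_inc u hu, Dir.deg_part_inc u' hu',
    Dir.deg_part_inc_of_ne hne, Dir.deg_part_inc_of_ne hne.symm, z1, z2, z3, z4] at d1 d2
  have hi : e = i := by cases e <;> cases i <;> simp_all
  have hi' : e' = i' := by cases e' <;> cases i' <;> simp_all
  subst hi hi'
  have hAA : A = A' := add_right_cancel (add_right_cancel hA)
  have hBB : B = B' := add_right_cancel (add_right_cancel (h2.symm.trans g2))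
  subst hAA hBB
  obtain ⟨y1, y2, y3⟩ := y
  obtain ⟨y1', y2', y3'⟩ := y'
  simp only at h3 h4 g3 g4 h5 h6 h7 g5 g6 g7
  have hfst : y1 = y1' := by
    cases e <;> cases e'
    · exact (h5 rfl).symm.trans (g5 rfl)
    · exact (h7 rfl rfl).unique (g7 rfl rfl)
    · exact (h6 rfl rfl).unique (g6 rfl rfl)
    · exact (h5 rfl).symm.trans (g5 rfl)
  rw [hfst, h3, g3, h4, g4]

lemma MixedRel.symp_eq {A : Mono n} {a a' : Dir n} (h : MixedRel A σ m w a a') :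
    a.symp = a'.symp := by
  obtain ⟨ε, j, j', rfl, rfl, -, -⟩ := h
  cases ε <;> rfl

variable {τ₁ : ℝ} {N : ℕ} {θ μ τ : ℝ} {κ : ℕ} {L θ₁ μ₁ θ₂ μ₂ : ℝ} {κ₁ κ₂ : ℕ}

lemma exists_termRel (hR₁ : Relaxed (siteBound n) τ₁ N d τ L θ μ θ₁ μ₁ κ₁ κ₂)
    (hR₂ : Relaxed (siteBound n) τ₁ N d τ L θ μ θ₂ μ₂ κ₂ κ₁) {Φ Γ : Series n} {ξ : Fin b → ℝ}
    (hΦ : ToeplitzAt τ₁ N θ₁ μ₁ τ κ₁ Φ ξ) (hΓ : ToeplitzAt τ₁ N θ₂ μ₂ τ κ₂ Γ ξ)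
    (hΦm : ∀ P : Mono n, P.momentum ≠ 0 → Φ P ξ = 0)
    (hΓm : ∀ P : Mono n, P.momentum ≠ 0 → Γ P ξ = 0)
    (hΦk : ∀ P : Mono n, κ₁ ≤ P.absK → Φ P ξ = 0) (hΓk : ∀ P : Mono n, κ₂ ≤ P.absK → Γ P ξ = 0)
    (h : TwinPair τ₁ N θ μ τ κ M σ m w σ' m' w')
    (x : Fiber (M + (Dir.site σ m).inc + (Dir.site σ' m').inc)) (hx : brTerm Φ Γ x.1 ξ ≠ 0) :
    ∃ y : Fiber (M + (Dir.site σ w).inc + (Dir.site σ' w').inc),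
      TermRel M σ m w σ' m' w' x.1 y.1 ∧ brTerm Φ Γ x.1 ξ = brTerm Φ Γ y.1 ξ := by
  obtain ⟨⟨a, X, Y⟩, hXY⟩ := x
  simp only at hXY hx ⊢
  obtain ⟨e', X', Y', rfl, rfl, hXY'⟩ := exists_split (Dir.not_isAng_site σ' m') hXY
  obtain ⟨e, A, B, rfl, rfl, rfl⟩ := exists_split (Dir.not_isAng_site σ m) hXY'
  have hx1 : Φ (A + Mono.part e (Dir.site σ m).inc + Mono.part e' (Dir.site σ' m').inc + a.inc) ξ
      ≠ 0 := by
    intro h0; apply hx; simp [brTerm, Series.deriv, h0]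
  have hx2 : Γ (B + Mono.part (!e) (Dir.site σ m).inc + Mono.part (!e') (Dir.site σ' m').inc +
      a.conj.inc) ξ ≠ 0 := by
    intro h0; apply hx; simp [brTerm, Series.deriv, h0]
  have m1 := not_imp_comm.1 (hΦm _) hx1
  have m2 := not_imp_comm.1 (hΓm _) hx2
  have habs : ∀ (A : Mono n) (e e' : Bool) (u u' : Dir n),
      (A + Mono.part e u.inc + Mono.part e' u'.inc).absK = A.absK := by
    intro A e e' u u'
    cases e <;> cases e' <;> simp [Mono.absK_add_inc]
  have k1 : A.absK < κ₁ := by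
    have := not_le.1 (not_imp_not.2 (hΦk _) hx1)
    rwa [Mono.absK_add_inc, habs] at this
  have k2 : B.absK < κ₂ := by
    have := not_le.1 (not_imp_not.2 (hΓk _) hx2)
    rwa [Mono.absK_add_inc, habs] at this
  suffices hs : ∃ a', (e = e' → a = a') ∧ (e = true → e' = false → MixedRel A σ m w a a') ∧
      (e = false → e' = true → MixedRel A σ' m' w' a a') ∧ a.symp = a'.symp ∧
      Φ.deriv a (A + Mono.part e (Dir.site σ m).inc + Mono.part e' (Dir.site σ' m').inc) ξ =
        Φ.deriv a' (A + Mono.part e (Dir.site σ w).inc + Mono.part e' (Dir.site σ' w').inc) ξ ∧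
      Γ.deriv a.conj (B + Mono.part (!e) (Dir.site σ m).inc +
          Mono.part (!e') (Dir.site σ' m').inc) ξ =
        Γ.deriv a'.conj (B + Mono.part (!e) (Dir.site σ w).inc +
          Mono.part (!e') (Dir.site σ' w').inc) ξ by
    obtain ⟨a', s1, s2, s3, s4, s5, s6⟩ := hs
    refine ⟨⟨(a', A + Mono.part e (Dir.site σ w).inc + Mono.part e' (Dir.site σ' w').inc,
      B + Mono.part (!e) (Dir.site σ w).inc + Mono.part (!e') (Dir.site σ' w').inc), ?_⟩,
      ⟨A, B, e, e', rfl, rfl, rfl, rfl, rfl, s1, s2, s3⟩, ?_⟩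
    · cases e <;> cases e' <;> simp <;> abel
    · simp only [brTerm, s4, s5, s6]
  -- Equal Booleans put both distant variables into one factor, and the contracted direction stays
  -- the same; different ones give the mixed terms, where it moves along with the distant site.
  cases e <;> cases e' <;> simp only [Bool.not_true, Bool.not_false, Mono.part_true,
    Mono.part_false, add_zero] at m1 m2 ⊢
  · refine ⟨a, fun _ => rfl, by simp, by simp, rfl, rfl, ?_⟩
    have h' : TwinPair τ₁ N θ μ τ κ (B + A) σ m w σ' m' w' := by rwa [add_comm B A]
    exact h'.both_aux hR₂ hR₁.disp hΓ k2 k1 (by rwa [Dir.conj_conj])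
  · obtain ⟨a', r, r1, r2⟩ := h.swap.mixed_aux hR₁ hR₂ hΦ hΓ k1 k2 m1
    exact ⟨a', by simp, by simp, fun _ _ => r, r.symp_eq, r1, r2⟩
  · obtain ⟨a', r, r1, r2⟩ := h.mixed_aux hR₁ hR₂ hΦ hΓ k1 k2 m1
    exact ⟨a', by simp, fun _ _ => r, by simp, r.symp_eq, r1, r2⟩
  · exact ⟨a, fun _ => rfl, by simp, by simp, rfl, h.both_aux hR₁ hR₂.disp hΦ k1 k2 m2, rfl⟩

/-- The bracket of two series with the Töplitz property has the Töplitz property, for stronger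
parameters. -/
theorem ToeplitzAt.bracket (hR₁ : Relaxed (siteBound n) τ₁ N d τ L θ μ θ₁ μ₁ κ₁ κ₂)
    (hR₂ : Relaxed (siteBound n) τ₁ N d τ L θ μ θ₂ μ₂ κ₂ κ₁)
    (hκ : siteBound n * κ + μ * (N : ℝ) ^ 3 ≤ L) {Φ Γ : Series n} {ξ : Fin b → ℝ}
    (hΦ : ToeplitzAt τ₁ N θ₁ μ₁ τ κ₁ Φ ξ) (hΓ : ToeplitzAt τ₁ N θ₂ μ₂ τ κ₂ Γ ξ)
    (hΦm : ∀ P : Mono n, P.momentum ≠ 0 → Φ P ξ = 0)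
    (hΓm : ∀ P : Mono n, P.momentum ≠ 0 → Γ P ξ = 0)
    (hΦk : ∀ P : Mono n, κ₁ ≤ P.absK → Φ P ξ = 0)
    (hΓk : ∀ P : Mono n, κ₂ ≤ P.absK → Γ P ξ = 0) :
    ToeplitzAt τ₁ N θ μ τ κ (bracket Φ Γ) ξ := by
  intro M σ m w σ' m' w' h
  have hC := siteBound_nonneg n
  -- The low part is too small to contain a distant variable, and its momentum is too small for the
  -- two distant variables to be equal.
  have hdisj : ∀ {m w m' w' : NormalSite n}, TwinPair τ₁ N θ μ τ κ M σ m w σ' m' w' →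
      Dir.site σ m ≠ Dir.site σ' m' ∧ (Dir.site σ m).deg M = 0 ∧ (Dir.site σ' m').deg M = 0 := by
    intro m w m' w' h
    obtain ⟨ℓ, hℓ, -, h1, h2⟩ := h.twin
    have hMκ : (M.absK : ℝ) ≤ κ := by exact_mod_cast h.absK_lt.le
    have hM0 := M.lowSize_nonneg
    have hmom := eucl_momentum_le M
    have hk0 : siteBound n * M.absK ≤ siteBound n * κ := by gcongr
    have hk1 : 0 ≤ siteBound n * κ := by positivity
    have hlow := h.lowSize_lt
    have hmL : ∀ {x : ℝ}, θ * (N : ℝ) ^ τ₁ < x → L < x := fun hx => by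
      linarith [hR₁.high, hR₁.size]
    refine ⟨fun heq => ?_, Dir.deg_site_eq_zero ?_, Dir.deg_site_eq_zero ?_⟩
    · obtain ⟨rfl, rfl⟩ := Dir.site_injective heq
      have h8 : sgn σ • m.1 + sgn σ • m.1 = (2 : ℤ) • (sgn σ • m.1) := by rw [two_smul]
      have h9 : eucl (-M.momentum) = 2 * eucl m.1 := by
        rw [← h.left_momentum, h8, eucl_zsmul, eucl_sgn_smul]
        norm_num
      rw [eucl_neg] at h9
      have := hmL h1.1
      linarith
    · have := hmL h1.1
      linarith
    · have := hmL h2.1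
      linarith
  obtain ⟨u1, u2, u3⟩ := hdisj h
  obtain ⟨v1, v2, v3⟩ := hdisj h.symm
  unfold QuasiToeplitz.bracket
  refine tsum_eq_tsum_of_rel (fun x y => TermRel M σ m w σ' m' w' x.1 y.1)
    (exists_termRel hR₁ hR₂ hΦ hΓ hΦm hΓm hΦk hΓk h) (fun y hy => ?_)
    (fun x y y' r r' => Subtype.ext (r.unique u1 u2 u3 r'))
    (fun x x' y r r' => Subtype.ext (r.symm.unique v1 v2 v3 r'.symm))
  obtain ⟨x, r, hx⟩ := exists_termRel hR₁ hR₂ hΦ hΓ hΦm hΓm hΦk hΓk h.symm y hy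
  exact ⟨x, r.symm, hx⟩

end ToeplitzBracket

/-! ### Piecewise Töplitz functions in terms of twin monomials. -/

section PiecewiseToeplitz

variable {d b : ℕ} {n : Fin b → Fin d → ℤ} {τ₁ : ℝ} {N : ℕ} {θ μ τ : ℝ} {M : Mono n}
  {σ σ' : Bool} {m m' : NormalSite n} {A : Set (Fin d → ℝ)}

lemma isBilinearWithCut_iff : IsBilinearWithCut τ₁ N θ μ τ M σ m σ' m' A ↔
    sgn σ • m.1 + sgn σ' • m'.1 = -M.momentum ∧ M.absK < N ∧ θ * (N : ℝ) ^ τ₁ < eucl m.1 ∧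
      θ * (N : ℝ) ^ τ₁ < eucl m'.1 ∧ M.lowSize < μ * (N : ℝ) ^ 3 ∧
      ∃ (ℓ : ℕ) (hℓ : ℓ < d) (V V' : Fin ℓ → Fin d → ℤ) (P P' : Fin ℓ → ℤ), 0 < ℓ ∧
        CutData (siteBound n) N θ μ τ m.1 hℓ V P ∧ CutData (siteBound n) N θ μ τ m'.1 hℓ V' P' ∧
        signKey (display V P) ≤ signKey (display V' P') ∧ A = affineSpace V P := by
  unfold IsBilinearWithCut
  refine and_congr_right fun _ => and_congr_right fun _ => and_congr_right fun _ =>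
    and_congr_right fun _ => and_congr_right fun _ => ?_
  constructor
  · rintro ⟨ℓ, hℓ, v, w, p, q, h0, h1, h2, h3, h4, h5, h6⟩
    exact ⟨ℓ, hℓ, _, _, _, _, h0, ⟨v, p, h1, h3, rfl, rfl⟩, ⟨w, q, h2, h4, rfl, rfl⟩,
      signKey_le_iff.2 h5, h6⟩
  · rintro ⟨ℓ, hℓ, V, V', P, P', h0, ⟨v, p, h1, h3, rfl, rfl⟩, ⟨w, q, h2, h4, rfl, rfl⟩, h5, h6⟩
    exact ⟨ℓ, hℓ, v, w, p, q, h0, h1, h2, h3, h4, signKey_le_iff.1 h5, h6⟩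

lemma IsBilinearWithCut.mono (h : IsBilinearWithCut τ₁ N θ μ τ M σ m σ' m' A) {θ' μ' : ℝ}
    (hθ : θ' ≤ θ) (hμ : μ ≤ μ') : IsBilinearWithCut τ₁ N θ' μ' τ M σ m σ' m' A := by
  rw [isBilinearWithCut_iff] at h ⊢
  obtain ⟨h1, h2, h3, h4, h5, ℓ, hℓ, V, V', P, P', h0, h6, h7, h8⟩ := h
  refine ⟨h1, h2, lt_of_le_of_lt (by gcongr) h3, lt_of_le_of_lt (by gcongr) h4,
    h5.trans_le (by gcongr), ℓ, hℓ, V, V', P, P', h0, h6.mono hθ hμ, h7.mono hθ hμ, h8⟩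

lemma IsBilinear.mono {P : Mono n} (h : IsBilinear τ₁ N θ μ τ P) {θ' μ' : ℝ}
    (hθ : θ' ≤ θ) (hμ : μ ≤ μ') : IsBilinear τ₁ N θ' μ' τ P := by
  obtain ⟨M, σ, m, σ', m', A, h, rfl⟩ := h
  exact ⟨M, σ, m, σ', m', A, h.mono hθ hμ, rfl⟩

lemma IsBilinear.absK_lt {P : Mono n} (h : IsBilinear τ₁ N θ μ τ P) : P.absK < N := by
  obtain ⟨M, σ, m, σ', m', A, h, rfl⟩ := h
  rw [Mono.mulVar_eq, Mono.mulVar_eq, Mono.absK_add_inc, Mono.absK_add_inc]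
  exact h.2.1

/-- Twin monomials are bilinear, with the same cut up to the order of the two sites. -/
lemma TwinPair.exists_cut {w w' : NormalSite n} (h : TwinPair τ₁ N θ μ τ N M σ m w σ' m' w') :
    ∃ A, (IsBilinearWithCut τ₁ N θ μ τ M σ m σ' m' A ∧ IsBilinearWithCut τ₁ N θ μ τ M σ w σ' w' A) ∨
      IsBilinearWithCut τ₁ N θ μ τ M σ' m' σ m A ∧ IsBilinearWithCut τ₁ N θ μ τ M σ' w' σ w A := by
  obtain ⟨ℓ, hℓ, h0, ⟨h1, h2, V, P, h3, h4⟩, h5, h6, V', P', h7, h8⟩ := h.twin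
  simp only [isBilinearWithCut_iff]
  rcases le_total (signKey (display V P)) (signKey (display V' P')) with hle | hle
  · exact ⟨affineSpace V P, Or.inl ⟨⟨h.left_momentum, h.absK_lt, h1, h5, h.lowSize_lt, ℓ, hℓ, V, V',
      P, P', h0, h3, h7, hle, rfl⟩, ⟨h.right_momentum, h.absK_lt, h2, h6, h.lowSize_lt, ℓ, hℓ, V, V',
      P, P', h0, h4, h8, hle, rfl⟩⟩⟩
  · have hs := h.swap
    exact ⟨affineSpace V' P', Or.inr ⟨⟨hs.left_momentum, h.absK_lt, h5, h1, h.lowSize_lt, ℓ, hℓ, V', V,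
      P', P, h0, h7, h3, hle, rfl⟩, ⟨hs.right_momentum, h.absK_lt, h6, h2, h.lowSize_lt, ℓ, hℓ, V', V,
      P', P, h0, h8, h4, hle, rfl⟩⟩⟩

lemma TwinPair.isBilinear {w w' : NormalSite n} (h : TwinPair τ₁ N θ μ τ N M σ m w σ' m' w') :
    IsBilinear τ₁ N θ μ τ (M + (Dir.site σ m).inc + (Dir.site σ' m').inc) := by
  obtain ⟨A, ⟨h1, -⟩ | ⟨h1, -⟩⟩ := h.exists_cut
  · exact ⟨M, σ, m, σ', m', A, h1, by rw [Mono.mulVar_eq, Mono.mulVar_eq]⟩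
  · exact ⟨M, σ', m', σ, m, A, h1, by rw [Mono.mulVar_eq, Mono.mulVar_eq, add_right_comm]⟩

/-- Twins have equal momenta and cuts, hence equal arguments of `g`. Which site supplies the cut is
decided by the two cuts alone, hence in the same way for both monomials. -/
lemma IsPiecewiseToeplitz.toeplitzAt {ρ r s : ℝ} {O : Set (Fin b → ℝ)} {F : Series n}
    (hF : IsPiecewiseToeplitz ρ O τ₁ r s N θ μ τ F) {ξ : Fin b → ℝ} (hξ : ξ ∈ O) :
    ToeplitzAt τ₁ N θ μ τ N F ξ := by
  obtain ⟨-, -, g, hg⟩ := hF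
  intro M σ m w σ' m' w' h
  obtain ⟨A, ⟨h1, h2⟩ | ⟨h1, h2⟩⟩ := h.exists_cut
  · have e1 := hg _ _ _ _ _ _ h1 ξ hξ
    have e2 := hg _ _ _ _ _ _ h2 ξ hξ
    rw [Mono.mulVar_eq, Mono.mulVar_eq] at e1 e2
    rw [e1, e2, h.left_momentum, h.right_momentum]
  · have e1 := hg _ _ _ _ _ _ h1 ξ hξ
    have e2 := hg _ _ _ _ _ _ h2 ξ hξ
    rw [Mono.mulVar_eq, Mono.mulVar_eq, add_right_comm] at e1 e2
    rw [e1, e2, h.swap.left_momentum, h.swap.right_momentum]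

lemma ToeplitzAt.mono {κ κ' : ℕ} {Φ : Series n} {ξ : Fin b → ℝ}
    (h : ToeplitzAt τ₁ N θ μ τ κ Φ ξ) {θ' μ' : ℝ} (hθ : θ ≤ θ') (hμ : μ' ≤ μ) (hκ : κ' ≤ κ) :
    ToeplitzAt τ₁ N θ' μ' τ κ' Φ ξ := by
  intro M σ m w σ' m' w' hp
  obtain ⟨ℓ, hℓ, h0, h1, h2⟩ := hp.twin
  exact h _ _ _ _ _ _ _ ⟨hp.absK_lt.trans_le hκ, hp.lowSize_lt.trans_le (by gcongr),
    hp.left_momentum, hp.right_momentum, ℓ, hℓ, h0, h1.mono hθ hμ, h2.mono hθ hμ⟩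

/-- Bilinear monomials with the same cut are twins. -/
lemma IsBilinearWithCut.twinPair {L : ℝ} (hL : siteBound n * N + μ * (N : ℝ) ^ 3 ≤ L)
    (hsep : μ * (N : ℝ) ^ τ + siteBound n * N * L ≤ θ * (N : ℝ) ^ (4 * d * τ))
    {w w' : NormalSite n} (h : IsBilinearWithCut τ₁ N θ μ τ M σ m σ' m' A)
    (h' : IsBilinearWithCut τ₁ N θ μ τ M σ w σ' w' A) :
    TwinPair τ₁ N θ μ τ N M σ m w σ' m' w' := by
  rw [isBilinearWithCut_iff] at h h'
  obtain ⟨h1, h2, h3, h4, h5, ℓ, hℓ, V, V', P, P', h0, h6, h7, -, h8⟩ := h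
  obtain ⟨g1, g2, g3, g4, g5, ℓ', hℓ', W, W', Q, Q', g0, g6, g7, -, g8⟩ := h'
  obtain ⟨rfl, rfl, rfl⟩ := h6.eq_of_affineSpace_eq g6 (h8.symm.trans g8)
  have g6' : CutData (siteBound n) N θ μ τ w.1 hℓ V P := g6
  have hs := sgn_mul_self σ'
  have hsolve : ∀ x y : Fin d → ℤ, sgn σ • x + sgn σ' • y = -M.momentum →
      y = (-(sgn σ' * sgn σ)) • x + -(sgn σ' • M.momentum) := by
    intro x y hxy
    have h9 := congrArg (fun x => sgn σ' • x) hxy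
    simp only [smul_add, smul_smul, hs, one_smul, smul_neg] at h9
    rw [neg_smul, ← h9]
    abel
  have hc : eucl (-(sgn σ' • M.momentum)) ≤ L := by
    rw [eucl_neg, eucl_sgn_smul]
    refine (eucl_momentum_le M).trans (le_trans ?_ hL)
    have hC := siteBound_nonneg n
    have : (M.absK : ℝ) ≤ N := by exact_mod_cast h2.le
    gcongr
  have heabs : |-(sgn σ' * sgn σ)| = 1 := by rw [abs_neg, abs_mul, abs_sgn, abs_sgn, one_mul]
  have h7' := h7
  have g7' := g7
  rw [hsolve _ _ h1] at h7'
  rw [hsolve _ _ g1] at g7'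
  -- Bilinearity names only the cut of the first site. The second sites arise from the first ones by
  -- the same sign and displacement, so they share a cut too.
  obtain ⟨rfl, rfl⟩ := CutData.eq_of_translate h0 h6 g6' heabs hc h7' g7' hsep
  exact ⟨h2, h5, h1, g1, ℓ', hℓ, h0, ⟨h3, g3, V, P, h6, g6'⟩, h4, g4, V', P', h7, g7⟩

open Classical in
/-- The bilinear part of a series with the Töplitz property is piecewise Töplitz. -/
lemma isPiecewiseToeplitz_bilinearPart {ρ r s L : ℝ} {O : Set (Fin b → ℝ)} {G : Series n}
    (hL : siteBound n * N + μ * (N : ℝ) ^ 3 ≤ L)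
    (hsep : μ * (N : ℝ) ^ τ + siteBound n * N * L ≤ θ * (N : ℝ) ^ (4 * d * τ))
    (hG : ∀ ξ ∈ O, ToeplitzAt τ₁ N θ μ τ N G ξ) (hA : MemA ρ O r s (bilinearPart τ₁ N θ μ τ G)) :
    IsPiecewiseToeplitz ρ O τ₁ r s N θ μ τ (bilinearPart τ₁ N θ μ τ G) := by
  refine ⟨hA, fun P hP ξ _ => by simp [bilinearPart, hP], ?_⟩
  -- The symbol is the value at a chosen pair of sites with cut `A`; the Töplitz property makes the
  -- choice immaterial. The argument `σ m + σ' m'` can be ignored, since bilinearity fixes it as the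
  -- negative momentum of `M`.
  refine ⟨fun M σ σ' _ A ξ => if h : ∃ x : NormalSite n × NormalSite n,
    IsBilinearWithCut τ₁ N θ μ τ M σ x.1 σ' x.2 A then
      G ((M.mulVar σ h.choose.1).mulVar σ' h.choose.2) ξ else 0, ?_⟩
  intro M σ m σ' m' A h ξ hξ
  have hex : ∃ x : NormalSite n × NormalSite n,
    IsBilinearWithCut τ₁ N θ μ τ M σ x.1 σ' x.2 A := ⟨(m, m'), h⟩
  have hbil : IsBilinear τ₁ N θ μ τ ((M.mulVar σ m).mulVar σ' m') := ⟨M, σ, m, σ', m', A, h, rfl⟩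
  simp only [bilinearPart, hbil, if_true, hex, dite_true]
  have := hG ξ hξ _ _ _ _ _ _ _ (h.twinPair hL hsep hex.choose_spec)
  rw [Mono.mulVar_eq, Mono.mulVar_eq, this, Mono.mulVar_eq, Mono.mulVar_eq]

/-- Restriction of a piecewise Töplitz function to the bilinear monomials of stronger parameters. -/
lemma IsPiecewiseToeplitz.bilinearPart {ρ r s r' s' θ' μ' : ℝ} {O : Set (Fin b → ℝ)} {F : Series n}
    (hF : IsPiecewiseToeplitz ρ O τ₁ r s N θ μ τ F) (hθ : θ ≤ θ') (hμ : μ' ≤ μ)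
    (hA : MemA ρ O r' s' (bilinearPart τ₁ N θ' μ' τ F)) :
    IsPiecewiseToeplitz ρ O τ₁ r' s' N θ' μ' τ (bilinearPart τ₁ N θ' μ' τ F) := by
  obtain ⟨-, -, g, hg⟩ := hF
  refine ⟨hA, fun P hP ξ _ => by simp [QuasiToeplitz.bilinearPart, hP], g, ?_⟩
  intro M σ m σ' m' A h ξ hξ
  have hbil : IsBilinear τ₁ N θ' μ' τ ((M.mulVar σ m).mulVar σ' m') := ⟨M, σ, m, σ', m', A, h, rfl⟩
  simp only [QuasiToeplitz.bilinearPart, hbil, if_true]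
  exact hg _ _ _ _ _ _ (h.mono hθ hμ) ξ hξ

lemma bracket_eq_zero_of_absK {Φ Γ : Series n} {ξ : Fin b → ℝ} {κ₁ κ₂ : ℕ}
    (hΦk : ∀ P : Mono n, κ₁ ≤ P.absK → Φ P ξ = 0) (hΓk : ∀ P : Mono n, κ₂ ≤ P.absK → Γ P ξ = 0)
    {P : Mono n} (hP : κ₁ + κ₂ ≤ P.absK) : bracket Φ Γ P ξ = 0 := by
  unfold bracket
  rw [← tsum_zero (β := Fiber P)]
  refine tsum_congr fun x => ?_
  have h1 := Mono.absK_add_le x.1.2.1 x.1.2.2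
  rw [x.2] at h1
  unfold brTerm Series.deriv
  by_cases h : κ₁ ≤ x.1.2.1.absK
  · rw [hΦk _ (by rwa [Mono.absK_add_inc])]
    simp
  · rw [hΓk (x.1.2.2 + _) (by rw [Mono.absK_add_inc]; omega)]
    simp

end PiecewiseToeplitz

/-! ### Restrictions, linear operations and bracket differences. -/

section SeriesAlgebra

variable {d b : ℕ} {n : Fin b → Fin d → ℤ} {O : Set (Fin b → ℝ)} {ρ r s : ℝ}

lemma coeffNorm_le_of_eq_or (hO : IsOpen O) {c c' : (Fin b → ℝ) → ℂ}
    (h : Set.EqOn c c' O ∨ Set.EqOn c 0 O) : coeffNorm O c ≤ coeffNorm O c' := by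
  rcases h with h | h
  · exact (coeffNorm_congr hO h).le
  · rw [coeffNorm_congr hO h]
    have : coeffNorm O (0 : (Fin b → ℝ) → ℂ) = 0 := coeffNorm_zero
    rw [this]
    exact bot_le

lemma memA_restrict (hz : ∃ i, n i = 0) (hρ : 0 < ρ) (hO : IsOpen O) {f h : Series n}
    (hf : MemA ρ O r s f) (hfh : ∀ M, Set.EqOn (h M) (f M) O ∨ Set.EqOn (h M) 0 O) :
    MemA ρ O r s h ∧ XNorm ρ O r s h ≤ XNorm ρ O r s f := by
  have hc : ∀ M, ContDiffOn ℝ 1 (h M) O := by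
    intro M
    rcases hfh M with h1 | h1
    · exact (hf.1 M).congr h1
    · exact contDiffOn_const.congr h1
  have hle : XNorm ρ O r s h ≤ XNorm ρ O r s f := by
    rw [XNorm_eq hz hρ hO hc, XNorm_eq hz hρ hO hf.1]
    exact fieldNorm_mono fun M => coeffNorm_le_of_eq_or hO (hfh M)
  refine ⟨⟨hc, fun M hM ξ hξ => ?_, hle.trans_lt hf.2.2⟩, hle⟩
  rcases hfh M with h1 | h1
  · rw [h1 hξ]; exact hf.2.1 M hM ξ hξ
  · exact h1 hξ

lemma memA_bilinearPart (hz : ∃ i, n i = 0) (hρ : 0 < ρ) (hO : IsOpen O) {f : Series n}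
    (hf : MemA ρ O r s f) (τ₁ : ℝ) (N : ℕ) (θ μ τ : ℝ) :
    MemA ρ O r s (bilinearPart τ₁ N θ μ τ f) ∧
      XNorm ρ O r s (bilinearPart τ₁ N θ μ τ f) ≤ XNorm ρ O r s f := by
  refine memA_restrict hz hρ hO hf fun M => ?_
  by_cases h : IsBilinear τ₁ N θ μ τ M
  · exact Or.inl fun ξ _ => by simp [bilinearPart, h]
  · exact Or.inr fun ξ _ => by simp [bilinearPart, h]

lemma memA_zero (hz : ∃ i, n i = 0) (hρ : 0 < ρ) (hO : IsOpen O) :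
    MemA ρ O r s (0 : Series n) ∧ XNorm ρ O r s (0 : Series n) = 0 := by
  have h0 : XNorm ρ O r s (0 : Series n) = 0 := by
    rw [XNorm_eq hz hρ hO (f := 0) fun M => contDiffOn_const]
    have : coeffs O (0 : Series n) = fun M => 0 * (0 : ℝ≥0∞) := by
      funext M
      rw [zero_mul]
      exact coeffNorm_zero
    rw [this]
    rw [fieldNorm_const_mul, zero_mul]
  exact ⟨⟨fun M => contDiffOn_const, fun _ _ _ _ => rfl, by rw [h0]; simp⟩, h0⟩

lemma memA_const_mul (hz : ∃ i, n i = 0) (hρ : 0 < ρ) (hO : IsOpen O) {f : Series n}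
    (hf : MemA ρ O r s f) (c : ℂ) : MemA ρ O r s (fun M ξ => c * f M ξ) ∧
      XNorm ρ O r s (fun M ξ => c * f M ξ) = ‖c‖ₑ * XNorm ρ O r s f := by
  have hc : ∀ M, ContDiffOn ℝ 1 (fun ξ => c * f M ξ) O := fun M => contDiffOn_const.mul (hf.1 M)
  have he : XNorm ρ O r s (fun M ξ => c * f M ξ) = ‖c‖ₑ * XNorm ρ O r s f := by
    rw [XNorm_eq hz hρ hO hc, XNorm_eq hz hρ hO hf.1, ← fieldNorm_const_mul]
    congr 1
    funext M
    exact coeffNorm_const_mul hO (hf.1 M) c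
  refine ⟨⟨hc, fun M hM ξ hξ => by simp [hf.2.1 M hM ξ hξ], ?_⟩, he⟩
  rw [he]
  exact ENNReal.mul_lt_top (by simp) hf.2.2

lemma memA_add (hz : ∃ i, n i = 0) (hρ : 0 < ρ) (hO : IsOpen O) {f g : Series n}
    (hf : MemA ρ O r s f) (hg : MemA ρ O r s g) : MemA ρ O r s (f + g) ∧
      XNorm ρ O r s (f + g) ≤ XNorm ρ O r s f + XNorm ρ O r s g := by
  have hc : ∀ M, ContDiffOn ℝ 1 ((f + g) M) O := fun M => (hf.1 M).add (hg.1 M)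
  have he : XNorm ρ O r s (f + g) ≤ XNorm ρ O r s f + XNorm ρ O r s g := by
    rw [XNorm_eq hz hρ hO hc, XNorm_eq hz hρ hO hf.1, XNorm_eq hz hρ hO hg.1]
    refine le_trans (fieldNorm_mono fun M => ?_) (fieldNorm_add_le _ _)
    exact coeffNorm_add_le hO (hf.1 M) (hg.1 M)
  refine ⟨⟨hc, fun M hM ξ hξ => ?_, he.trans_lt (ENNReal.add_lt_top.2 ⟨hf.2.2, hg.2.2⟩)⟩, he⟩
  simp [hf.2.1 M hM ξ hξ, hg.2.1 M hM ξ hξ]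

lemma memA_sub (hz : ∃ i, n i = 0) (hρ : 0 < ρ) (hO : IsOpen O) {f g : Series n}
    (hf : MemA ρ O r s f) (hg : MemA ρ O r s g) : MemA ρ O r s (f - g) := by
  have h := (memA_add hz hρ hO hf (memA_const_mul hz hρ hO hg (-1)).1).1
  have : f - g = f + fun M ξ => -1 * g M ξ := by
    funext M ξ
    simp [sub_eq_add_neg]
  rwa [this]

lemma memA_sum (hz : ∃ i, n i = 0) (hρ : 0 < ρ) (hO : IsOpen O) {ι : Type*} (S : Finset ι)
    {f : ι → Series n} (hf : ∀ i ∈ S, MemA ρ O r s (f i)) : MemA ρ O r s (∑ i ∈ S, f i) ∧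
      XNorm ρ O r s (∑ i ∈ S, f i) ≤ ∑ i ∈ S, XNorm ρ O r s (f i) := by
  classical
  induction S using Finset.induction_on with
  | empty => simpa using ⟨(memA_zero hz hρ hO).1, (memA_zero hz hρ hO).2⟩
  | insert a S ha ih =>
    rw [Finset.sum_insert ha, Finset.sum_insert ha]
    have h1 := ih fun i hi => hf i (Finset.mem_insert_of_mem hi)
    have h2 := memA_add hz hρ hO (hf a (Finset.mem_insert_self a S)) h1.1
    exact ⟨h2.1, h2.2.trans (by gcongr; exact h1.2)⟩

lemma memA_congr (hz : ∃ i, n i = 0) (hρ : 0 < ρ) (hO : IsOpen O) {f g : Series n}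
    (hf : MemA ρ O r s f) (h : ∀ M, Set.EqOn (g M) (f M) O) :
    MemA ρ O r s g ∧ XNorm ρ O r s g ≤ XNorm ρ O r s f :=
  memA_restrict hz hρ hO hf fun M => Or.inl (h M)

/-- Smaller domains. -/
lemma memA_domain_mono (hz : ∃ i, n i = 0) (hρ : 0 < ρ) (hO : IsOpen O) {r' s' : ℝ} (hr' : 0 < r')
    (hr : r' ≤ r) (hs : s' ≤ s) {f : Series n} (hf : MemA ρ O r s f) : MemA ρ O r' s' f ∧
      XNorm ρ O r' s' f ≤ ENNReal.ofReal ((r / r') ^ 2) * XNorm ρ O r s f := by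
  have hle : XNorm ρ O r' s' f ≤ ENNReal.ofReal ((r / r') ^ 2) * XNorm ρ O r s f := by
    rw [XNorm_eq hz hρ hO hf.1, XNorm_eq hz hρ hO hf.1]
    exact fieldNorm_domain_mono hr' hr hs _
  exact ⟨⟨hf.1, hf.2.1, hle.trans_lt (ENNReal.mul_lt_top ENNReal.ofReal_lt_top hf.2.2)⟩, hle⟩

/-- The bracket difference, as a sum of brackets. -/
lemma bracket_sub_bracket (hz : ∃ i, n i = 0) (hρ : 0 < ρ) (hO : IsOpen O) (hr : 0 < r) (hs : 0 ≤ s)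
    {f g Φ Γ : Series n} (hf : MemA ρ O r s f) (hg : MemA ρ O r s g) (hΦ : MemA ρ O r s Φ)
    (hΓ : MemA ρ O r s Γ) (M : Mono n) :
    Set.EqOn ((bracket f g - bracket Φ Γ) M) ((bracket f (g - Γ) + bracket (f - Φ) Γ) M) O := by
  intro ξ hξ
  have hsum : ∀ {f g : Series n}, MemA ρ O r s f → MemA ρ O r s g →
      Summable fun x : Fiber M => brTerm f g x.1 ξ := fun {f g} hf hg =>
    summable_brTerm hO hf.1 hg.1 (cBracket_ne_top hz hρ hr hs ((memA_iff hz hρ hO).1 hf).2.2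
      ((memA_iff hz hρ hO).1 hg).2.2 M) hξ
  have h1 := hsum hf hg
  have h2 := hsum hΦ hΓ
  have h3 := hsum hf (memA_sub hz hρ hO hg hΓ)
  have h4 := hsum (memA_sub hz hρ hO hf hΦ) hΓ
  simp only [Pi.sub_apply, Pi.add_apply, bracket]
  rw [← h1.tsum_sub h2, ← h3.tsum_add h4]
  refine tsum_congr fun x => ?_
  simp only [brTerm, Series.deriv, Pi.sub_apply]
  ring

end SeriesAlgebra

/-! ### Iterated brackets -/

section IteratedBrackets

variable {d b : ℕ} {n : Fin b → Fin d → ℤ} {O : Set (Fin b → ℝ)} {ρ : ℝ}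

/-- The `k`-th of `J` equidistant values from `x` to `x'`. -/
def interp (x x' : ℝ) (J k : ℕ) : ℝ := x - k / J * (x - x')

@[simp] lemma interp_zero (x x' : ℝ) (J : ℕ) : interp x x' J 0 = x := by simp [interp]

lemma interp_self (x x' : ℝ) {J : ℕ} (hJ : J ≠ 0) : interp x x' J J = x' := by
  have : (J : ℝ) ≠ 0 := by exact_mod_cast hJ
  simp [interp, div_self this]

lemma interp_succ (x x' : ℝ) {J : ℕ} (hJ : J ≠ 0) (k : ℕ) :
    interp x x' J k - interp x x' J (k + 1) = (x - x') / J := by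
  have : (J : ℝ) ≠ 0 := by exact_mod_cast hJ
  unfold interp
  push_cast
  field_simp
  ring

lemma le_interp {x x' : ℝ} (h : x' ≤ x) {J k : ℕ} (hk : k ≤ J) : x' ≤ interp x x' J k := by
  have h1 : (k : ℝ) / J ≤ 1 := div_le_one_of_le₀ (by exact_mod_cast hk) (by positivity)
  unfold interp
  nlinarith

lemma interp_le {x x' : ℝ} (h : x' ≤ x) (J k : ℕ) : interp x x' J k ≤ x := by
  have h1 : 0 ≤ (k : ℝ) / J * (x - x') := mul_nonneg (by positivity) (by linarith)
  unfold interp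
  linarith

/-- The constant of the bracket estimate between `D(r, s)` and `D(r', s')`. -/
def bracketConst (r s r' s' : ℝ) : ℝ := 2 * (r / r') ^ 2 / min (s - s') (1 - r' / r)

lemma bracketConst_pos {r s r' s' : ℝ} (hr' : 0 < r') (hr : r' < r) (hs : s' < s) :
    0 < bracketConst r s r' s' := by
  have h0 : 0 < r := hr'.trans hr
  have h1 : r' / r < 1 := (div_lt_one h0).2 hr
  have h2 : 0 < min (s - s') (1 - r' / r) := lt_min (by linarith) (by linarith)
  unfold bracketConst
  positivity

/-- One step of the bracket estimate along the scale of domains. -/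
lemma XNorm_bracket_step (hz : ∃ i, n i = 0) (hρ : 0 < ρ) (hO : IsOpen O) {r s r' s' : ℝ}
    (hr' : 0 < r') (hr : r' < r) (hs' : 0 ≤ s') (hs : s' < s) {J k : ℕ} (hk : k < J)
    {f g : Series n} (hf : MemA ρ O r s f)
    (hg : MemA ρ O (interp r r' J k) (interp s s' J k) g) :
    MemA ρ O (interp r r' J (k + 1)) (interp s s' J (k + 1)) (bracket f g) ∧
      XNorm ρ O (interp r r' J (k + 1)) (interp s s' J (k + 1)) (bracket f g) ≤
        ENNReal.ofReal (bracketConst r s r' s' * J) * XNorm ρ O r s f *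
          XNorm ρ O (interp r r' J k) (interp s s' J k) g := by
  have hJ : J ≠ 0 := by omega
  have hJ0 : (0 : ℝ) < J := by exact_mod_cast Nat.pos_of_ne_zero hJ
  set a := interp r r' J k with ha
  set a' := interp r r' J (k + 1) with ha'
  set σ := interp s s' J k with hσ
  set σ' := interp s s' J (k + 1) with hσ'
  have ea : a - a' = (r - r') / J := interp_succ r r' hJ k
  have eσ : σ - σ' = (s - s') / J := interp_succ s s' hJ k
  have h1 : r' ≤ a' := le_interp hr.le hk
  have h2 : a ≤ r := interp_le hr.le J k
  have h3 : s' ≤ σ' := le_interp hs.le hk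
  have h4 : σ ≤ s := interp_le hs.le J k
  have h5 : a' < a := by
    have : 0 < (r - r') / J := div_pos (by linarith) hJ0
    linarith
  have h6 : σ' < σ := by
    have : 0 < (s - s') / J := div_pos (by linarith) hJ0
    linarith
  have ha'0 : 0 < a' := hr'.trans_le h1
  have ha0 : 0 < a := ha'0.trans h5
  have hr0 : 0 < r := hr'.trans hr
  obtain ⟨hfA, hfN⟩ := memA_domain_mono hz hρ hO ha0 h2 h4 hf
  refine ⟨memA_bracket hz hρ hO ha'0 h5 (hs'.trans h3) h6 hfA hg, ?_⟩
  refine (XNorm_bracket_le hz hρ hO ha'0 h5 (hs'.trans h3) h6 hfA hg).trans ?_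
  gcongr ?_ * _
  refine (mul_le_mul_right hfN _).trans ?_
  rw [← mul_assoc, ← ENNReal.ofReal_mul' (by positivity)]
  gcongr ENNReal.ofReal ?_ * _
  unfold bracketConst
  set D := min (s - s') (1 - r' / r) with hD
  have hD0 : 0 < D := lt_min (by linarith) (by
    have := (div_lt_one hr0).2 hr
    linarith)
  have hmin : D / J ≤ min (σ - σ') (1 - a' / a) := by
    refine le_min ?_ ?_
    · rw [eσ]
      gcongr
      exact min_le_left _ _
    · have e1 : 1 - a' / a = (r - r') / J / a := by rw [← ea]; field_simp
      rw [e1, div_right_comm]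
      gcongr
      calc D ≤ 1 - r' / r := min_le_right _ _
        _ = (r - r') / r := by field_simp
        _ ≤ (r - r') / a := by
          have : 0 ≤ r - r' := by linarith
          gcongr
  -- The intermediate radius cancels in `(a / a')² (r / a)²`; compared with a single bracket between
  -- the two extreme domains only the factor `J` is lost.
  calc 2 * (a / a') ^ 2 / min (σ - σ') (1 - a' / a) * (r / a) ^ 2
      ≤ 2 * (a / a') ^ 2 / (D / J) * (r / a) ^ 2 := by gcongr
    _ = 2 * (r / a') ^ 2 / D * J := by field_simp
    _ ≤ 2 * (r / r') ^ 2 / D * J := by gcongr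

/-- Iterated brackets along the scale of domains. -/
lemma XNorm_iterate_bracket (hz : ∃ i, n i = 0) (hρ : 0 < ρ) (hO : IsOpen O) {r s r' s' : ℝ}
    (hr' : 0 < r') (hr : r' < r) (hs' : 0 ≤ s') (hs : s' < s) (J : ℕ)
    {f g : Series n} (hf : MemA ρ O r s f) (hg : MemA ρ O r s g) {T S : ℝ≥0∞}
    (hT : XNorm ρ O r s f ≤ T) (hS : XNorm ρ O r s g ≤ S) {k : ℕ} (hk : k ≤ J) :
    MemA ρ O (interp r r' J k) (interp s s' J k) ((bracket f)^[k] g) ∧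
      XNorm ρ O (interp r r' J k) (interp s s' J k) ((bracket f)^[k] g) ≤
        (ENNReal.ofReal (bracketConst r s r' s' * J) * T) ^ k * S := by
  induction k with
  | zero => simpa using ⟨hg, hS⟩
  | succ k ih =>
    obtain ⟨h1, h2⟩ := ih (by omega)
    obtain ⟨h3, h4⟩ := XNorm_bracket_step hz hρ hO hr' hr hs' hs (show k < J by omega) hf h1
    rw [Function.iterate_succ_apply']
    refine ⟨h3, h4.trans ?_⟩
    rw [pow_succ', mul_assoc _ _ S]
    gcongr

/-- Stability of iterated brackets along the scale of domains. -/
lemma XNorm_iterate_bracket_sub (hz : ∃ i, n i = 0) (hρ : 0 < ρ) (hO : IsOpen O) {r s r' s' : ℝ}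
    (hr' : 0 < r') (hr : r' < r) (hs' : 0 ≤ s') (hs : s' < s) (J : ℕ)
    {f g Φ Γ : Series n} (hf : MemA ρ O r s f) (hg : MemA ρ O r s g) (hΦ : MemA ρ O r s Φ)
    (hΓ : MemA ρ O r s Γ) {T S ε : ℝ≥0∞}
    (hfT : XNorm ρ O r s f ≤ T) (hΦT : XNorm ρ O r s Φ ≤ T)
    (hΓS : XNorm ρ O r s Γ ≤ S) (hfΦ : XNorm ρ O r s (f - Φ) ≤ ε * T)
    (hgΓ : XNorm ρ O r s (g - Γ) ≤ ε * S) {k : ℕ} (hk : k ≤ J) :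
    XNorm ρ O (interp r r' J k) (interp s s' J k) ((bracket f)^[k] g - (bracket Φ)^[k] Γ) ≤
        (k + 1) * ε * ((ENNReal.ofReal (bracketConst r s r' s' * J) * T) ^ k * S) := by
  set B := ENNReal.ofReal (bracketConst r s r' s' * J) with hB
  induction k with
  | zero => simpa using hgΓ
  | succ k ih =>
    have hk' : k < J := by omega
    have h1 := (XNorm_iterate_bracket hz hρ hO hr' hr hs' hs J hf hg le_rfl le_rfl hk'.le).1
    have h2 := XNorm_iterate_bracket hz hρ hO hr' hr hs' hs J hΦ hΓ hΦT hΓS hk'.le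
    have h3 := XNorm_bracket_step hz hρ hO hr' hr hs' hs hk' hf (memA_sub hz hρ hO h1 h2.1)
    have h4 := XNorm_bracket_step hz hρ hO hr' hr hs' hs hk' (memA_sub hz hρ hO hf hΦ) h2.1
    have hpos : 0 < interp r r' J k := hr'.trans_le (le_interp hr.le hk'.le)
    have hspos : 0 ≤ interp s s' J k := hs'.trans (le_interp hs.le hk'.le)
    have hdom : ∀ {f : Series n}, MemA ρ O r s f →
        MemA ρ O (interp r r' J k) (interp s s' J k) f := fun hf =>
      (memA_domain_mono hz hρ hO hpos (interp_le hr.le J k) (interp_le hs.le J k) hf).1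
    rw [Function.iterate_succ_apply', Function.iterate_succ_apply']
    refine (memA_congr hz hρ hO (memA_add hz hρ hO h3.1 h4.1).1
      (bracket_sub_bracket hz hρ hO hpos hspos (hdom hf) h1 (hdom hΦ) h2.1)).2.trans ?_
    refine (memA_add hz hρ hO h3.1 h4.1).2.trans ?_
    -- The error of the previous iterate passes through the bracket with `f`, and replacing `f` by
    -- `Φ` adds one more unit of `ε`.
    calc _ ≤ B * T * ((k + 1) * ε * ((B * T) ^ k * S)) + B * (ε * T) * ((B * T) ^ k * S) := by
          refine add_le_add (h3.2.trans ?_) (h4.2.trans ?_)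
          · gcongr
            exact ih hk'.le
          · gcongr
            exact h2.2
      _ = _ := by
          push_cast
          ring

end IteratedBrackets

/-! ### The losses of `μ` and `θ`, and what they pay for. -/

section Margins

/-- The loss in `μ` per bracket. -/
def lossMu (C₁ : ℝ) (N : ℕ) : ℝ := C₁ / (N : ℝ) ^ 2

/-- The loss in `θ` per bracket. -/
def lossTheta (C₁ : ℝ) (N d : ℕ) (τ₀ μ' : ℝ) : ℝ := C₁ * (2 * μ') / (N : ℝ) ^ (4 * d * τ₀ - 4)

lemma pow_le_rpow_of_le {x t : ℝ} (hx : 1 ≤ x) {k : ℕ} (h : (k : ℝ) ≤ t) : x ^ k ≤ x ^ t := by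
  rw [← Real.rpow_natCast]
  exact Real.rpow_le_rpow_of_exponent_le hx h

variable {C₁ τ₀ τ₁ τ μ' : ℝ} {N d J : ℕ}

/-- One loss in `θ` pays for `C₁ N L` with `L = 2 μ' N³`, the change of the constants of a
presentation under a displacement of size `L`. -/
lemma le_lossTheta_mul (hC : 0 ≤ C₁) (hN : 1 ≤ (N : ℝ)) (hμ' : 0 ≤ μ') {t : ℝ}
    (ht : 4 * d * τ₀ ≤ t) : C₁ * (2 * μ') * (N : ℝ) ^ 4 ≤ lossTheta C₁ N d τ₀ μ' * (N : ℝ) ^ t := by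
  have hN0 : (0 : ℝ) < N := by linarith
  unfold lossTheta
  rw [div_mul_eq_mul_div, mul_div_assoc, ← Real.rpow_sub hN0]
  gcongr
  exact pow_le_rpow_of_le hN (by push_cast; linarith)

lemma le_lossMu_mul (hC : 0 ≤ C₁) (hN : 1 ≤ (N : ℝ)) {t : ℝ} (ht : 12 ≤ t) :
    C₁ * (N : ℝ) ^ 10 ≤ lossMu C₁ N * (N : ℝ) ^ t := by
  have hN0 : (0 : ℝ) < N := by linarith
  calc C₁ * (N : ℝ) ^ 10 = lossMu C₁ N * (N : ℝ) ^ 12 := by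
        unfold lossMu
        field_simp
    _ ≤ _ := by
        have : 0 ≤ lossMu C₁ N := by unfold lossMu; positivity
        gcongr
        exact pow_le_rpow_of_le hN (by exact_mod_cast ht)

/-- In the budget `μ N³` for the low variables, one loss pays exactly for the momentum of Fourier
modes with `|k| ≤ N`. -/
lemma lossMu_mul_cube (hN : 1 ≤ (N : ℝ)) : lossMu C₁ N * (N : ℝ) ^ 3 = C₁ * N := by
  have hN0 : (0 : ℝ) < N := by linarith
  unfold lossMu
  field_simp

/-- The standing assumptions on the order `N` and the exponents. -/
structure Admissible (C₁ τ₀ τ₁ τ : ℝ) (N d : ℕ) : Prop where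
  one_le_bound : 1 ≤ C₁
  large : 8 * C₁ ≤ N
  dim : 1 ≤ d
  exponent : 12 ≤ τ₀
  lower : τ₀ ≤ τ
  upper : 4 * d * τ ≤ τ₁

/-- Displacements are bounded by `L = 2 μ' N³`. The number `q` measures the Fourier modes of the low
factor in units of `N`, each of which costs one loss in `μ`. The remaining conditions have room to
spare because `8 C₁ ≤ N` and `12 ≤ τ₀`. -/
lemma relaxed_of_margin (h : Admissible C₁ τ₀ τ₁ τ N d) (hμ' : 1 / 2 ≤ μ') (hJ : J + 1 ≤ N)
    {q θo μo θ₁ μ₁ : ℝ} {κ₁ κ₂ : ℕ} (hq : 1 ≤ q) (hκ₂ : (κ₂ : ℝ) ≤ q * N)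
    (hκ₁ : (κ₁ : ℝ) ≤ (J + 1) * N) (hμo : μ' ≤ μo) (hμo' : μo ≤ μ' + J * lossMu C₁ N)
    (hθ : θ₁ + lossTheta C₁ N d τ₀ μ' ≤ θo) (hμ : μo + q * lossMu C₁ N ≤ μ₁)
    (hθ₁ : 1 / 2 ≤ θ₁) (hμ₁ : μ₁ ≤ 4) :
    Relaxed C₁ τ₁ N d τ (2 * μ' * (N : ℝ) ^ 3) θo μo θ₁ μ₁ κ₁ κ₂ := by
  obtain ⟨hC, hN, hd, hτ₀, hτ, hτ₁⟩ := h
  set x : ℝ := (N : ℝ) with hx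
  have hx8 : 8 ≤ x := by linarith
  have hx1 : 1 ≤ x := by linarith
  have hx0 : 0 < x := by linarith
  have hC0 : 0 ≤ C₁ := by linarith
  have hd1 : (1 : ℝ) ≤ d := by exact_mod_cast hd
  have hν : 0 ≤ lossMu C₁ N := by unfold lossMu; positivity
  have hω : 0 ≤ lossTheta C₁ N d τ₀ μ' := by unfold lossTheta; positivity
  have hqν : lossMu C₁ N ≤ q * lossMu C₁ N := le_mul_of_one_le_left hν hq
  have hμ4 : μ' ≤ 4 := by linarith
  have hJx : (J : ℝ) + 1 ≤ x := by rw [hx]; exact_mod_cast hJ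
  have hν3 : lossMu C₁ N * x ^ 3 = C₁ * x := lossMu_mul_cube hx1
  have h4dτ : 48 ≤ 4 * d * τ := by
    calc (48 : ℝ) = 4 * 1 * 12 := by norm_num
      _ ≤ 4 * d * τ := by gcongr; linarith
  have h4dτ₀ : 4 * d * τ₀ ≤ 4 * d * τ := by gcongr
  have h4dτ' : 4 * τ ≤ 4 * d * τ := by
    calc 4 * τ = 4 * 1 * τ := by ring
      _ ≤ 4 * d * τ := by gcongr; linarith
  have hx3 : 0 < x ^ 3 := by positivity
  have hx2 : 64 ≤ x ^ 2 := by
    calc (64 : ℝ) = 8 ^ 2 := by norm_num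
      _ ≤ x ^ 2 := by gcongr
  have hpow : ∀ {t : ℝ}, 5 ≤ t → x ^ 5 ≤ x ^ t := fun ht =>
    pow_le_rpow_of_le hx1 (by exact_mod_cast ht)
  have hωt : ∀ {t : ℝ}, 4 * d * τ₀ ≤ t → C₁ * (2 * μ') * x ^ 4 ≤ lossTheta C₁ N d τ₀ μ' * x ^ t :=
    fun ht => le_lossTheta_mul hC0 hx1 (by linarith) ht
  -- Since `J + 1 ≤ N`, Fourier modes up to `(J + 1) N` and `J` losses in `μ` contribute at most `2
  -- C₁ N²`, which is at most `N³ / 2` and so fits into the second half of `L`.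
  have hdisp : C₁ * κ₁ + μo * x ^ 3 ≤ 2 * μ' * x ^ 3 := by
    have e1 : C₁ * κ₁ ≤ C₁ * ((J + 1) * x) := by gcongr
    have e2 : μo * x ^ 3 ≤ μ' * x ^ 3 + J * (C₁ * x) := by
      rw [← hν3, ← mul_assoc, ← add_mul]
      gcongr
    have e3 : C₁ * ((J + 1) * x) + J * (C₁ * x) ≤ C₁ * x * (2 * x) := by
      calc C₁ * ((J + 1) * x) + J * (C₁ * x) = C₁ * x * (2 * J + 1) := by ring
        _ ≤ C₁ * x * (2 * x) := by gcongr; linarith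
    have e4 : C₁ * x * (2 * x) ≤ x ^ 3 / 2 := by
      have : C₁ * x ^ 2 ≤ x / 8 * x ^ 2 := by gcongr; linarith
      linarith
    have e5 : 1 / 2 * x ^ 3 ≤ μ' * x ^ 3 := by gcongr
    linarith
  refine ⟨by linarith, by linarith, ?_, hdisp, ?_, ?_, ?_, ?_, ?_, ?_, ?_⟩
  · have e1 : C₁ * κ₂ ≤ C₁ * (q * x) := by gcongr
    have e2 : (μo + q * lossMu C₁ N) * x ^ 3 ≤ μ₁ * x ^ 3 := by gcongr
    have e3 : q * lossMu C₁ N * x ^ 3 = C₁ * (q * x) := by rw [mul_assoc, hν3]; ring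
    linarith
  · have e1 : x ≤ x ^ 3 := le_self_pow₀ hx1 (by norm_num)
    have e2 : 1 / 2 * x ^ 3 ≤ μ' * x ^ 3 := by gcongr
    linarith
  · have e1 := hpow (show 5 ≤ τ₁ by linarith)
    have e2 : 1 / 2 * x ^ 5 ≤ θ₁ * x ^ τ₁ := by gcongr
    have e3 : 64 * x ^ 3 ≤ x ^ 5 := by
      calc 64 * x ^ 3 ≤ x ^ 2 * x ^ 3 := by gcongr
        _ = x ^ 5 := by ring
    have e4 : 2 * μ' * x ^ 3 ≤ 8 * x ^ 3 := by gcongr; linarith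
    linarith
  · have e1 := hωt (h4dτ₀.trans hτ₁)
    have e2 : (θ₁ + lossTheta C₁ N d τ₀ μ') * x ^ τ₁ ≤ θo * x ^ τ₁ := by gcongr
    have e3 : 2 * μ' * x ^ 3 ≤ C₁ * (2 * μ') * x ^ 4 := by
      have : 1 ≤ C₁ * x := one_le_mul_of_one_le_of_one_le hC hx1
      have h0 : 0 ≤ 2 * μ' * x ^ 3 := by positivity
      calc 2 * μ' * x ^ 3 ≤ 2 * μ' * x ^ 3 * (C₁ * x) := le_mul_of_one_le_right h0 this
        _ = _ := by ring
    linarith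
  · have e1 : C₁ * x ^ 10 ≤ lossMu C₁ N * x ^ τ := le_lossMu_mul hC0 hx1 (hτ₀.trans hτ)
    have e2 : (μo + lossMu C₁ N) * x ^ τ ≤ μ₁ * x ^ τ := by gcongr; linarith
    have e3 : C₁ * x * (2 * μ' * x ^ 3) ≤ C₁ * x ^ 10 := by
      have h6 : 8 ≤ x ^ 6 := by
        calc (8 : ℝ) ≤ x := hx8
          _ ≤ x ^ 6 := le_self_pow₀ hx1 (by norm_num)
      calc C₁ * x * (2 * μ' * x ^ 3) = C₁ * (2 * μ' * x ^ 4) := by ring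
        _ ≤ C₁ * (x ^ 6 * x ^ 4) := by gcongr; linarith
        _ = _ := by ring
    linarith
  · have e1 := hωt h4dτ₀
    have e2 : (θ₁ + lossTheta C₁ N d τ₀ μ') * x ^ (4 * d * τ) ≤ θo * x ^ (4 * d * τ) := by gcongr
    have e3 : C₁ * x * (2 * μ' * x ^ 3) = C₁ * (2 * μ') * x ^ 4 := by ring
    linarith
  · have e1 : C₁ * x * (2 * μ' * x ^ 3) ≤ x ^ 5 := by
      calc C₁ * x * (2 * μ' * x ^ 3) = C₁ * (2 * μ') * x ^ 4 := by ring
        _ ≤ C₁ * 8 * x ^ 4 := by gcongr; linarith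
        _ ≤ x * x ^ 4 := by gcongr; linarith
        _ = _ := by ring
    have e2 := hpow (show 5 ≤ τ by linarith)
    have e3 : μ₁ * x ^ τ ≤ 4 * x ^ τ := by gcongr
    have e4 : 64 * x ^ τ ≤ x ^ (4 * d * τ) := by
      calc 64 * x ^ τ ≤ x ^ (2 : ℝ) * x ^ τ := by
            gcongr
            exact_mod_cast hx2
        _ = x ^ (2 + τ) := by rw [Real.rpow_add hx0]
        _ ≤ _ := by gcongr; linarith
    have e5 : 1 / 2 * x ^ (4 * d * τ) ≤ θo * x ^ (4 * d * τ) := by gcongr; linarith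
    have e6 : 0 ≤ x ^ τ := by positivity
    linarith
  · calc 1 < x := by linarith
      _ = 1 * x := by ring
      _ ≤ C₁ * x := by gcongr

end Margins

/-! ### The Töplitz property of iterated brackets. -/

section ToeplitzIteration

variable {d b : ℕ} {n : Fin b → Fin d → ℤ} {τ₀ τ₁ τ : ℝ} {N J : ℕ}

lemma bracket_eq_zero_of_momentum {Φ Γ : Series n} {ξ : Fin b → ℝ}
    (hΦm : ∀ P : Mono n, P.momentum ≠ 0 → Φ P ξ = 0)
    (hΓm : ∀ P : Mono n, P.momentum ≠ 0 → Γ P ξ = 0) {P : Mono n} (hP : P.momentum ≠ 0) :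
    bracket Φ Γ P ξ = 0 := by
  unfold bracket
  rw [tsum_congr fun x : Fiber P => brTerm_eq_zero hΦm hΓm (by rw [x.2]; exact hP), tsum_zero]

/-- Iterated brackets keep the Töplitz property, as long as the margins allow it. -/
lemma toeplitzAt_iterate_bracket (h : Admissible (siteBound n) τ₀ τ₁ τ N d) {θ μ θ' μ' : ℝ}
    (hμ' : 1 / 2 ≤ μ') (hJ : J + 1 ≤ N) (hθ : 1 / 2 ≤ θ) (hμ : μ ≤ 4)
    (hθ' : θ + J * lossTheta (siteBound n) N d τ₀ μ' ≤ θ')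
    (hμJ : μ' + J * lossMu (siteBound n) N ≤ μ) {Φ Γ : Series n} {ξ : Fin b → ℝ}
    (hΦ : ToeplitzAt τ₁ N θ μ τ N Φ ξ) (hΓ : ToeplitzAt τ₁ N θ μ τ N Γ ξ)
    (hΦm : ∀ P : Mono n, P.momentum ≠ 0 → Φ P ξ = 0)
    (hΓm : ∀ P : Mono n, P.momentum ≠ 0 → Γ P ξ = 0)
    (hΦk : ∀ P : Mono n, N ≤ P.absK → Φ P ξ = 0) (hΓk : ∀ P : Mono n, N ≤ P.absK → Γ P ξ = 0)
    {i : ℕ} (hi : i ≤ J) :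
    ToeplitzAt τ₁ N (θ' - (J - i) * lossTheta (siteBound n) N d τ₀ μ')
        (μ' + (J - i) * lossMu (siteBound n) N) τ ((i + 1) * N) ((bracket Φ)^[i] Γ) ξ ∧
      (∀ P : Mono n, P.momentum ≠ 0 → ((bracket Φ)^[i] Γ) P ξ = 0) ∧
      ∀ P : Mono n, (i + 1) * N ≤ P.absK → ((bracket Φ)^[i] Γ) P ξ = 0 := by
  set ω := lossTheta (siteBound n) N d τ₀ μ' with hω
  set ν := lossMu (siteBound n) N with hν
  have hC0 := siteBound_nonneg n
  have hω0 : 0 ≤ ω := by rw [hω]; unfold lossTheta; positivity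
  have hν0 : 0 ≤ ν := by rw [hν]; unfold lossMu; positivity
  induction i with
  | zero =>
    simp only [Nat.cast_zero, sub_zero, zero_add, one_mul, Function.iterate_zero, id]
    exact ⟨hΓ.mono (by linarith) hμJ le_rfl, hΓm, hΓk⟩
  | succ i ih =>
    obtain ⟨h1, h2, h3⟩ := ih (by omega)
    have hiJ : (i : ℝ) + 1 ≤ J := by exact_mod_cast hi
    have hi0 : (0 : ℝ) ≤ i := Nat.cast_nonneg i
    rw [Function.iterate_succ_apply']
    push_cast
    have hJω : ((J : ℝ) - (i + 1)) * ω ≤ J * ω := by gcongr; linarith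
    have hJν : ((J : ℝ) - (i + 1)) * ν ≤ J * ν := by gcongr; linarith
    have hJν0 : 0 ≤ ((J : ℝ) - (i + 1)) * ν := mul_nonneg (by linarith) hν0
    have hiω : 0 ≤ (i : ℝ) * ω := mul_nonneg hi0 hω0
    have hiν : 0 ≤ (i : ℝ) * ν := mul_nonneg hi0 hν0
    have hNN : (0 : ℝ) ≤ N := Nat.cast_nonneg N
    -- The factor `Φ` meets low modes up to `(i + 1) N`, which costs `i + 1` losses. The new
    -- parameters lie `J - (i + 1)` losses above `μ'`, so this uses exactly the margin `J`.
    have hR₁ := relaxed_of_margin h hμ' hJ (q := i + 1) (θo := θ' - ((J : ℝ) - (i + 1)) * ω)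
      (μo := μ' + ((J : ℝ) - (i + 1)) * ν) (θ₁ := θ) (μ₁ := μ) (κ₁ := N) (κ₂ := (i + 1) * N)
      (by linarith) (by push_cast; exact le_rfl)
      (by nlinarith) (by linarith) (by linarith) (by nlinarith) (by nlinarith) hθ hμ
    have hR₂ := relaxed_of_margin h hμ' hJ (q := 1) (θo := θ' - ((J : ℝ) - (i + 1)) * ω)
      (μo := μ' + ((J : ℝ) - (i + 1)) * ν) (θ₁ := θ' - (J - i) * ω) (μ₁ := μ' + (J - i) * ν)
      (κ₁ := (i + 1) * N) (κ₂ := N)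
      le_rfl (by rw [one_mul]) (by push_cast; gcongr; linarith) (by linarith) (by linarith)
      (by linarith) (by linarith) (by nlinarith) (by nlinarith)
    -- Only the bound on displacements is taken from here, for the Fourier modes up to `(i + 2) N`
    -- of the new bracket.
    have hR₃ := relaxed_of_margin h hμ' hJ (q := 1) (θo := θ' - ((J : ℝ) - (i + 1)) * ω)
      (μo := μ' + ((J : ℝ) - (i + 1)) * ν) (θ₁ := θ' - (J - i) * ω) (μ₁ := μ' + (J - i) * ν)
      (κ₁ := (i + 1 + 1) * N) (κ₂ := N)
      le_rfl (by rw [one_mul]) (by push_cast; gcongr) (by linarith) (by linarith)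
      (by linarith) (by linarith) (by nlinarith) (by nlinarith)
    refine ⟨ToeplitzAt.bracket hR₁ hR₂ hR₃.disp hΦ h1 hΦm h2 hΦk h3, fun P hP => ?_,
      fun P hP => bracket_eq_zero_of_absK hΦk h3 (le_trans (le_of_eq (by ring)) hP)⟩
    exact bracket_eq_zero_of_momentum hΦm h2 hP

end ToeplitzIteration

/-! ### Piecewise Töplitz approximants of iterated brackets -/

section Approximants

variable {d b : ℕ} {n : Fin b → Fin d → ℤ} {O : Set (Fin b → ℝ)} {ρ : ℝ}
  {τ₀ τ₁ τ : ℝ} {N : ℕ} {θ μ : ℝ}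

open Classical in
/-- The truncation of `f` to `|k| < N`, with its bilinear part replaced by `F`. -/
def nearSeries (τ₁ : ℝ) (N : ℕ) (θ μ τ : ℝ) (F f : Series n) : Series n := fun P ξ =>
  if IsBilinear τ₁ N θ μ τ P then F P ξ else if P.absK < N then f P ξ else 0

lemma nearSeries_eq_zero {F f : Series n} {P : Mono n} (h : N ≤ P.absK) (ξ : Fin b → ℝ) :
    nearSeries τ₁ N θ μ τ F f P ξ = 0 := by
  have h1 : ¬ IsBilinear τ₁ N θ μ τ P := fun h' => absurd h'.absK_lt (not_lt.2 h)
  simp [nearSeries, h1, not_lt.2 h]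

lemma nearSeries_toeplitzAt {r s : ℝ} {F : Series n}
    (hF : IsPiecewiseToeplitz ρ O τ₁ r s N θ μ τ F) (f : Series n) {ξ : Fin b → ℝ} (hξ : ξ ∈ O) :
    ToeplitzAt τ₁ N θ μ τ N (nearSeries τ₁ N θ μ τ F f) ξ := by
  intro M σ m w σ' m' w' h
  have h1 := h.isBilinear
  have h2 := h.symm.isBilinear
  simp only [nearSeries, h1, h2, if_true]
  exact hF.toeplitzAt hξ _ _ _ _ _ _ _ h

lemma memA_nearSeries (hz : ∃ i, n i = 0) (hρ : 0 < ρ) (hO : IsOpen O) {r s : ℝ} {F f : Series n}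
    (hF : MemA ρ O r s F) (hf : MemA ρ O r s f) {T : ℝ≥0∞} (hFT : XNorm ρ O r s F ≤ T)
    (hfT : XNorm ρ O r s f ≤ T) : MemA ρ O r s (nearSeries τ₁ N θ μ τ F f) ∧
      XNorm ρ O r s (nearSeries τ₁ N θ μ τ F f) ≤ 2 * T := by
  classical
  have h1 := memA_restrict hz hρ hO (h := fun P ξ => if IsBilinear τ₁ N θ μ τ P then F P ξ else 0) hF
    fun M => by
      by_cases h : IsBilinear τ₁ N θ μ τ M
      · exact Or.inl fun ξ _ => by simp [h]
      · exact Or.inr fun ξ _ => by simp [h]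
  have h2 := memA_restrict hz hρ hO
    (h := fun P ξ => if ¬ IsBilinear τ₁ N θ μ τ P ∧ P.absK < N then f P ξ else 0) hf
    fun M => by
      by_cases h : ¬ IsBilinear τ₁ N θ μ τ M ∧ M.absK < N
      · exact Or.inl fun ξ _ => by simp only [h]; simp
      · exact Or.inr fun ξ _ => by simp only [h]; simp
  have h3 := memA_add hz hρ hO h1.1 h2.1
  have heq : nearSeries τ₁ N θ μ τ F f = (fun P ξ => if IsBilinear τ₁ N θ μ τ P then F P ξ else 0) +
      fun P ξ => if ¬ IsBilinear τ₁ N θ μ τ P ∧ P.absK < N then f P ξ else 0 := by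
    funext P ξ
    by_cases h : IsBilinear τ₁ N θ μ τ P <;> by_cases h' : P.absK < N <;>
      simp [nearSeries, h, h']
  rw [heq, two_mul]
  exact ⟨h3.1, h3.2.trans (add_le_add (h1.2.trans hFT) (h2.2.trans hfT))⟩

/-- The truncated series is close to `f` on a smaller domain. -/
lemma XNorm_sub_nearSeries_le (hz : ∃ i, n i = 0) (hρ : 0 < ρ) (hO : IsOpen O) {r s : ℝ}
    (hr : 0 < r) {F f : Series n} (hF : IsPiecewiseToeplitz ρ O τ₁ r s N θ μ τ F)
    (hf : MemA ρ O r s f) {T : ℝ≥0∞} (hfT : XNorm ρ O r s f ≤ T) {W : ℝ} (hW : 0 < W)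
    (hFT : XNorm ρ O r s (fun P ξ => (W : ℂ) * (bilinearPart τ₁ N θ μ τ f P ξ - F P ξ)) ≤ T)
    {η : ℝ} (hη : 0 ≤ η) (hηW : Real.exp (-(η * N)) * W ≤ 1) :
    XNorm ρ O r (s - η) (f - nearSeries τ₁ N θ μ τ F f) ≤ ENNReal.ofReal W⁻¹ * (2 * T) := by
  classical
  have hres : ∀ {f : Series n}, MemA ρ O r s f → MemA ρ O r (s - η) f ∧
      XNorm ρ O r (s - η) f ≤ XNorm ρ O r s f := by
    intro f hf
    have := memA_domain_mono hz hρ hO hr le_rfl (show s - η ≤ s by linarith) hf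
    simpa [div_self hr.ne'] using this
  have hsub := memA_sub hz hρ hO (memA_bilinearPart hz hρ hO hf τ₁ N θ μ τ).1 hF.1
  have h1 : XNorm ρ O r (s - η) (bilinearPart τ₁ N θ μ τ f - F) ≤ ENNReal.ofReal W⁻¹ * T := by
    have hm := (memA_const_mul hz hρ hO hsub (W : ℂ)).2
    have hWe : ‖(W : ℂ)‖ₑ = ENNReal.ofReal W := by
      rw [← ofReal_norm, Complex.norm_real, Real.norm_of_nonneg hW.le]
    refine (hres hsub).2.trans ?_
    rw [ENNReal.ofReal_inv_of_pos hW, mul_comm, ← div_eq_mul_inv, ENNReal.le_div_iff_mul_le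
      (Or.inl (by simpa using hW)) (Or.inl ENNReal.ofReal_ne_top), mul_comm, ← hWe, ← hm]
    exact hFT
  -- Outside the bilinear monomials, where the error is controlled by the quasi-Töplitz norm, the
  -- two series differ in the high Fourier modes only; there the loss `η` gains `exp (-(η N)) ≤
  -- W⁻¹`.
  set h : Series n := fun P ξ => if ¬ IsBilinear τ₁ N θ μ τ P ∧ N ≤ P.absK then f P ξ else 0 with hh
  have h2 := memA_restrict hz hρ hO (h := h) hf
    fun M => by
      by_cases hc : ¬ IsBilinear τ₁ N θ μ τ M ∧ N ≤ M.absK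
      · exact Or.inl fun ξ _ => by simp only [hh, hc]; simp
      · exact Or.inr fun ξ _ => by simp only [hh, hc]; simp
  have h3 : XNorm ρ O r (s - η) h ≤ ENNReal.ofReal W⁻¹ * T := by
    have huv : XNorm ρ O r (s - η) h ≤
        ENNReal.ofReal (Real.exp (-(η * N))) * XNorm ρ O r s h := by
      rw [XNorm_eq hz hρ hO h2.1.1, XNorm_eq hz hρ hO h2.1.1]
      refine fieldNorm_ultraviolet hη fun M hM => ?_
      have : h M = fun _ => 0 := by
        funext ξ
        simp [hh, not_le.2 hM]
      simp [coeffs, this]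
    refine huv.trans (mul_le_mul' (ENNReal.ofReal_le_ofReal ?_) (h2.2.trans hfT))
    rwa [← one_div, le_div_iff₀ hW]
  have hadd := memA_add hz hρ hO (hres hsub).1 (hres h2.1).1
  refine (memA_congr hz hρ hO hadd.1 fun M ξ hξ => ?_).2.trans (hadd.2.trans ?_)
  · by_cases hb : IsBilinear τ₁ N θ μ τ M
    · simp [nearSeries, bilinearPart, hh, hb]
    · have hF0 := hF.2.1 M hb ξ hξ
      by_cases hk : M.absK < N
      · simp [nearSeries, bilinearPart, hh, hb, hF0, hk]
      · simp [nearSeries, bilinearPart, hh, hb, hF0, hk, not_lt.1 hk]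
  · calc _ ≤ ENNReal.ofReal W⁻¹ * T + ENNReal.ofReal W⁻¹ * T := add_le_add h1 h3
      _ = _ := by ring

lemma bilinearPart_sub (f g : Series n) : bilinearPart τ₁ N θ μ τ (f - g) =
    bilinearPart τ₁ N θ μ τ f - bilinearPart τ₁ N θ μ τ g := by
  funext P ξ
  by_cases h : IsBilinear τ₁ N θ μ τ P <;> simp [bilinearPart, h]

/-- The approximant of an iterated bracket. -/
lemma exists_approximant (hz : ∃ i, n i = 0) (hρ : 0 < ρ) (hO : IsOpen O) {r s r' s' : ℝ}
    (hr' : 0 < r') (hr : r' < r) (hs' : 0 ≤ s') (hadm : Admissible (siteBound n) τ₀ τ₁ τ N d)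
    {θ' μ' : ℝ} (hμ' : 1 / 2 ≤ μ') {J : ℕ} (hJ0 : J ≠ 0) (hJ : J + 1 ≤ N) (hθ : 1 / 2 ≤ θ)
    (hμ : μ ≤ 4) (hθ' : θ + J * lossTheta (siteBound n) N d τ₀ μ' ≤ θ')
    (hμJ : μ' + J * lossMu (siteBound n) N ≤ μ) {f₁ f₂ F₁ F₂ : Series n}
    (hf₁ : MemA ρ O r s f₁) (hf₂ : MemA ρ O r s f₂)
    (hF₁ : IsPiecewiseToeplitz ρ O τ₁ r s N θ μ τ F₁)
    (hF₂ : IsPiecewiseToeplitz ρ O τ₁ r s N θ μ τ F₂) {T₁ T₂ : ℝ≥0∞}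
    (hf₁T : XNorm ρ O r s f₁ ≤ T₁) (hf₂T : XNorm ρ O r s f₂ ≤ T₂) (hF₁T : XNorm ρ O r s F₁ ≤ T₁)
    (hF₂T : XNorm ρ O r s F₂ ≤ T₂) {W : ℝ} (hW : 0 < W)
    (hW₁ : XNorm ρ O r s (fun P ξ => (W : ℂ) * (bilinearPart τ₁ N θ μ τ f₁ P ξ - F₁ P ξ)) ≤ T₁)
    (hW₂ : XNorm ρ O r s (fun P ξ => (W : ℂ) * (bilinearPart τ₁ N θ μ τ f₂ P ξ - F₂ P ξ)) ≤ T₂)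
    {η : ℝ} (hη : 0 ≤ η) (hηs : s' < s - η) (hηW : Real.exp (-(η * N)) * W ≤ 1) :
    ∃ G, IsPiecewiseToeplitz ρ O τ₁ r' s' N θ' μ' τ G ∧
      XNorm ρ O r' s' G ≤
        (ENNReal.ofReal (bracketConst r (s - η) r' s' * J) * (2 * T₁)) ^ J * (2 * T₂) ∧
      XNorm ρ O r' s' (fun P ξ => (W : ℂ) *
        (bilinearPart τ₁ N θ' μ' τ ((bracket f₁)^[J] f₂) P ξ - G P ξ)) ≤
        (J + 1) * ((ENNReal.ofReal (bracketConst r (s - η) r' s' * J) * (2 * T₁)) ^ J *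
          (2 * T₂)) := by
  have hr0 := hr'.trans hr
  set Φ₁ := nearSeries τ₁ N θ μ τ F₁ f₁ with hΦ₁
  set Φ₂ := nearSeries τ₁ N θ μ τ F₂ f₂ with hΦ₂
  have hres : ∀ {f : Series n}, MemA ρ O r s f → MemA ρ O r (s - η) f ∧
      XNorm ρ O r (s - η) f ≤ XNorm ρ O r s f := by
    intro f hf
    have := memA_domain_mono hz hρ hO hr0 le_rfl (show s - η ≤ s by linarith) hf
    simpa [div_self hr0.ne'] using this
  have a1 := memA_nearSeries (τ₁ := τ₁) (N := N) (θ := θ) (μ := μ) (τ := τ) hz hρ hO hF₁.1 hf₁ hF₁T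
    hf₁T
  have a2 := memA_nearSeries (τ₁ := τ₁) (N := N) (θ := θ) (μ := μ) (τ := τ) hz hρ hO hF₂.1 hf₂ hF₂T
    hf₂T
  rw [← hΦ₁] at a1
  rw [← hΦ₂] at a2
  have e1 := XNorm_sub_nearSeries_le hz hρ hO hr0 hF₁ hf₁ hf₁T hW hW₁ hη hηW
  have e2 := XNorm_sub_nearSeries_le hz hρ hO hr0 hF₂ hf₂ hf₂T hW hW₂ hη hηW
  have hT1 : T₁ ≤ 2 * T₁ := le_mul_of_one_le_left' one_le_two
  have hfT : XNorm ρ O r (s - η) f₁ ≤ 2 * T₁ := ((hres hf₁).2.trans hf₁T).trans hT1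
  have b1 := XNorm_iterate_bracket hz hρ hO hr' hr hs' hηs J (hres a1.1).1 (hres a2.1).1
    ((hres a1.1).2.trans a1.2) ((hres a2.1).2.trans a2.2) le_rfl
  have b2 := XNorm_iterate_bracket hz hρ hO hr' hr hs' hηs J (hres hf₁).1 (hres hf₂).1
    hfT le_rfl le_rfl
  have b3 := XNorm_iterate_bracket_sub hz hρ hO hr' hr hs' hηs J (hres hf₁).1 (hres hf₂).1
    (hres a1.1).1 (hres a2.1).1 hfT ((hres a1.1).2.trans a1.2) ((hres a2.1).2.trans a2.2) e1 e2
    le_rfl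
  rw [interp_self _ _ hJ0, interp_self _ _ hJ0] at b1 b2 b3
  have hbil := memA_bilinearPart hz hρ hO b1.1 τ₁ N θ' μ' τ
  have hJ1 : (1 : ℝ) ≤ J := by exact_mod_cast Nat.one_le_iff_ne_zero.2 hJ0
  have hω0 : 0 ≤ lossTheta (siteBound n) N d τ₀ μ' := by
    have := siteBound_nonneg n
    unfold lossTheta
    positivity
  have hν0 : 0 ≤ lossMu (siteBound n) N := by
    have := siteBound_nonneg n
    unfold lossMu
    positivity
  have hωJ := le_mul_of_one_le_left hω0 hJ1
  have hνJ := le_mul_of_one_le_left hν0 hJ1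
  have hR := relaxed_of_margin hadm hμ' hJ (q := 1) (θo := θ') (μo := μ') (θ₁ := θ) (μ₁ := μ)
    (κ₁ := N) (κ₂ := N) le_rfl (by rw [one_mul])
    (le_mul_of_one_le_left (Nat.cast_nonneg N) (by linarith)) le_rfl (by linarith) (by linarith)
    (by linarith) hθ hμ
  -- The full iterated bracket of the modified series has the Töplitz property; it is projected only
  -- at the end, since brackets of bilinear parts alone would miss contributions from the other
  -- monomials.
  refine ⟨bilinearPart τ₁ N θ' μ' τ ((bracket Φ₁)^[J] Φ₂), ?_, hbil.2.trans b1.2, ?_⟩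
  · refine isPiecewiseToeplitz_bilinearPart hR.disp ?_ (fun ξ hξ => ?_) hbil.1
    · refine le_trans ?_ hR.sep
      gcongr
      exact hR.le_μ
    · have h3 := (toeplitzAt_iterate_bracket hadm hμ' hJ hθ hμ hθ' hμJ
        (nearSeries_toeplitzAt hF₁ f₁ hξ) (nearSeries_toeplitzAt hF₂ f₂ hξ)
        (fun P hP => a1.1.2.1 P hP ξ hξ) (fun P hP => a2.1.2.1 P hP ξ hξ)
        (fun P hP => nearSeries_eq_zero hP ξ) (fun P hP => nearSeries_eq_zero hP ξ) le_rfl).1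
      rw [sub_self, zero_mul, zero_mul, sub_zero, add_zero] at h3
      exact h3.mono le_rfl le_rfl (Nat.le_mul_of_pos_left N (Nat.succ_pos J))
  · have hsub := memA_sub hz hρ hO b2.1 b1.1
    have hbs := memA_bilinearPart hz hρ hO hsub τ₁ N θ' μ' τ
    have hc := memA_const_mul hz hρ hO hbs.1 (W : ℂ)
    rw [bilinearPart_sub] at hc hbs
    refine hc.2.le.trans ?_
    have hWe : ‖(W : ℂ)‖ₑ = ENNReal.ofReal W := by
      rw [← ofReal_norm, Complex.norm_real, Real.norm_of_nonneg hW.le]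
    rw [hWe]
    refine (mul_le_mul_right (hbs.2.trans b3) _).trans_eq ?_
    have hWW : ENNReal.ofReal W * ENNReal.ofReal W⁻¹ = 1 := by
      rw [← ENNReal.ofReal_mul hW.le, mul_inv_cancel₀ hW.ne', ENNReal.ofReal_one]
    rw [← mul_assoc, mul_left_comm (ENNReal.ofReal W), hWW, mul_one]

end Approximants

/-! ### Sums of series -/

section SeriesSums

variable {d b : ℕ} {n : Fin b → Fin d → ℤ} {O : Set (Fin b → ℝ)} {ρ r s : ℝ}

lemma XNorm_le_tsum (hz : ∃ i, n i = 0) (hρ : 0 < ρ) (hO : IsOpen O) {ι : Type*} {a : ι → Series n}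
    {h : Series n} (ha : ∀ i M, ContDiffOn ℝ 1 (a i M) O) (hh : ∀ M, ContDiffOn ℝ 1 (h M) O)
    (heq : ∀ M, ∀ ξ ∈ O, h M ξ = ∑' i, a i M ξ) :
    XNorm ρ O r s h ≤ ∑' i, XNorm ρ O r s (a i) := by
  rw [XNorm_eq hz hρ hO hh, tsum_congr fun i => XNorm_eq hz hρ hO (ha i)]
  refine le_trans (fieldNorm_mono fun M => ?_) (fieldNorm_tsum_le fun i => coeffs O (a i))
  by_cases hfin : ∑' i, coeffs O (a i) M = ⊤
  · rw [hfin]; exact le_top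
  · unfold coeffs
    rw [coeffNorm_congr hO (heq M)]
    exact (contDiffOn_tsum_coeff hO (fun i => ha i M) hfin).2

/-- Sums of sequences in `𝒜_{r,s}`. -/
lemma exists_hasSum_series (hz : ∃ i, n i = 0) (hρ : 0 < ρ) (hO : IsOpen O) (hr : 0 < r)
    {a : ℕ → Series n} (ha : ∀ j, MemA ρ O r s (a j)) (hX : ∑' j, XNorm ρ O r s (a j) ≠ ⊤)
    (hpair : ∀ ζ ζ' : NormalSite n → ℝ≥0∞, InBall ρ r ζ → InBall ρ r ζ' →
      ∑' j, pair (coeffs O (a (j + 1))) (domWeight r s ζ ζ') ≠ ⊤) :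
    ∃ g, MemA ρ O r s g ∧ (∀ M, ∀ ξ ∈ O, HasSum (fun j => a j M ξ) (g M ξ)) ∧
      ∀ ξ ∈ O, ∀ x ∈ domain n ρ r s, HasSum (fun j => (a j).eval ξ x) (g.eval ξ x) := by
  have hfin : ∀ M, ∑' j, coeffNorm O (a (j + 1) M) ≠ ⊤ := by
    intro M
    obtain ⟨ζ, hζ, hb⟩ := exists_pos_inBall (n := n) hz hρ hr
    have h1 := hpair ζ ζ hb hb
    have h2 : (∑' j, coeffNorm O (a (j + 1) M)) * domWeight r s ζ ζ M ≤
        ∑' j, pair (coeffs O (a (j + 1))) (domWeight r s ζ ζ) := by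
      rw [← ENNReal.tsum_mul_right]
      exact ENNReal.tsum_le_tsum fun j =>
        ENNReal.le_tsum (f := fun M => coeffs O (a (j + 1)) M * domWeight r s ζ ζ M) M
    intro ht
    rw [ht, ENNReal.top_mul (domWeight_ne_zero hr hζ hζ M)] at h2
    exact h1 (top_le_iff.1 h2)
  -- The first term is kept apart: `XNorm` does not control constant terms, and the full majorant
  -- bound `hpair` is available from the second term on only.
  set h : Series n := fun M ξ => ∑' j, a (j + 1) M ξ with hh
  have hC : ∀ M, ContDiffOn ℝ 1 (h M) O := fun M =>
    (contDiffOn_tsum_coeff hO (fun j => (ha (j + 1)).1 M) (hfin M)).1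
  have hsum : ∀ M, ∀ ξ ∈ O, HasSum (fun j => a (j + 1) M ξ) (h M ξ) := by
    intro M ξ hξ
    refine (Summable.of_norm (summable_of_tsum_enorm (ne_top_of_le_ne_top (hfin M) ?_))).hasSum
    exact ENNReal.tsum_le_tsum fun j => enorm_le_coeffNorm hξ
  have hg : ∀ M, ∀ ξ ∈ O, HasSum (fun j => a j M ξ) ((a 0 + h) M ξ) := by
    intro M ξ hξ
    rw [← hasSum_nat_add_iff' 1]
    simpa using hsum M ξ hξ
  have hgC : ∀ M, ContDiffOn ℝ 1 ((a 0 + h) M) O := fun M => ((ha 0).1 M).add (hC M)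
  refine ⟨a 0 + h, ⟨hgC, fun M hM ξ hξ => ?_, ?_⟩, hg, fun ξ hξ x hx => ?_⟩
  · rw [← (hg M ξ hξ).tsum_eq, tsum_congr fun j => (ha j).2.1 M hM ξ hξ, tsum_zero]
  · exact (XNorm_le_tsum hz hρ hO (fun j => (ha j).1) hgC
      fun M ξ hξ => (hg M ξ hξ).tsum_eq.symm).trans_lt (lt_top_iff_ne_top.2 hX)
  · set U : ℕ × Mono n → ℂ := fun p => a (p.1 + 1) p.2 ξ * p.2.eval x with hU
    have hUs : Summable U := by
      refine Summable.of_norm (summable_of_tsum_enorm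
        (ne_top_of_le_ne_top (hpair _ _ hx.2.2.1 hx.2.2.2) ?_))
      rw [ENNReal.tsum_prod']
      refine ENNReal.tsum_le_tsum fun j => ENNReal.tsum_le_tsum fun M => ?_
      rw [hU, enorm_mul]
      exact mul_le_mul' (enorm_le_coeffNorm hξ) (enorm_eval_le (mem_polydisc_of_mem_domain hx) M)
    have hUs' : Summable fun p : Mono n × ℕ => U p.swap := hUs.prod_symm
    have hterm : ∀ M, h M ξ * M.eval x = ∑' j, U (j, M) := by
      intro M
      rw [hU]
      simp only
      rw [tsum_mul_right]
    have hhs : Summable fun M => h M ξ * M.eval x := by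
      simp_rw [hterm]
      exact hUs'.prod
    rw [← hasSum_nat_add_iff' 1]
    have heval : (a 0 + h).eval ξ x = (a 0).eval ξ x + h.eval ξ x := by
      unfold Series.eval
      rw [← (summable_eval hz hρ hr ((memA_iff hz hρ hO).1 (ha 0)).2.2 hξ hx).tsum_add hhs]
      exact tsum_congr fun M => by simp [add_mul]
    rw [heval]
    simp only [Finset.range_one, Finset.sum_singleton, add_sub_cancel_left]
    have hval : h.eval ξ x = ∑' j, (a (j + 1)).eval ξ x := by
      unfold Series.eval
      refine (tsum_congr hterm).trans ?_
      exact Summable.tsum_comm (f := fun j M => U (j, M)) hUs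
    rw [hval]
    exact hUs.prod.hasSum

variable {τ₁ : ℝ} {N : ℕ} {θ μ τ : ℝ}

lemma isPiecewiseToeplitz_zero (hz : ∃ i, n i = 0) (hρ : 0 < ρ) (hO : IsOpen O) :
    IsPiecewiseToeplitz ρ O τ₁ r s N θ μ τ (0 : Series n) :=
  ⟨(memA_zero hz hρ hO).1, fun _ _ _ _ => rfl, 0, fun _ _ _ _ _ _ _ _ _ => rfl⟩

lemma IsPiecewiseToeplitz.const_mul (hz : ∃ i, n i = 0) (hρ : 0 < ρ) (hO : IsOpen O)
    {F : Series n} (hF : IsPiecewiseToeplitz ρ O τ₁ r s N θ μ τ F) (c : ℂ) :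
    IsPiecewiseToeplitz ρ O τ₁ r s N θ μ τ (fun P ξ => c * F P ξ) := by
  obtain ⟨h1, h2, g, hg⟩ := hF
  refine ⟨(memA_const_mul hz hρ hO h1 c).1, fun P hP ξ hξ => by simp [h2 P hP ξ hξ],
    fun M σ σ' p A ξ => c * g M σ σ' p A ξ, fun M σ m σ' m' A h ξ hξ => ?_⟩
  simp only
  rw [hg M σ m σ' m' A h ξ hξ]

lemma IsPiecewiseToeplitz.sum (hz : ∃ i, n i = 0) (hρ : 0 < ρ) (hO : IsOpen O) {ι : Type*}
    (S : Finset ι) {F : ι → Series n}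
    (hF : ∀ i ∈ S, IsPiecewiseToeplitz ρ O τ₁ r s N θ μ τ (F i)) :
    IsPiecewiseToeplitz ρ O τ₁ r s N θ μ τ (∑ i ∈ S, F i) := by
  classical
  induction S using Finset.induction_on with
  | empty => simpa using isPiecewiseToeplitz_zero hz hρ hO
  | insert a S ha ih =>
    rw [Finset.sum_insert ha]
    obtain ⟨h1, h2, g, hg⟩ := ih fun i hi => hF i (Finset.mem_insert_of_mem hi)
    obtain ⟨h1', h2', g', hg'⟩ := hF a (Finset.mem_insert_self a S)
    refine ⟨(memA_add hz hρ hO h1' h1).1, fun P hP ξ hξ => ?_,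
      fun M σ σ' p A ξ => g' M σ σ' p A ξ + g M σ σ' p A ξ, fun M σ m σ' m' A h ξ hξ => ?_⟩
    · rw [Pi.add_apply, Pi.add_apply, h2 P hP ξ hξ, h2' P hP ξ hξ, add_zero]
    · simp only [Pi.add_apply]
      rw [hg M σ m σ' m' A h ξ hξ, hg' M σ m σ' m' A h ξ hξ]

/-- Termwise approximation of the sum of a series of functions. -/
lemma exists_approximant_of_hasSum (hz : ∃ i, n i = 0) (hρ : 0 < ρ) (hO : IsOpen O)
    {a G : ℕ → Series n} {g : Series n} (ha : ∀ j, MemA ρ O r s (a j)) (hg : MemA ρ O r s g)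
    (hsum : ∀ M, ∀ ξ ∈ O, HasSum (fun j => a j M ξ) (g M ξ))
    (hG : ∀ j, IsPiecewiseToeplitz ρ O τ₁ r s N θ μ τ (G j)) {J : ℕ} (hJ : ∀ j, J < j → G j = 0)
    {W : ℝ} {B : ℕ → ℝ≥0∞} (h1 : ∀ j, XNorm ρ O r s (a j) ≤ B j)
    (h2 : ∀ j, XNorm ρ O r s (G j) ≤ B j)
    (h3 : ∀ j, XNorm ρ O r s (fun P ξ => (W : ℂ) * (bilinearPart τ₁ N θ μ τ (a j) P ξ - G j P ξ)) ≤
      B j) :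
    ∃ F, IsPiecewiseToeplitz ρ O τ₁ r s N θ μ τ F ∧
      max (XNorm ρ O r s g) (max (XNorm ρ O r s F)
        (XNorm ρ O r s fun P ξ => (W : ℂ) * (bilinearPart τ₁ N θ μ τ g P ξ - F P ξ))) ≤
        ∑' j, B j := by
  set F : Series n := ∑ j ∈ Finset.range (J + 1), G j with hF
  have hPT := IsPiecewiseToeplitz.sum hz hρ hO (Finset.range (J + 1)) fun j _ => hG j
  refine ⟨F, hPT, max_le ?_ (max_le ?_ ?_)⟩
  · exact (XNorm_le_tsum hz hρ hO (fun j => (ha j).1) hg.1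
      fun M ξ hξ => (hsum M ξ hξ).tsum_eq.symm).trans (ENNReal.tsum_le_tsum h1)
  · refine (memA_sum hz hρ hO _ fun j _ => (hG j).1).2.trans ?_
    exact (Finset.sum_le_sum fun j _ => h2 j).trans (ENNReal.sum_le_tsum _)
  · have hmem : ∀ j, MemA ρ O r s
        (fun P ξ => (W : ℂ) * (bilinearPart τ₁ N θ μ τ (a j) P ξ - G j P ξ)) := fun j =>
      (memA_const_mul hz hρ hO (memA_sub hz hρ hO
        (memA_bilinearPart hz hρ hO (ha j) τ₁ N θ μ τ).1 (hG j).1) (W : ℂ)).1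
    have hmem' : MemA ρ O r s (fun P ξ => (W : ℂ) * (bilinearPart τ₁ N θ μ τ g P ξ - F P ξ)) :=
      (memA_const_mul hz hρ hO (memA_sub hz hρ hO
        (memA_bilinearPart hz hρ hO hg τ₁ N θ μ τ).1 hPT.1) (W : ℂ)).1
    refine (XNorm_le_tsum hz hρ hO (fun j => (hmem j).1) hmem'.1 fun M ξ hξ => ?_).trans
      (ENNReal.tsum_le_tsum h3)
    have hs1 : HasSum (fun j => bilinearPart τ₁ N θ μ τ (a j) M ξ)
        (bilinearPart τ₁ N θ μ τ g M ξ) := by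
      by_cases hb : IsBilinear τ₁ N θ μ τ M
      · simpa [bilinearPart, hb] using hsum M ξ hξ
      · simp [bilinearPart, hb]
    have hs2 : HasSum (fun j => G j M ξ) (F M ξ) := by
      have : F M ξ = ∑ j ∈ Finset.range (J + 1), G j M ξ := by
        rw [hF]
        simp [Finset.sum_apply]
      rw [this]
      refine hasSum_sum_of_ne_finset_zero fun j hj => ?_
      rw [hJ j (by simpa using hj)]
      rfl
    exact ((hs1.sub hs2).mul_left (W : ℂ)).tsum_eq.symm

end SeriesSums

/-! ### Quantitative form of the approximation -/

section Scaled

variable {d b : ℕ} {n : Fin b → Fin d → ℤ} {O : Set (Fin b → ℝ)} {ρ : ℝ}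
  {τ₀ τ₁ τ : ℝ} {N : ℕ} {θ μ : ℝ}

/-- By `J^J / J! ≤ e^J`, the factorial of the Lie series absorbs the factor `J` that each bracket
loses on a scale of `J` domains. -/
lemma ofReal_inv_factorial_mul_pow_le {β : ℝ} (hβ : 0 ≤ β) (J : ℕ) (T : ℝ≥0∞) :
    ENNReal.ofReal (1 / J.factorial) * (ENNReal.ofReal (β * J) * T) ^ J ≤
      (ENNReal.ofReal (Real.exp 1 * β) * T) ^ J := by
  rw [mul_pow, mul_pow, ← mul_assoc, ← ENNReal.ofReal_pow (by positivity),
    ← ENNReal.ofReal_pow (by positivity), ← ENNReal.ofReal_mul (by positivity)]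
  gcongr ENNReal.ofReal ?_ * _
  have h := Real.pow_div_factorial_le_exp (J : ℝ) (Nat.cast_nonneg J) J
  calc 1 / (J.factorial : ℝ) * (β * J) ^ J = (J : ℝ) ^ J / J.factorial * β ^ J := by
        rw [mul_pow]; ring
    _ ≤ Real.exp J * β ^ J := by gcongr
    _ = (Real.exp 1 * β) ^ J := by rw [mul_pow, ← Real.exp_nat_mul, mul_one]

/-- `F` is a piecewise Töplitz approximant of `f` with error `T / W`. -/
structure Approximates (ρ : ℝ) (O : Set (Fin b → ℝ)) (τ₁ r s : ℝ) (N : ℕ) (θ μ τ W : ℝ)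
    (f F : Series n) (T : ℝ≥0∞) : Prop where
  toeplitz : IsPiecewiseToeplitz ρ O τ₁ r s N θ μ τ F
  left_le : XNorm ρ O r s f ≤ T
  right_le : XNorm ρ O r s F ≤ T
  error_le : XNorm ρ O r s (fun P ξ => (W : ℂ) * (bilinearPart τ₁ N θ μ τ f P ξ - F P ξ)) ≤ T

lemma bilinearPart_const_mul (c : ℂ) (f : Series n) :
    bilinearPart τ₁ N θ μ τ (fun P ξ => c * f P ξ) = fun P ξ => c * bilinearPart τ₁ N θ μ τ f P ξ := by
  funext P ξ
  by_cases h : IsBilinear τ₁ N θ μ τ P <;> simp [bilinearPart, h]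

lemma two_mul_succ_le_four_pow {J : ℕ} (hJ : J ≠ 0) : (J + 1) * 2 ≤ 4 ^ J := by
  obtain ⟨k, rfl⟩ := Nat.exists_eq_succ_of_ne_zero hJ
  clear hJ
  induction k with
  | zero => norm_num
  | succ k ih =>
    rw [pow_succ]
    simp only [Nat.succ_eq_add_one] at *
    omega

/-- The terms of the Lie series. -/
lemma XNorm_scaled_iterate_le (hz : ∃ i, n i = 0) (hρ : 0 < ρ) (hO : IsOpen O) {r s r' s' : ℝ}
    (hr' : 0 < r') (hr : r' < r) (hs' : 0 ≤ s') (hs : s' < s) {J : ℕ} (hJ0 : J ≠ 0)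
    {f₁ f₂ : Series n} (hf₁ : MemA ρ O r s f₁) (hf₂ : MemA ρ O r s f₂) {T₁ T₂ : ℝ≥0∞}
    (hf₁T : XNorm ρ O r s f₁ ≤ T₁) (hf₂T : XNorm ρ O r s f₂ ≤ T₂) {c : ℂ}
    (hc : ‖c‖ₑ ≤ ENNReal.ofReal (1 / J.factorial)) :
    MemA ρ O r' s' (fun P ξ => c * (bracket f₁)^[J] f₂ P ξ) ∧
    XNorm ρ O r' s' (fun P ξ => c * (bracket f₁)^[J] f₂ P ξ) ≤
      (ENNReal.ofReal (Real.exp 1 * bracketConst r s r' s') * T₁) ^ J * T₂ := by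
  have h := XNorm_iterate_bracket hz hρ hO hr' hr hs' hs J hf₁ hf₂ hf₁T hf₂T le_rfl
  rw [interp_self _ _ hJ0, interp_self _ _ hJ0] at h
  have h' := memA_const_mul hz hρ hO h.1 c
  refine ⟨h'.1, h'.2.le.trans ((mul_le_mul' hc h.2).trans ?_)⟩
  rw [← mul_assoc]
  gcongr ?_ * _
  exact ofReal_inv_factorial_mul_pow_le (bracketConst_pos hr' hr hs).le J T₁

/-- The factor `8` is `2 · 4`: replacing the bilinear part may double the norms, and the count of
errors satisfies `2 (J + 1) ≤ 4^J`. -/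
lemma exists_scaled_approximant (hz : ∃ i, n i = 0) (hρ : 0 < ρ) (hO : IsOpen O) {r s r' s' : ℝ}
    (hr' : 0 < r') (hr : r' < r) (hs' : 0 ≤ s') (hadm : Admissible (siteBound n) τ₀ τ₁ τ N d)
    {θ' μ' : ℝ} (hμ' : 1 / 2 ≤ μ') {J : ℕ} (hJ0 : J ≠ 0) (hJ : J + 1 ≤ N) (hθ : 1 / 2 ≤ θ)
    (hμ : μ ≤ 4) (hθ' : θ + J * lossTheta (siteBound n) N d τ₀ μ' ≤ θ')
    (hμJ : μ' + J * lossMu (siteBound n) N ≤ μ) {f₁ f₂ F₁ F₂ : Series n}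
    (hf₁ : MemA ρ O r s f₁) (hf₂ : MemA ρ O r s f₂) {T₁ T₂ : ℝ≥0∞} {W : ℝ} (hW : 0 < W)
    (h₁ : Approximates ρ O τ₁ r s N θ μ τ W f₁ F₁ T₁)
    (h₂ : Approximates ρ O τ₁ r s N θ μ τ W f₂ F₂ T₂)
    {η : ℝ} (hη : 0 ≤ η) (hηs : s' < s - η) (hηW : Real.exp (-(η * N)) * W ≤ 1) {c : ℂ}
    (hc : ‖c‖ₑ ≤ ENNReal.ofReal (1 / J.factorial)) :
    ∃ G, Approximates ρ O τ₁ r' s' N θ' μ' τ W (fun P ξ => c * (bracket f₁)^[J] f₂ P ξ) G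
      ((ENNReal.ofReal (8 * (Real.exp 1 * bracketConst r (s - η) r' s')) * T₁) ^ J * T₂) := by
  have hr0 := hr'.trans hr
  set β := bracketConst r (s - η) r' s' with hβ
  have hβ0 : 0 < β := bracketConst_pos hr' hr hηs
  obtain ⟨G, hG, hG1, hG2⟩ := exists_approximant hz hρ hO hr' hr hs' hadm hμ' hJ0 hJ hθ hμ hθ' hμJ
    hf₁ hf₂ h₁.toeplitz h₂.toeplitz h₁.left_le h₂.left_le h₁.right_le h₂.right_le hW h₁.error_le
    h₂.error_le hη hηs hηW
  rw [← hβ] at hG1 hG2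
  have hfac := ofReal_inv_factorial_mul_pow_le hβ0.le J (2 * T₁)
  have h8 : ENNReal.ofReal (8 * (Real.exp 1 * β)) * T₁ =
      4 * (ENNReal.ofReal (Real.exp 1 * β) * (2 * T₁)) := by
    rw [ENNReal.ofReal_mul (by norm_num), ENNReal.ofReal_ofNat]
    ring
  set X := ENNReal.ofReal (Real.exp 1 * β) * (2 * T₁) with hX
  have key : (J + 1) * (X ^ J * (2 * T₂)) ≤
      (ENNReal.ofReal (8 * (Real.exp 1 * β)) * T₁) ^ J * T₂ := by
    have h4 : ((J : ℝ≥0∞) + 1) * 2 ≤ 4 ^ J := by exact_mod_cast two_mul_succ_le_four_pow hJ0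
    rw [h8, mul_pow 4 X]
    calc (J + 1) * (X ^ J * (2 * T₂)) = ((J : ℝ≥0∞) + 1) * 2 * (X ^ J * T₂) := by ring
      _ ≤ 4 ^ J * (X ^ J * T₂) := by gcongr
      _ = _ := by ring
  have key' : X ^ J * (2 * T₂) ≤ (ENNReal.ofReal (8 * (Real.exp 1 * β)) * T₁) ^ J * T₂ :=
    le_trans (le_mul_of_one_le_left' le_add_self) key
  have hres : ∀ {f : Series n}, MemA ρ O r s f → MemA ρ O r (s - η) f ∧
      XNorm ρ O r (s - η) f ≤ XNorm ρ O r s f := by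
    intro f hf
    have := memA_domain_mono hz hρ hO hr0 le_rfl (show s - η ≤ s by linarith) hf
    simpa [div_self hr0.ne'] using this
  have hX1 := XNorm_scaled_iterate_le hz hρ hO hr' hr hs' hηs hJ0 (hres hf₁).1 (hres hf₂).1
    ((hres hf₁).2.trans h₁.left_le) ((hres hf₂).2.trans h₂.left_le) hc
  rw [← hβ] at hX1
  have hone : (1 : ℝ≥0∞) ≤ 2 := one_le_two
  refine ⟨fun P ξ => c * G P ξ, hG.const_mul hz hρ hO c, ?_, ?_, ?_⟩
  · refine hX1.2.trans (le_trans ?_ key')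
    gcongr
    · rw [hX]
      gcongr
      exact le_mul_of_one_le_left' hone
    · exact le_mul_of_one_le_left' hone
  · refine (memA_const_mul hz hρ hO hG.1 c).2.le.trans ((mul_le_mul' hc hG1).trans ?_)
    rw [← mul_assoc]
    exact (mul_le_mul_left hfac _).trans key'
  · have hb : MemA ρ O r' s' ((bracket f₁)^[J] f₂) := by
      have := (XNorm_iterate_bracket hz hρ hO hr' hr hs' hηs J (hres hf₁).1 (hres hf₂).1
        le_rfl le_rfl le_rfl).1
      rwa [interp_self _ _ hJ0, interp_self _ _ hJ0] at this
    have hE := (memA_const_mul hz hρ hO (memA_sub hz hρ hO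
      (memA_bilinearPart hz hρ hO hb τ₁ N θ' μ' τ).1 hG.1) (W : ℂ)).1
    have heq : (fun P ξ => (W : ℂ) * (bilinearPart τ₁ N θ' μ' τ
        (fun P ξ => c * (bracket f₁)^[J] f₂ P ξ) P ξ - c * G P ξ)) = fun P ξ => c * ((W : ℂ) *
        (bilinearPart τ₁ N θ' μ' τ ((bracket f₁)^[J] f₂) P ξ - G P ξ)) := by
      rw [bilinearPart_const_mul]
      funext P ξ
      ring
    rw [heq]
    refine (memA_const_mul hz hρ hO hE c).2.le.trans ((mul_le_mul' hc hG2).trans ?_)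
    rw [mul_left_comm, ← mul_assoc (ENNReal.ofReal _)]
    refine le_trans ?_ key
    gcongr

/-- Approximation by zero of the high terms of the Lie series. -/
lemma approximates_zero (hz : ∃ i, n i = 0) (hρ : 0 < ρ) (hO : IsOpen O) {r s : ℝ} {f : Series n}
    (hf : MemA ρ O r s f) {W : ℝ} (hW : 1 ≤ W) {T : ℝ≥0∞}
    (hT : ENNReal.ofReal W * XNorm ρ O r s f ≤ T) :
    Approximates ρ O τ₁ r s N θ μ τ W f 0 T := by
  have hW1 : (1 : ℝ≥0∞) ≤ ENNReal.ofReal W := by simpa using ENNReal.ofReal_le_ofReal hW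
  have hb := memA_bilinearPart hz hρ hO hf τ₁ N θ μ τ
  refine ⟨isPiecewiseToeplitz_zero hz hρ hO, (le_mul_of_one_le_left' hW1).trans hT, ?_, ?_⟩
  · rw [(memA_zero hz hρ hO).2]; exact bot_le
  · have heq : (fun P ξ => (W : ℂ) * (bilinearPart τ₁ N θ μ τ f P ξ - (0 : Series n) P ξ)) =
        fun P ξ => (W : ℂ) * bilinearPart τ₁ N θ μ τ f P ξ := by
      funext P ξ
      simp
    have hWe : ‖(W : ℂ)‖ₑ = ENNReal.ofReal W := by
      rw [← ofReal_norm, Complex.norm_real, Real.norm_of_nonneg (by linarith)]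
    rw [heq, (memA_const_mul hz hρ hO hb.1 (W : ℂ)).2, hWe]
    exact (mul_le_mul_right hb.2 _).trans hT

/-- Restriction of an approximant to a smaller domain and stronger parameters. -/
lemma Approximates.restrict (hz : ∃ i, n i = 0) (hρ : 0 < ρ) (hO : IsOpen O) {r s r' s' : ℝ}
    (hr' : 0 < r') (hr : r' ≤ r) (hs : s' ≤ s) {θ' μ' : ℝ} (hθ : θ ≤ θ') (hμ : μ' ≤ μ)
    {f F : Series n} (hf : MemA ρ O r s f) {W : ℝ} {T : ℝ≥0∞}
    (h : Approximates ρ O τ₁ r s N θ μ τ W f F T) :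
    Approximates ρ O τ₁ r' s' N θ' μ' τ W f (bilinearPart τ₁ N θ' μ' τ F)
      (ENNReal.ofReal ((r / r') ^ 2) * T) := by
  have hF := h.toeplitz.1
  have hF' := memA_domain_mono hz hρ hO hr' hr hs hF
  have hFb := memA_bilinearPart hz hρ hO hF'.1 τ₁ N θ' μ' τ
  refine ⟨h.toeplitz.bilinearPart hθ hμ hFb.1,
    (memA_domain_mono hz hρ hO hr' hr hs hf).2.trans (mul_le_mul_right h.left_le _),
    hFb.2.trans (hF'.2.trans (mul_le_mul_right h.right_le _)), ?_⟩
  have hE := (memA_const_mul hz hρ hO (memA_sub hz hρ hO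
    (memA_bilinearPart hz hρ hO hf τ₁ N θ μ τ).1 hF) (W : ℂ)).1
  have hE' := memA_domain_mono hz hρ hO hr' hr hs hE
  refine (memA_restrict hz hρ hO hE'.1 fun M => ?_).2.trans
    (hE'.2.trans (mul_le_mul_right h.error_le _))
  by_cases hb : IsBilinear τ₁ N θ' μ' τ M
  · have hb' := hb.mono hθ hμ
    exact Or.inl fun ξ _ => by simp [bilinearPart, hb, hb']
  · exact Or.inr fun ξ _ => by simp [bilinearPart, hb]

end Scaled

/-! ### Approximants supplied by the quasi-Töplitz norm. -/

section QuasiToeplitzNorm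

variable {d b : ℕ} {n : Fin b → Fin d → ℤ} {O : Set (Fin b → ℝ)} {ρ τ₀ r s K θ μ : ℝ}

lemma exists_approximates_of_lt {f : Series n} {T : ℝ≥0∞} (h : qtNorm ρ O τ₀ r s K θ μ f < T)
    {N : ℕ} (hN : K ≤ N) {τ : ℝ} (hτ : τ₀ ≤ τ ∧ τ ≤ tauOne d τ₀ / (4 * d)) :
    ∃ F, Approximates ρ O (tauOne d τ₀) r s N θ μ τ ((N : ℝ) ^ (4 * d * τ)) f F T := by
  have h1 : (⨅ (F : Series n) (_ : IsPiecewiseToeplitz ρ O (tauOne d τ₀) r s N θ μ τ F),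
      max (XNorm ρ O r s f) (max (XNorm ρ O r s F)
        (XNorm ρ O r s fun P ξ => (((N : ℝ) ^ (4 * d * τ) : ℝ) : ℂ) *
          (bilinearPart (tauOne d τ₀) N θ μ τ f P ξ - F P ξ)))) < T := by
    refine lt_of_le_of_lt ?_ h
    unfold qtNorm
    exact le_iSup_of_le N (le_iSup_of_le hN (le_iSup_of_le τ (le_iSup_of_le hτ le_rfl)))
  simp only [iInf_lt_iff] at h1
  obtain ⟨F, hF, hlt⟩ := h1
  rw [max_lt_iff, max_lt_iff] at hlt
  exact ⟨F, hF, hlt.1.le, hlt.2.1.le, hlt.2.2.le⟩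

lemma XNorm_le_qtNorm {f : Series n} {N : ℕ} (hN : K ≤ N) {τ : ℝ}
    (hτ : τ₀ ≤ τ ∧ τ ≤ tauOne d τ₀ / (4 * d)) : XNorm ρ O r s f ≤ qtNorm ρ O τ₀ r s K θ μ f := by
  refine le_of_forall_gt fun T hT => ?_
  obtain ⟨F, hF, hlt⟩ : ∃ T', qtNorm ρ O τ₀ r s K θ μ f < T' ∧ T' < T := exists_between hT
  obtain ⟨G, hG⟩ := exists_approximates_of_lt hF hN hτ
  exact hG.left_le.trans_lt hlt

/-- The infimum need not be attained. Doubling makes the bound strict unless the norm is zero, and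
then `f` has vanishing vector field and zero approximates it. -/
lemma exists_approximates_two_mul (hz : ∃ i, n i = 0) (hρ : 0 < ρ) (hO : IsOpen O) {f : Series n}
    (hf : IsQuasiToeplitz ρ O τ₀ r s K θ μ f) {N : ℕ} (hN : K ≤ N)
    {τ : ℝ} (hτ : τ₀ ≤ τ ∧ τ ≤ tauOne d τ₀ / (4 * d)) (hW : 1 ≤ (N : ℝ) ^ (4 * d * τ)) :
    ∃ F, Approximates ρ O (tauOne d τ₀) r s N θ μ τ ((N : ℝ) ^ (4 * d * τ)) f F
      (2 * qtNorm ρ O τ₀ r s K θ μ f) := by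
  by_cases h0 : qtNorm ρ O τ₀ r s K θ μ f = 0
  · have hX := XNorm_le_qtNorm (ρ := ρ) (O := O) (r := r) (s := s) (θ := θ) (μ := μ) (f := f) hN hτ
    rw [h0] at hX ⊢
    exact ⟨0, approximates_zero hz hρ hO hf.1 hW (by rw [le_bot_iff.1 hX]; simp)⟩
  · refine exists_approximates_of_lt ?_ hN hτ
    have := ENNReal.add_lt_add_left (a := qtNorm ρ O τ₀ r s K θ μ f) hf.2.ne (pos_iff_ne_zero.2 h0)
    rwa [add_zero, ← two_mul] at this

/-- The bracket estimates are linear in the bound `T` of the second function, so it suffices to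
prove them for all `T'` above its norm. -/
lemma ENNReal.le_mul_of_forall_gt {x c T : ℝ≥0∞} (hc : c ≠ ⊤) (hT : T ≠ ⊤)
    (h : ∀ T', T < T' → T' ≠ ⊤ → x ≤ c * T') : x ≤ c * T := by
  by_cases hc0 : c = 0
  · have := h (T + 1) (ENNReal.lt_add_right hT one_ne_zero) (by simp [hT])
    rwa [hc0, zero_mul] at this ⊢
  · rw [mul_comm, ← ENNReal.div_le_iff hc0 hc]
    refine le_of_forall_gt_imp_ge_of_dense fun T' hT' => ?_
    by_cases htop : T' = ⊤
    · rw [htop]; exact le_top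
    · rw [ENNReal.div_le_iff hc0 hc, mul_comm]
      exact h T' hT' htop

end QuasiToeplitzNorm

/-! ### Numerical conditions -/

section Numerics

lemma exp_two_le_eight : Real.exp 2 ≤ 8 := by
  have h := Real.exp_one_lt_d9
  have h1 : Real.exp 2 = Real.exp 1 * Real.exp 1 := by rw [← Real.exp_add]; norm_num
  rw [h1]
  nlinarith [Real.exp_pos 1]

lemma two_le_log {x : ℝ} (hx : 8 ≤ x) : 2 ≤ Real.log x := by
  rw [Real.le_log_iff_exp_le (by linarith)]
  exact exp_two_le_eight.trans hx

/-- Monotonicity by which the hypotheses at `K'` imply the corresponding conditions at every order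
`N ≥ K'`. -/
lemma log_div_self_le {x y : ℝ} (hx : 8 ≤ x) (hxy : x ≤ y) : Real.log y / y ≤ Real.log x / x := by
  have h1 : Real.exp 1 ≤ x := by
    have := Real.exp_one_lt_d9
    linarith
  exact Real.log_div_self_antitoneOn h1 (h1.trans hxy) hxy

/-- Ensures `J + 1 ≤ N` for the terms `J ≤ log² N`. As `log x / √x` decreases beyond `e² ≤ 8`, its
value at `8` suffices. -/
lemma log_sq_add_one_le {x : ℝ} (hx : 8 ≤ x) : Real.log x ^ 2 + 1 ≤ x := by
  have hx0 : 0 < x := by linarith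
  have h1 : Real.exp 2 ≤ (8 : ℝ) := exp_two_le_eight
  have h2 := Real.log_div_sqrt_antitoneOn h1 (h1.trans hx) hx
  simp only at h2
  have h3 : Real.log 8 ≤ 21 / 10 := by
    have : (8 : ℝ) = 2 ^ 3 := by norm_num
    rw [this, Real.log_pow]
    have := Real.log_two_lt_d9
    push_cast
    linarith
  have hlx : 0 ≤ Real.log x := by linarith [two_le_log hx]
  have h5 : (Real.log x / Real.sqrt x) ^ 2 ≤ (Real.log 8 / Real.sqrt 8) ^ 2 := by gcongr
  rw [div_pow, div_pow, Real.sq_sqrt hx0.le, Real.sq_sqrt (by norm_num), div_le_div_iff₀ hx0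
    (by norm_num)] at h5
  have h6 : Real.log 8 ^ 2 ≤ (21 / 10) ^ 2 := by
    have := two_le_log (le_refl (8 : ℝ))
    gcongr
  nlinarith

variable {C₁ τ₀ μ' : ℝ} {N d J : ℕ}

/-- With `J ≤ log² N` the total loss is at most `C₁ (log N / N)²`, which decreases in `N`. -/
lemma mul_lossMu_le {K' D : ℝ} (hC : 0 ≤ C₁) (hK : 8 ≤ K') (hN : K' ≤ N)
    (hJ : (J : ℝ) ≤ Real.log N ^ 2) (h : C₁ * Real.log K' ^ 2 / K' ^ 2 ≤ D) :
    J * lossMu C₁ N ≤ D := by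
  have hN0 : (0 : ℝ) < N := by linarith
  have hl := two_le_log (hK.trans hN)
  refine le_trans ?_ h
  calc J * lossMu C₁ N ≤ Real.log N ^ 2 * lossMu C₁ N := by
        gcongr
        unfold lossMu
        positivity
    _ = C₁ * (Real.log N / N) ^ 2 := by
        unfold lossMu
        field_simp
    _ ≤ C₁ * (Real.log K' / K') ^ 2 := by
        have h1 := log_div_self_le hK hN
        gcongr
    _ = _ := by rw [div_pow]; ring

lemma mul_lossTheta_le {K' D : ℝ} (hC : 0 ≤ C₁) (hμ' : 0 ≤ μ') (hd : 2 ≤ 4 * d * τ₀ - 4)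
    (hK : 8 ≤ K') (hN : K' ≤ N) (hJ : (J : ℝ) ≤ Real.log N ^ 2)
    (h : C₁ * (2 * μ' * Real.log K' ^ 2) / K' ^ (4 * d * τ₀ - 4) ≤ D) :
    J * lossTheta C₁ N d τ₀ μ' ≤ D := by
  have hK0 : 0 < K' := by linarith
  have hN0 : (0 : ℝ) < N := by linarith
  have hl := two_le_log (hK.trans hN)
  -- Two powers are split off and paired with `log²`, so that both remaining quantities decrease in
  -- `N`.
  have hsplit : ∀ {x : ℝ}, 0 < x → x ^ (4 * d * τ₀ - 4) = x ^ 2 * x ^ (4 * d * τ₀ - 4 - 2) := by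
    intro x hx
    rw [← Real.rpow_natCast x 2, ← Real.rpow_add hx]
    congr 1
    push_cast
    ring
  refine le_trans ?_ h
  calc J * lossTheta C₁ N d τ₀ μ' ≤ Real.log N ^ 2 * lossTheta C₁ N d τ₀ μ' := by
        gcongr
        unfold lossTheta
        positivity
    _ = C₁ * (2 * μ') * (Real.log N / N) ^ 2 / (N : ℝ) ^ (4 * d * τ₀ - 4 - 2) := by
        unfold lossTheta
        rw [hsplit hN0]
        field_simp
    _ ≤ C₁ * (2 * μ') * (Real.log K' / K') ^ 2 / K' ^ (4 * d * τ₀ - 4 - 2) := by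
        have := log_div_self_le hK hN
        gcongr
    _ = _ := by
        rw [hsplit hK0, div_pow]
        field_simp

lemma lossMu_le {K' : ℝ} (hC : 0 ≤ C₁) (hK : 0 < K') (hN : K' ≤ N) :
    lossMu C₁ N ≤ C₁ / K' ^ 2 := by
  unfold lossMu
  gcongr

lemma lossTheta_le {K' : ℝ} (hC : 0 ≤ C₁) (hμ' : 0 ≤ μ') (hd : 0 ≤ 4 * d * τ₀ - 4) (hK : 0 < K')
    (hN : K' ≤ N) : lossTheta C₁ N d τ₀ μ' ≤ C₁ * (2 * μ') / K' ^ (4 * d * τ₀ - 4) := by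
  unfold lossTheta
  gcongr

/-- The loss of analyticity in the angles which is used for the ultraviolet cut-off. -/
def angleLoss (τ₁ s s' : ℝ) : ℝ := (s - s') * (τ₁ / (τ₁ + 1))

lemma sub_angleLoss {τ₁ : ℝ} (hτ₁ : 0 < τ₁) (s s' : ℝ) :
    s - angleLoss τ₁ s s' - s' = (s - s') / (τ₁ + 1) := by
  unfold angleLoss
  field_simp
  ring

/-- The fraction `τ₁ / (τ₁ + 1)` of the width makes the cut-off beat `N^{τ₁}`. The rest, `(s - s') /
(τ₁ + 1)`, remains for the Cauchy estimates and puts the factor `τ₁ + 1` into the constant. -/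
lemma exp_neg_angleLoss_mul_le {τ₁ s s' t K' : ℝ} (hτ₁ : 0 < τ₁) (hK : 8 ≤ K') (hN : K' ≤ N)
    (ht : t ≤ τ₁) (h : (τ₁ + 1) * Real.log K' ≤ (s - s') * K') :
    Real.exp (-(angleLoss τ₁ s s' * N)) * (N : ℝ) ^ t ≤ 1 := by
  have hK0 : 0 < K' := by linarith
  have hN0 : (0 : ℝ) < N := by linarith
  have hl := two_le_log (hK.trans hN)
  have h1 : Real.log N / N ≤ (s - s') / (τ₁ + 1) := by
    refine (log_div_self_le hK hN).trans ?_
    rw [div_le_div_iff₀ hK0 (by linarith)]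
    linarith
  rw [div_le_iff₀ hN0] at h1
  rw [Real.rpow_def_of_pos hN0, ← Real.exp_add, Real.exp_le_one_iff]
  have h2 : Real.log N * t ≤ Real.log N * τ₁ := by gcongr
  have h3 : Real.log N * τ₁ ≤ (s - s') / (τ₁ + 1) * N * τ₁ := by gcongr
  have h4 : angleLoss τ₁ s s' * N = (s - s') / (τ₁ + 1) * N * τ₁ := by
    unfold angleLoss
    field_simp
  linarith

lemma bracketConst_angleLoss_le {τ₁ r s r' s' : ℝ} (hτ₁ : 0 < τ₁) (hr' : 0 < r') (hr : r' < r)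
    (hs : s' < s) :
    bracketConst r (s - angleLoss τ₁ s s') r' s' ≤ 2 * (τ₁ + 1) * (delta r s r' s')⁻¹ := by
  have hr0 : 0 < r := hr'.trans hr
  have h1 : r' / r < 1 := (div_lt_one hr0).2 hr
  set D := min (s - s') (1 - r' / r) with hD
  have hD0 : 0 < D := lt_min (by linarith) (by linarith)
  unfold bracketConst delta
  rw [sub_angleLoss hτ₁]
  have hmin : D / (τ₁ + 1) ≤ min ((s - s') / (τ₁ + 1)) (1 - r' / r) := by
    refine le_min ?_ ?_
    · gcongr
      exact min_le_left _ _
    · refine (div_le_self hD0.le (by linarith)).trans (min_le_right _ _)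
  calc 2 * (r / r') ^ 2 / min ((s - s') / (τ₁ + 1)) (1 - r' / r) ≤
      2 * (r / r') ^ 2 / (D / (τ₁ + 1)) := by gcongr
    _ = _ := by
      rw [← hD]
      field_simp

lemma one_le_siteBound {b : ℕ} {n : Fin b → Fin d → ℤ} (hne : ∃ i, n i ≠ 0) : 1 ≤ siteBound n := by
  obtain ⟨i, hi⟩ := hne
  exact (one_le_eucl hi).trans (eucl_le_siteBound i)

lemma one_le_dim {b : ℕ} {n : Fin b → Fin d → ℤ} (hne : ∃ i, n i ≠ 0) : 1 ≤ d := by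
  obtain ⟨i, hi⟩ := hne
  obtain ⟨j, -⟩ := Function.ne_iff.1 hi
  exact Nat.one_le_iff_ne_zero.2 fun h => by subst h; exact j.elim0

lemma le_tauOne (hd : 1 ≤ d) (hτ₀ : 0 ≤ τ₀) : 4 * d * (τ₀ + 1) ≤ tauOne d τ₀ := by
  have hd1 : (1 : ℝ) ≤ d := by exact_mod_cast hd
  unfold tauOne
  gcongr
  exact le_self_pow₀ (by linarith) (by omega)

lemma eight_mul_le {K : ℝ} (hC : 1 ≤ C₁) (hd : 1 ≤ d)
    (hK : 8 * (d.factorial : ℝ) * C₁ ^ d < K) : 8 * C₁ ≤ K := by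
  have h1 : (1 : ℝ) ≤ d.factorial := by exact_mod_cast d.factorial_pos
  have h2 : C₁ ≤ C₁ ^ d := le_self_pow₀ hC (by omega)
  have h3 : 8 * 1 * C₁ ≤ 8 * (d.factorial : ℝ) * C₁ ^ d := by gcongr
  linarith

end Numerics

/-! ### The Lie series -/

section LieSeries

variable {d b : ℕ} {n : Fin b → Fin d → ℤ} {O : Set (Fin b → ℝ)} {ρ r s r' s' : ℝ}
  {τ₀ τ : ℝ} {N J : ℕ} {K K' θ μ θ' μ' : ℝ} {f₁ f₂ : Series n}

lemma exists_lieSeries (hz : ∃ i, n i = 0) (hρ : 0 < ρ) (hO : IsOpen O) (hr : 0 < r) (hs : 0 ≤ s)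
    (hf₁ : MemA ρ O r s f₁) (hmem : ∀ j, MemA ρ O r s ((bracket f₁)^[j] f₂)) {c : ℕ → ℂ}
    (hc : ∀ j, ‖c j‖ₑ ≤ ENNReal.ofReal (1 / j.factorial))
    (hX : ∑' j : ℕ, ENNReal.ofReal (1 / j.factorial) * XNorm ρ O r s ((bracket f₁)^[j] f₂) ≠ ⊤) :
    ∃ g, MemA ρ O r s g ∧
      (∀ M, ∀ ξ ∈ O, HasSum (fun j => c j * (bracket f₁)^[j] f₂ M ξ) (g M ξ)) ∧
      ∀ ξ ∈ O, ∀ x ∈ domain n ρ r s,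
        HasSum (fun j => c j * Series.eval ((bracket f₁)^[j] f₂) ξ x) (g.eval ξ x) := by
  have hX' : ∑' j, XNorm ρ O r s (fun M ξ => c j * (bracket f₁)^[j] f₂ M ξ) ≠ ⊤ := by
    refine ne_top_of_le_ne_top hX (ENNReal.tsum_le_tsum fun j => ?_)
    rw [(memA_const_mul hz hρ hO (hmem j) (c j)).2]
    gcongr
    exact hc j
  -- The majorant of a bracket, constant term included, is bounded on the same domain by the norms
  -- of its factors. So the majorant of term `j + 1` is controlled by the vector field of term `j`.
  have hpair : ∀ ζ ζ' : NormalSite n → ℝ≥0∞, InBall ρ r ζ → InBall ρ r ζ' →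
      ∑' j, pair (coeffs O (fun M ξ => c (j + 1) * (bracket f₁)^[j + 1] f₂ M ξ))
        (domWeight r s ζ ζ') ≠ ⊤ := by
    intro ζ ζ' hζ hζ'
    set A := ENNReal.ofReal (4 * r ^ 2) * XNorm ρ O r s f₁ with hA
    have hAt : A ≠ ⊤ := ENNReal.mul_ne_top ENNReal.ofReal_ne_top hf₁.2.2.ne
    refine ne_top_of_le_ne_top (ENNReal.mul_ne_top hAt hX) ?_
    rw [← ENNReal.tsum_mul_left]
    refine ENNReal.tsum_le_tsum fun j => ?_
    have hcj : ‖c (j + 1)‖ₑ ≤ ENNReal.ofReal (1 / j.factorial) := by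
      refine (hc (j + 1)).trans (ENNReal.ofReal_le_ofReal ?_)
      have : (j.factorial : ℝ) ≤ (j + 1).factorial := by
        exact_mod_cast Nat.factorial_le (Nat.le_succ j)
      have : (0 : ℝ) < j.factorial := by exact_mod_cast j.factorial_pos
      gcongr
    have hle : ∀ M, coeffs O (fun M ξ => c (j + 1) * (bracket f₁)^[j + 1] f₂ M ξ) M ≤
        ENNReal.ofReal (1 / j.factorial) *
          cBracket (coeffs O f₁) (coeffs O ((bracket f₁)^[j] f₂)) M := by
      intro M
      unfold coeffs
      rw [coeffNorm_const_mul hO ((hmem (j + 1)).1 M), Function.iterate_succ_apply']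
      exact mul_le_mul' hcj (coeffs_bracket_le hO hf₁.1 (hmem j).1 M)
    refine (pair_mono hle fun _ => le_rfl).trans ?_
    have hpull : pair (fun M => ENNReal.ofReal (1 / j.factorial) *
          cBracket (coeffs O f₁) (coeffs O ((bracket f₁)^[j] f₂)) M) (domWeight r s ζ ζ') =
        ENNReal.ofReal (1 / j.factorial) *
          pair (cBracket (coeffs O f₁) (coeffs O ((bracket f₁)^[j] f₂))) (domWeight r s ζ ζ') := by
      unfold pair
      rw [← ENNReal.tsum_mul_left]
      exact tsum_congr fun M => mul_assoc _ _ _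
    rw [hpull]
    refine (mul_le_mul_right (pair_cBracket_domWeight_le hz hρ hr hs hζ hζ' _ _) _).trans ?_
    rw [← XNorm_eq hz hρ hO hf₁.1, ← XNorm_eq hz hρ hO (hmem j).1, hA]
    exact le_of_eq (by ring)
  obtain ⟨g, hg, hsum, heval⟩ := exists_hasSum_series hz hρ hO hr
    (a := fun j M ξ => c j * (bracket f₁)^[j] f₂ M ξ)
    (fun j => (memA_const_mul hz hρ hO (hmem j) (c j)).1) hX' hpair
  refine ⟨g, hg, hsum, fun ξ hξ x hx => ?_⟩
  convert heval ξ hξ x hx using 2 with j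
  unfold Series.eval
  rw [← tsum_mul_left]
  exact tsum_congr fun M => by ring

/-- The constant of the theorem. -/
def lieConst (d : ℕ) (τ₀ : ℝ) : ℝ := 32 * (tauOne d τ₀ + 1) * Real.exp (tauOne d τ₀)

lemma delta_pos (hr' : 0 < r') (hr : r' < r) (hs : s' < s) : 0 < delta r s r' s' := by
  have hr0 := hr'.trans hr
  have h1 : r' / r < 1 := (div_lt_one hr0).2 hr
  have : 0 < min (s - s') (1 - r' / r) := lt_min (by linarith) (by linarith)
  unfold delta
  positivity

lemma bracketConst_eq (hr' : 0 < r') (hr : r' < r) (hs : s' < s) :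
    bracketConst r s r' s' = 2 * (delta r s r' s')⁻¹ := by
  have hr0 := hr'.trans hr
  have h1 : r' / r < 1 := (div_lt_one hr0).2 hr
  have : 0 < min (s - s') (1 - r' / r) := lt_min (by linarith) (by linarith)
  unfold bracketConst delta
  field_simp

/-- The standing assumptions on the parameters. -/
structure Parameters (n : Fin b → Fin d → ℤ) (τ₀ r s r' s' K K' θ μ θ' μ' : ℝ) : Prop where
  zero : ∃ i, n i = 0
  ne_zero : ∃ i, n i ≠ 0
  exponent : 12 ≤ τ₀
  radius_pos : 0 < r'
  radius_lt : r' < r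
  angle_pos : 0 < s'
  angle_lt : s' < s
  large : 8 * siteBound n ≤ K
  le : K ≤ K'
  theta : 1 / 2 < θ
  mu' : 1 / 2 < μ'
  mu : μ < 4
  cutoff : (tauOne d τ₀ + 1) * Real.log K' ≤ (s - s') * K'

/-! ### Bracket and Lie series under the standing assumptions. -/

namespace Parameters

lemma eight_le (h : Parameters n τ₀ r s r' s' K K' θ μ θ' μ') : 8 ≤ K' := by
  linarith [h.large, h.le, one_le_siteBound h.ne_zero]

lemma le_tauOne (h : Parameters n τ₀ r s r' s' K K' θ μ θ' μ') : 4 * d * (τ₀ + 1) ≤ tauOne d τ₀ :=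
  QuasiToeplitz.le_tauOne (one_le_dim h.ne_zero) (by linarith [h.exponent])

lemma one_le_tauOne (h : Parameters n τ₀ r s r' s' K K' θ μ θ' μ') : 1 ≤ tauOne d τ₀ := by
  have hd : (1 : ℝ) ≤ d := by exact_mod_cast one_le_dim h.ne_zero
  nlinarith [h.le_tauOne, h.exponent]

lemma exponent_le (h : Parameters n τ₀ r s r' s' K K' θ μ θ' μ')
    (hτ : τ₀ ≤ τ ∧ τ ≤ tauOne d τ₀ / (4 * d)) : 4 * d * τ ≤ tauOne d τ₀ := by
  have hd : (1 : ℝ) ≤ d := by exact_mod_cast one_le_dim h.ne_zero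
  have := (le_div_iff₀ (by positivity : (0 : ℝ) < 4 * d)).1 hτ.2
  linarith

lemma range_mem (h : Parameters n τ₀ r s r' s' K K' θ μ θ' μ') :
    τ₀ ≤ τ₀ ∧ τ₀ ≤ tauOne d τ₀ / (4 * d) := by
  have hd : (1 : ℝ) ≤ d := by exact_mod_cast one_le_dim h.ne_zero
  refine ⟨le_rfl, (le_div_iff₀ (by positivity : (0 : ℝ) < 4 * d)).2 ?_⟩
  nlinarith [h.le_tauOne]

lemma admissible (h : Parameters n τ₀ r s r' s' K K' θ μ θ' μ')
    (hN : K' ≤ N) (hτ : τ₀ ≤ τ ∧ τ ≤ tauOne d τ₀ / (4 * d)) :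
    Admissible (siteBound n) τ₀ (tauOne d τ₀) τ N d :=
  ⟨one_le_siteBound h.ne_zero, by linarith [h.large, h.le], one_le_dim h.ne_zero, h.exponent, hτ.1,
    h.exponent_le hτ⟩

lemma one_le_rpow (h : Parameters n τ₀ r s r' s' K K' θ μ θ' μ')
    (hN : K' ≤ N) (hτ : τ₀ ≤ τ ∧ τ ≤ tauOne d τ₀ / (4 * d)) :
    1 ≤ (N : ℝ) ^ (4 * d * τ) := by
  have := h.exponent
  have : 0 ≤ τ := by linarith [hτ.1]
  exact Real.one_le_rpow (by linarith [h.eight_le]) (by positivity)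

lemma XNorm_le (h : Parameters n τ₀ r s r' s' K K' θ μ θ' μ')
    (f : Series n) : XNorm ρ O r s f ≤ qtNorm ρ O τ₀ r s K θ μ f :=
  XNorm_le_qtNorm (Nat.le_ceil K) h.range_mem

/-- The low terms of the Lie series. -/
lemma exists_low_approximant (h : Parameters n τ₀ r s r' s' K K' θ μ θ' μ')
    (hρ : 0 < ρ) (hO : IsOpen O)
    (hf₁ : IsQuasiToeplitz ρ O τ₀ r s K θ μ f₁) (hf₂ : IsQuasiToeplitz ρ O τ₀ r s K θ μ f₂)
    (hN : K' ≤ N) (hτ : τ₀ ≤ τ ∧ τ ≤ tauOne d τ₀ / (4 * d)) (hJ0 : J ≠ 0) (hJ : J + 1 ≤ N)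
    (hθ' : θ + J * lossTheta (siteBound n) N d τ₀ μ' ≤ θ')
    (hμJ : μ' + J * lossMu (siteBound n) N ≤ μ) {c : ℂ}
    (hc : ‖c‖ₑ ≤ ENNReal.ofReal (1 / J.factorial)) {T : ℝ≥0∞}
    (hT : qtNorm ρ O τ₀ r s K θ μ f₂ < T) :
    ∃ G, Approximates ρ O (tauOne d τ₀) r' s' N θ' μ' τ ((N : ℝ) ^ (4 * d * τ))
      (fun P ξ => c * (bracket f₁)^[J] f₂ P ξ) G
      ((ENNReal.ofReal (32 * (tauOne d τ₀ + 1) * Real.exp 1 * (delta r s r' s')⁻¹) *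
        qtNorm ρ O τ₀ r s K θ μ f₁) ^ J * T) := by
  have hτ₁ := h.one_le_tauOne
  have hW := h.one_le_rpow hN hτ
  -- The bound of `f₁` is raised to the power `J`, so its factor two goes into the constant; that of
  -- `f₂` enters linearly and may be any `T` above the norm.
  obtain ⟨F₁, hF₁⟩ := exists_approximates_two_mul h.zero hρ hO hf₁ (h.le.trans hN) hτ hW
  obtain ⟨F₂, hF₂⟩ := exists_approximates_of_lt hT (h.le.trans hN) hτ
  have hss : 0 < s - s' := sub_pos.2 h.angle_lt
  have hη : 0 ≤ angleLoss (tauOne d τ₀) s s' := by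
    unfold angleLoss
    positivity
  have hηs : s' < s - angleLoss (tauOne d τ₀) s s' := by
    have h1 := sub_angleLoss (show 0 < tauOne d τ₀ by linarith) s s'
    have h2 : 0 < (s - s') / (tauOne d τ₀ + 1) := by positivity
    linarith
  obtain ⟨G, hG⟩ := exists_scaled_approximant h.zero hρ hO h.radius_pos h.radius_lt
    h.angle_pos.le (h.admissible hN hτ) h.mu'.le hJ0 hJ h.theta.le h.mu.le hθ' hμJ hf₁.1 hf₂.1
    (by linarith) hF₁ hF₂ hη hηs
    (exp_neg_angleLoss_mul_le (by linarith) h.eight_le hN (h.exponent_le hτ) h.cutoff) hc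
  have hle : (ENNReal.ofReal (8 * (Real.exp 1 *
      bracketConst r (s - angleLoss (tauOne d τ₀) s s') r' s')) *
        (2 * qtNorm ρ O τ₀ r s K θ μ f₁)) ^ J * T ≤
      (ENNReal.ofReal (32 * (tauOne d τ₀ + 1) * Real.exp 1 * (delta r s r' s')⁻¹) *
        qtNorm ρ O τ₀ r s K θ μ f₁) ^ J * T := by
    gcongr ?_ ^ J * T
    rw [← mul_assoc]
    gcongr
    have h2 : (2 : ℝ≥0∞) = ENNReal.ofReal 2 := by simp
    rw [h2, ← ENNReal.ofReal_mul' (by norm_num)]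
    refine ENNReal.ofReal_le_ofReal ?_
    have hb := bracketConst_angleLoss_le (show 0 < tauOne d τ₀ by linarith) h.radius_pos h.radius_lt
      h.angle_lt
    have := mul_le_mul_of_nonneg_left hb (show 0 ≤ 16 * Real.exp 1 by positivity)
    linarith
  exact ⟨G, hG.toeplitz, hG.left_le.trans hle, hG.right_le.trans hle, hG.error_le.trans hle⟩

/-- The high terms of the Lie series. -/
lemma approximates_high (h : Parameters n τ₀ r s r' s' K K' θ μ θ' μ') (hρ : 0 < ρ) (hO : IsOpen O)
    (hf₁ : IsQuasiToeplitz ρ O τ₀ r s K θ μ f₁) (hf₂ : IsQuasiToeplitz ρ O τ₀ r s K θ μ f₂)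
    (hN : K' ≤ N) (hτ : τ₀ ≤ τ ∧ τ ≤ tauOne d τ₀ / (4 * d)) (hJ : Real.log N ≤ J) {c : ℂ}
    (hc : ‖c‖ₑ ≤ ENNReal.ofReal (1 / J.factorial)) :
    Approximates ρ O (tauOne d τ₀) r' s' N θ' μ' τ ((N : ℝ) ^ (4 * d * τ))
      (fun P ξ => c * (bracket f₁)^[J] f₂ P ξ) 0
      ((ENNReal.ofReal (lieConst d τ₀ * Real.exp 1 * (delta r s r' s')⁻¹) *
        qtNorm ρ O τ₀ r s K θ μ f₁) ^ J * qtNorm ρ O τ₀ r s K θ μ f₂) := by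
  have hτ₁ := h.one_le_tauOne
  have hN0 : (0 : ℝ) < N := by linarith [h.eight_le]
  have hJ0 : J ≠ 0 := by
    rintro rfl
    have := two_le_log (h.eight_le.trans hN)
    simp at hJ
    linarith
  have hδ := delta_pos h.radius_pos h.radius_lt h.angle_lt
  have hX := XNorm_scaled_iterate_le h.zero hρ hO h.radius_pos h.radius_lt h.angle_pos.le
    h.angle_lt hJ0 hf₁.1 hf₂.1 (h.XNorm_le f₁) (h.XNorm_le f₂) hc
  refine approximates_zero h.zero hρ hO hX.1 (h.one_le_rpow hN hτ)
    ((mul_le_mul_right hX.2 _).trans ?_)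
  rw [← mul_assoc]
  gcongr ?_ * _
  -- Since `log N ≤ J`, the weight of the error is only one more geometric factor.
  have hWle : (N : ℝ) ^ (4 * d * τ) ≤ Real.exp (tauOne d τ₀) ^ J := by
    rw [Real.rpow_def_of_pos hN0, ← Real.exp_nat_mul, Real.exp_le_exp]
    have hl := two_le_log (h.eight_le.trans hN)
    calc Real.log N * (4 * d * τ) ≤ Real.log N * tauOne d τ₀ := by
          have := h.exponent_le hτ
          gcongr
      _ ≤ J * tauOne d τ₀ := by gcongr
  calc ENNReal.ofReal ((N : ℝ) ^ (4 * d * τ)) *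
        (ENNReal.ofReal (Real.exp 1 * bracketConst r s r' s') *
          qtNorm ρ O τ₀ r s K θ μ f₁) ^ J ≤
      ENNReal.ofReal (Real.exp (tauOne d τ₀)) ^ J *
        (ENNReal.ofReal (Real.exp 1 * bracketConst r s r' s') *
          qtNorm ρ O τ₀ r s K θ μ f₁) ^ J := by
        rw [← ENNReal.ofReal_pow (Real.exp_pos _).le]
        gcongr
    _ = (ENNReal.ofReal (Real.exp (tauOne d τ₀) * (Real.exp 1 * bracketConst r s r' s')) *
          qtNorm ρ O τ₀ r s K θ μ f₁) ^ J := by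
        rw [← mul_pow, ← mul_assoc, ← ENNReal.ofReal_mul (Real.exp_pos _).le]
    _ ≤ _ := by
        gcongr (ENNReal.ofReal ?_ * _) ^ J
        rw [bracketConst_eq h.radius_pos h.radius_lt h.angle_lt]
        have h1 : 0 ≤ Real.exp (tauOne d τ₀) * Real.exp 1 * (delta r s r' s')⁻¹ := by positivity
        unfold lieConst
        nlinarith

lemma le_lieConst_mul (h : Parameters n τ₀ r s r' s' K K' θ μ θ' μ') {x : ℝ} (hx : 0 ≤ x) :
    32 * (tauOne d τ₀ + 1) * Real.exp 1 * x ≤ lieConst d τ₀ * x := by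
  have := h.one_le_tauOne
  unfold lieConst
  gcongr

/-- The quasi-Töplitz norm of the Poisson bracket. -/
lemma qtNorm_bracket_le (h : Parameters n τ₀ r s r' s' K K' θ μ θ' μ') (hρ : 0 < ρ) (hO : IsOpen O)
    (hf₁ : IsQuasiToeplitz ρ O τ₀ r s K θ μ f₁) (hf₂ : IsQuasiToeplitz ρ O τ₀ r s K θ μ f₂)
    (hμ : siteBound n / K' ^ 2 ≤ μ - μ')
    (hθ : siteBound n * (2 * μ') / K' ^ (4 * d * τ₀ - 4) ≤ θ' - θ) :
    IsQuasiToeplitz ρ O τ₀ r' s' K' θ' μ' (bracket f₁ f₂) ∧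
    qtNorm ρ O τ₀ r' s' K' θ' μ' (bracket f₁ f₂) ≤
      ENNReal.ofReal (lieConst d τ₀ * (delta r s r' s')⁻¹) *
        qtNorm ρ O τ₀ r s K θ μ f₁ * qtNorm ρ O τ₀ r s K θ μ f₂ := by
  have hδ := delta_pos h.radius_pos h.radius_lt h.angle_lt
  have hd : (1 : ℝ) ≤ d := by exact_mod_cast one_le_dim h.ne_zero
  have hC := one_le_siteBound h.ne_zero
  have hK8 := h.eight_le
  have hmem : MemA ρ O r' s' (bracket f₁ f₂) := memA_iterate_bracket h.zero hρ hO hf₁.1 hf₂.1 1 _ _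
    h.radius_pos h.radius_lt h.angle_pos.le h.angle_lt
  have hle : qtNorm ρ O τ₀ r' s' K' θ' μ' (bracket f₁ f₂) ≤
      ENNReal.ofReal (lieConst d τ₀ * (delta r s r' s')⁻¹) *
        qtNorm ρ O τ₀ r s K θ μ f₁ * qtNorm ρ O τ₀ r s K θ μ f₂ := by
    refine ENNReal.le_mul_of_forall_gt (ENNReal.mul_ne_top ENNReal.ofReal_ne_top hf₁.2.ne) hf₂.2.ne
      fun T hT _ => ?_
    unfold qtNorm
    refine iSup_le fun N => iSup_le fun hN => iSup_le fun τ => iSup_le fun hτ => ?_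
    have hN8 : (8 : ℝ) ≤ N := hK8.trans hN
    have hθ₁ := lossTheta_le (C₁ := siteBound n) (μ' := μ') (d := d) (τ₀ := τ₀) (by linarith)
      (by linarith [h.mu']) (by nlinarith [h.exponent]) (by linarith) hN
    have hμ₁ := lossMu_le (C₁ := siteBound n) (by linarith) (by linarith) hN
    obtain ⟨G, hG⟩ := h.exists_low_approximant hρ hO hf₁ hf₂ hN hτ (J := 1) one_ne_zero
      (by have : 8 ≤ N := by exact_mod_cast hN8
          omega) (by push_cast; linarith) (by push_cast; linarith) (c := 1) (by simp) hT
    have hG' : ∀ {x : ℝ≥0∞}, x ≤ (ENNReal.ofReal (32 * (tauOne d τ₀ + 1) * Real.exp 1 *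
        (delta r s r' s')⁻¹) * qtNorm ρ O τ₀ r s K θ μ f₁) ^ 1 * T →
        x ≤ ENNReal.ofReal (lieConst d τ₀ * (delta r s r' s')⁻¹) *
          qtNorm ρ O τ₀ r s K θ μ f₁ * T := by
      intro x hx
      refine hx.trans ?_
      rw [pow_one]
      gcongr ENNReal.ofReal ?_ * _ * _
      exact h.le_lieConst_mul (inv_nonneg.2 hδ.le)
    have h1 := hG' hG.left_le
    have h2 := hG' hG.right_le
    have h3 := hG' hG.error_le
    simp only [one_mul, Function.iterate_one] at h1 h3
    exact iInf_le_of_le G (iInf_le_of_le hG.toeplitz (max_le h1 (max_le h2 h3)))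
  exact ⟨⟨hmem, hle.trans_lt (ENNReal.mul_lt_top (ENNReal.mul_lt_top ENNReal.ofReal_lt_top hf₁.2)
    hf₂.2)⟩, hle⟩

/-- The quasi-Töplitz norm of the Lie series. -/
lemma exists_lieSeries_qtNorm_le (h : Parameters n τ₀ r s r' s' K K' θ μ θ' μ')
    (hρ : 0 < ρ) (hO : IsOpen O)
    (hf₁ : IsQuasiToeplitz ρ O τ₀ r s K θ μ f₁) (hf₂ : IsQuasiToeplitz ρ O τ₀ r s K θ μ f₂)
    (hμ : siteBound n * Real.log K' ^ 2 / K' ^ 2 ≤ μ - μ')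
    (hθ : siteBound n * (2 * μ' * Real.log K' ^ 2) / K' ^ (4 * d * τ₀ - 4) ≤ θ' - θ)
    (hsmall : ENNReal.ofReal (lieConst d τ₀ * Real.exp 1 * (delta r s r' s')⁻¹) *
      qtNorm ρ O τ₀ r s K θ μ f₁ < 1) {c : ℕ → ℂ} (hc0 : c 0 = 1)
    (hc : ∀ j, ‖c j‖ₑ ≤ ENNReal.ofReal (1 / j.factorial)) :
    ∃ g : Series n,
      (∀ ξ ∈ O, ∀ x ∈ domain n ρ r' s',
        HasSum (fun j => c j * Series.eval ((bracket f₁)^[j] f₂) ξ x) (g.eval ξ x)) ∧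
      IsQuasiToeplitz ρ O τ₀ r' s' K' θ' μ' g ∧
      qtNorm ρ O τ₀ r' s' K' θ' μ' g ≤ ENNReal.ofReal ((r / r') ^ 2) *
        (1 - ENNReal.ofReal (lieConst d τ₀ * Real.exp 1 * (delta r s r' s')⁻¹) *
          qtNorm ρ O τ₀ r s K θ μ f₁)⁻¹ * qtNorm ρ O τ₀ r s K θ μ f₂ := by
  have hδ := delta_pos h.radius_pos h.radius_lt h.angle_lt
  have hd : (1 : ℝ) ≤ d := by exact_mod_cast one_le_dim h.ne_zero
  have hC := one_le_siteBound h.ne_zero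
  have hK8 := h.eight_le
  have hτ₁ := h.one_le_tauOne
  have hlK := two_le_log hK8
  have hK0 : 0 < K' := by linarith
  have hμ'0 := h.mu'
  have hmem : ∀ j, MemA ρ O r' s' ((bracket f₁)^[j] f₂) := fun j =>
    memA_iterate_bracket h.zero hρ hO hf₁.1 hf₂.1 j _ _ h.radius_pos h.radius_lt h.angle_pos.le
      h.angle_lt
  set y := ENNReal.ofReal (lieConst d τ₀ * Real.exp 1 * (delta r s r' s')⁻¹) *
      qtNorm ρ O τ₀ r s K θ μ f₁ with hy
  set R := ENNReal.ofReal ((r / r') ^ 2) with hR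
  have hR1 : 1 ≤ R := by
    rw [hR, ← ENNReal.ofReal_one]
    refine ENNReal.ofReal_le_ofReal (one_le_pow₀ ?_)
    rw [one_le_div h.radius_pos]
    exact h.radius_lt.le
  have hgeom : ∀ T : ℝ≥0∞, ∑' j, R * (y ^ j * T) = R * (1 - y)⁻¹ * T := by
    intro T
    rw [ENNReal.tsum_mul_left, ENNReal.tsum_mul_right, ENNReal.tsum_geometric, mul_assoc]
  have hRtop : R * (1 - y)⁻¹ ≠ ⊤ :=
    ENNReal.mul_ne_top ENNReal.ofReal_ne_top (ENNReal.inv_ne_top.2 (tsub_pos_of_lt hsmall).ne')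
  have hX : ∑' j : ℕ, ENNReal.ofReal (1 / j.factorial) *
      XNorm ρ O r' s' ((bracket f₁)^[j] f₂) ≠ ⊤ := by
    refine ne_top_of_le_ne_top (ENNReal.mul_ne_top hRtop hf₂.2.ne) ?_
    rw [← hgeom]
    refine ENNReal.tsum_le_tsum fun j => ?_
    rcases Nat.eq_zero_or_pos j with rfl | hj
    · have := (memA_domain_mono h.zero hρ hO h.radius_pos h.radius_lt.le h.angle_lt.le hf₂.1).2
      simpa using this.trans (mul_le_mul_right (h.XNorm_le f₂) _)
    · have hnorm : ‖((1 / j.factorial : ℝ) : ℂ)‖ₑ = ENNReal.ofReal (1 / j.factorial) := by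
        rw [← ofReal_norm, Complex.norm_real, Real.norm_of_nonneg (by positivity)]
      have h1 := (XNorm_scaled_iterate_le h.zero hρ hO h.radius_pos h.radius_lt h.angle_pos.le
        h.angle_lt hj.ne' hf₁.1 hf₂.1 (h.XNorm_le f₁) (h.XNorm_le f₂) hnorm.le).2
      rw [(memA_const_mul h.zero hρ hO (hmem j) _).2, hnorm] at h1
      refine h1.trans (le_trans ?_ (le_mul_of_one_le_left' hR1))
      rw [hy]
      gcongr (ENNReal.ofReal ?_ * _) ^ j * _
      rw [bracketConst_eq h.radius_pos h.radius_lt h.angle_lt]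
      have h2 := h.le_lieConst_mul (inv_nonneg.2 hδ.le)
      have h3 : 0 ≤ lieConst d τ₀ * (delta r s r' s')⁻¹ := le_trans (by positivity) h2
      have h4 : 0 ≤ (tauOne d τ₀ + 1) * Real.exp 1 * (delta r s r' s')⁻¹ := by positivity
      have h5 : 2 ≤ lieConst d τ₀ := by
        unfold lieConst
        nlinarith [Real.add_one_le_exp (tauOne d τ₀)]
      have h6 : 0 ≤ Real.exp 1 * (delta r s r' s')⁻¹ := by positivity
      nlinarith
  obtain ⟨g, hg, hsum, heval⟩ := exists_lieSeries h.zero hρ hO h.radius_pos h.angle_pos.le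
    (hf₁.1.mono h.zero hρ hO h.radius_pos h.radius_lt.le h.angle_lt.le) hmem hc hX
  have hle : qtNorm ρ O τ₀ r' s' K' θ' μ' g ≤
      R * (1 - y)⁻¹ * qtNorm ρ O τ₀ r s K θ μ f₂ := by
    refine ENNReal.le_mul_of_forall_gt hRtop hf₂.2.ne fun T hT _ => ?_
    rw [← hgeom]
    unfold qtNorm
    refine iSup_le fun N => iSup_le fun hN => iSup_le fun τ => iSup_le fun hτ => ?_
    have hN8 : (8 : ℝ) ≤ N := hK8.trans hN
    have hlN := two_le_log hN8
    -- The terms are split at `log² N`. Up to there the margins allow Töplitz approximants; beyond,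
    -- `log N ≤ j` and zero is used, so that the approximant of the sum is a finite sum.
    have hterm : ∀ j : ℕ, ∃ G, Approximates ρ O (tauOne d τ₀) r' s' N θ' μ' τ
        ((N : ℝ) ^ (4 * d * τ)) (fun P ξ => c j * (bracket f₁)^[j] f₂ P ξ) G (R * (y ^ j * T)) ∧
        (⌊Real.log N ^ 2⌋₊ < j → G = 0) := by
      intro j
      by_cases hj : ⌊Real.log N ^ 2⌋₊ < j
      · have hj' := Nat.lt_of_floor_lt hj
        have happ := h.approximates_high (θ' := θ') (μ' := μ') hρ hO hf₁ hf₂ hN hτ (J := j)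
          (by nlinarith) (hc j)
        have hle : y ^ j * qtNorm ρ O τ₀ r s K θ μ f₂ ≤ R * (y ^ j * T) :=
          le_trans (by gcongr) (le_mul_of_one_le_left' hR1)
        exact ⟨0, ⟨happ.toeplitz, happ.left_le.trans hle, happ.right_le.trans hle,
          happ.error_le.trans hle⟩, fun _ => rfl⟩
      · have hj' : (j : ℝ) ≤ Real.log N ^ 2 :=
          (Nat.le_floor_iff (by positivity)).1 (not_lt.1 hj)
        have hmarginμ := mul_lossMu_le (by linarith) hK8 hN hj' hμ
        have hmarginθ := mul_lossTheta_le (by linarith) (by linarith)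
          (by nlinarith [h.exponent]) hK8 hN hj' hθ
        rcases Nat.eq_zero_or_pos j with rfl | hj0
        -- The term `j = 0` is `f₂` itself: no bracket is taken, and its restriction to the smaller
        -- domain costs `(r / r')²`.
        · obtain ⟨F, hF⟩ := exists_approximates_of_lt hT (h.le.trans hN) hτ
          refine ⟨bilinearPart (tauOne d τ₀) N θ' μ' τ F, ?_, fun h => absurd h hj⟩
          simpa [hc0] using hF.restrict h.zero hρ hO h.radius_pos h.radius_lt.le h.angle_lt.le
            (by simpa using hmarginθ) (by simpa using hmarginμ) hf₂.1
        · obtain ⟨G, hG⟩ := h.exists_low_approximant (θ' := θ') hρ hO hf₁ hf₂ hN hτ (J := j) hj0.ne'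
            (by have := log_sq_add_one_le hN8
                have : ((j + 1 : ℕ) : ℝ) ≤ N := by push_cast; linarith
                exact_mod_cast this) (by linarith) (by linarith) (hc j) hT
          have hle : (ENNReal.ofReal (32 * (tauOne d τ₀ + 1) * Real.exp 1 *
              (delta r s r' s')⁻¹) * qtNorm ρ O τ₀ r s K θ μ f₁) ^ j * T ≤ R * (y ^ j * T) := by
            refine le_trans ?_ (le_mul_of_one_le_left' hR1)
            rw [hy]
            gcongr (ENNReal.ofReal ?_ * _) ^ j * _
            have h1 := h.le_lieConst_mul (inv_nonneg.2 hδ.le)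
            have h2 : 1 ≤ Real.exp 1 := Real.one_le_exp (by norm_num)
            have h3 : 0 ≤ lieConst d τ₀ * (delta r s r' s')⁻¹ := le_trans (by positivity) h1
            nlinarith
          exact ⟨G, ⟨hG.toeplitz, hG.left_le.trans hle, hG.right_le.trans hle,
            hG.error_le.trans hle⟩, fun h => absurd h hj⟩
    choose G hG hG0 using hterm
    obtain ⟨F, hF, hFle⟩ := exists_approximant_of_hasSum h.zero hρ hO
      (fun j => (memA_const_mul h.zero hρ hO (hmem j) (c j)).1) hg hsum (fun j => (hG j).toeplitz)
      hG0 (fun j => (hG j).left_le) (fun j => (hG j).right_le) (fun j => (hG j).error_le)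
    exact iInf_le_of_le F (iInf_le_of_le hF hFle)
  exact ⟨g, heval, ⟨hg, hle.trans_lt (ENNReal.mul_lt_top (lt_top_iff_ne_top.2 hRtop) hf₂.2)⟩, hle⟩

end Parameters

end LieSeries

/-! ### The hypotheses of the proposition and its proof. -/

lemma enorm_pow_div_factorial_le {t : ℝ} (ht : |t| ≤ 1) (j : ℕ) :
    ‖(t : ℂ) ^ j / (j.factorial : ℂ)‖ₑ ≤ ENNReal.ofReal (1 / j.factorial) := by
  rw [← ofReal_norm]
  refine ENNReal.ofReal_le_ofReal ?_
  rw [norm_div, norm_pow, Complex.norm_real, Complex.norm_natCast, Real.norm_eq_abs]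
  gcongr
  exact pow_le_one₀ (abs_nonneg t) ht

lemma cutoff_of_exp_mul_rpow_lt_one {x y t : ℝ} (hy : 0 < y)
    (h : Real.exp (-x) * y ^ t < 1) : t * Real.log y < x := by
  rw [Real.rpow_def_of_pos hy, ← Real.exp_add, Real.exp_lt_one_iff] at h
  linarith

end QuasiToeplitz
end

open QuasiToeplitz in
theorem proposition5 {d b : ℕ} (n : Fin b → Fin d → ℤ)
    (hzero : ∃ i, n i = 0) (hne : ∃ i, n i ≠ 0)
    (τ₀ : ℝ) (hτ₀ : max ((d : ℝ) + b) 12 < τ₀) :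
    ∃ C : ℝ, 0 < C ∧
      ∀ (ρ : ℝ) (_ : 0 < ρ) (O : Set (Fin b → ℝ)) (_ : IsOpen O) (_ : Bornology.IsBounded O)
        (r s r' s' : ℝ) (_ : 0 < r') (_ : r' < r) (_ : 0 < s') (_ : s' < s)
        (K θ μ K' θ' μ' : ℝ)
        (_ : 8 * (d.factorial : ℝ) * siteBound n ^ d < K) (_ : K ≤ K')
        (_ : 1 / 2 < θ) (_ : θ' < 4) (_ : 1 / 2 < μ') (_ : μ < 4)
        (f₁ f₂ : Series n)
        (_ : IsQuasiToeplitz ρ O τ₀ r s K θ μ f₁) (_ : IsQuasiToeplitz ρ O τ₀ r s K θ μ f₂),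
        -- (i) the Poisson bracket
        (siteBound n / K' ^ 2 ≤ μ - μ' →
          siteBound n * (2 * μ') / K' ^ (4 * d * τ₀ - 4) < θ' - θ →
          Real.exp (-(s - s') * K') * K' ^ (tauOne d τ₀ + 1) < 1 →
          ∃ g : Series n,
            (∀ ξ ∈ O, ∀ x ∈ domain n ρ r' s', poisson (f₁.eval ξ) (f₂.eval ξ) x = g.eval ξ x) ∧
            IsQuasiToeplitz ρ O τ₀ r' s' K' θ' μ' g ∧
            qtNorm ρ O τ₀ r' s' K' θ' μ' g ≤
              ENNReal.ofReal (C * (delta r s r' s')⁻¹) *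
                qtNorm ρ O τ₀ r s K θ μ f₁ * qtNorm ρ O τ₀ r s K θ μ f₂) ∧
        -- (ii) the Hamiltonian flow
        (siteBound n * Real.log K' ^ 2 / K' ^ 2 ≤ μ - μ' →
          siteBound n * (2 * μ' * Real.log K' ^ 2) / K' ^ (4 * d * τ₀ - 4) < θ' - θ →
          Real.exp (-(s - s') * (K' / Real.log K' ^ 2)) * K' ^ tauOne d τ₀ < 1 →
          ENNReal.ofReal (C * Real.exp 1 * (delta r s r' s')⁻¹) *
            qtNorm ρ O τ₀ r s K θ μ f₁ < 1 →
          ∀ t : ℝ, |t| ≤ 1 →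
          ∃ g : Series n,
            (∀ ξ ∈ O, ∀ x ∈ domain n ρ r' s',
              HasSum (fun j : ℕ => (t : ℂ) ^ j / (j.factorial : ℂ) *
                ((poisson (f₁.eval ξ))^[j] (f₂.eval ξ)) x) (g.eval ξ x)) ∧
            IsQuasiToeplitz ρ O τ₀ r' s' K' θ' μ' g ∧
            qtNorm ρ O τ₀ r' s' K' θ' μ' g ≤
              ENNReal.ofReal ((r / r') ^ 2) *
                (1 - ENNReal.ofReal (C * Real.exp 1 * (delta r s r' s')⁻¹) *
                  qtNorm ρ O τ₀ r s K θ μ f₁)⁻¹ *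
                qtNorm ρ O τ₀ r s K θ μ f₂) := by
  have hτ12 : 12 ≤ τ₀ := (le_max_right _ _).trans hτ₀.le
  have hd := one_le_dim hne
  have hd1 : (1 : ℝ) ≤ d := by exact_mod_cast hd
  have hτ₁ : 1 ≤ tauOne d τ₀ := by nlinarith [le_tauOne hd (show 0 ≤ τ₀ by linarith)]
  have hC₁ := one_le_siteBound hne
  -- The constant has to dominate `32 (τ₁ + 1) e` from the terms with Töplitz approximants, and `2
  -- e^{τ₁}` from those approximated by zero.
  refine ⟨lieConst d τ₀, by unfold lieConst; positivity, ?_⟩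
  intro ρ hρ O hO _ r s r' s' hr' hr hs' hs K θ μ K' θ' μ' hK hKK' hθ _ hμ' hμ f₁ f₂ hf₁ hf₂
  have hKC := eight_mul_le hC₁ hd hK
  have hK8 : 8 ≤ K' := by linarith
  have hK0 : 0 < K' := by linarith
  have hlog := two_le_log hK8
  have hparam : (tauOne d τ₀ + 1) * Real.log K' ≤ (s - s') * K' →
      Parameters n τ₀ r s r' s' K K' θ μ θ' μ' := fun h =>
    ⟨hzero, hne, hτ12, hr', hr, hs', hs, hKC, hKK', hθ, hμ', hμ, h⟩
  have hdom := domain_mono (n := n) (ρ := ρ) hr' hr.le hs.le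
  refine ⟨fun h₁ h₂ h₃ => ?_, fun h₁ h₂ h₃ h₄ t ht => ?_⟩
  · rw [neg_mul] at h₃
    obtain ⟨hg, hle⟩ := (hparam (cutoff_of_exp_mul_rpow_lt_one hK0 h₃).le).qtNorm_bracket_le hρ hO
      hf₁ hf₂ h₁ h₂.le
    exact ⟨bracket f₁ f₂, fun ξ hξ x hx => iterate_poisson_eq hzero hρ hO (hr'.trans hr)
      (hs'.trans hs) hf₁.1 hf₂.1 hξ 1 x (hdom hx), hg, hle⟩
  · rw [neg_mul] at h₃
    have h₅ := cutoff_of_exp_mul_rpow_lt_one hK0 h₃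
    -- The hypothesis says `τ₁ log³ K' < (s - s') K'`. As `log K' ≥ 2` and `τ₁ ≥ 1`, the left side
    -- is at least `4 τ₁ log K' ≥ (τ₁ + 1) log K'`.
    have hcut : (tauOne d τ₀ + 1) * Real.log K' ≤ (s - s') * K' := by
      rw [← mul_div_assoc, lt_div_iff₀ (by positivity)] at h₅
      have h6 : 8 ≤ Real.log K' ^ 3 := by
        calc (8 : ℝ) = 2 ^ 3 := by norm_num
          _ ≤ _ := by gcongr
      have h7 : 4 * Real.log K' ≤ Real.log K' ^ 3 := by nlinarith
      have h8 : tauOne d τ₀ * (4 * Real.log K') ≤ tauOne d τ₀ * Real.log K' ^ 3 := by gcongr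
      nlinarith
    obtain ⟨g, hsum, hg, hle⟩ := (hparam hcut).exists_lieSeries_qtNorm_le hρ hO hf₁ hf₂ h₁ h₂.le h₄
      (c := fun j => (t : ℂ) ^ j / (j.factorial : ℂ)) (by simp) (enorm_pow_div_factorial_le ht)
    refine ⟨g, fun ξ hξ x hx => ?_, hg, hle⟩
    simp only [iterate_poisson_eq hzero hρ hO (hr'.trans hr) (hs'.trans hs) hf₁.1 hf₂.1 hξ _ x
      (hdom hx)]
    exact hsum ξ hξ x hx
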